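/- Let $n,\ell,r$ be integers with $1\le \ell\le n-1$ and $0\le r\le n-\ell$, and let $I_0=\{1,\dots,n\}$ carry the Cartan matrix of finite type $B_n$, normalised by $C_{i,j}=\alpha_j(\alpha_i^\vee)$, so that $C_{n-1,n}=-1$ and $C_{n,n-1}=-2$. **Monomial crystal.** Consider Laurent monomials $m=\prod_{i\in I_0,\,l\in\mathbb Z}Y_{i,l}^{u_{i,l}(m)}$ (finitely many exponents nonzero); put $Y_{0,l}=1$ and $A_{i,l}=Y_{i,l-1}Y_{i,l+1}\prod_{j\in I_0,\,j\ne i}Y_{j,l}^{C_{j,i}}$. The weight $\mathrm{wt}(m)$ is given by $\mathrm{wt}(m)(\alpha_i^\vee)=\sum_l u_{i,l}(m)$. Set $\varphi_{i,L}(m)=\sum_{l\le L}u_{i,l}(m)$, $\varphi_i(m)=\max_L\varphi_{i,L}(m)$, $\varepsilon_{i,L}(m)=-\sum_{l\ge L}u_{i,l}(m)$, $\varepsilon_i(m)=\max_L\varepsilon_{i,L}(m)$, $p_i(m)=\max\{L:\varepsilon_{i,L}(m)=\varepsilon_i(m)\}$, $q_i(m)=\min\{L:\varphi_{i,L}(m)=\varphi_i(m)\}$.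 Then $\tilde e_i m=mA_{i,p_i(m)-1}$ if $\varepsilon_i(m)>0$ and $\tilde e_im=0$ otherwise; $\tilde f_i m=mA_{i,q_i(m)+1}^{-1}$ if $\varphi_i(m)>0$ and $\tilde f_im=0$ otherwise. Let $\mathcal M_{I_0}(m)$ be the set of monomials obtained from $m$ by applying the operators $\tilde e_i,\tilde f_i$ ($i\in I_0$) repeatedly, with the structure $(\mathrm{wt},\varepsilon_i,\varphi_i,\tilde e_i,\tilde f_i)_{i\in I_0}$. **Boxes.** Let $\mathbf B=\{1\prec 2\prec\dots\prec n\prec 0\prec\overline n\prec\dots\prec\overline 1\}$. For $s\in\mathbb Z$ put $\boxed{i}_s=Y_{i-1,s+i}^{-1}Y_{i,s+i-1}$ and $\boxed{\overline i}_s=Y_{i-1,s+2n-i}Y_{i,s+2n+1-i}^{-1}$ for $1\le i\le n-1$, $\boxed{n}_s=Y_{n-1,s+n}^{-1}Y_{n,s+n-1}^{2}$, $\boxed{0}_s=Y_{n,s+n+1}^{-1}Y_{n,s+n-1}$, $\boxed{\overline n}_s=Y_{n-1,s+n}Y_{n,s+n+1}^{-2}$. For $0\le h\le\ell$ let $M_{\ell,h,r}=Y_{h,\ell-h}\,Y_{h,\ell-h-2r}^{-1}\,Y_{\ell,-2r}$,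 and for $T=((i_1,\dots,i_h),(i_{h+1},\dots,i_\ell))$ with entries in $\mathbf B$ let $$m_T=\prod_{a=1}^{h}\boxed{i_a}_{\ell+1-2a}\ \prod_{a=h+1}^{\ell}\boxed{i_a}_{\ell+1-2a-2r}.$$ **Tableaux.** Below, $k,k',k''$ denote elements of $\{1,\dots,n\}$ and positions $a,b,\dots$ lie in $\{1,\dots,\ell\}$; a condition that involves $i_h$ and $i_{h+1}$ (or $i_{h+1}$) is void if such an entry does not exist. Let $B_{\ell,h,r}$ be the set of all such $T$ that satisfy: * (B.1) $i_1\prec\dots\prec i_h$ and $i_{h+1}\prec\dots\prec i_\ell$, except that $0$ may be repeated in each column. * (B.2) There are no $a<b\le h$ with $i_a=k$, $i_b=\overline k$, $b-a=n-k$. * (B.3) There are no $h+1\le a<b$ with $i_a=k$, $i_b=\overline k$, $b-a=n-k$. * (B.4) There are no $a\le h<b$ with $i_a=k$, $i_b=\overline k$, $b-a=n+1-\max(r,1)-k$. * (B.5) If $i_{h+1}=k$ and $i_h\succeq i_{h+1}$, then $i_h=k'$ for some $k'\in\{1,\dots,n\}$, and $(\overline{k'},\overline{k'-1},\dots,\overline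 k)$ appears as $(i_{b'},i_{b'+1},\dots,i_b)$ with $n-r-k+1<b-h\le n-k$. * (B.6) If $i_{h+1}=\overline k$ and $i_h\succeq i_{h+1}$, then $i_h=\overline{k'}$ for some $k'\in\{1,\dots,n\}$, and $(k',k'+1,\dots,k)$ appears as $(i_{a'},i_{a'+1},\dots,i_a)$ with $n-r-k+1\le h-a<n-k$. * (B.7) If $i_{h+1}=0$, then $i_h\preceq 0$. Give $B_{\ell,h,r}$ the following structure: $\mathrm{wt},\varepsilon_i,\varphi_i$ of $T$ are those of $m_T$; and $\tilde f_iT$ (resp. $\tilde e_iT$) is the tableau $T'\in B_{\ell,h,r}$ with $m_{T'}=\tilde f_im_T$ (resp. $\tilde e_im_T$) that is obtained from $T$ by replacing one entry along (resp. against) an arrow with label $i$ of $1\xrightarrow{1}2\xrightarrow{2}\cdots\xrightarrow{n-1}n\xrightarrow{n}0\xrightarrow{n}\overline n\xrightarrow{n-1}\cdots\xrightarrow{1}\overline 1$, and is $0$ if there is no such $T'$. **The map $\tau_{\ell,h,r}$.** Let $0\le h\le\ell-1$ and $T\in B_{\ell,h,r}$. The tableau $\tau_{\ell,h,r}(T)$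 has columns of lengths $h+1$ and $\ell-h-1$, and its sequence of entries is the following. * (a) Suppose $i_{h+1}=k$ and there is $b$ with $i_b=\overline k$, $n-r-k+1<b-h\le n-k$. Let $(i_{b''},\dots,i_b)=(\overline{k''},\overline{k''-1},\dots,\overline k)$ be the longest such run of successive letters ending at position $b$. Replace $i_{h+1}$ by $k''+1$ and $(i_{b''},\dots,i_b)$ by $(\overline{k''+1},\overline{k''},\dots,\overline{k+1})$. * (b) Suppose $i_{h+1}=\overline k$ and there is $a$ with $i_a=k$, $n-r-k+1\le h-a<n-k$. Let $(i_{a''},\dots,i_a)=(k'',k''+1,\dots,k)$ be the longest such run of successive letters ending at position $a$. Replace $(i_{a''},\dots,i_a)$ by $(k''-1,\dots,k-1)$ and $i_{h+1}$ by $\overline{k''-1}$. * (c) Otherwise all entries are unchanged. All other entries are unchanged in cases (a) and (b). **Theorem.** 1. For $0\le h\le\ell$, both $B_{\ell,h,r}$ and $\mathcal M_{I_0}(M_{\ell,h,r})$ are crystals of type $B_n$, and $T\mapsto m_T$ is a crystal isomorphism from $B_{\ell,h,r}$ onto $\mathcal M_{I_0}(M_{\ell,h,r})$ (a bijection that preserves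 $\mathrm{wt},\varepsilon_i,\varphi_i$ and commutes with all $\tilde e_i,\tilde f_i$). 2. For $0\le h\le\ell-1$, $\tau_{\ell,h,r}$ is a crystal isomorphism from $B_{\ell,h,r}$ onto $B_{\ell,h+1,r}$, and $m_T\mapsto m_{\tau_{\ell,h,r}(T)}$ is a crystal isomorphism from $\mathcal M_{I_0}(M_{\ell,h,r})$ onto $\mathcal M_{I_0}(M_{\ell,h+1,r})$. -/

import Mathlib

namespace TypeB

noncomputable section

/-! ### Crystals -/

/-- The data of a crystal with index set `I` on the set `B`. A weight `λ` is recorded by its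
coordinates `λ(α_i^∨)`, `i ∈ I`, in the basis of fundamental weights (all Cartan matrices below
are invertible). The value `none` of the Kashiwara operators is the element `0` adjoined to `B`. -/
structure CrystalData (I B : Type) where
  wt : B → I → ℤ
  ε : I → B → ℤ
  φ : I → B → ℤ
  e : I → B → Option B
  f : I → B → Option B

/-- The axioms of a crystal for the Cartan matrix `C`, with the convention `α_i(α_j^∨) = C j i`. -/
structure IsCrystal {I B : Type} (C : Matrix I I ℤ) (S : CrystalData I B) : Prop where
  φ_eq : ∀ i b, S.φ i b = S.ε i b + S.wt b i
  wt_e : ∀ i b b', S.e i b = some b' → ∀ j, S.wt b' j = S.wt b j + C j i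
  ε_e : ∀ i b b', S.e i b = some b' → S.ε i b' = S.ε i b - 1
  φ_e : ∀ i b b', S.e i b = some b' → S.φ i b' = S.φ i b + 1
  wt_f : ∀ i b b', S.f i b = some b' → ∀ j, S.wt b' j = S.wt b j - C j i
  ε_f : ∀ i b b', S.f i b = some b' → S.ε i b' = S.ε i b + 1
  φ_f : ∀ i b b', S.f i b = some b' → S.φ i b' = S.φ i b - 1
  f_iff_e : ∀ i b b', S.f i b = some b' ↔ S.e i b' = some b

/-- `g` is an isomorphism of crystals: a bijection that preserves `wt`, `ε`, `φ` and commutes with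
all Kashiwara operators (`0` being sent to `0`). -/
structure IsCrystalIso {I B B' : Type} (S : CrystalData I B) (S' : CrystalData I B')
    (g : B → B') : Prop where
  bijective : Function.Bijective g
  wt_map : ∀ b, S'.wt (g b) = S.wt b
  ε_map : ∀ i b, S'.ε i (g b) = S.ε i b
  φ_map : ∀ i b, S'.φ i (g b) = S.φ i b
  e_map : ∀ i b, S'.e i (g b) = (S.e i b).map g
  f_map : ∀ i b, S'.f i (g b) = (S.f i b).map g

/-- The elements reached from `b₀` by the Kashiwara operators. -/
inductive Generated {I B : Type} (S : CrystalData I B) (b₀ : B) : B → Prop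
  | base : Generated S b₀ b₀
  | e {b b' : B} (i : I) : Generated S b₀ b → S.e i b = some b' → Generated S b₀ b'
  | f {b b' : B} (i : I) : Generated S b₀ b → S.f i b = some b' → Generated S b₀ b'

open Classical in
/-- The restriction of a crystal to a subset (used below for subsets stable under `e`, `f`). -/
def CrystalData.restrict {I B : Type} (S : CrystalData I B) (X : Set B) : CrystalData I X where
  wt x := S.wt x
  ε i x := S.ε i x
  φ i x := S.φ i x
  e i x := (S.e i x).bind fun y => if hy : y ∈ X then some ⟨y, hy⟩ else none
  f i x := (S.f i x).bind fun y => if hy : y ∈ X then some ⟨y, hy⟩ else none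

/-! ### The monomial crystal of type `B_n`

The node `i ∈ I₀ = {1, …, n}` is the element `i - 1` of `Fin n`. -/

/-- The Cartan matrix of type `B_n` in the convention `C_{i,j} = α_j(α_i^∨)`, so that
`C_{n-1,n} = -1` and `C_{n,n-1} = -2`: the simple root `α_n` is short. -/
def cartan (n : ℕ) : Matrix (Fin n) (Fin n) ℤ := (CartanMatrix.B n).transpose

/-- Laurent monomials in the variables `Y_{i,l}`, `i ∈ I₀`, `l ∈ ℤ`, as families of exponents. The
group is written additively: `m + m'` is the product of the monomials `m` and `m'`. -/
abbrev Monomial (n : ℕ) : Type := (Fin n × ℤ) →₀ ℤ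

/-- The variable `Y_{i,l}` for `i ∈ {1, …, n}`; by convention `Y_{0,l} = 1`. -/
def Y (n i : ℕ) (l : ℤ) : Monomial n :=
  if hi : 1 ≤ i ∧ i ≤ n then Finsupp.single (⟨i - 1, by omega⟩, l) 1 else 0

/-- `A_{i,l} = Y_{i,l-1} Y_{i,l+1} ∏_{j ≠ i} Y_{j,l}^{C_{j,i}}`. -/
def A {n : ℕ} (i : Fin n) (l : ℤ) : Monomial n :=
  Finsupp.single (i, l - 1) 1 + Finsupp.single (i, l + 1) 1
    + ∑ j ∈ Finset.univ.erase i, Finsupp.single (j, l) (cartan n j i)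

/-- `wt(m)(α_i^∨) = ∑_l u_{i,l}(m)`. -/
def wt {n : ℕ} (m : Monomial n) (i : Fin n) : ℤ :=
  m.sum fun x u => if x.1 = i then u else 0

/-- `φ_{i,L}(m) = ∑_{l ≤ L} u_{i,l}(m)`. -/
def φL {n : ℕ} (i : Fin n) (L : ℤ) (m : Monomial n) : ℤ :=
  m.sum fun x u => if x.1 = i ∧ x.2 ≤ L then u else 0

/-- `ε_{i,L}(m) = - ∑_{l ≥ L} u_{i,l}(m)`. -/
def εL {n : ℕ} (i : Fin n) (L : ℤ) (m : Monomial n) : ℤ :=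
  - m.sum fun x u => if x.1 = i ∧ L ≤ x.2 then u else 0

/-- `φ_i(m) = max_L φ_{i,L}(m)`; only finitely many values occur. -/
def φ {n : ℕ} (i : Fin n) (m : Monomial n) : ℤ := ⨆ L : ℤ, φL i L m

/-- `ε_i(m) = max_L ε_{i,L}(m)`; only finitely many values occur. -/
def ε {n : ℕ} (i : Fin n) (m : Monomial n) : ℤ := ⨆ L : ℤ, εL i L m

/-- `p_i(m) = max {L | ε_{i,L}(m) = ε_i(m)}`; used only when `ε_i(m) > 0`, and then the set is
nonempty and bounded above. -/
def p {n : ℕ} (i : Fin n) (m : Monomial n) : ℤ := sSup {L : ℤ | εL i L m = ε i m}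

/-- `q_i(m) = min {L | φ_{i,L}(m) = φ_i(m)}`; used only when `φ_i(m) > 0`, and then the set is
nonempty and bounded below. -/
def q {n : ℕ} (i : Fin n) (m : Monomial n) : ℤ := sInf {L : ℤ | φL i L m = φ i m}

/-- The operators `wt, ε_i, φ_i, ẽ_i, f̃_i` (`i ∈ I₀`) on monomials. -/
def monomialCrystal (n : ℕ) : CrystalData (Fin n) (Monomial n) where
  wt := wt
  ε := ε
  φ := φ
  e i m := if ε i m = 0 then none else some (m + A i (p i m - 1))
  f i m := if φ i m = 0 then none else some (m - A i (q i m + 1))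

/-- The set of monomials of `𝓜_{I₀}(m)`, the `I₀`-subcrystal generated by `m`. -/
def component {n : ℕ} (m : Monomial n) : Set (Monomial n) :=
  {m' | Generated (monomialCrystal n) m m'}

/-- The `I₀`-crystal `𝓜_{I₀}(m)`. -/
def componentCrystal {n : ℕ} (m : Monomial n) : CrystalData (Fin n) (component m) :=
  (monomialCrystal n).restrict (component m)

/-- `M_{ℓ,h,r} = Y_{h,ℓ-h} Y_{h,ℓ-h-2r}⁻¹ Y_{ℓ,-2r}`. -/
def M (n ℓ h r : ℕ) : Monomial n :=
  Y n h ((ℓ : ℤ) - h) - Y n h ((ℓ : ℤ) - h - 2 * r) + Y n ℓ (-2 * (r : ℤ))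

/-! ### Tableaux -/

/-- The letters `k`, `0` and `k̄`. -/
inductive Letter : Type
  | pos (k : ℕ)
  | zero
  | neg (k : ℕ)

/-- The letter belongs to `𝐁 = {1, …, n, 0, n̄, …, 1̄}`. -/
def Letter.Valid (n : ℕ) : Letter → Prop
  | .pos k => 1 ≤ k ∧ k ≤ n
  | .zero => True
  | .neg k => 1 ≤ k ∧ k ≤ n

/-- The position of a letter in `1 ≺ 2 ≺ ⋯ ≺ n ≺ 0 ≺ n̄ ≺ ⋯ ≺ 2̄ ≺ 1̄`. -/
def Letter.rank (n : ℕ) : Letter → ℤ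
  | .pos k => k
  | .zero => n + 1
  | .neg k => 2 * n + 2 - k

/-- The arrows of the crystal of the vector representation:
`1 →¹ 2 →² ⋯ → n →ⁿ 0 →ⁿ n̄ → ⋯ →² 2̄ →¹ 1̄`; here `i ∈ {1, …, n}`. -/
inductive Letter.Arrow (n : ℕ) : ℕ → Letter → Letter → Prop
  | pos (i : ℕ) : 1 ≤ i → i < n → Letter.Arrow n i (.pos i) (.pos (i + 1))
  | toZero : Letter.Arrow n n (.pos n) .zero
  | fromZero : Letter.Arrow n n .zero (.neg n)
  | neg (i : ℕ) : 1 ≤ i → i < n → Letter.Arrow n i (.neg (i + 1)) (.neg i)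

/-- The monomial of a box with entry `x` and suffix `s` (with `Y_{0,*} = 1`). -/
def box (n : ℕ) (x : Letter) (s : ℤ) : Monomial n :=
  match x with
  | .pos k =>
      if k = n then - Y n (n - 1) (s + n) + 2 • Y n n (s + n - 1)
      else - Y n (k - 1) (s + k) + Y n k (s + k - 1)
  | .zero => - Y n n (s + n + 1) + Y n n (s + n - 1)
  | .neg k =>
      if k = n then Y n (n - 1) (s + n) - 2 • Y n n (s + n + 1)
      else Y n (k - 1) (s + 2 * n - k) - Y n k (s + 2 * n + 1 - k)

/-- Tableaux `(i_1, …, i_ℓ)`, indexed by `{1, …, ℓ}`. The division into the columns `(i_1, …, i_h)`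
and `(i_{h+1}, …, i_ℓ)` is specified by the parameter `h` of the definitions below. -/
abbrev Tableau (ℓ : ℕ) : Type := Finset.Icc 1 ℓ → Letter

/-- `1 ≤ a ≤ ℓ` and `i_a = x`. -/
def Tableau.Has {ℓ : ℕ} (T : Tableau ℓ) (a : ℕ) (x : Letter) : Prop :=
  ∃ ha : a ∈ Finset.Icc 1 ℓ, T ⟨a, ha⟩ = x

/-- `m_T`: the suffix of the box `a` is `ℓ + 1 - 2a` in the first column and `ℓ + 1 - 2a - 2r` in
the second one. -/
def mon (n h r : ℕ) {ℓ : ℕ} (T : Tableau ℓ) : Monomial n :=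
  ∑ a : Finset.Icc 1 ℓ,
    box n (T a) ((ℓ : ℤ) + 1 - 2 * (a : ℕ) - if (a : ℕ) ≤ h then 0 else 2 * (r : ℤ))

/-- The conditions (B.1)–(B.7). -/
structure IsTableau (n h r : ℕ) {ℓ : ℕ} (T : Tableau ℓ) : Prop where
  valid : ∀ a, (T a).Valid n
  B1 : ∀ a x y, T.Has a x → T.Has (a + 1) y → a ≠ h →
    x.rank n < y.rank n ∨ (x = .zero ∧ y = .zero)
  B2 : ¬ ∃ a b k : ℕ, a < b ∧ b ≤ h ∧ T.Has a (.pos k) ∧ T.Has b (.neg k) ∧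
    (b : ℤ) - a = n - k
  B3 : ¬ ∃ a b k : ℕ, h + 1 ≤ a ∧ a < b ∧ T.Has a (.pos k) ∧ T.Has b (.neg k) ∧
    (b : ℤ) - a = n - k
  B4 : ¬ ∃ a b k : ℕ, a ≤ h ∧ h + 1 ≤ b ∧ T.Has a (.pos k) ∧ T.Has b (.neg k) ∧
    (b : ℤ) - a = n + 1 - max (r : ℤ) 1 - k
  B5 : ∀ k x, T.Has (h + 1) (.pos k) → T.Has h x → (Letter.pos k).rank n ≤ x.rank n →
    ∃ k', x = .pos k' ∧ ∃ b' b : ℕ, b' ≤ b ∧ b' + k' = b + k ∧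
      (∀ c, b' ≤ c → c ≤ b → T.Has c (.neg (b + k - c))) ∧
      (n : ℤ) - r - k + 1 < (b : ℤ) - h ∧ (b : ℤ) - h ≤ n - k
  B6 : ∀ k x, T.Has (h + 1) (.neg k) → T.Has h x → (Letter.neg k).rank n ≤ x.rank n →
    ∃ k', x = .neg k' ∧ ∃ a' a : ℕ, a' ≤ a ∧ a' + k = a + k' ∧
      (∀ c, a' ≤ c → c ≤ a → T.Has c (.pos (k' + (c - a')))) ∧
      (n : ℤ) - r - k + 1 ≤ (h : ℤ) - a ∧ (h : ℤ) - a < n - k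
  B7 : ∀ x, T.Has (h + 1) .zero → T.Has h x → x.rank n ≤ Letter.zero.rank n

/-- The set `B_{ℓ,h,r}`. -/
def B (n ℓ h r : ℕ) : Set (Tableau ℓ) := {T | IsTableau n h r T}

/-- `T'` is obtained from `T` by replacing one entry along an `i`-arrow. -/
def Tableau.Step (n : ℕ) {ℓ : ℕ} (i : ℕ) (T T' : Tableau ℓ) : Prop :=
  ∃ a, Letter.Arrow n i (T a) (T' a) ∧ ∀ c, c ≠ a → T' c = T c

open Classical in
/-- The crystal structure on `B_{ℓ,h,r}`: `wt`, `ε_i`, `φ_i` are those of the monomial `m_T`, and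
`f̃_i T` (resp. `ẽ_i T`) is the tableau of `B_{ℓ,h,r}` that is obtained by replacing one entry of `T`
along an `i`-arrow (resp. against an `i`-arrow) and whose monomial is `f̃_i m_T` (resp. `ẽ_i m_T`);
it is `0` if there is no such tableau. -/
def tableauCrystal (n ℓ h r : ℕ) : CrystalData (Fin n) (B n ℓ h r) where
  wt T := wt (mon n h r T.1)
  ε i T := ε i (mon n h r T.1)
  φ i T := φ i (mon n h r T.1)
  e i T :=
    if hT : ∃ T' : B n ℓ h r, Tableau.Step n (i + 1) T'.1 T.1 ∧
        (monomialCrystal n).e i (mon n h r T.1) = some (mon n h r T'.1)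
    then some hT.choose else none
  f i T :=
    if hT : ∃ T' : B n ℓ h r, Tableau.Step n (i + 1) T.1 T'.1 ∧
        (monomialCrystal n).f i (mon n h r T.1) = some (mon n h r T'.1)
    then some hT.choose else none

/-! ### The map `τ_{ℓ,h,r}` -/

/-- `i_{h+1} = k`, `i_b = k̄` and `n - r - k + 1 < b - h ≤ n - k`. -/
def CaseA (n h r : ℕ) {ℓ : ℕ} (T : Tableau ℓ) (k b : ℕ) : Prop :=
  T.Has (h + 1) (.pos k) ∧ T.Has b (.neg k) ∧
    (n : ℤ) - r - k + 1 < (b : ℤ) - h ∧ (b : ℤ) - h ≤ n - k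

/-- `i_{h+1} = k̄`, `i_a = k` and `n - r - k + 1 ≤ h - a < n - k`. -/
def CaseB (n h r : ℕ) {ℓ : ℕ} (T : Tableau ℓ) (k a : ℕ) : Prop :=
  T.Has (h + 1) (.neg k) ∧ T.Has a (.pos k) ∧
    (n : ℤ) - r - k + 1 ≤ (h : ℤ) - a ∧ (h : ℤ) - a < n - k

/-- The least `b''` such that `(i_{b''}, …, i_b)` consists of successive barred letters ending in
`i_b = k̄`. -/
def startA {ℓ : ℕ} (T : Tableau ℓ) (k b : ℕ) : ℕ :=
  sInf {c | 1 ≤ c ∧ c ≤ b ∧ ∀ d, c ≤ d → d ≤ b → T.Has d (.neg (b + k - d))}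

/-- The least `a''` such that `(i_{a''}, …, i_a)` consists of successive unbarred letters ending in
`i_a = k`. -/
def startB {ℓ : ℕ} (T : Tableau ℓ) (k a : ℕ) : ℕ :=
  sInf {c | 1 ≤ c ∧ c ≤ a ∧ ∀ d, c ≤ d → d ≤ a → ∃ j, j + a = k + d ∧ T.Has d (.pos j)}

/-- With `k'' = k + b - b''`: the entry `i_{h+1} = k` becomes `k'' + 1`, and the successive part
ending in `i_b = k̄`, which starts with the bar of `k''`, becomes the one that starts with the bar of
`k'' + 1`. -/
def tauA (h : ℕ) {ℓ : ℕ} (T : Tableau ℓ) (k b : ℕ) : Tableau ℓ := fun c =>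
  if (c : ℕ) = h + 1 then .pos (b + k - startA T k b + 1)
  else if startA T k b ≤ (c : ℕ) ∧ (c : ℕ) ≤ b then .neg (b + k - (c : ℕ) + 1)
  else T c

/-- With `k'' = k - (a - a'')`: the entry `i_{h+1} = k̄` becomes the bar of `k'' - 1`, and the
successive part `(k'', …, k)` ending in `i_a = k` becomes `(k'' - 1, …, k - 1)`. -/
def tauB (h : ℕ) {ℓ : ℕ} (T : Tableau ℓ) (k a : ℕ) : Tableau ℓ := fun c =>
  if (c : ℕ) = h + 1 then .neg (k + startB T k a - a - 1)
  else if startB T k a ≤ (c : ℕ) ∧ (c : ℕ) ≤ a then .pos (k + (c : ℕ) - a - 1)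
  else T c

open Classical in
/-- The map `τ_{ℓ,h,r}`; its values are divided into columns after the entry `h + 1`. For a tableau
in `B_{ℓ,h,r}` the pair `(k, b)`, resp. `(k, a)`, is unique if it exists. -/
def tau (n h r : ℕ) {ℓ : ℕ} (T : Tableau ℓ) : Tableau ℓ :=
  if hA : ∃ x : ℕ × ℕ, CaseA n h r T x.1 x.2 then tauA h T hA.choose.1 hA.choose.2
  else if hB : ∃ x : ℕ × ℕ, CaseB n h r T x.1 x.2 then tauB h T hB.choose.1 hB.choose.2
  else T

end

end TypeB

/-! Everything is read off from the partial sums of exponents. The operator `f̃_i` acts at the first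
maximum of `L ↦ φ_{i,L}(m)`, and `ẽ_i` acts at the last one. In the monomial of a tableau the
variables `Y_{i,l}` occur only with `l ≡ ℓ + i` modulo 2. This parity makes `ẽ_i` and `f̃_i` partial
inverses of each other, and it allows the level `l = ℓ + i + 2L` to be replaced by the index `L`.

Letters are coded by their ranks `1, …, 2n+1`, the bar of `k` having rank `2n+2-k`. The partial sums
for node `i` become a sum `F` of unit steps. For `i < n` the letters `i` and bar of `i+1` give steps
up, and the letters `i+1` and bar of `i` give steps down. For `i = n` the letters `n` and bar of `n`
count twice, and each `0` gives a step up followed at once by a step down. The place of a step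
depends on the position of the letter, and the second column is displaced by `r`. Adjacent letters
of one arrow cancel, so for `i < n` a column contributes at most one step for each of the two arrows
labelled `i` (`strand_cases`). Raising a letter along an `i`-arrow divides the monomial by some
`A_{i,l}` (`box_arrow`, `smon_bump`), so a step on tableaux is a step on monomials.

For `h = ℓ` there is only one column. Closure under the operators, uniqueness of the entry on which
`f̃_i` acts, and the fact that `(1, …, ℓ)` is the only source are then checked directly
(`good_single`).

The general case descends from `h + 1` to `h` along `τ`, which is encoded as a relation `Rel t s`
between integer sequences. Reversing a sequence and exchanging `k` with its bar turns the relation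
around, so that every construction of `s` from `t` also yields `t` from `s`. Hence `Rel` is a
bijection between the tableaux for `h` and those for `h + 1`.

The heart is `Rel.compare`. Related sequences have partial sums with the same final value, and the
same maximum as soon as the sum for `s` is positive somewhere. Every `f̃_i`-step of `s` lifts to one
of `t`, and the results are related again. The reason is that `τ`, together with the displacement of
the entry `h + 1` by `r`, only moves a few steps of `F` across a window. Either the first maximum is
not affected and the same entry is raised on both sides, or the entry at `h + 1` and an entry
belonging to a run exchange their roles. In the latter case the exchanged run grows, shrinks,
appears or disappears.

With this comparison the property `Good` (closure under the operators, injectivity of `T ↦ m_T`, a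
single source) passes from `h + 1` to `h`, by `Good.pred`. Injectivity is an induction on the sum of
the ranks that descends along `ẽ_i`. The monomial of the source telescopes to `M_{ℓ,h,r}`
(`smon_highest`), so the monomials of tableaux are exactly the component of that monomial. All
crystal axioms and isomorphisms then follow from the embedding of each crystal into the monomials.
-/

namespace TypeB

/-! ### First and last maxima of the partial sums -/

/-- `q` is the least point at which `g` attains its maximum. -/
def IsFirstMax (g : ℤ → ℤ) (q : ℤ) : Prop := (∀ L, g L ≤ g q) ∧ ∀ L, L < q → g L < g q

/-- `q` is the greatest point at which `g` attains its maximum. -/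
def IsLastMax (g : ℤ → ℤ) (q : ℤ) : Prop := (∀ L, g L ≤ g q) ∧ ∀ L, q < L → g L < g q

lemma IsFirstMax.unique {g : ℤ → ℤ} {q q' : ℤ} (h : IsFirstMax g q) (h' : IsFirstMax g q') :
    q = q' := by
  rcases lt_trichotomy q q' with hlt | rfl | hlt
  · have := h'.2 _ hlt; have := h.1 q'; omega
  · rfl
  · have := h.2 _ hlt; have := h'.1 q; omega

lemma IsLastMax.unique {g : ℤ → ℤ} {q q' : ℤ} (h : IsLastMax g q) (h' : IsLastMax g q') :
    q = q' := by
  rcases lt_trichotomy q q' with hlt | rfl | hlt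
  · have := h.2 _ hlt; have := h'.1 q; omega
  · rfl
  · have := h'.2 _ hlt; have := h.1 q'; omega

/-- Outside a bounded interval `g` is constant on either side, so a maximum exists. A positive value
is needed for a first one: `g` vanishes far to the left, so the points of maximum are then bounded
below. -/
lemma exists_isFirstMax {g : ℤ → ℤ} {lo hi c : ℤ} (hlo : ∀ L, L ≤ lo → g L = 0)
    (hhi : ∀ L, hi ≤ L → g L = c) (hpos : ∃ L, 0 < g L) : ∃ q, IsFirstMax g q ∧ 0 < g q := by
  obtain ⟨L₀, hL₀⟩ := hpos
  have hfin : (Finset.Icc lo (max lo hi)).Nonempty := ⟨lo, by simp⟩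
  obtain ⟨x, hx, hmax⟩ := Finset.exists_max_image _ g hfin
  have hmax' : ∀ L, g L ≤ g x := by
    intro L
    by_cases h1 : L ≤ lo
    · rw [hlo L h1, ← hlo lo le_rfl]; exact hmax _ (by simp)
    by_cases h2 : max lo hi ≤ L
    · rw [hhi L (by omega), ← hhi (max lo hi) (by omega)]; exact hmax _ (by simp)
    exact hmax _ (by simp only [Finset.mem_Icc]; omega)
  have hx0 : 0 < g x := lt_of_lt_of_le hL₀ (hmax' _)
  obtain ⟨q, hq, hq'⟩ := Int.exists_least_of_bdd (P := fun z => g z = g x)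
    ⟨lo, fun z hz => by
      by_contra hlt
      have := hlo z (by omega)
      omega⟩ ⟨x, rfl⟩
  refine ⟨q, ⟨fun L => hq ▸ hmax' L, fun L hL => ?_⟩, by omega⟩
  have h1 := hmax' L
  rcases lt_or_eq_of_le h1 with h2 | h2
  · omega
  · have := hq' L h2; omega

/-! ### The partial sums of a monomial -/

section Monomial

variable {n : ℕ}

lemma φL_add (i : Fin n) (L : ℤ) (m m' : Monomial n) :
    φL i L (m + m') = φL i L m + φL i L m' := by
  unfold φL
  exact Finsupp.sum_add_index' (by simp) (by intros; split_ifs <;> simp)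

lemma φL_zero (i : Fin n) (L : ℤ) : φL i L (0 : Monomial n) = 0 := by simp [φL]

lemma φL_single (i : Fin n) (L : ℤ) (x : Fin n × ℤ) (u : ℤ) :
    φL i L (Finsupp.single x u) = if x.1 = i ∧ x.2 ≤ L then u else 0 := by
  unfold φL
  exact Finsupp.sum_single_index (by simp)

/-- `φL` as an additive homomorphism. -/
def φHom (i : Fin n) (L : ℤ) : Monomial n →+ ℤ where
  toFun := φL i L
  map_zero' := φL_zero i L
  map_add' := φL_add i L

lemma φL_sub (i : Fin n) (L : ℤ) (m m' : Monomial n) :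
    φL i L (m - m') = φL i L m - φL i L m' := map_sub (φHom i L) m m'

lemma φL_neg (i : Fin n) (L : ℤ) (m : Monomial n) :
    φL i L (-m) = - φL i L m := map_neg (φHom i L) m

lemma φL_sum {ι : Type*} (s : Finset ι) (i : Fin n) (L : ℤ) (m : ι → Monomial n) :
    φL i L (∑ a ∈ s, m a) = ∑ a ∈ s, φL i L (m a) := map_sum (φHom i L) m s

lemma exists_level_bounds (m : Monomial n) :
    ∃ lo hi : ℤ, ∀ x ∈ m.support, lo < x.2 ∧ x.2 ≤ hi := by
  obtain ⟨lo, hlo⟩ := (m.support.image Prod.snd).bddBelow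
  obtain ⟨hi, hhi⟩ := (m.support.image Prod.snd).bddAbove
  refine ⟨lo - 1, hi, fun x hx => ⟨?_, ?_⟩⟩
  · have := hlo (Finset.mem_coe.2 (Finset.mem_image_of_mem Prod.snd hx)); omega
  · exact hhi (Finset.mem_coe.2 (Finset.mem_image_of_mem Prod.snd hx))

lemma exists_φL_bounds (i : Fin n) (m : Monomial n) :
    ∃ lo hi : ℤ, (∀ L, L ≤ lo → φL i L m = 0) ∧ ∀ L, hi ≤ L → φL i L m = wt m i := by
  obtain ⟨lo, hi, h⟩ := exists_level_bounds m
  refine ⟨lo, hi, fun L hL => ?_, fun L hL => ?_⟩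
  · unfold φL Finsupp.sum
    refine Finset.sum_eq_zero fun x hx => if_neg ?_
    have := h x hx
    omega
  · unfold φL wt Finsupp.sum
    refine Finset.sum_congr rfl fun x hx => ?_
    have := h x hx
    have h2 : x.2 ≤ L := by omega
    simp [h2]

/-- The sums over `l ≥ L` and over `l ≤ L - 1` add up to the weight. Hence `ε_i` and `p_i` can be
expressed by the same partial sums as `φ_i`, with an index shift by one. -/
lemma εL_eq (i : Fin n) (L : ℤ) (m : Monomial n) :
    εL i L m = φL i (L - 1) m - wt m i := by
  unfold εL φL wt Finsupp.sum
  rw [← Finset.sum_sub_distrib, ← Finset.sum_neg_distrib]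
  refine Finset.sum_congr rfl fun x _ => ?_
  by_cases h1 : x.1 = i <;> by_cases h2 : L ≤ x.2
  · have : ¬ x.2 ≤ L - 1 := by omega
    simp [h1, h2, this]
  · have : x.2 ≤ L - 1 := by omega
    simp [h1, h2, this]
  · simp [h1]
  · simp [h1]

lemma wt_eq_of_φL {m m' : Monomial n} {i : Fin n} {d : ℤ}
    (h : ∃ L₀, ∀ L, L₀ ≤ L → φL i L m' = φL i L m + d) : wt m' i = wt m i + d := by
  obtain ⟨L₀, h⟩ := h
  obtain ⟨_, hi, _, h1⟩ := exists_φL_bounds i m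
  obtain ⟨_, hi', _, h1'⟩ := exists_φL_bounds i m'
  have := h (max L₀ (max hi hi')) (by omega)
  rw [h1 _ (by omega), h1' _ (by omega)] at this
  exact this

lemma φL_le_bdd (i : Fin n) (m : Monomial n) : ∃ v, ∀ L, φL i L m ≤ v := by
  obtain ⟨lo, hi, h1, h2⟩ := exists_φL_bounds i m
  by_cases hp : ∃ L, 0 < φL i L m
  · obtain ⟨q, hq, -⟩ := exists_isFirstMax h1 h2 hp
    exact ⟨_, hq.1⟩
  · push Not at hp
    exact ⟨0, hp⟩

lemma φ_eq_of_max {i : Fin n} {m : Monomial n} {v : ℤ} (h : ∀ L, φL i L m ≤ v)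
    (hv : ∃ L, φL i L m = v) : φ i m = v := by
  obtain ⟨L, hL⟩ := hv
  refine le_antisymm (ciSup_le h) ?_
  rw [← hL]
  exact le_ciSup (f := fun L => φL i L m) ⟨v, by rintro _ ⟨L, rfl⟩; exact h L⟩ L

lemma φL_le_φ (i : Fin n) (L : ℤ) (m : Monomial n) : φL i L m ≤ φ i m := by
  obtain ⟨v, hv⟩ := φL_le_bdd i m
  exact le_ciSup (f := fun L => φL i L m) ⟨v, by rintro _ ⟨L, rfl⟩; exact hv L⟩ L

lemma φ_nonneg (i : Fin n) (m : Monomial n) : 0 ≤ φ i m := by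
  obtain ⟨lo, hi, h1, h2⟩ := exists_φL_bounds i m
  have := φL_le_φ i lo m
  rwa [h1 lo le_rfl] at this

lemma wt_le_φ (i : Fin n) (m : Monomial n) : wt m i ≤ φ i m := by
  obtain ⟨lo, hi, h1, h2⟩ := exists_φL_bounds i m
  have := φL_le_φ i hi m
  rwa [h2 hi le_rfl] at this

lemma exists_φL_eq_φ (i : Fin n) (m : Monomial n) : ∃ L, φL i L m = φ i m := by
  obtain ⟨lo, hi, h1, h2⟩ := exists_φL_bounds i m
  by_cases hp : ∃ L, 0 < φL i L m
  · obtain ⟨q, hq, -⟩ := exists_isFirstMax h1 h2 hp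
    exact ⟨q, (φ_eq_of_max hq.1 ⟨q, rfl⟩).symm⟩
  · push Not at hp
    exact ⟨lo, by rw [h1 lo le_rfl, φ_eq_of_max hp ⟨lo, h1 lo le_rfl⟩]⟩

lemma ε_eq (i : Fin n) (m : Monomial n) : ε i m = φ i m - wt m i := by
  obtain ⟨L, hL⟩ := exists_φL_eq_φ i m
  refine le_antisymm (ciSup_le fun L => ?_) ?_
  · rw [εL_eq]; have := φL_le_φ i (L - 1) m; omega
  · rw [← hL]
    have : εL i (L + 1) m = φL i L m - wt m i := by rw [εL_eq]; simp
    rw [← this]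
    refine le_ciSup (f := fun L => εL i L m) ⟨φ i m - wt m i, ?_⟩ (L + 1)
    rintro _ ⟨L, rfl⟩
    simp only [εL_eq]
    have := φL_le_φ i (L - 1) m; omega

lemma φ_eq_zero_iff (i : Fin n) (m : Monomial n) : φ i m = 0 ↔ ∀ L, φL i L m ≤ 0 := by
  constructor
  · intro h L; rw [← h]; exact φL_le_φ i L m
  · intro h
    obtain ⟨L, hL⟩ := exists_φL_eq_φ i m
    have := h L; have := φ_nonneg i m; omega

lemma ε_eq_zero_iff (i : Fin n) (m : Monomial n) : ε i m = 0 ↔ ∀ L, φL i L m ≤ wt m i := by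
  rw [ε_eq]
  constructor
  · intro h L; have := φL_le_φ i L m; omega
  · intro h
    obtain ⟨L, hL⟩ := exists_φL_eq_φ i m
    have := h L; have := wt_le_φ i m; omega

/-- For a nonzero maximum the set in the definition of `q` is bounded below, so that its `sInf` is a
true minimum and not a default value. -/
lemma isFirstMax_q {i : Fin n} {m : Monomial n} (h : φ i m ≠ 0) :
    IsFirstMax (fun L => φL i L m) (q i m) := by
  obtain ⟨lo, hi, h1, h2⟩ := exists_φL_bounds i m
  obtain ⟨L₀, hL₀⟩ := exists_φL_eq_φ i m
  have hb : BddBelow {L : ℤ | φL i L m = φ i m} := ⟨lo, fun L hL => by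
    by_contra hlt
    have := h1 L (by omega)
    simp only [Set.mem_ofPred_eq] at hL; omega⟩
  have hq : φL i (q i m) m = φ i m := Int.csInf_mem (s := {L : ℤ | φL i L m = φ i m}) ⟨L₀, hL₀⟩ hb
  refine ⟨fun L => ?_, fun L hL => ?_⟩
  · simp only [hq]; exact φL_le_φ i L m
  · simp only [hq]
    refine lt_of_le_of_ne (φL_le_φ i L m) fun he => ?_
    have := csInf_le hb he
    exact absurd hL (not_lt.2 this)

/-- The shift `p - 1` comes from `εL_eq`; it is also the index of the factor `A` in the definition
of `ẽ_i`. -/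
lemma isLastMax_p {i : Fin n} {m : Monomial n} (h : ε i m ≠ 0) :
    IsLastMax (fun L => φL i L m) (p i m - 1) := by
  obtain ⟨lo, hi, h1, h2⟩ := exists_φL_bounds i m
  obtain ⟨L₀, hL₀⟩ := exists_φL_eq_φ i m
  have hset : {L : ℤ | εL i L m = ε i m} = {L : ℤ | φL i (L - 1) m = φ i m} := by
    ext L; simp [εL_eq, ε_eq]
  rw [ε_eq] at h
  have hb : BddAbove {L : ℤ | φL i (L - 1) m = φ i m} := ⟨hi + 1, fun L hL => by
    by_contra hlt
    have := h2 (L - 1) (by omega)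
    simp only [Set.mem_ofPred_eq] at hL; omega⟩
  have hp : φL i (p i m - 1) m = φ i m := by
    have := Int.csSup_mem (s := {L : ℤ | φL i (L - 1) m = φ i m}) ⟨L₀ + 1, by simpa using hL₀⟩ hb
    rw [← hset] at this
    have h3 : p i m ∈ {L : ℤ | εL i L m = ε i m} := this
    rwa [hset] at h3
  refine ⟨fun L => ?_, fun L hL => ?_⟩
  · simp only [hp]; exact φL_le_φ i L m
  · simp only [hp]
    refine lt_of_le_of_ne (φL_le_φ i L m) fun he => ?_
    have h4 : L + 1 ≤ sSup {L : ℤ | φL i (L - 1) m = φ i m} := le_csSup hb (by simpa using he)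
    rw [← hset] at h4
    have h5 : L + 1 ≤ p i m := h4
    omega

/-- This form and the one for `ẽ_i` below replace suprema and infima in all later arguments:
exhibiting a first or last maximum is enough. -/
lemma f_eq_some_iff {i : Fin n} {m m' : Monomial n} :
    (monomialCrystal n).f i m = some m' ↔
      ∃ q, IsFirstMax (fun L => φL i L m) q ∧ 0 < φL i q m ∧ m' = m - A i (q + 1) := by
  by_cases h : φ i m = 0
  · simp only [monomialCrystal, h, if_true, reduceCtorEq, false_iff]
    rintro ⟨q, hq, hpos, -⟩
    have := (φ_eq_zero_iff i m).1 h q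
    omega
  · simp only [monomialCrystal, h, if_false, Option.some.injEq]
    have hq := isFirstMax_q h
    constructor
    · rintro rfl
      refine ⟨_, hq, ?_, rfl⟩
      obtain ⟨L, hL⟩ := exists_φL_eq_φ i m
      have h3 : φL i L m ≤ φL i (q i m) m := hq.1 L
      have := φ_nonneg i m
      omega
    · rintro ⟨q', hq', -, rfl⟩
      rw [hq.unique hq']

lemma e_eq_some_iff {i : Fin n} {m m' : Monomial n} :
    (monomialCrystal n).e i m = some m' ↔
      ∃ q, IsLastMax (fun L => φL i L m) q ∧ wt m i < φL i q m ∧ m' = m + A i q := by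
  by_cases h : ε i m = 0
  · simp only [monomialCrystal, h, if_true, reduceCtorEq, false_iff]
    rintro ⟨q, hq, hpos, -⟩
    have := (ε_eq_zero_iff i m).1 h q
    omega
  · simp only [monomialCrystal, h, if_false, Option.some.injEq]
    have hq := isLastMax_p h
    constructor
    · rintro rfl
      refine ⟨_, hq, ?_, rfl⟩
      obtain ⟨L, hL⟩ := exists_φL_eq_φ i m
      have h3 : φL i L m ≤ φL i (p i m - 1) m := hq.1 L
      have := wt_le_φ i m
      rw [ε_eq] at h
      omega
    · rintro ⟨q', hq', -, rfl⟩
      rw [hq.unique hq']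

lemma φ_eq_of_isFirstMax {i : Fin n} {m : Monomial n} {q : ℤ}
    (h : IsFirstMax (fun L => φL i L m) q) : φ i m = φL i q m :=
  φ_eq_of_max h.1 ⟨q, rfl⟩

lemma φL_A_self (i : Fin n) (l L : ℤ) :
    φL i L (A i l) = (if l - 1 ≤ L then 1 else 0) + (if l + 1 ≤ L then 1 else 0) := by
  unfold A
  rw [φL_add, φL_add, φL_single, φL_single, φL_sum, Finset.sum_eq_zero]
  · simp
  · intro j hj
    rw [φL_single, if_neg]
    simp only [Finset.mem_erase] at hj
    tauto

lemma φL_A_ne {i j : Fin n} (hij : j ≠ i) (l L : ℤ) :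
    φL j L (A i l) = if l ≤ L then cartan n j i else 0 := by
  unfold A
  rw [φL_add, φL_add, φL_single, φL_single, φL_sum, Finset.sum_eq_single j]
  · simp [φL_single, hij.symm]
  · intro k _ hk
    rw [φL_single, if_neg]; tauto
  · intro hj; simp [hij] at hj

lemma cartan_self (i : Fin n) : cartan n i i = 2 := by
  simp [cartan]

lemma wt_add (m m' : Monomial n) (i : Fin n) : wt (m + m') i = wt m i + wt m' i := by
  unfold wt
  exact Finsupp.sum_add_index' (by simp) (by intros; split_ifs <;> simp)

lemma wt_A (i j : Fin n) (l : ℤ) : wt (A i l) j = cartan n j i := by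
  have h0 : wt (0 : Monomial n) j = 0 := by simp [wt]
  have : wt (A i l) j = wt (0 : Monomial n) j + cartan n j i := by
    refine wt_eq_of_φL ⟨l + 1, fun L hL => ?_⟩
    rw [φL_zero]
    by_cases hij : j = i
    · subst hij
      rw [φL_A_self, cartan_self, if_pos (by omega), if_pos (by omega)]; norm_num
    · rw [φL_A_ne hij, if_pos (by omega), zero_add]
  rw [this, h0, zero_add]

lemma wt_sub_A (m : Monomial n) (i j : Fin n) (l : ℤ) :
    wt (m - A i l) j = wt m j - cartan n j i := by
  have := wt_add (m - A i l) (A i l) j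
  rw [sub_add_cancel, wt_A] at this
  omega

lemma φ_of_f {i : Fin n} {m m' : Monomial n} (h : (monomialCrystal n).f i m = some m') :
    φ i m' = φ i m - 1 := by
  obtain ⟨q, hq, hpos, rfl⟩ := f_eq_some_iff.1 h
  rw [φ_eq_of_isFirstMax hq]
  refine φ_eq_of_max (fun L => ?_) ⟨q, ?_⟩
  · rw [φL_sub, φL_A_self]
    have := hq.1 L; have := hq.2 L
    simp only at *
    split_ifs <;> omega
  · rw [φL_sub, φL_A_self, if_pos (by omega), if_neg (by omega)]; ring

lemma φ_of_e {i : Fin n} {m m' : Monomial n} (h : (monomialCrystal n).e i m = some m') :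
    φ i m' = φ i m + 1 := by
  obtain ⟨q, hq, hpos, rfl⟩ := e_eq_some_iff.1 h
  rw [φ_eq_of_max hq.1 ⟨q, rfl⟩]
  refine φ_eq_of_max (fun L => ?_) ⟨q, ?_⟩
  · rw [φL_add, φL_A_self]
    have := hq.1 L; have := hq.2 L
    simp only at *
    split_ifs <;> omega
  · rw [φL_add, φL_A_self, if_pos (by omega), if_neg (by omega)]; ring

/-- The exponents `u_{i,l}(m)` vanish unless `l ≡ c` modulo `2`. -/
def HasParity (i : Fin n) (c : ℤ) (m : Monomial n) : Prop :=
  ∀ l, φL i l m ≠ φL i (l - 1) m → (2 : ℤ) ∣ l - c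

/-- By parity the sum does not change from `q` to `q + 1`. Dividing by `A_{i,q+1}` lowers it by one
at `q` and `q + 1` and by two from `q + 2` on, while before `q` it was already smaller than the
maximum. So the new last maximum is at `q + 1`, and `ẽ_i` multiplies by the same factor. Without
parity the value at `q + 1` could be smaller. -/
lemma e_of_f {i : Fin n} {c : ℤ} {m m' : Monomial n} (hm : HasParity i c m)
    (h : (monomialCrystal n).f i m = some m') : (monomialCrystal n).e i m' = some m := by
  obtain ⟨q, hq, hpos, rfl⟩ := f_eq_some_iff.1 h
  have h1 := hq.2 (q - 1) (by omega)
  have hpar := hm q (by simp only at h1; omega)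
  have hq1 : φL i (q + 1) m = φL i q m := by
    by_contra hne
    have := hm (q + 1) (by simpa using hne)
    omega
  have hval : φL i (q + 1) (m - A i (q + 1)) = φL i q m - 1 := by
    rw [φL_sub, φL_A_self, hq1, if_pos (by omega), if_neg (by omega)]; ring
  refine e_eq_some_iff.2 ⟨q + 1, ⟨fun L => ?_, fun L hL => ?_⟩, ?_, by simp⟩
  · simp only [hval]
    rw [φL_sub, φL_A_self]
    have := hq.1 L; have := hq.2 L
    simp only at *
    split_ifs <;> omega
  · simp only [hval]
    rw [φL_sub, φL_A_self, if_pos (by omega), if_pos (by omega)]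
    have := hq.1 L
    simp only at *
    omega
  · rw [hval, wt_sub_A, cartan_self]
    have := wt_le_φ i m
    rw [φ_eq_of_isFirstMax hq] at this
    omega

lemma f_of_e {i : Fin n} {c : ℤ} {m m' : Monomial n} (hm : HasParity i c m)
    (h : (monomialCrystal n).e i m = some m') : (monomialCrystal n).f i m' = some m := by
  obtain ⟨q, hq, hpos, rfl⟩ := e_eq_some_iff.1 h
  have h1 := hq.2 (q + 1) (by omega)
  have hpar := hm (q + 1) (by simp only at h1; rw [add_sub_cancel_right]; omega)
  have hq1 : φL i (q - 1) m = φL i q m := by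
    by_contra hne
    have := hm q (Ne.symm hne)
    omega
  have hval : φL i (q - 1) (m + A i q) = φL i q m + 1 := by
    rw [φL_add, φL_A_self, hq1, if_pos (by omega), if_neg (by omega)]; ring
  refine f_eq_some_iff.2 ⟨q - 1, ⟨fun L => ?_, fun L hL => ?_⟩, ?_, by simp⟩
  · simp only [hval]
    rw [φL_add, φL_A_self]
    have := hq.1 L; have := hq.2 L
    simp only at *
    split_ifs <;> omega
  · simp only [hval]
    rw [φL_add, φL_A_self, if_neg (by omega), if_neg (by omega)]
    have := hq.1 L
    simp only at *
    omega
  · rw [hval]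
    have := φ_nonneg i m
    rw [φ_eq_of_max hq.1 ⟨q, rfl⟩] at this
    simp only at this
    omega

end Monomial

end TypeB

namespace TypeB

/-! ### Tableaux as integer sequences

A tableau is encoded by the sequence `t` of the positions of its entries in
`1 ≺ ⋯ ≺ n ≺ 0 ≺ n̄ ≺ ⋯ ≺ 1̄`, extended by `0`. -/

/-- The step function of a half line. -/
def stp (x L : ℤ) : ℤ := if x ≤ L then 1 else 0

/-- `t` is increasing on `[lo, hi]`, except that the value `n + 1` may be repeated. -/
def Col (n : ℤ) (t : ℤ → ℤ) (lo hi : ℤ) : Prop :=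
  ∀ a, lo ≤ a → a + 1 ≤ hi → t a < t (a + 1) ∨ (t a = n + 1 ∧ t (a + 1) = n + 1)

/-- The number of entries `ρ` at positions `a` of `[lo, hi]` with `θ ≤ a`. -/
noncomputable def cnt (t : ℤ → ℤ) (lo hi ρ θ : ℤ) : ℤ :=
  ∑ a ∈ Finset.Icc lo hi, if t a = ρ ∧ θ ≤ a then 1 else 0

/-- The contribution of the arrow `ρ → ρ + 1` to the partial sums. -/
noncomputable def strand (t : ℤ → ℤ) (lo hi ρ θ : ℤ) : ℤ := cnt t lo hi ρ θ - cnt t lo hi (ρ + 1) (θ + 1)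

/-- The contribution of the column `[lo, hi]` to the partial sums for the node `i`. -/
noncomputable def colF (n i : ℤ) (t : ℤ → ℤ) (lo hi x : ℤ) : ℤ :=
  strand t lo hi i (-x) + strand t lo hi (2 * n + 1 - i) (n - i - x) +
    if i = n then cnt t lo hi n (-x) - cnt t lo hi (n + 2) (1 - x) else 0

/-- The partial sums of a tableau for the node `i`. -/
noncomputable def F (n ℓ h r i : ℤ) (t : ℤ → ℤ) (L : ℤ) : ℤ :=
  colF n i t 1 h L + colF n i t (h + 1) ℓ (L + r)

/-- The place of the increment for an entry `ρ` at position `c` in the partial sums. -/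
def lev (n h r i ρ c : ℤ) : ℤ :=
  (if ρ ≤ n then 0 else n - i) - c - if c ≤ h then 0 else r

lemma stp_nonneg (x L : ℤ) : 0 ≤ stp x L := by unfold stp; split_ifs <;> omega

/-! ### Counting letters in one column. -/

section Column

variable {n lo hi ρ : ℤ} {t : ℤ → ℤ}

/-- Only the rank `n + 1` may be repeated. Below and above it the increase is strict, so the
difference of ranks bounds the difference of positions. -/
lemma Col.cmp (hC : Col n t lo hi) {a b : ℤ} (ha : lo ≤ a) (hab : a < b) (hb : b ≤ hi) :
    (t a < t b ∨ (t a = n + 1 ∧ t b = n + 1)) ∧ (t b ≤ n → t a + (b - a) ≤ t b) ∧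
      (n + 2 ≤ t a → t a + (b - a) ≤ t b) := by
  revert hb
  refine Int.leInduction (m := a + 1)
    (motive := fun b _ => b ≤ hi → (t a < t b ∨ (t a = n + 1 ∧ t b = n + 1)) ∧
      (t b ≤ n → t a + (b - a) ≤ t b) ∧ (n + 2 ≤ t a → t a + (b - a) ≤ t b)) ?_ ?_ b hab
  · intro hb
    have := hC a ha hb
    omega
  · intro b hab ih hb
    have h1 := ih (by omega)
    have := hC b (by omega) hb
    omega

lemma Col.le (hC : Col n t lo hi) {a b : ℤ} (ha : lo ≤ a) (hab : a ≤ b) (hb : b ≤ hi) :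
    t a ≤ t b := by
  rcases eq_or_lt_of_le hab with rfl | hlt
  · exact le_rfl
  · have := (hC.cmp ha hlt hb).1; omega

lemma Col.eq_of_eq (hC : Col n t lo hi) {a b : ℤ} (ha : lo ≤ a) (ha' : a ≤ hi) (hb : lo ≤ b)
    (hb' : b ≤ hi) (hab : t a = t b) (hne : t a ≠ n + 1) : a = b := by
  rcases lt_trichotomy a b with hlt | rfl | hlt
  · have := hC.cmp ha hlt hb'; omega
  · rfl
  · have := hC.cmp hb hlt ha'; omega

lemma Col.succ_eq (hC : Col n t lo hi) {a b : ℤ} (ha : lo ≤ a) (ha' : a ≤ hi) (hb : lo ≤ b)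
    (hb' : b ≤ hi) (hab : t b = t a + 1) (hne : t a ≠ n + 1) (hne' : t a ≠ n) : b = a + 1 := by
  rcases lt_trichotomy a b with hlt | rfl | hlt
  · have := hC.cmp ha hlt hb'; omega
  · omega
  · have := hC.cmp hb hlt ha'; omega

lemma cnt_eq_zero (θ : ℤ) (h : ∀ a, lo ≤ a → a ≤ hi → t a ≠ ρ) : cnt t lo hi ρ θ = 0 := by
  refine Finset.sum_eq_zero fun a ha => if_neg ?_
  rw [Finset.mem_Icc] at ha
  have := h a ha.1 ha.2
  tauto

lemma cnt_eq_stp (θ : ℤ) {p : ℤ} (h1 : lo ≤ p) (h2 : p ≤ hi) (hp : t p = ρ)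
    (h : ∀ a, lo ≤ a → a ≤ hi → t a = ρ → a = p) : cnt t lo hi ρ θ = stp θ p := by
  unfold cnt
  rw [Finset.sum_eq_single p]
  · simp [hp, stp]
  · intro a ha hap
    rw [Finset.mem_Icc] at ha
    exact if_neg fun h' => hap (h a ha.1 ha.2 h'.1)
  · intro hp'; simp only [Finset.mem_Icc, not_and] at hp'; exact absurd h2 (hp' h1)

lemma cnt_congr {s : ℤ → ℤ} (θ : ℤ) (h : ∀ a, lo ≤ a → a ≤ hi → (t a = ρ ↔ s a = ρ)) :
    cnt t lo hi ρ θ = cnt s lo hi ρ θ := by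
  refine Finset.sum_congr rfl fun a ha => ?_
  rw [Finset.mem_Icc] at ha
  simp only [h a ha.1 ha.2]

lemma cnt_top (θ : ℤ) (h : lo ≤ hi + 1) (hne : t (hi + 1) ≠ ρ) :
    cnt t lo (hi + 1) ρ θ = cnt t lo hi ρ θ := by
  unfold cnt
  have : Finset.Icc lo (hi + 1) = insert (hi + 1) (Finset.Icc lo hi) := by
    ext a; simp only [Finset.mem_insert, Finset.mem_Icc]; omega
  rw [this, Finset.sum_insert (by simp), if_neg (by tauto), zero_add]

lemma cnt_bot (θ : ℤ) (h : lo ≤ hi) (hne : t lo ≠ ρ) :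
    cnt t lo hi ρ θ = cnt t (lo + 1) hi ρ θ := by
  unfold cnt
  have : Finset.Icc lo hi = insert lo (Finset.Icc (lo + 1) hi) := by
    ext a; simp only [Finset.mem_insert, Finset.mem_Icc]; omega
  rw [this, Finset.sum_insert (by simp), if_neg (by tauto), zero_add]

lemma strand_congr {s : ℤ → ℤ} (θ : ℤ)
    (h : ∀ a, lo ≤ a → a ≤ hi → (t a = ρ ↔ s a = ρ) ∧ (t a = ρ + 1 ↔ s a = ρ + 1)) :
    strand t lo hi ρ θ = strand s lo hi ρ θ := by
  unfold strand
  rw [cnt_congr θ fun a h1 h2 => (h a h1 h2).1, cnt_congr (θ + 1) fun a h1 h2 => (h a h1 h2).2]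

lemma strand_top (θ : ℤ) (h : lo ≤ hi + 1) (hne : t (hi + 1) ≠ ρ) (hne' : t (hi + 1) ≠ ρ + 1) :
    strand t lo (hi + 1) ρ θ = strand t lo hi ρ θ := by
  unfold strand; rw [cnt_top _ h hne, cnt_top _ h hne']

lemma strand_bot (θ : ℤ) (h : lo ≤ hi) (hne : t lo ≠ ρ) (hne' : t lo ≠ ρ + 1) :
    strand t lo hi ρ θ = strand t (lo + 1) hi ρ θ := by
  unfold strand; rw [cnt_bot _ h hne, cnt_bot _ h hne']

lemma strand_zero (θ : ℤ) (h : ∀ a, lo ≤ a → a ≤ hi → t a ≠ ρ ∧ t a ≠ ρ + 1) :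
    strand t lo hi ρ θ = 0 := by
  unfold strand
  rw [cnt_eq_zero _ fun a h1 h2 => (h a h1 h2).1, cnt_eq_zero _ fun a h1 h2 => (h a h1 h2).2,
    sub_zero]

/-- The threshold for `ρ + 1` is shifted by one, exactly as its position is, so two letters joined
by the arrow in adjacent positions cancel for every `θ`. -/
lemma strand_both (hC : Col n t lo hi) (hρ : ρ ≠ n) (hρ' : ρ ≠ n + 1) (θ : ℤ) {p : ℤ}
    (h1 : lo ≤ p) (h2 : p + 1 ≤ hi) (hp : t p = ρ) (hp' : t (p + 1) = ρ + 1) :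
    strand t lo hi ρ θ = 0 := by
  unfold strand
  rw [cnt_eq_stp θ h1 (by omega) hp
      fun a ha ha' h => hC.eq_of_eq ha ha' h1 (by omega) (by omega) (by omega),
    cnt_eq_stp (θ + 1) (by omega) h2 hp'
      fun a ha ha' h => hC.eq_of_eq ha ha' (by omega) h2 (by omega) (by omega)]
  unfold stp; split_ifs <;> omega

lemma strand_plus (hC : Col n t lo hi) (hρ : ρ ≠ n) (hρ' : ρ ≠ n + 1) (θ : ℤ) {p : ℤ}
    (h1 : lo ≤ p) (h2 : p ≤ hi) (hp : t p = ρ) (hp' : p + 1 ≤ hi → t (p + 1) ≠ ρ + 1) :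
    strand t lo hi ρ θ = stp θ p := by
  unfold strand
  rw [cnt_eq_stp θ h1 (by omega) hp
      fun a ha ha' h => hC.eq_of_eq ha ha' h1 (by omega) (by omega) (by omega),
    cnt_eq_zero, sub_zero]
  intro a ha ha' h
  have := hC.succ_eq h1 h2 ha ha' (by omega) (by omega) (by omega)
  subst this
  exact hp' ha' h

lemma strand_minus (hC : Col n t lo hi) (hρ : ρ ≠ n) (hρ' : ρ ≠ n + 1) (θ : ℤ) {p : ℤ}
    (h1 : lo ≤ p) (h2 : p ≤ hi) (hp : t p = ρ + 1) (hp' : lo ≤ p - 1 → t (p - 1) ≠ ρ) :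
    strand t lo hi ρ θ = -stp (θ + 1) p := by
  unfold strand
  rw [cnt_eq_stp (θ + 1) h1 (by omega) hp
      fun a ha ha' h => hC.eq_of_eq ha ha' h1 (by omega) (by omega) (by omega),
    cnt_eq_zero, zero_sub]
  intro a ha ha' h
  have := hC.succ_eq ha ha' h1 h2 (by omega) (by omega) (by omega)
  subst this
  exact hp' (by omega) (by simpa using h)

/-- The three possible shapes of a strand. -/
lemma strand_cases (hC : Col n t lo hi) (hρ : ρ ≠ n) (hρ' : ρ ≠ n + 1) :
    ((∀ θ, strand t lo hi ρ θ = 0) ∧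
      ∀ a, lo ≤ a → a ≤ hi → (t a = ρ → a + 1 ≤ hi ∧ t (a + 1) = ρ + 1) ∧
        (t a = ρ + 1 → lo ≤ a - 1 ∧ t (a - 1) = ρ)) ∨
    (∃ p, lo ≤ p ∧ p ≤ hi ∧ t p = ρ ∧ (∀ a, lo ≤ a → a ≤ hi → t a ≠ ρ + 1) ∧
      ∀ θ, strand t lo hi ρ θ = stp θ p) ∨
    (∃ p, lo ≤ p ∧ p ≤ hi ∧ t p = ρ + 1 ∧ (∀ a, lo ≤ a → a ≤ hi → t a ≠ ρ) ∧
      ∀ θ, strand t lo hi ρ θ = -stp (θ + 1) p) := by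
  by_cases hA : ∃ p, lo ≤ p ∧ p ≤ hi ∧ t p = ρ
  · obtain ⟨p, h1, h2, hp⟩ := hA
    by_cases hB : p + 1 ≤ hi ∧ t (p + 1) = ρ + 1
    · refine Or.inl ⟨fun θ => strand_both hC hρ hρ' θ h1 hB.1 hp hB.2, fun a ha ha' => ⟨?_, ?_⟩⟩
      · intro h
        have := hC.eq_of_eq ha ha' h1 h2 (by omega) (by omega)
        subst this; exact hB
      · intro h
        have := hC.eq_of_eq ha ha' (by omega) hB.1 (by omega) (by omega)
        subst this; simpa using ⟨h1, hp⟩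
    · refine Or.inr (Or.inl ⟨p, h1, h2, hp, ?_, fun θ => strand_plus hC hρ hρ' θ h1 h2 hp ?_⟩)
      · intro a ha ha' h
        have := hC.succ_eq h1 h2 ha ha' (by omega) (by omega) (by omega)
        subst this; exact hB ⟨ha', h⟩
      · intro h h'; exact hB ⟨h, h'⟩
  · have hA' : ∀ a, lo ≤ a → a ≤ hi → t a ≠ ρ := fun a ha ha' h => hA ⟨a, ha, ha', h⟩
    by_cases hB : ∃ p, lo ≤ p ∧ p ≤ hi ∧ t p = ρ + 1
    · obtain ⟨p, h1, h2, hp⟩ := hB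
      exact Or.inr (Or.inr ⟨p, h1, h2, hp, hA',
        fun θ => strand_minus hC hρ hρ' θ h1 h2 hp fun h => hA' _ h (by omega)⟩)
    · have hB' : ∀ a, lo ≤ a → a ≤ hi → t a ≠ ρ + 1 := fun a ha ha' h => hB ⟨a, ha, ha', h⟩
      exact Or.inl ⟨fun θ => strand_zero θ fun a ha ha' => ⟨hA' a ha ha', hB' a ha ha'⟩,
        fun a ha ha' => ⟨fun h => absurd h (hA' a ha ha'), fun h => absurd h (hB' a ha ha')⟩⟩

lemma colF_of_lt {i : ℤ} (hi' : i < n) (x : ℤ) :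
    colF n i t lo hi x = strand t lo hi i (-x) + strand t lo hi (2 * n + 1 - i) (n - i - x) := by
  unfold colF; rw [if_neg (by omega), add_zero]

end Column

/-! ### The tableau conditions -/

/-- The conditions on the integer sequence of a tableau. -/
structure Tab (n ℓ h r : ℤ) (t : ℤ → ℤ) : Prop where
  out : ∀ a, ¬ (1 ≤ a ∧ a ≤ ℓ) → t a = 0
  one_le : ∀ a, 1 ≤ a → a ≤ ℓ → 1 ≤ t a
  le_top : ∀ a, 1 ≤ a → a ≤ ℓ → t a ≤ 2 * n + 1
  step : ∀ a, 1 ≤ a → a + 1 ≤ ℓ → a ≠ h →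
    t a < t (a + 1) ∨ (t a = n + 1 ∧ t (a + 1) = n + 1)
  col1 : ∀ a b, 1 ≤ a → a < b → b ≤ h → t a ≤ n → t a + t b = 2 * n + 2 → b - a ≠ n - t a
  col2 : ∀ a b, h + 1 ≤ a → a < b → b ≤ ℓ → t a ≤ n → t a + t b = 2 * n + 2 → b - a ≠ n - t a
  col12 : ∀ a b, 1 ≤ a → a ≤ h → h + 1 ≤ b → b ≤ ℓ → t a ≤ n → t a + t b = 2 * n + 2 →
    b - a ≠ n + 1 - max r 1 - t a
  cross : 1 ≤ h → h + 1 ≤ ℓ →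
    (t h < t (h + 1) ∨ (t h = n + 1 ∧ t (h + 1) = n + 1)) ∨
    (t (h + 1) ≤ t h ∧ t h ≤ n ∧ ∃ e, -h ≤ e ∧ e ≤ r - h - 2 ∧ n - t (h + 1) - e ≤ ℓ ∧
      t (n - t (h + 1) - e) = 2 * n + 2 - t (h + 1) ∧ h + 2 ≤ n - t h - e ∧
      t (n - t h - e) = 2 * n + 2 - t h) ∨
    (t (h + 1) ≤ t h ∧ n + 2 ≤ t (h + 1) ∧ ∃ d, n - r + 1 - h ≤ d ∧ d ≤ n - h - 1 ∧
      1 ≤ 2 * n + 2 - t h - d ∧ t (2 * n + 2 - t h - d) = 2 * n + 2 - t h ∧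
      2 * n + 2 - t (h + 1) - d ≤ h ∧
      t (2 * n + 2 - t (h + 1) - d) = 2 * n + 2 - t (h + 1))

lemma Tab.colOne {n ℓ h r : ℤ} {t : ℤ → ℤ} (hT : Tab n ℓ h r t) (hh : h ≤ ℓ) : Col n t 1 h :=
  fun a h1 h2 => hT.step a h1 (by omega) (by omega)

lemma Tab.colTwo {n ℓ h r : ℤ} {t : ℤ → ℤ} (hT : Tab n ℓ h r t) (hh : 0 ≤ h) :
    Col n t (h + 1) ℓ :=
  fun a h1 h2 => hT.step a (by omega) h2 (by omega)

/-- Replacing the entry at `c` along an arrow. -/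
def bump (t : ℤ → ℤ) (c : ℤ) : ℤ → ℤ := fun a => if a = c then t a + 1 else t a

@[simp] lemma bump_self (t : ℤ → ℤ) (c : ℤ) : bump t c c = t c + 1 := by simp [bump]

lemma bump_of_ne (t : ℤ → ℤ) {a c : ℤ} (h : a ≠ c) : bump t c a = t a := by simp [bump, h]

lemma bump_cases (t : ℤ → ℤ) (c a : ℤ) :
    (a = c ∧ bump t c a = t a + 1) ∨ (a ≠ c ∧ bump t c a = t a) := by
  by_cases h : a = c
  · exact Or.inl ⟨h, by simp [bump, h]⟩
  · exact Or.inr ⟨h, by simp [bump, h]⟩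

/-- The entry at `c` is the one on which `f̃_i` acts. -/
structure ActsAt (n ℓ h r i : ℤ) (t : ℤ → ℤ) (c : ℤ) : Prop where
  one_le : 1 ≤ c
  le : c ≤ ℓ
  letter : t c = i ∨ t c = 2 * n + 1 - i
  isFirstMax : IsFirstMax (F n ℓ h r i t) (lev n h r i (t c) c)
  pos : 0 < F n ℓ h r i t (lev n h r i (t c) c)

/-- `f̃_i t = t'` for tableaux. -/
def FStep (n ℓ h r i : ℤ) (t t' : ℤ → ℤ) : Prop :=
  Tab n ℓ h r t ∧ Tab n ℓ h r t' ∧ ∃ c, ActsAt n ℓ h r i t c ∧ t' = bump t c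

end TypeB

namespace TypeB

/-! ### The relation between the tableaux for `h` and for `h + 1` -/

/-- The entry `k` at `h + 1` is exchanged against the barred run `K, …, k`. -/
structure RelA (n ℓ h r : ℤ) (t s : ℤ → ℤ) (k K e : ℤ) : Prop where
  one_le : 1 ≤ k
  le : k ≤ K
  le_e : -h ≤ e
  e_le : e ≤ r - h - 2
  start : h + 2 ≤ n - K - e
  last : n - k - e ≤ ℓ
  left : t (h + 1) = k
  right : s (h + 1) = K + 1
  run : ∀ c, n - K - e ≤ c → c ≤ n - k - e → t c = c + n + 2 + e ∧ s c = c + n + 1 + e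
  same : ∀ c, c ≠ h + 1 → (c < n - K - e ∨ n - k - e < c) → s c = t c

/-- The barred entry `k` at `h + 1` is exchanged against the run `K, …, k`. -/
structure RelB (n ℓ h r : ℤ) (t s : ℤ → ℤ) (k K d : ℤ) : Prop where
  le : K ≤ k
  le_d : n - r + 1 - h ≤ d
  d_le : d ≤ n - h - 1
  start : 1 ≤ K - d
  last : k - d ≤ h
  left : t (h + 1) = 2 * n + 2 - k
  right : s (h + 1) = 2 * n + 3 - K
  run : ∀ c, K - d ≤ c → c ≤ k - d → t c = c + d ∧ s c = c + d - 1
  same : ∀ c, c ≠ h + 1 → (c < K - d ∨ k - d < c) → s c = t c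

/-- No exchange takes place. -/
structure RelC (n ℓ h r : ℤ) (t : ℤ → ℤ) : Prop where
  noA : ∀ b, h + 2 ≤ b → b ≤ ℓ → t (h + 1) ≤ n → t b = 2 * n + 2 - t (h + 1) →
    ¬ (-h ≤ n - t (h + 1) - b ∧ n - t (h + 1) - b ≤ r - h - 2)
  noB : ∀ a, 1 ≤ a → a ≤ h → n + 2 ≤ t (h + 1) → t a = 2 * n + 2 - t (h + 1) →
    ¬ (n - r + 1 - h ≤ t a - a ∧ t a - a ≤ n - h - 1)

/-- The relation `s = τ(t)`. -/
def Rel (n ℓ h r : ℤ) (t s : ℤ → ℤ) : Prop :=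
  Tab n ℓ h r t ∧ Tab n ℓ (h + 1) r s ∧
    ((∃ k K e, RelA n ℓ h r t s k K e) ∨ (∃ k K d, RelB n ℓ h r t s k K d) ∨
      (s = t ∧ RelC n ℓ h r t))

section

variable {n ℓ h r : ℤ} {t s : ℤ → ℤ} {k K e d : ℤ}

/-- Both exceptional alternatives at the border exhibit a partner of the entry `h + 1` in the range
that `RelC` forbids. -/
lemma Tab.cross_of_relC (hT : Tab n ℓ h r t) (hh : 1 ≤ h) (hl : h + 1 ≤ ℓ)
    (hC : RelC n ℓ h r t) : t h < t (h + 1) ∨ (t h = n + 1 ∧ t (h + 1) = n + 1) := by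
  rcases hT.cross hh hl with h1 | ⟨h1, h2, e, h3, h4, h5, h6, h7, h8⟩ |
    ⟨h1, h2, d, h3, h4, h5, h6, h7, h8⟩
  · exact h1
  · exact absurd ⟨by omega, by omega⟩ (hC.noA _ (by omega) h5 (by omega) h6)
  · exact absurd ⟨by omega, by omega⟩ (hC.noB _ (by omega) h7 (by omega) h8)

lemma tab_of_relC (hT : Tab n ℓ h r t) (hh : 0 ≤ h) (hl : h + 1 ≤ ℓ) (hC : RelC n ℓ h r t) :
    Tab n ℓ (h + 1) r t where
  out := hT.out
  one_le := hT.one_le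
  le_top := hT.le_top
  step a h1 h2 h3 := by
    by_cases ha : a = h
    · subst ha; exact hT.cross_of_relC h1 hl hC
    · exact hT.step a h1 h2 ha
  col1 a b h1 h2 h3 h4 h5 h6 := by
    by_cases hb : b = h + 1
    · subst hb
      -- For `r ≥ 2` the forbidden distance lies in the range of `noB`. For `r ≤ 1` that range is
      -- empty, and the claim is the condition on pairs in different columns, where `max r 1 = 1`.
      have h7 := hT.col12 a (h + 1) h1 (by omega) (by omega) hl h4 h5
      have h8 := hC.noB a h1 (by omega) (by omega) (by omega)
      omega
    · exact hT.col1 a b h1 h2 (by omega) h4 h5 h6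
  col2 a b h1 h2 h3 h4 h5 := hT.col2 a b (by omega) h2 h3 h4 h5
  col12 a b h1 h2 h3 h4 h5 h6 h7 := by
    by_cases ha : a = h + 1
    · subst ha
      -- Again `noA` covers `r ≥ 2`, and for `r ≤ 1` the required distance is the one excluded
      -- inside the second column.
      have h8 := hT.col2 (h + 1) b (by omega) (by omega) h4 h5 h6
      have h9 := hC.noA b (by omega) h4 h5 (by omega)
      omega
    · exact hT.col12 a b h1 (by omega) (by omega) h4 h5 h6 h7
  cross h1 h2 := Or.inl (hT.step _ h1 h2 (by omega))

/-- The order of letters can fail only next to the changed entries. In front of the run it would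
need the bar of `K + 1`, excluded by `hmax`. At the left neighbour of `h + 1` it would need `t h >
K`, which the border condition for `t` together with `hmax` rules out. At the new border the shifted
run itself supplies the barred letters required there. -/
lemma tab_of_relA (hT : Tab n ℓ h r t) (hh : 0 ≤ h) (hln : ℓ ≤ n - r)
    (hR : RelA n ℓ h r t s k K e)
    (hmax : h + 2 ≤ n - K - e - 1 → t (n - K - e - 1) ≠ 2 * n + 1 - K) :
    Tab n ℓ (h + 1) r s := by
  obtain ⟨g1, g2, g3, g4, g5, g6, g7, g8, run, same⟩ := hR
  have hc2 := hT.colTwo hh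
  -- If the order fails at the border of `t`, the run required there ends at the same bar of `k`,
  -- hence has the same offset `e`. Were it longer than the maximal run, the letter in front of the
  -- latter would be forced to be the bar of `K + 1`.
  have hth : 1 ≤ h → t h ≤ K := by
    intro h1
    rcases hT.cross h1 (by omega) with h2 | ⟨h1', h2, e', h3, h4, h5, h6, h7, h8⟩ |
      ⟨h1', h2, d, h3, h4, h5, h6, h7, h8⟩
    · omega
    · have r1 := (run (n - k - e) (by omega) (by omega)).1
      have h9 := hc2.eq_of_eq (a := n - t (h + 1) - e') (b := n - k - e) (by omega) (by omega)
        (by omega) (by omega) (by omega) (by omega)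
      have h10 : e' = e := by omega
      subst h10
      by_contra hK
      have h11 := hc2.cmp (a := n - t h - e') (b := n - K - e' - 1)
      have h12 := hc2.cmp (a := n - K - e' - 1) (b := n - K - e')
      have r2 := (run (n - K - e') (by omega) (by omega)).1
      by_cases hlt : n - t h - e' = n - K - e' - 1
      · rw [hlt] at h8 h7
        have := hmax h7
        omega
      · have := h11 (by omega) (by omega) (by omega)
        have := h12 (by omega) (by omega) (by omega)
        have := hmax (by omega)
        omega
    · omega
  have hs : ∀ c, c ≠ h + 1 → (s c = t c ∧ (c < n - K - e ∨ n - k - e < c)) ∨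
      (n - K - e ≤ c ∧ c ≤ n - k - e ∧ t c = c + n + 2 + e ∧ s c = c + n + 1 + e) := by
    intro c hc
    by_cases h1 : n - K - e ≤ c ∧ c ≤ n - k - e
    · exact Or.inr ⟨h1.1, h1.2, run c h1.1 h1.2⟩
    · exact Or.inl ⟨same c hc (by omega), by omega⟩
  refine ⟨fun a ha => ?_, fun a h1 h2 => ?_, fun a h1 h2 => ?_, fun a h1 h2 h3 => ?_,
    fun a b h1 h2 h3 h4 h5 => ?_, fun a b h1 h2 h3 h4 h5 => ?_,
    fun a b h1 h2 h3 h4 h5 h6 => ?_, fun h1 h2 => ?_⟩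
  · rw [same a (by omega) (by omega)]; exact hT.out a ha
  · have := hT.one_le a h1 h2
    by_cases ha : a = h + 1
    · subst ha; omega
    · have := hs a ha; omega
  · have := hT.le_top a h1 h2
    by_cases ha : a = h + 1
    · subst ha; omega
    · have := hs a ha; omega
  · by_cases ha : a = h
    · subst ha; have := hth h1; have := hs a (by omega); omega
    · have h4 := hT.step a h1 h2 ha
      have h5 := hs a h3
      have h6 := hs (a + 1) (by omega)
      have h7 : n - K - e = a + 1 → t a ≠ 2 * n + 1 - K := by
        intro h8; have := hmax (by omega)
        rwa [show n - K - e - 1 = a by omega] at this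
      omega
  · have hb : s b ≤ n := by
      by_cases hb : b = h + 1
      · subst hb; omega
      · have := hs b hb
        have := (hT.colOne (by omega)).le (a := b) (b := h) (by omega) (by omega) le_rfl
        have := hth (by omega)
        omega
    omega
  · have ha := hs a (by omega)
    have hb := hs b (by omega)
    have hc := hT.col2 a b (by omega) h2 h3
    omega
  · have hb := hs b (by omega)
    by_cases ha : a = h + 1
    · subst ha
      rcases hb with hb | hb
      · have r2 := (run (n - K - e) (by omega) (by omega))
        have h11 := hc2.cmp (a := b) (b := n - K - e)
        have h12 := hc2.cmp (b := b) (a := n - K - e)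
        have h13 : b = n - K - e - 1 → t b ≠ 2 * n + 1 - K := by
          rintro rfl; exact hmax (by omega)
        omega
      · omega
    · have ha' := hs a ha
      have hc := hT.col12 a b h1 (by omega) (by omega) h4
      omega
  · have h3 := hs (h + 1 + 1) (by omega)
    have h4 := hT.step (h + 1) h1 h2 (by omega)
    have h6 := hT.one_le (h + 1 + 1) (by omega) (by omega)
    by_cases h5 : K + 1 < s (h + 1 + 1)
    · exact Or.inl (Or.inl (by omega))
    · have r1 := run (n - s (h + 1 + 1) - (e - 1)) (by omega) (by omega)
      have r2 := run (n - s (h + 1) - (e - 1)) (by omega) (by omega)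
      refine Or.inr (Or.inl ⟨by omega, by omega, e - 1, by omega, by omega, by omega, by omega,
        by omega, by omega⟩)

/-- This is not the dual of `tab_of_relA`: duality exchanges source and target, so that the dual
statement constructs `t` from `s`. Both directions are needed. -/
lemma tab_of_relB (hT : Tab n ℓ h r t) (hh : 0 ≤ h) (hl : h + 1 ≤ ℓ) (hln : ℓ ≤ n - r)
    (hR : RelB n ℓ h r t s k K d)
    (hmax : 1 ≤ K - d - 1 → t (K - d - 1) ≠ K - 1) :
    Tab n ℓ (h + 1) r s := by
  obtain ⟨g2, g3, g4, g5, g6, g7, g8, run, same⟩ := hR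
  have hc1 := hT.colOne (by omega)
  have hc2 := hT.colTwo hh
  have hth : t h ≤ 2 * n + 2 - K := by
    rcases hT.cross (by omega) (by omega) with h2 | ⟨h1', h2, e', h3, h4, h5, h6, h7, h8⟩ |
      ⟨h1', h2, d', h3, h4, h5, h6, h7, h8⟩
    · omega
    · omega
    · have r1 := (run (k - d) (by omega) (by omega)).1
      have h9 := hc1.eq_of_eq (a := 2 * n + 2 - t (h + 1) - d') (b := k - d) (by omega) (by omega)
        (by omega) (by omega) (by omega) (by omega)
      have h10 : d' = d := by omega
      subst h10
      by_contra hK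
      have h11 := hc1.cmp (a := 2 * n + 2 - t h - d') (b := K - d' - 1)
      have h12 := hc1.cmp (a := K - d' - 1) (b := K - d')
      have r2 := (run (K - d') (by omega) (by omega)).1
      by_cases hlt : 2 * n + 2 - t h - d' = K - d' - 1
      · rw [hlt] at h6 h5
        have := hmax h5
        omega
      · have := h11 (by omega) (by omega) (by omega)
        have := h12 (by omega) (by omega) (by omega)
        have := hmax (by omega)
        omega
  have hs : ∀ c, c ≠ h + 1 → (s c = t c ∧ (c < K - d ∨ k - d < c)) ∨
      (K - d ≤ c ∧ c ≤ k - d ∧ t c = c + d ∧ s c = c + d - 1) := by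
    intro c hc
    by_cases h1 : K - d ≤ c ∧ c ≤ k - d
    · exact Or.inr ⟨h1.1, h1.2, run c h1.1 h1.2⟩
    · exact Or.inl ⟨same c hc (by omega), by omega⟩
  refine ⟨fun a ha => ?_, fun a h1 h2 => ?_, fun a h1 h2 => ?_, fun a h1 h2 h3 => ?_,
    fun a b h1 h2 h3 h4 h5 => ?_, fun a b h1 h2 h3 h4 h5 => ?_,
    fun a b h1 h2 h3 h4 h5 h6 => ?_, fun h1 h2 => ?_⟩
  · rw [same a (by omega) (by omega)]; exact hT.out a ha
  · have := hT.one_le a h1 h2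
    by_cases ha : a = h + 1
    · subst ha; omega
    · have := hs a ha; omega
  · have := hT.le_top a h1 h2
    by_cases ha : a = h + 1
    · subst ha; omega
    · have := hs a ha; omega
  · by_cases ha : a = h
    · subst ha; have := hs a (by omega); omega
    · have h4 := hT.step a h1 h2 ha
      have h5 := hs a h3
      have h6 := hs (a + 1) (by omega)
      have h7 : K - d = a + 1 → t a ≠ K - 1 := by
        intro h8; have := hmax (by omega)
        rwa [show K - d - 1 = a by omega] at this
      omega
  · have ha := hs a (by omega)
    by_cases hb : b = h + 1
    · subst hb
      rcases ha with ha | ha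
      · have r2 := run (K - d) (by omega) (by omega)
        have h11 := hc1.cmp (a := a) (b := K - d)
        have h12 := hc1.cmp (b := a) (a := K - d)
        have h13 : a = K - d - 1 → t a ≠ K - 1 := by
          rintro rfl; exact hmax (by omega)
        omega
      · omega
    · have hb' := hs b hb
      have hc := hT.col1 a b (by omega) h2 (by omega)
      omega
  · have ha := hs a (by omega)
    have hb := hs b (by omega)
    have hc := hT.col2 a b (by omega) h2 h3
    omega
  · have hb := hs b (by omega)
    by_cases ha : a = h + 1
    · subst ha; omega
    · have ha' := hs a ha
      have hc := hT.col12 a b h1 (by omega) (by omega) h4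
      omega
  · have h3 := hs (h + 1 + 1) (by omega)
    have h4 := hT.step (h + 1) h1 h2 (by omega)
    have h6 := hT.le_top (h + 1 + 1) (by omega) (by omega)
    by_cases h5 : 2 * n + 3 - K < s (h + 1 + 1)
    · exact Or.inl (Or.inl (by omega))
    · have r1 := run (2 * n + 2 - s (h + 1) - (d - 1)) (by omega) (by omega)
      have r2 := run (2 * n + 2 - s (h + 1 + 1) - (d - 1)) (by omega) (by omega)
      refine Or.inr (Or.inr ⟨by omega, by omega, d - 1, by omega, by omega, by omega, by omega,
        by omega, by omega⟩)

end

end TypeB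

/-! ### Existence and uniqueness of the related sequence. -/

namespace TypeB

section

variable {n ℓ h r : ℤ} {t s : ℤ → ℤ} {k K e d : ℤ}

lemma exists_relA {b : ℤ} (hT : Tab n ℓ h r t) (hh : 0 ≤ h) (hb : h + 2 ≤ b) (hb' : b ≤ ℓ)
    (htb : t b = 2 * n + 2 - t (h + 1)) (he : -h ≤ n - t (h + 1) - b)
    (he' : n - t (h + 1) - b ≤ r - h - 2) :
    ∃ s k K e, RelA n ℓ h r t s k K e ∧
      (h + 2 ≤ n - K - e - 1 → t (n - K - e - 1) ≠ 2 * n + 1 - K) := by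
  obtain ⟨k, hkk⟩ : ∃ k, k = t (h + 1) := ⟨_, rfl⟩
  obtain ⟨e, hee⟩ : ∃ e, e = n - k - b := ⟨_, rfl⟩
  -- The greatest admissible `K` gives the longest run of successive barred letters that ends at
  -- `b`; along it the sum of the unbarred letter, the position and `e` equals `n`.
  obtain ⟨K, ⟨h1, h2, h3⟩, hK⟩ := Int.exists_greatest_of_bdd
    (P := fun K => k ≤ K ∧ h + 2 ≤ n - K - e ∧
      ∀ c, n - K - e ≤ c → c ≤ n - k - e → t c = c + n + 2 + e)
    ⟨n - e - h - 2, fun z hz => by omega⟩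
    ⟨k, le_rfl, by omega, fun c hc hc' => by
      obtain rfl : c = b := by omega
      omega⟩
  have hone := hT.one_le (h + 1) (by omega) (by omega)
  refine ⟨fun c => if c = h + 1 then K + 1 else if n - K - e ≤ c ∧ c ≤ n - k - e then t c - 1
    else t c, k, K, e, ⟨by omega, h1, by omega, by omega, h2, by omega, hkk.symm, by simp, ?_, ?_⟩,
    ?_⟩
  · intro c hc hc'
    have := h3 c hc hc'
    simp only [hc, hc', and_self, if_true]
    rw [if_neg (by omega)]
    omega
  · intro c hc hc'
    rw [if_neg hc, if_neg (by omega)]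
  · intro h4 h5
    have := hK (K + 1) ⟨by omega, by omega, fun c hc hc' => by
      by_cases hc2 : c = n - K - e - 1
      · subst hc2; omega
      · exact h3 c (by omega) hc'⟩
    omega

lemma exists_relB {a : ℤ} (ha : 1 ≤ a) (ha' : a ≤ h)
    (hta : t a = 2 * n + 2 - t (h + 1)) (he : n - r + 1 - h ≤ t a - a)
    (he' : t a - a ≤ n - h - 1) :
    ∃ s k K d, RelB n ℓ h r t s k K d ∧ (1 ≤ K - d - 1 → t (K - d - 1) ≠ K - 1) := by
  obtain ⟨k, hkk⟩ : ∃ k, k = t a := ⟨_, rfl⟩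
  obtain ⟨d, hdd⟩ : ∃ d, d = k - a := ⟨_, rfl⟩
  obtain ⟨K, ⟨h1, h2, h3⟩, hK⟩ := Int.exists_least_of_bdd
    (P := fun K => K ≤ k ∧ 1 ≤ K - d ∧ ∀ c, K - d ≤ c → c ≤ k - d → t c = c + d)
    ⟨d + 1, fun z hz => by omega⟩
    ⟨k, le_rfl, by omega, fun c hc hc' => by
      obtain rfl : c = a := by omega
      omega⟩
  refine ⟨fun c => if c = h + 1 then 2 * n + 3 - K else if K - d ≤ c ∧ c ≤ k - d then t c - 1
    else t c, k, K, d, ⟨h1, by omega, by omega, h2, by omega, by omega, by simp, ?_, ?_⟩, ?_⟩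
  · intro c hc hc'
    have := h3 c hc hc'
    simp only [hc, hc', and_self, if_true]
    rw [if_neg (by omega)]
    omega
  · intro c hc hc'
    rw [if_neg hc, if_neg (by omega)]
  · intro h4 h5
    have := hK (K - 1) ⟨by omega, by omega, fun c hc hc' => by
      by_cases hc2 : c = K - d - 1
      · subst hc2; omega
      · exact h3 c (by omega) hc'⟩
    omega

lemma exists_rel_right (hT : Tab n ℓ h r t) (hh : 0 ≤ h) (hl : h + 1 ≤ ℓ) (hln : ℓ ≤ n - r) :
    ∃ s, Rel n ℓ h r t s := by
  by_cases hA : ∃ b, h + 2 ≤ b ∧ b ≤ ℓ ∧ t (h + 1) ≤ n ∧ t b = 2 * n + 2 - t (h + 1) ∧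
      -h ≤ n - t (h + 1) - b ∧ n - t (h + 1) - b ≤ r - h - 2
  · obtain ⟨b, h1, h2, h3, h4, h5, h6⟩ := hA
    obtain ⟨s, k, K, e, hR, hmax⟩ := exists_relA hT hh h1 h2 h4 h5 h6
    exact ⟨s, hT, tab_of_relA hT hh hln hR hmax, Or.inl ⟨k, K, e, hR⟩⟩
  by_cases hB : ∃ a, 1 ≤ a ∧ a ≤ h ∧ t a = 2 * n + 2 - t (h + 1) ∧
      n - r + 1 - h ≤ t a - a ∧ t a - a ≤ n - h - 1
  · obtain ⟨a, h1, h2, h3, h4, h5⟩ := hB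
    obtain ⟨s, k, K, d, hR, hmax⟩ := exists_relB (ℓ := ℓ) h1 h2 h3 h4 h5
    exact ⟨s, hT, tab_of_relB hT hh hl hln hR hmax, Or.inr (Or.inl ⟨k, K, d, hR⟩)⟩
  have hC : RelC n ℓ h r t :=
    ⟨fun b h1 h2 h3 h4 h5 => hA ⟨b, h1, h2, h3, h4, h5⟩,
      fun a h1 h2 h3 h4 h5 => hB ⟨a, h1, h2, h4, h5⟩⟩
  exact ⟨t, hT, tab_of_relC hT hh hl hC, Or.inr (Or.inr ⟨rfl, hC⟩)⟩

/-! ### Duality -/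

/-- The dual sequence: the order of the entries is reversed and `k`, `k̄` are exchanged. -/
def dual (n ℓ : ℤ) (t : ℤ → ℤ) : ℤ → ℤ :=
  fun a => if 1 ≤ a ∧ a ≤ ℓ then 2 * n + 2 - t (ℓ + 1 - a) else 0

lemma dual_apply {a : ℤ} (h1 : 1 ≤ a) (h2 : a ≤ ℓ) : dual n ℓ t a = 2 * n + 2 - t (ℓ + 1 - a) := by
  simp [dual, h1, h2]

lemma dual_dual (h : ∀ a, ¬ (1 ≤ a ∧ a ≤ ℓ) → t a = 0) : dual n ℓ (dual n ℓ t) = t := by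
  ext a
  by_cases ha : 1 ≤ a ∧ a ≤ ℓ
  · rw [dual_apply ha.1 ha.2, dual_apply (by omega) (by omega)]
    rw [show ℓ + 1 - (ℓ + 1 - a) = a by ring]; ring
  · rw [h a ha]; simp [dual, ha]

/-- Reversal exchanges the two columns, hence the conditions inside each of them, and it exchanges
the two exceptional alternatives at the border. Offsets are related by `d + e = n - ℓ - 1`. -/
lemma Tab.dual (hT : Tab n ℓ h r t) (hh : 0 ≤ h) (hl : h ≤ ℓ) :
    Tab n ℓ (ℓ - h) r (dual n ℓ t) := by
  have hd : ∀ a, 1 ≤ a → a ≤ ℓ → TypeB.dual n ℓ t a = 2 * n + 2 - t (ℓ + 1 - a) :=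
    fun a h1 h2 => dual_apply h1 h2
  refine ⟨fun a ha => ?_, fun a h1 h2 => ?_, fun a h1 h2 => ?_, fun a h1 h2 h3 => ?_,
    fun a b h1 h2 h3 => ?_, fun a b h1 h2 h3 => ?_, fun a b h1 h2 h3 h4 => ?_, fun h1 h2 => ?_⟩
  · simp [TypeB.dual, ha]
  · rw [hd a h1 h2]; have := hT.le_top (ℓ + 1 - a) (by omega) (by omega); omega
  · rw [hd a h1 h2]; have := hT.one_le (ℓ + 1 - a) (by omega) (by omega); omega
  · rw [hd a h1 (by omega), hd (a + 1) (by omega) h2]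
    have := hT.step (ℓ + 1 - (a + 1)) (by omega) (by omega) (by omega)
    rw [show ℓ + 1 - (a + 1) + 1 = ℓ + 1 - a by ring] at this
    omega
  · rw [hd a h1 (by omega), hd b (by omega) (by omega)]
    have := hT.col2 (ℓ + 1 - b) (ℓ + 1 - a) (by omega) (by omega) (by omega)
    omega
  · rw [hd a (by omega) (by omega), hd b (by omega) h3]
    have := hT.col1 (ℓ + 1 - b) (ℓ + 1 - a) (by omega) (by omega) (by omega)
    omega
  · rw [hd a (by omega) (by omega), hd b (by omega) h4]
    have := hT.col12 (ℓ + 1 - b) (ℓ + 1 - a) (by omega) (by omega) (by omega) (by omega)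
    omega
  · rw [hd (ℓ - h) h1 (by omega), hd (ℓ - h + 1) (by omega) h2,
      show ℓ + 1 - (ℓ - h) = h + 1 by ring, show ℓ + 1 - (ℓ - h + 1) = h by ring]
    rcases hT.cross (by omega) (by omega) with h3 | ⟨h1', h2', e, h3, h4, h5, h6, h7, h8⟩ |
      ⟨h1', h2', d, h3, h4, h5, h6, h7, h8⟩
    · omega
    · have hone := hT.one_le (h + 1) (by omega) (by omega)
      have q1 := hd (ℓ + 1 - (n - t h - e)) (by omega) (by omega)
      have q2 := hd (ℓ + 1 - (n - t (h + 1) - e)) (by omega) (by omega)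
      rw [show ℓ + 1 - (ℓ + 1 - (n - t h - e)) = n - t h - e by ring, h8] at q1
      rw [show ℓ + 1 - (ℓ + 1 - (n - t (h + 1) - e)) = n - t (h + 1) - e by ring, h6] at q2
      refine Or.inr (Or.inr ⟨by omega, by omega, n - e - ℓ - 1, by omega, by omega, by omega,
        ?_, by omega, ?_⟩)
      · rw [show 2 * n + 2 - (2 * n + 2 - t (h + 1)) - (n - e - ℓ - 1) =
          ℓ + 1 - (n - t (h + 1) - e) by ring, q2]
      · rw [show 2 * n + 2 - (2 * n + 2 - t h) - (n - e - ℓ - 1) =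
          ℓ + 1 - (n - t h - e) by ring, q1]
    · have htop := hT.le_top h (by omega) (by omega)
      obtain ⟨x, hx⟩ : ∃ x, x = 2 * n + 2 - t h := ⟨_, rfl⟩
      obtain ⟨y, hy⟩ : ∃ y, y = 2 * n + 2 - t (h + 1) := ⟨_, rfl⟩
      -- The barred runs are required to start at `h + 2` or later, the unbarred ones may end as
      -- late as `h`. This asymmetry is harmless, since here the entry at `h` is barred.
      have hne : y - d ≠ h := by
        intro h9; rw [← hy, h9] at h8; omega
      rw [← hx] at h5 h6 ⊢
      rw [← hy] at h7 h8 ⊢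
      have q1 := hd (ℓ + 1 - (x - d)) (by omega) (by omega)
      have q2 := hd (ℓ + 1 - (y - d)) (by omega) (by omega)
      rw [show ℓ + 1 - (ℓ + 1 - (x - d)) = x - d by ring, h6] at q1
      rw [show ℓ + 1 - (ℓ + 1 - (y - d)) = y - d by ring, h8] at q2
      refine Or.inr (Or.inl ⟨by omega, by omega, n - d - ℓ - 1, by omega, by omega, by omega,
        ?_, by omega, ?_⟩)
      · rw [show n - x - (n - d - ℓ - 1) = ℓ + 1 - (x - d) by ring, q1]
      · rw [show n - y - (n - d - ℓ - 1) = ℓ + 1 - (y - d) by ring, q2]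

/-- The new parameters are `K + 1` and `k + 1` because the dual pair starts from the already shifted
run of `s`. -/
lemma RelA.dual (hR : RelA n ℓ h r t s k K e) (hh : 0 ≤ h) (hl : h + 1 ≤ ℓ) :
    RelB n ℓ (ℓ - h - 1) r (dual n ℓ s) (dual n ℓ t) (K + 1) (k + 1) (n - e - ℓ) := by
  obtain ⟨g1, g2, g3, g4, g5, g6, g7, g8, run, same⟩ := hR
  refine ⟨by omega, by omega, by omega, by omega, by omega, ?_, ?_, fun c h1 h2 => ?_,
    fun c h1 h2 => ?_⟩
  · rw [dual_apply (by omega) (by omega), show ℓ + 1 - (ℓ - h - 1 + 1) = h + 1 by ring]; omega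
  · rw [dual_apply (by omega) (by omega), show ℓ + 1 - (ℓ - h - 1 + 1) = h + 1 by ring]; omega
  · rw [dual_apply (by omega) (by omega), dual_apply (by omega) (by omega)]
    have := run (ℓ + 1 - c) (by omega) (by omega)
    omega
  · unfold TypeB.dual
    split_ifs
    · rw [same (ℓ + 1 - c) (by omega) (by omega)]
    · rfl

lemma RelB.dual (hR : RelB n ℓ h r t s k K d) (hh : 0 ≤ h) (hl : h + 1 ≤ ℓ) (hln : ℓ ≤ n - r) :
    RelA n ℓ (ℓ - h - 1) r (dual n ℓ s) (dual n ℓ t) (K - 1) (k - 1) (n - d - ℓ) := by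
  obtain ⟨g2, g3, g4, g5, g6, g7, g8, run, same⟩ := hR
  refine ⟨by omega, by omega, by omega, by omega, by omega, by omega, ?_, ?_, fun c h1 h2 => ?_,
    fun c h1 h2 => ?_⟩
  · rw [dual_apply (by omega) (by omega), show ℓ + 1 - (ℓ - h - 1 + 1) = h + 1 by ring]; omega
  · rw [dual_apply (by omega) (by omega), show ℓ + 1 - (ℓ - h - 1 + 1) = h + 1 by ring]; omega
  · rw [dual_apply (by omega) (by omega), dual_apply (by omega) (by omega)]
    have := run (ℓ + 1 - c) (by omega) (by omega)
    omega
  · unfold TypeB.dual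
    split_ifs
    · rw [same (ℓ + 1 - c) (by omega) (by omega)]
    · rfl

lemma RelC.dual (hT : Tab n ℓ h r t) (hR : RelC n ℓ h r t) (hh : 0 ≤ h) (hl : h + 1 ≤ ℓ) :
    RelC n ℓ (ℓ - h - 1) r (dual n ℓ t) := by
  have e1 : TypeB.dual n ℓ t (ℓ - h - 1 + 1) = 2 * n + 2 - t (h + 1) := by
    rw [dual_apply (by omega) (by omega), show ℓ + 1 - (ℓ - h - 1 + 1) = h + 1 by ring]
  constructor
  · intro b h1 h2
    rw [e1, dual_apply (by omega) (by omega)]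
    intro h3 h4 h5
    have q1 := hR.noB (ℓ + 1 - b) (by omega) (by omega) (by omega) (by omega)
    have q2 := hT.col12 (ℓ + 1 - b) (h + 1) (by omega) (by omega) (by omega) (by omega)
    omega
  · intro a h1 h2
    rw [e1, dual_apply (by omega) (by omega)]
    intro h3 h4 h5
    have q1 := hR.noA (ℓ + 1 - a) (by omega) (by omega) (by omega) (by omega)
    have q2 := hT.col2 (h + 1) (ℓ + 1 - a) (by omega) (by omega) (by omega)
    omega

lemma Rel.dual (hR : Rel n ℓ h r t s) (hh : 0 ≤ h) (hl : h + 1 ≤ ℓ) (hln : ℓ ≤ n - r) :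
    Rel n ℓ (ℓ - h - 1) r (dual n ℓ s) (dual n ℓ t) := by
  obtain ⟨hT, hS, h1⟩ := hR
  refine ⟨?_, ?_, ?_⟩
  · have := hS.dual (by omega) hl
    rwa [show ℓ - (h + 1) = ℓ - h - 1 by ring] at this
  · have := hT.dual hh (by omega)
    rwa [show ℓ - h - 1 + 1 = ℓ - h by ring]
  · rcases h1 with ⟨k, K, e, hA⟩ | ⟨k, K, d, hB⟩ | ⟨rfl, hC⟩
    · exact Or.inr (Or.inl ⟨_, _, _, hA.dual hh hl⟩)
    · exact Or.inl ⟨_, _, _, hB.dual hh hl hln⟩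
    · exact Or.inr (Or.inr ⟨rfl, hC.dual hT hh hl⟩)

/-- The relation to the right of the dual sequence is dualised back. -/
lemma exists_rel_left (hS : Tab n ℓ (h + 1) r s) (hh : 0 ≤ h) (hl : h + 1 ≤ ℓ)
    (hln : ℓ ≤ n - r) : ∃ t, Rel n ℓ h r t s := by
  have h1 := hS.dual (by omega) hl
  rw [show ℓ - (h + 1) = ℓ - h - 1 by ring] at h1
  obtain ⟨u, hu⟩ := exists_rel_right h1 (by omega) (by omega) hln
  have h2 := hu.dual (by omega) (by omega) hln
  rw [dual_dual hS.out, show ℓ - (ℓ - h - 1) - 1 = h by ring] at h2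
  exact ⟨_, h2⟩

/-- Maximality of the run is not part of `RelA`, but follows from both sequences being tableaux. A
letter prolonging the run of `t` in front is unchanged in `s` and would be repeated there; at the
other end the roles of `t` and `s` are exchanged. -/
lemma RelA.unique (hT : Tab n ℓ h r t) (hS : Tab n ℓ (h + 1) r s) (hh : 0 ≤ h)
    (hR : RelA n ℓ h r t s k K e) :
    (h + 2 ≤ n - K - e - 1 → t (n - K - e - 1) ≠ 2 * n + 1 - K) ∧
    (n - k - e + 1 ≤ ℓ → s (n - k - e + 1) ≠ 2 * n + 2 - k) := by
  constructor
  · intro h1 h2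
    have h3 := hR.same (n - K - e - 1) (by omega) (by omega)
    have h4 := hR.le
    have h5 := (hR.run (n - K - e) (by omega) (by omega)).2
    have h6 := hR.last
    have h7 := (hS.colTwo (by omega)).cmp (a := n - K - e - 1) (b := n - K - e)
      (by omega) (by omega) (by omega)
    have := hR.start
    have := hR.one_le
    have := hR.le_e
    omega
  · intro h1 h2
    have h4 := hR.le
    have := hR.start
    have := hR.one_le
    have h3 := hR.same (n - k - e + 1) (by omega) (by omega)
    have h5 := (hR.run (n - k - e) (by omega) (by omega)).1
    have h7 := (hT.colTwo hh).cmp (a := n - k - e) (b := n - k - e + 1)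
      (by omega) (by omega) (by omega)
    have := hR.le_e
    omega

/-- The entry `h + 1` and `RelC` separate the three cases. Then `k` is read off at `h + 1`, the
offset from the unique position of the partner of `k`, and `K` is fixed by maximality. -/
lemma Rel.right_unique {s' : ℤ → ℤ} (h1 : Rel n ℓ h r t s) (h2 : Rel n ℓ h r t s') (hh : 0 ≤ h)
    (hl : h + 1 ≤ ℓ) : s = s' := by
  obtain ⟨hT, hS, h1⟩ := h1
  obtain ⟨-, hS', h2⟩ := h2
  have hc1 := hT.colOne (by omega)
  have hc2 := hT.colTwo hh
  rcases h1 with ⟨k, K, e, hA⟩ | ⟨k, K, d, hB⟩ | ⟨rfl, hC⟩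
  · have m1 := (hA.unique hT hS hh).1
    obtain ⟨g1, g2, g3, g4, g5, g6, g7, g8, run, same⟩ := hA
    have p1 := (run (n - k - e) (by omega) (by omega)).1
    rcases h2 with ⟨k', K', e', hA'⟩ | ⟨k', K', d', hB'⟩ | ⟨rfl, hC'⟩
    · have m1' := (hA'.unique hT hS' hh).1
      obtain ⟨g1', g2', g3', g4', g5', g6', g7', g8', run', same'⟩ := hA'
      obtain rfl : k = k' := by omega
      have p1' := (run' (n - k - e') (by omega) (by omega)).1
      have := hc2.eq_of_eq (a := n - k - e) (b := n - k - e') (by omega) (by omega)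
        (by omega) (by omega) (by omega) (by omega)
      obtain rfl : e = e' := by omega
      have hK : K = K' := by
        rcases lt_trichotomy K K' with hlt | hK | hlt
        · have := (run' (n - K - e - 1) (by omega) (by omega)).1
          exact absurd (by omega) (m1 (by omega))
        · exact hK
        · have := (run (n - K' - e - 1) (by omega) (by omega)).1
          exact absurd (by omega) (m1' (by omega))
      subst hK
      ext c
      by_cases hc : c = h + 1
      · subst hc; omega
      by_cases hc2 : n - K - e ≤ c ∧ c ≤ n - k - e
      · rw [(run c hc2.1 hc2.2).2, (run' c hc2.1 hc2.2).2]
      · rw [same c hc (by omega), same' c hc (by omega)]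
    · have := hB'.left; have := hB'.d_le; have := hB'.last; omega
    · exact absurd ⟨by omega, by omega⟩ (hC'.noA (n - k - e) (by omega) g6 (by omega) (by omega))
  · have q1 : ∀ {s k K d}, Tab n ℓ (h + 1) r s → RelB n ℓ h r t s k K d → 1 ≤ K - d - 1 →
        t (K - d - 1) ≠ K - 1 := by
      intro s k K d hS hB h1 h2
      have h3 := hB.same (K - d - 1) (by have := hB.last; have := hB.le; omega) (by omega)
      have h4 := hB.le
      have h5 := (hB.run (K - d) (by omega) (by omega)).2
      have h6 := hB.last
      have h7 := (hS.colOne hl).cmp (a := K - d - 1) (b := K - d) (by omega) (by omega) (by omega)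
      have := hB.d_le
      omega
    have m1 := q1 hS hB
    obtain ⟨g2, g3, g4, g5, g6, g7, g8, run, same⟩ := hB
    have p1 := (run (k - d) (by omega) (by omega)).1
    rcases h2 with ⟨k', K', e', hA'⟩ | ⟨k', K', d', hB'⟩ | ⟨rfl, hC'⟩
    · have := hA'.left; have := hA'.le; have := hA'.start; have := hA'.le_e; omega
    · have m1' := q1 hS' hB'
      obtain ⟨g2', g3', g4', g5', g6', g7', g8', run', same'⟩ := hB'
      obtain rfl : k = k' := by omega
      have p1' := (run' (k - d') (by omega) (by omega)).1
      have := hc1.eq_of_eq (a := k - d) (b := k - d') (by omega) (by omega)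
        (by omega) (by omega) (by omega) (by omega)
      obtain rfl : d = d' := by omega
      have hK : K = K' := by
        rcases lt_trichotomy K K' with hlt | hK | hlt
        · have := (run (K' - d - 1) (by omega) (by omega)).1
          exact absurd (by omega) (m1' (by omega))
        · exact hK
        · have := (run' (K - d - 1) (by omega) (by omega)).1
          exact absurd (by omega) (m1 (by omega))
      subst hK
      ext c
      by_cases hc : c = h + 1
      · subst hc; omega
      by_cases hc2 : K - d ≤ c ∧ c ≤ k - d
      · rw [(run c hc2.1 hc2.2).2, (run' c hc2.1 hc2.2).2]
      · rw [same c hc (by omega), same' c hc (by omega)]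
    · exact absurd ⟨by omega, by omega⟩ (hC'.noB (k - d) (by omega) g6 (by omega) (by omega))
  · rcases h2 with ⟨k', K', e', hA'⟩ | ⟨k', K', d', hB'⟩ | ⟨rfl, hC'⟩
    · obtain ⟨g1, g2, g3, g4, g5, g6, g7, g8, run, same⟩ := hA'
      have p1 := (run (n - k' - e') (by omega) (by omega)).1
      exact absurd ⟨by omega, by omega⟩ (hC.noA (n - k' - e') (by omega) g6 (by omega) (by omega))
    · obtain ⟨g2, g3, g4, g5, g6, g7, g8, run, same⟩ := hB'
      have p1 := (run (k' - d') (by omega) (by omega)).1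
      exact absurd ⟨by omega, by omega⟩ (hC.noB (k' - d') (by omega) g6 (by omega) (by omega))
    · rfl

/-- For lifting steps only `s` is known to be a tableau. The condition on `t` comes from the
construction in the dual picture, where maximality is required at the other end of the run of `s`.
-/
lemma rel_of_relA (hS : Tab n ℓ (h + 1) r s) (hh : 0 ≤ h) (hl : h + 1 ≤ ℓ) (hln : ℓ ≤ n - r)
    (hR : RelA n ℓ h r t s k K e)
    (hmax : n - k - e + 1 ≤ ℓ → s (n - k - e + 1) ≠ 2 * n + 2 - k) : Rel n ℓ h r t s := by
  have hout : ∀ a, ¬ (1 ≤ a ∧ a ≤ ℓ) → t a = 0 := fun a ha => by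
    have := hR.last; have := hR.start
    rw [← hR.same a (by omega) (by omega)]; exact hS.out a ha
  have h1 := hS.dual (by omega) hl
  rw [show ℓ - (h + 1) = ℓ - h - 1 by ring] at h1
  have h2 := tab_of_relB h1 (by omega) (by omega) hln (hR.dual hh hl) fun h3 h4 => by
    have := hR.last; have := hR.le; have := hR.start
    rw [dual_apply (by omega) (by omega)] at h4
    refine hmax (by omega) ?_
    rw [show n - k - e + 1 = ℓ + 1 - (k + 1 - (n - e - ℓ) - 1) by ring]
    omega
  have h3 := h2.dual (by omega) (by omega)
  rw [dual_dual hout, show ℓ - (ℓ - h - 1 + 1) = h by ring] at h3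
  exact ⟨h3, hS, Or.inl ⟨_, _, _, hR⟩⟩

lemma rel_of_relB (hS : Tab n ℓ (h + 1) r s) (hh : 0 ≤ h) (hl : h + 1 ≤ ℓ) (hln : ℓ ≤ n - r)
    (hR : RelB n ℓ h r t s k K d)
    (hmax : k - d + 1 ≤ h → s (k - d + 1) ≠ k) : Rel n ℓ h r t s := by
  have hout : ∀ a, ¬ (1 ≤ a ∧ a ≤ ℓ) → t a = 0 := fun a ha => by
    have := hR.last; have := hR.start
    rw [← hR.same a (by omega) (by omega)]; exact hS.out a ha
  have h1 := hS.dual (by omega) hl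
  rw [show ℓ - (h + 1) = ℓ - h - 1 by ring] at h1
  have h2 := tab_of_relA h1 (by omega) hln (hR.dual hh hl hln) fun h3 h4 => by
    have := hR.last; have := hR.le; have := hR.start
    rw [dual_apply (by omega) (by omega)] at h4
    refine hmax (by omega) ?_
    rw [show k - d + 1 = ℓ + 1 - (n - (k - 1) - (n - d - ℓ) - 1) by ring]
    omega
  have h3 := h2.dual (by omega) (by omega)
  rw [dual_dual hout, show ℓ - (ℓ - h - 1 + 1) = h by ring] at h3
  exact ⟨h3, hS, Or.inr (Or.inl ⟨_, _, _, hR⟩)⟩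

/-- The hypotheses are `RelC` for the dual of `s`, spelled out; this explains the ranges shifted by
one. -/
lemma rel_of_relC (hS : Tab n ℓ (h + 1) r s) (hh : 0 ≤ h) (hl : h + 1 ≤ ℓ)
    (hA : ∀ b, h + 2 ≤ b → b ≤ ℓ → s (h + 1) ≤ n → s b = 2 * n + 2 - s (h + 1) →
      ¬ (-h - 1 ≤ n - s (h + 1) - b ∧ n - s (h + 1) - b ≤ r - h - 3))
    (hB : ∀ a, 1 ≤ a → a ≤ h → n + 2 ≤ s (h + 1) → s a = 2 * n + 2 - s (h + 1) →
      ¬ (n - r - h ≤ s a - a ∧ s a - a ≤ n - h - 2)) : Rel n ℓ h r s s := by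
  have h1 := hS.dual (by omega) hl
  rw [show ℓ - (h + 1) = ℓ - h - 1 by ring] at h1
  have e1 : TypeB.dual n ℓ s (ℓ - h - 1 + 1) = 2 * n + 2 - s (h + 1) := by
    rw [dual_apply (by omega) (by omega), show ℓ + 1 - (ℓ - h - 1 + 1) = h + 1 by ring]
  have hC : RelC n ℓ (ℓ - h - 1) r (dual n ℓ s) := by
    constructor
    · intro b h1 h2
      rw [e1, dual_apply (by omega) (by omega)]
      intro h3 h4 h5
      have q1 := hB (ℓ + 1 - b) (by omega) (by omega) (by omega) (by omega)
      omega
    · intro a h1 h2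
      rw [e1, dual_apply (by omega) (by omega)]
      intro h3 h4 h5
      have q1 := hA (ℓ + 1 - a) (by omega) (by omega) (by omega) (by omega)
      omega
  have h2 := tab_of_relC h1 (by omega) (by omega) hC
  have hC' := hC.dual h1 (by omega) (by omega)
  rw [dual_dual hS.out, show ℓ - (ℓ - h - 1) - 1 = h by ring] at hC'
  have h4 := h2.dual (by omega) (by omega)
  rw [dual_dual hS.out, show ℓ - (ℓ - h - 1 + 1) = h by ring] at h4
  exact ⟨h4, hS, Or.inr (Or.inr ⟨rfl, hC'⟩)⟩

lemma Rel.left_unique {t' : ℤ → ℤ} (h1 : Rel n ℓ h r t s) (h2 : Rel n ℓ h r t' s) (hh : 0 ≤ h)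
    (hl : h + 1 ≤ ℓ) (hln : ℓ ≤ n - r) : t = t' := by
  have := (h1.dual hh hl hln).right_unique (h2.dual hh hl hln) (by omega) (by omega)
  rw [← dual_dual (n := n) h1.1.out, ← dual_dual (n := n) h2.1.out, this]

end

end TypeB

namespace TypeB

/-! ### Moving steps of partial sums -/

section

variable {Ft Fs z : ℤ → ℤ} {A B q m x : ℤ}

lemma stp_spec (x L : ℤ) : (x ≤ L ∧ stp x L = 1) ∨ (L < x ∧ stp x L = 0) := by
  unfold stp; split_ifs <;> omega

/-- The two functions differ only on `[A, B)`, where `Fs` is larger by one. The hypothesis on the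
window keeps the first maximum of `Fs` out of it, and the smaller function `Ft` has the same value
there. -/
lemma firstMax_window (h : ∀ L, Fs L = Ft L + (stp A L - stp B L))
    (hw : ∀ L, A ≤ L → L < B → Fs L ≤ Fs (A - 1)) (hAB : A ≤ B) (hq : IsFirstMax Fs q) :
    IsFirstMax Ft q ∧ Ft q = Fs q := by
  have hle : ∀ L, Ft L ≤ Fs L := by
    intro L; rw [h L]; unfold stp; split_ifs <;> omega
  have hnot : ¬ (A ≤ q ∧ q < B) := fun h' => by
    have := hw q h'.1 h'.2; have := hq.2 (A - 1) (by omega); omega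
  have heq : Ft q = Fs q := by
    rw [h q]; unfold stp; split_ifs <;> omega
  refine ⟨⟨fun L => ?_, fun L hL => ?_⟩, heq⟩
  · have := hle L; have := hq.1 L; omega
  · have := hle L; have := hq.2 L hL; omega

lemma nonpos_window (h : ∀ L, Fs L = Ft L + (stp A L - stp B L)) (hAB : A ≤ B)
    (hs : ∀ L, Fs L ≤ 0) (L : ℤ) : Ft L ≤ 0 := by
  have h1 := h L; have := hs L; unfold stp at h1; split_ifs at h1 <;> omega

/-- In this and the next lemmas a step up of `Ft` at `A` is moved to `B`, so that `Fs` is smaller by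
one on `[A, B)`. The value `m = 1` records a neighbouring letter that cancels the step at `A`: then
`Ft` has no step there, while `Fs` has a dip on the window. A further step at `x` may be present. -/
lemma plusMove_zero (hFt : ∀ L, Ft L = (1 - m) * stp A L) (hFs : ∀ L, Fs L = stp B L - m * stp A L)
    (hm : m = 0 ∨ m = 1) (hAB : A < B) :
    ((∀ L, Fs L ≤ 0) → ∀ L, Ft L ≤ 0) ∧ (IsFirstMax Fs q → 0 < Fs q →
      q = B ∧ m = 0 ∧ IsFirstMax Ft A ∧ Ft A = Fs q) := by
  rcases hm with rfl | rfl
  · refine ⟨fun h => ?_, fun hq hq0 => ?_⟩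
    · have := h B
      rw [hFs] at this; simp [stp] at this
    · have h1 := hq.1 B
      have h2 := hq.2 B
      rw [hFs] at hq0
      simp only [hFs, stp] at h1 h2 hq0
      have hqB : q = B := by split_ifs at h1 h2 hq0 <;> omega
      subst hqB
      refine ⟨rfl, rfl, ⟨fun L => ?_, fun L hL => ?_⟩, ?_⟩
      · simp only [hFt, stp]; split_ifs <;> omega
      · simp only [hFt, stp]; split_ifs <;> omega
      · simp only [hFt, hFs, stp]; split_ifs <;> omega
  · refine ⟨fun _ L => by simp [hFt], fun hq hq0 => ?_⟩
    rw [hFs] at hq0; unfold stp at hq0; split_ifs at hq0 <;> omega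

lemma plusMove_minus (hFt : ∀ L, Ft L = (1 - m) * stp A L - stp x L)
    (hFs : ∀ L, Fs L = stp B L - m * stp A L - stp x L)
    (hm : m = 0 ∨ m = 1) (hAB : A < B) (hx : x ≤ A ∨ B < x) :
    ((∀ L, Fs L ≤ 0) → ∀ L, Ft L ≤ 0) ∧ (IsFirstMax Fs q → 0 < Fs q →
      q = B ∧ m = 0 ∧ IsFirstMax Ft A ∧ Ft A = Fs q) := by
  rcases hm with rfl | rfl
  · refine ⟨fun h L => ?_, fun hq hq0 => ?_⟩
    · have := h B
      simp only [hFs, stp] at this; simp only [hFt, stp]; split_ifs at this ⊢ <;> omega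
    · have h1 := hq.1 B
      have h2 := hq.2 B
      rw [hFs] at hq0
      simp only [hFs, stp] at h1 h2 hq0
      have hqB : q = B ∧ B < x := by split_ifs at h1 h2 hq0 <;> omega
      obtain ⟨rfl, hx'⟩ := hqB
      refine ⟨rfl, rfl, ⟨fun L => ?_, fun L hL => ?_⟩, ?_⟩
      · simp only [hFt, stp]; split_ifs <;> omega
      · simp only [hFt, stp]; split_ifs <;> omega
      · simp only [hFt, hFs, stp]; split_ifs <;> omega
  · refine ⟨fun _ L => by have := stp_nonneg x L; simp [hFt]; omega, fun hq hq0 => ?_⟩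
    rw [hFs] at hq0; unfold stp at hq0; split_ifs at hq0 <;> omega

/-- The middle alternative is the one in which the operator changes different entries: a step up at
`x` strictly inside the window is the first maximum of `Ft`, but the moved step at `B` is that of
`Fs`. This is how an exchanged pair is created. -/
lemma plusMove_plus (hFt : ∀ L, Ft L = (1 - m) * stp A L + stp x L)
    (hFs : ∀ L, Fs L = stp B L - m * stp A L + stp x L)
    (hm : m = 0 ∨ m = 1) (hAB : A < B) (hx : m = 1 → x ≠ A) :
    ((∀ L, Fs L ≤ 0) → ∀ L, Ft L ≤ 0) ∧ (IsFirstMax Fs q → 0 < Fs q →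
      (q = B ∧ m = 0 ∧ x ≤ A ∧ IsFirstMax Ft A ∧ Ft A = Fs q) ∨
      (q = B ∧ A < x ∧ x < B ∧ IsFirstMax Ft x ∧ Ft x = Fs q) ∨
      (q = x ∧ (x < A ∨ B ≤ x) ∧ IsFirstMax Ft x ∧ Ft x = Fs q)) := by
  rcases hm with rfl | rfl
  · refine ⟨fun h L => ?_, fun hq hq0 => ?_⟩
    · have := h B
      simp only [hFs, stp] at this; simp only [hFt, stp]; split_ifs at this ⊢ <;> omega
    · have h1 := hq.1 B
      have h2 := hq.2 B
      have h3 := hq.1 x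
      have h4 := hq.2 x
      have hqq : (q = B ∧ x ≤ B) ∨ (q = x ∧ B < x) := by
        simp only [hFs, stp] at h1 h2 h3 h4; split_ifs at h1 h2 h3 h4 <;> omega
      have e1 : Fs q = 2 := by
        rcases hqq with ⟨rfl, h5⟩ | ⟨rfl, h5⟩ <;> simp only [hFs, stp] <;> split_ifs <;> omega
      rw [e1]
      by_cases hxA : x ≤ A
      · refine Or.inl ⟨by omega, rfl, hxA, ⟨fun L => ?_, fun L hL => ?_⟩, ?_⟩ <;>
          simp only [hFt, stp] <;> split_ifs <;> omega
      · by_cases hxB : x < B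
        · refine Or.inr (Or.inl ⟨by omega, by omega, hxB, ⟨fun L => ?_, fun L hL => ?_⟩, ?_⟩) <;>
            simp only [hFt, stp] <;> split_ifs <;> omega
        · refine Or.inr (Or.inr ⟨by omega, by omega, ⟨fun L => ?_, fun L hL => ?_⟩, ?_⟩) <;>
            simp only [hFt, stp] <;> split_ifs <;> omega
  · have hxA := hx rfl
    refine ⟨fun h L => ?_, fun hq hq0 => ?_⟩
    · have h1 := h (max B x)
      simp only [hFs, stp] at h1; simp only [hFt, stp]; split_ifs at h1 ⊢ <;> omega
    · have h1 := hq.1 B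
      have h2 := hq.2 B
      have h3 := hq.1 x
      have h4 := hq.2 x
      have hqq : (q = B ∧ A < x ∧ x ≤ B) ∨ (q = x ∧ (x < A ∨ B < x)) := by
        simp only [hFs, one_mul] at h1 h2 h3 h4
        have := stp_spec B q; have := stp_spec A q; have := stp_spec x q
        have := stp_spec B x; have := stp_spec A x; have := stp_spec x x
        have := stp_spec B B; have := stp_spec A B; have := stp_spec x B
        omega
      have e1 : Fs q = 1 := by
        rcases hqq with ⟨rfl, h5⟩ | ⟨rfl, h5⟩ <;> simp only [hFs, stp] <;> split_ifs <;> omega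
      rw [e1]
      by_cases hxB : A < x ∧ x < B
      · refine Or.inr (Or.inl ⟨by omega, hxB.1, hxB.2, ⟨fun L => ?_, fun L hL => ?_⟩, ?_⟩) <;>
          simp only [hFt, stp] <;> split_ifs <;> omega
      · refine Or.inr (Or.inr ⟨by omega, by omega, ⟨fun L => ?_, fun L hL => ?_⟩, ?_⟩) <;>
          simp only [hFt, stp] <;> split_ifs <;> omega

/-- This is the shape for a run of length one. The entry at `h + 1` and its partner are both
affected by the same node; the two signs `w` and `m` record cancellation by the neighbours on either
side of the border. -/
lemma crossMove {w C : ℤ} (hFt : ∀ L, Ft L = (1 - w) * stp C L + (1 - m) * stp A L - stp (B + 1) L)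
    (hFs : ∀ L, Fs L = stp B L - w * stp C L - m * stp A L)
    (hm : m = 0 ∨ m = 1) (hw : w = 0 ∨ w = 1) (hAB : A < B) (hBC : B + 1 < C) :
    ((∀ L, Fs L ≤ 0) → ∀ L, Ft L ≤ 0) ∧ (IsFirstMax Fs q → 0 < Fs q →
      q = B ∧ m = 0 ∧ IsFirstMax Ft A ∧ Ft A = Fs q) := by
  rcases hm with rfl | rfl
  · refine ⟨fun h L => ?_, fun hq hq0 => ?_⟩
    · have := h B
      rw [hFs] at this; simp only [stp] at this
      rcases hw with rfl | rfl <;> split_ifs at this <;> omega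
    · have h1 := hq.1 B
      have h2 := hq.2 B
      have hqB : q = B := by
        simp only [hFs, stp] at h1 h2 hq0
        rcases hw with rfl | rfl <;> split_ifs at h1 h2 hq0 <;> omega
      subst hqB
      refine ⟨rfl, rfl, ⟨fun L => ?_, fun L hL => ?_⟩, ?_⟩
      · simp only [hFt, stp]; rcases hw with rfl | rfl <;> split_ifs <;> omega
      · simp only [hFt, stp]; rcases hw with rfl | rfl <;> split_ifs <;> omega
      · simp only [hFt, hFs, stp]; rcases hw with rfl | rfl <;> split_ifs <;> omega
  · refine ⟨fun _ L => ?_, fun hq hq0 => ?_⟩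
    · simp only [hFt, stp]; rcases hw with rfl | rfl <;> split_ifs <;> omega
    · rw [hFs] at hq0; unfold stp at hq0
      rcases hw with rfl | rfl <;> split_ifs at hq0 <;> omega

end

end TypeB

namespace TypeB

/-! ### Comparison of the operators on related sequences -/

lemma strand_low {t : ℤ → ℤ} {lo hi ρ θ : ℤ} (h : hi < θ) : strand t lo hi ρ θ = 0 := by
  unfold strand cnt
  rw [Finset.sum_eq_zero, Finset.sum_eq_zero, sub_zero] <;>
  · intro a ha
    rw [Finset.mem_Icc] at ha
    exact if_neg (by omega)

section

variable {n ℓ h r i : ℤ} {t s s' : ℤ → ℤ} {k K e d : ℤ}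

lemma F_of_lt (hi : i < n) (L : ℤ) : F n ℓ h r i t L =
    strand t 1 h i (-L) + strand t 1 h (2 * n + 1 - i) (n - i - L) +
      (strand t (h + 1) ℓ i (-(L + r)) + strand t (h + 1) ℓ (2 * n + 1 - i) (n - i - (L + r))) := by
  unfold F; rw [colF_of_lt hi, colF_of_lt hi]

/-- The partial sums of `t` and of `s` have the same final value, and the same maximum as far as
it is positive, and `f̃_i` respects the relation. -/
def Compare (n ℓ h r i : ℤ) (t s : ℤ → ℤ) : Prop :=
  (∀ L, n ≤ L → F n ℓ h r i t L = F n ℓ (h + 1) r i s L) ∧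
  ((∀ L, F n ℓ (h + 1) r i s L ≤ 0) → ∀ L, F n ℓ h r i t L ≤ 0) ∧
  ∀ s', FStep n ℓ (h + 1) r i s s' → ∃ t', FStep n ℓ h r i t t' ∧ Rel n ℓ h r t' s' ∧
    ∃ q q', IsFirstMax (F n ℓ (h + 1) r i s) q ∧ IsFirstMax (F n ℓ h r i t) q' ∧
      F n ℓ h r i t q' = F n ℓ (h + 1) r i s q

/-- The partial sums have the same end and the same first maximum. -/
def SameMax (n : ℤ) (Ft Fs : ℤ → ℤ) : Prop :=
  (∀ L, n ≤ L → Ft L = Fs L) ∧ ((∀ L, Fs L ≤ 0) → ∀ L, Ft L ≤ 0) ∧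
  ∀ q, IsFirstMax Fs q → IsFirstMax Ft q ∧ Ft q = Fs q

lemma SameMax.of_eq {Ft Fs : ℤ → ℤ} (h : ∀ L, Ft L = Fs L) : SameMax n Ft Fs := by
  have : Ft = Fs := funext h
  subst this
  exact ⟨fun _ _ => rfl, id, fun q hq => ⟨hq, rfl⟩⟩

lemma SameMax.of_window {Ft Fs : ℤ → ℤ} {A B : ℤ} (h : ∀ L, Fs L = Ft L + (stp A L - stp B L))
    (hw : ∀ L, A ≤ L → L < B → Fs L ≤ Fs (A - 1)) (hAB : A ≤ B) (hB : B ≤ n) :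
    SameMax n Ft Fs :=
  ⟨fun L hL => by have := h L; have := stp_spec A L; have := stp_spec B L; omega,
    nonpos_window h hAB, fun _ hq => firstMax_window h hw hAB hq⟩

lemma exists_fstep {c q q' : ℤ} (hR : Rel n ℓ h r t s) (hR' : Rel n ℓ h r (bump t c) s')
    (h1 : 1 ≤ c) (h2 : c ≤ ℓ) (hc : t c = i ∨ t c = 2 * n + 1 - i)
    (hq' : IsFirstMax (F n ℓ h r i t) q') (hlev : q' = lev n h r i (t c) c)
    (hq : IsFirstMax (F n ℓ (h + 1) r i s) q) (hval : F n ℓ h r i t q' = F n ℓ (h + 1) r i s q)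
    (hpos : 0 < F n ℓ (h + 1) r i s q) :
    ∃ t', FStep n ℓ h r i t t' ∧ Rel n ℓ h r t' s' ∧
    ∃ q q', IsFirstMax (F n ℓ (h + 1) r i s) q ∧ IsFirstMax (F n ℓ h r i t) q' ∧
      F n ℓ h r i t q' = F n ℓ (h + 1) r i s q := by
  subst hlev
  exact ⟨bump t c, ⟨hR.1, hR'.1, c, ⟨h1, h2, hc, hq', by omega⟩, rfl⟩, hR', q, _, hq, hq', hval⟩

lemma lev_succ {ρ c : ℤ} (hc : c ≠ h + 1) : lev n (h + 1) r i ρ c = lev n h r i ρ c := by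
  unfold lev
  split_ifs <;> omega

/-- The shape of a pair in `RelA`. -/
structure PicA (n ℓ h : ℤ) (t s : ℤ → ℤ) (k K e : ℤ) : Prop where
  col1 : ∀ a, 1 ≤ a → a ≤ h → s a = t a ∧ 1 ≤ t a ∧ t a ≤ K
  mid : ∀ a, h + 2 ≤ a → a < n - K - e → s a = t a ∧ k < t a ∧ t a < 2 * n + 1 - K
  last : ∀ a, n - k - e < a → a ≤ ℓ → s a = t a ∧ 2 * n + 2 - k < t a ∧ t a ≤ 2 * n + 1

/-- The entry `K + 1` of `s` at `h + 1` bounds the first column from above, the entry `k` of `t`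
there bounds the second one from below, and the run separates the rest. For each node this leaves
very few places where a relevant letter can occur. -/
lemma RelA.pic (hT : Tab n ℓ h r t) (hS : Tab n ℓ (h + 1) r s) (hR : RelA n ℓ h r t s k K e)
    (hh : 0 ≤ h) : PicA n ℓ h t s k K e := by
  obtain ⟨g1, g2, g3, g4, g5, g6, g7, g8, run, same⟩ := hR
  have r1 := run (n - K - e) (by omega) (by omega)
  have r2 := run (n - k - e) (by omega) (by omega)
  have c1 := hS.colOne (by omega)
  have c2 := hT.colTwo hh
  have c3 := hS.colTwo (by omega)
  refine ⟨fun a h1 h2 => ?_, fun a h1 h2 => ?_, fun a h1 h2 => ?_⟩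
  · have := same a (by omega) (by omega)
    have := hT.one_le a h1 (by omega)
    have := c1.cmp h1 (b := h + 1) (by omega) le_rfl
    omega
  · have := same a (by omega) (by omega)
    have := c2.cmp (a := h + 1) (b := a) le_rfl (by omega) (by omega)
    have := c3.cmp (a := a) (b := n - K - e) (by omega) (by omega) (by omega)
    omega
  · have := same a (by omega) (by omega)
    have := hT.le_top a (by omega) (by omega)
    have := c2.cmp (a := n - k - e) (b := a) (by omega) (by omega) (by omega)
    omega

/-- Raising an entry outside `h + 1` and the run leaves the exchange data `k`, `K`, `e` valid for
the new pair. -/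
lemma RelA.same_step {c q : ℤ} (hR : Rel n ℓ h r t s) (hA : RelA n ℓ h r t s k K e)
    (hh : 0 ≤ h) (hl : h + 1 ≤ ℓ) (hln : ℓ ≤ n - r) (hS' : Tab n ℓ (h + 1) r (bump s c))
    (hc : ActsAt n ℓ (h + 1) r i s c) (h1 : c ≠ h + 1) (h2 : c < n - K - e ∨ n - k - e < c)
    (hlev : q = lev n (h + 1) r i (s c) c)
    (hq : IsFirstMax (F n ℓ h r i t) q) (hval : F n ℓ h r i t q = F n ℓ (h + 1) r i s q) :
    ∃ t', FStep n ℓ h r i t t' ∧ Rel n ℓ h r t' (bump s c) ∧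
    ∃ q q', IsFirstMax (F n ℓ (h + 1) r i s) q ∧ IsFirstMax (F n ℓ h r i t) q' ∧
      F n ℓ h r i t q' = F n ℓ (h + 1) r i s q := by
  have hpic := hA.pic hR.1 hR.2.1 hh
  have hsc := hA.same c h1 h2
  have hlet := hc.letter
  have hgl := hA.last
  have hgs := hA.start
  have hgle := hA.le
  rw [hsc] at hlet
  subst hlev
  refine exists_fstep (c := c) hR (rel_of_relA (k := k) (K := K) (e := e) hS' hh hl hln ?_ ?_)
    hc.one_le hc.le hlet hq (by rw [lev_succ h1, hsc]) hc.isFirstMax hval hc.pos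
  · refine ⟨hA.one_le, hA.le, hA.le_e, hA.e_le, hA.start, hA.last, ?_, ?_, fun a h3 h4 => ?_,
      fun a h3 h4 => ?_⟩
    · rw [bump_of_ne _ (Ne.symm h1)]; exact hA.left
    · rw [bump_of_ne _ (Ne.symm h1)]; exact hA.right
    · rw [bump_of_ne _ (by omega), bump_of_ne _ (by omega)]; exact hA.run a h3 h4
    · unfold bump; rw [hA.same a h3 h4]
  · intro h3
    have := hpic.last _ (by omega) h3
    have := bump_cases s c (n - k - e + 1)
    omega

lemma RelA.compare_of_sameMax (hR : Rel n ℓ h r t s) (hA : RelA n ℓ h r t s k K e)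
    (hh : 0 ≤ h) (hl : h + 1 ≤ ℓ) (hln : ℓ ≤ n - r) (h1 : i ≠ k) (h2 : i ≠ K + 1) (hi : i ≤ n)
    (hM : SameMax n (F n ℓ h r i t) (F n ℓ (h + 1) r i s)) : Compare n ℓ h r i t s := by
  refine ⟨hM.1, hM.2.1, ?_⟩
  rintro s' ⟨-, hS', c, hc, rfl⟩
  obtain ⟨hq, hval⟩ := hM.2.2 _ hc.isFirstMax
  have hlet := hc.letter
  have hone := hc.one_le
  have := hA.right
  have := hA.start
  have := hA.last
  have := hA.le_e
  have := hA.one_le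
  refine hA.same_step hR hh hl hln hS' hc ?_ ?_ rfl hq hval
  · rintro rfl; omega
  -- For `i ≠ k` the entry raised inside the run would not be its last one and would then coincide
  -- with its successor.
  · by_contra hcr
    have h3 := hA.run c (by omega) (by omega)
    have h4 := hA.run (c + 1) (by omega) (by omega)
    have h5 := hS'.step c (by omega) (by omega) (by omega)
    rw [bump_self, bump_of_ne _ (by omega)] at h5
    omega

/-- In `t` the letter `k` at `h + 1` gives a step down at `-h - r`, and the bar of `k` at the end of
the run a step up at `e + 1 - r`. Both letters have left their places in `s`, so the sums differ
only on the window between these points. Inside it no step up of `s` can occur. -/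
lemma RelA.sameMax_pred (hT : Tab n ℓ h r t) (hS : Tab n ℓ (h + 1) r s)
    (hA : RelA n ℓ h r t s k K e) (hh : 0 ≤ h) (hi : i = k - 1) (hi1 : 1 ≤ i) :
    SameMax n (F n ℓ h r i t) (F n ℓ (h + 1) r i s) := by
  have hpic := hA.pic hT hS hh
  obtain ⟨g1, g2, g3, g4, g5, g6, g7, g8, run, same⟩ := hA
  have c1 := hT.colOne (by omega)
  have c2 := hT.colTwo hh
  have c3 := hS.colTwo (by omega)
  have r2 := run (n - k - e) (by omega) (by omega)
  have e1 : ∀ L, strand t 1 h (2 * n + 1 - i) (n - i - L) = 0 := fun L => strand_zero _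
    fun a h1 h2 => by have := hpic.col1 a h1 h2; omega
  have e2 : ∀ L, strand s 1 (h + 1) (2 * n + 1 - i) (n - i - L) = 0 := fun L => by
    rw [strand_top _ (by omega) (by omega) (by omega)]
    exact strand_zero _ fun a h1 h2 => by have := hpic.col1 a h1 h2; omega
  have e3 : ∀ L, strand s 1 (h + 1) i (-L) = strand t 1 h i (-L) := fun L => by
    rw [strand_top _ (by omega) (by omega) (by omega)]
    exact strand_congr _ fun a h1 h2 => by have := hpic.col1 a h1 h2; omega
  have e4 : ∀ L, strand t (h + 1) ℓ i (-(L + r)) = -stp (-h - r) L := fun L => by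
    rw [strand_minus c2 (by omega) (by omega) _ (p := h + 1) (by omega) (by omega) (by omega)
      (by omega)]
    unfold stp; split_ifs <;> omega
  have e5 : ∀ L, strand s (h + 1 + 1) ℓ i (-(L + r)) = 0 := fun L => strand_zero _
    fun a h1 h2 => by
      by_cases h3 : a < n - K - e
      · have := hpic.mid a (by omega) h3; omega
      by_cases h4 : a ≤ n - k - e
      · have := run a (by omega) h4; omega
      have := hpic.last a (by omega) h2; omega
  have e6 : (∀ L, strand s (h + 1 + 1) ℓ (2 * n + 1 - i) (n - i - (L + r)) =
      strand t (h + 1) ℓ (2 * n + 1 - i) (n - i - (L + r)) - stp (e + 1 - r) L) ∧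
      ∀ L L', L' ≤ L → strand s (h + 1 + 1) ℓ (2 * n + 1 - i) (n - i - (L + r)) ≤
        strand s (h + 1 + 1) ℓ (2 * n + 1 - i) (n - i - (L' + r)) := by
    by_cases hb : n - k - e + 1 ≤ ℓ ∧ t (n - k - e + 1) = 2 * n + 1 - i + 1
    · have q1 := hpic.last _ (by omega) hb.1
      have q2 : ∀ L, strand s (h + 1 + 1) ℓ (2 * n + 1 - i) (n - i - (L + r)) =
          - stp (e + 1 - r) L := fun L => by
        rw [strand_minus c3 (by omega) (by omega) _ (p := n - k - e + 1) (by omega) hb.1 (by omega)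
          (fun _ => by rw [add_sub_cancel_right]; omega)]
        unfold stp; split_ifs <;> omega
      constructor
      · intro L
        rw [q2, strand_both c2 (by omega) (by omega) _ (p := n - k - e) (by omega) hb.1 (by omega)
          hb.2]
        ring
      · intro L L' hL
        rw [q2, q2]; unfold stp; split_ifs <;> omega
    · have q2 : ∀ L, strand s (h + 1 + 1) ℓ (2 * n + 1 - i) (n - i - (L + r)) = 0 :=
        fun L => strand_zero _ fun a h1 h2 => by
          by_cases h3 : a < n - K - e
          · have := hpic.mid a (by omega) h3; omega
          by_cases h4 : a ≤ n - k - e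
          · have := run a (by omega) h4; omega
          have := hpic.last a (by omega) h2
          refine ⟨by omega, fun h5 => hb ?_⟩
          have := c2.succ_eq (a := n - k - e) (b := a) (by omega) (by omega) (by omega) h2
            (by omega) (by omega) (by omega)
          subst this; exact ⟨h2, by omega⟩
      constructor
      · intro L
        rw [q2, strand_plus c2 (by omega) (by omega) _ (p := n - k - e) (by omega) (by omega)
          (by omega) (fun h1 h2 => hb ⟨h1, h2⟩)]
        unfold stp; split_ifs <;> omega
      · intro L L' hL
        rw [q2, q2]
  refine SameMax.of_window (A := -h - r) (B := e + 1 - r) (fun L => ?_) (fun L h1 h2 => ?_)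
    (by omega) (by omega)
  · rw [F_of_lt (by omega), F_of_lt (by omega), e1, e2, e3, e4, e5, e6.1]; ring
  · rw [F_of_lt (by omega), F_of_lt (by omega), e2, e2, e3, e3, e5, e5]
    have z1 : strand t 1 h i (-L) = 0 := strand_low (by omega)
    have z2 : strand t 1 h i (-(-h - r - 1)) = 0 := strand_low (by omega)
    have := e6.2 L (-h - r - 1) (by omega)
    omega

/-- The step down of the bar of `K` in `t` is cancelled in `s` by the bar of `K + 1` now in front of
it; instead the letter `K + 1` at `h + 1` gives a step down at `-h`, possibly by no longer leaving
the letter `K` at `h` unpaired. -/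
lemma RelA.sameMax_top (hT : Tab n ℓ h r t) (hS : Tab n ℓ (h + 1) r s)
    (hA : RelA n ℓ h r t s k K e) (hh : 0 ≤ h) (hi : i = K) (hkK : k < K) :
    SameMax n (F n ℓ h r i t) (F n ℓ (h + 1) r i s) := by
  have hpic := hA.pic hT hS hh
  obtain ⟨g1, g2, g3, g4, g5, g6, g7, g8, run, same⟩ := hA
  have c1 := hT.colOne (by omega)
  have c2 := hT.colTwo hh
  have c1s := hS.colOne (by omega)
  have c3 := hS.colTwo (by omega)
  have r1 := run (n - K - e) (by omega) (by omega)
  have r2 := run (n - K - e + 1) (by omega) (by omega)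
  have e1 : ∀ L, strand t 1 h (2 * n + 1 - i) (n - i - L) = 0 := fun L => strand_zero _
    fun a h1 h2 => by have := hpic.col1 a h1 h2; omega
  have e2 : ∀ L, strand s 1 (h + 1) (2 * n + 1 - i) (n - i - L) = 0 := fun L => by
    rw [strand_top _ (by omega) (by omega) (by omega)]
    exact strand_zero _ fun a h1 h2 => by have := hpic.col1 a h1 h2; omega
  have e3 : ∀ L, strand s 1 (h + 1) i (-L) = strand t 1 h i (-L) - stp (-h) L := fun L => by
    by_cases hb : 1 ≤ h ∧ t h = i
    · have := hpic.col1 h hb.1 le_rfl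
      rw [strand_both c1s (by omega) (by omega) _ (p := h) hb.1 (by omega) (by omega) (by omega),
        strand_plus c1 (by omega) (by omega) _ (p := h) hb.1 (by omega) (by omega) (by omega)]
      unfold stp; split_ifs <;> omega
    · rw [strand_zero (t := t) _ fun a h1 h2 => by
          have := hpic.col1 a h1 h2
          refine ⟨fun h3 => hb ?_, by omega⟩
          have h4 := c1s.succ_eq (a := a) (b := h + 1) h1 (by omega) (by omega) le_rfl
            (by omega) (by omega) (by omega)
          have h5 : a = h := by omega
          subst h5; exact ⟨h1, h3⟩,
        strand_minus c1s (by omega) (by omega) _ (p := h + 1) (by omega) (by omega) (by omega)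
          fun h1 h2 => hb ?_]
      · unfold stp; split_ifs <;> omega
      · rw [add_sub_cancel_right] at h1 h2
        have := hpic.col1 h h1 le_rfl
        omega
  have e4 : ∀ L, strand t (h + 1) ℓ i (-(L + r)) = strand s (h + 1 + 1) ℓ i (-(L + r)) := fun L => by
    rw [strand_bot _ (by omega) (by omega) (by omega)]
    refine strand_congr _ fun a h1 h2 => ?_
    by_cases h3 : a < n - K - e
    · have := hpic.mid a (by omega) h3; omega
    by_cases h4 : a ≤ n - k - e
    · have := run a (by omega) h4; omega
    have := hpic.last a (by omega) h2; omega
  have e5 : ∀ L, strand t (h + 1) ℓ (2 * n + 1 - i) (n - i - (L + r)) = - stp (e + 1 - r) L :=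
    fun L => by
    rw [strand_minus c2 (by omega) (by omega) _ (p := n - K - e) (by omega) (by omega) (by omega)
      fun h1 h2 => ?_]
    · unfold stp; split_ifs <;> omega
    · by_cases h3 : n - K - e - 1 = h + 1
      · rw [h3] at h2; omega
      · have := hpic.mid _ (by omega) (show n - K - e - 1 < n - K - e by omega); omega
  have e6 : ∀ L, strand s (h + 1 + 1) ℓ (2 * n + 1 - i) (n - i - (L + r)) = 0 := fun L =>
    strand_both c3 (by omega) (by omega) _ (p := n - K - e) (by omega) (by omega) (by omega)
      (by omega)
  have e7 : ∀ L, e + 1 - r - 1 ≤ L → strand s (h + 1 + 1) ℓ i (-(L + r)) =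
      strand s (h + 1 + 1) ℓ i (-(e + 1 - r - 1 + r)) := by
    intro L hL
    rcases strand_cases c3 (ρ := i) (by omega) (by omega) with ⟨h1, -⟩ | ⟨p, h1, h2, h3, -, h4⟩ |
      ⟨p, h1, h2, h3, -, h4⟩
    · rw [h1, h1]
    · rw [h4, h4]; unfold stp; rw [if_pos (by omega), if_pos (by omega)]
    · rw [h4, h4]; unfold stp; rw [if_pos (by omega), if_pos (by omega)]
  refine SameMax.of_window (A := e + 1 - r) (B := -h) (fun L => ?_) (fun L h1 h2 => ?_)
    (by omega) (by omega)
  · rw [F_of_lt (by omega), F_of_lt (by omega), e1, e2, e3, e4, e5, e6]; ring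
  · rw [F_of_lt (by omega), F_of_lt (by omega), e2, e2, e3, e3, e6, e6]
    have z1 : strand t 1 h i (-L) = 0 := strand_low (by omega)
    have z2 : strand t 1 h i (-(e + 1 - r - 1)) = 0 := strand_low (by omega)
    rw [z1, z2, e7 L (by omega)]
    unfold stp; split_ifs <;> omega

/-- Either no letter of the node is changed, or `k < i < K` and both relevant barred letters are
adjacent in the run before and after the shift, hence cancel. -/
lemma RelA.sameMax_other (hT : Tab n ℓ h r t) (hS : Tab n ℓ (h + 1) r s)
    (hA : RelA n ℓ h r t s k K e) (hh : 0 ≤ h) (hin : i ≤ n)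
    (h1 : i ≠ k - 1) (h2 : i ≠ k) (h3 : i ≠ K) (h4 : i ≠ K + 1) :
    SameMax n (F n ℓ h r i t) (F n ℓ (h + 1) r i s) := by
  have hpic := hA.pic hT hS hh
  obtain ⟨g1, g2, g3, g4, g5, g6, g7, g8, run, same⟩ := hA
  have c2 := hT.colTwo hh
  have c3 := hS.colTwo (by omega)
  have key1 : ∀ ρ θ, ρ ≠ K + 1 → cnt s 1 (h + 1) ρ θ = cnt t 1 h ρ θ := fun ρ θ h1 => by
    rw [cnt_top _ (by omega) (by omega)]
    exact cnt_congr _ fun a h1 h2 => by have := hpic.col1 a h1 h2; omega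
  have key2 : ∀ ρ θ, ρ ≠ k → (ρ ≤ 2 * n - K ∨ 2 * n + 2 - k < ρ) →
      cnt s (h + 1 + 1) ℓ ρ θ = cnt t (h + 1) ℓ ρ θ := fun ρ θ h1 h2 => by
    rw [cnt_bot (t := t) _ (by omega) (by omega)]
    refine cnt_congr _ fun a h3 h4 => ?_
    by_cases h3 : a < n - K - e
    · have := hpic.mid a (by omega) h3; omega
    by_cases h4 : a ≤ n - k - e
    · have := run a (by omega) h4; omega
    have := hpic.last a (by omega) (by omega); omega
  refine SameMax.of_eq fun L => ?_
  by_cases hlt : i < n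
  · have e1 : strand t (h + 1) ℓ (2 * n + 1 - i) (n - i - (L + r)) =
        strand s (h + 1 + 1) ℓ (2 * n + 1 - i) (n - i - (L + r)) := by
      by_cases hik : k < i ∧ i < K
      · have r1 := run (n - i - e) (by omega) (by omega)
        have r2 := run (n - i - e - 1) (by omega) (by omega)
        have r3 := run (n - i - e + 1) (by omega) (by omega)
        rw [strand_both c2 (by omega) (by omega) _ (p := n - i - e - 1) (by omega) (by omega)
            (by omega) (by rw [sub_add_cancel]; omega),
          strand_both c3 (by omega) (by omega) _ (p := n - i - e) (by omega) (by omega)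
            (by omega) (by omega)]
      · unfold strand
        rw [key2 _ _ (by omega) (by omega), key2 _ _ (by omega) (by omega)]
    rw [F_of_lt hlt, F_of_lt hlt, e1]
    unfold strand
    rw [key1 _ _ (by omega), key1 _ _ (by omega), key1 _ _ (by omega), key1 _ _ (by omega),
      key2 i _ (by omega) (by omega), key2 (i + 1) _ (by omega) (by omega)]
  · unfold F colF strand
    rw [key1 _ _ (by omega), key1 _ _ (by omega), key1 _ _ (by omega), key1 _ _ (by omega),
      key1 _ _ (by omega), key1 _ _ (by omega), key2 _ _ (by omega) (by omega),
      key2 _ _ (by omega) (by omega), key2 _ _ (by omega) (by omega),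
      key2 _ _ (by omega) (by omega), key2 _ _ (by omega) (by omega),
      key2 _ _ (by omega) (by omega)]

end

end TypeB

/-! ### Exchange of an unbarred border letter: the nodes at its ends. -/

namespace TypeB

section

variable {Ft Fs z : ℤ → ℤ} {A B q m : ℤ}

/-- A partial sum which is a single step away from the window `[A, B]`. -/
def FarStep (A B : ℤ) (z : ℤ → ℤ) : Prop :=
  (∀ L, z L = 0) ∨ (∃ x, (x < A ∨ B < x) ∧ ∀ L, z L = stp x L) ∨
    ∃ x, (x ≤ A ∨ B < x) ∧ ∀ L, z L = -stp x L

/-- A column not involved in the exchange contributes at most one step. If this step is away from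
the window, only two outcomes remain: the moved step is the first maximum, or a distant one is and
it stays the same. -/
lemma plusMove_far (hFt : ∀ L, Ft L = (1 - m) * stp A L + z L)
    (hFs : ∀ L, Fs L = stp B L - m * stp A L + z L)
    (hm : m = 0 ∨ m = 1) (hAB : A < B) (hz : FarStep A B z) :
    ((∀ L, Fs L ≤ 0) → ∀ L, Ft L ≤ 0) ∧ (IsFirstMax Fs q → 0 < Fs q →
      (q = B ∧ m = 0 ∧ IsFirstMax Ft A ∧ Ft A = Fs q) ∨
      ((q < A ∨ B < q) ∧ IsFirstMax Ft q ∧ Ft q = Fs q)) := by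
  rcases hz with hz | ⟨x, hx, hz⟩ | ⟨x, hx, hz⟩
  · have h1 := plusMove_zero (q := q) (m := m) (A := A) (B := B) (Ft := Ft) (Fs := Fs)
      (fun L => by rw [hFt, hz, add_zero]) (fun L => by rw [hFs, hz, add_zero]) hm hAB
    exact ⟨h1.1, fun h2 h3 => Or.inl (h1.2 h2 h3)⟩
  · have h1 := plusMove_plus (q := q) (m := m) (A := A) (B := B) (x := x) (Ft := Ft) (Fs := Fs)
      (fun L => by rw [hFt, hz]) (fun L => by rw [hFs, hz]) hm hAB (by omega)
    refine ⟨h1.1, fun h2 h3 => ?_⟩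
    rcases h1.2 h2 h3 with ⟨h4, h5, -, h6⟩ | ⟨h4, h5, h6, h7⟩ | ⟨rfl, h5, h6⟩
    · exact Or.inl ⟨h4, h5, h6⟩
    · omega
    · exact Or.inr ⟨by omega, h6⟩
  · have h1 := plusMove_minus (q := q) (m := m) (A := A) (B := B) (x := x) (Ft := Ft) (Fs := Fs)
      (fun L => by rw [hFt, hz]; ring) (fun L => by rw [hFs, hz]; ring) hm hAB hx
    exact ⟨h1.1, fun h2 h3 => Or.inl (h1.2 h2 h3)⟩

end

section

variable {n ℓ h r i : ℤ} {t s s' : ℤ → ℤ} {k K e d : ℤ}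

/-- When `f̃_k` raises the last letter of the run of `s` to the bar of `k`, on the side of `t` it
raises `k` at `h + 1` to `k + 1`. The run thereby becomes shorter by one letter, and the new pair
has parameters `k + 1`, `K`. -/
lemma RelA.compare_bottom (hR : Rel n ℓ h r t s) (hA : RelA n ℓ h r t s k K e) (hh : 0 ≤ h)
    (hl : h + 1 ≤ ℓ) (hln : ℓ ≤ n - r) (hi : i = k) (hkK : k < K) :
    Compare n ℓ h r i t s := by
  obtain ⟨hT, hS, -⟩ := id hR
  have hpic := hA.pic hT hS hh
  obtain ⟨g1, g2, g3, g4, g5, g6, g7, g8, run, same⟩ := id hA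
  have c1 := hT.colOne (by omega)
  have c2 := hT.colTwo hh
  have c3 := hS.colTwo (by omega)
  have r1 := run (n - k - e) (by omega) (by omega)
  have r2 := run (n - k - e - 1) (by omega) (by omega)
  have e1 : ∀ L, strand t 1 h (2 * n + 1 - i) (n - i - L) = 0 := fun L => strand_zero _
    fun a h1 h2 => by have := hpic.col1 a h1 h2; omega
  have e2 : ∀ L, strand s 1 (h + 1) (2 * n + 1 - i) (n - i - L) = 0 := fun L => by
    rw [strand_top _ (by omega) (by omega) (by omega)]
    exact strand_zero _ fun a h1 h2 => by have := hpic.col1 a h1 h2; omega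
  have e3 : ∀ L, strand s 1 (h + 1) i (-L) = strand t 1 h i (-L) := fun L => by
    rw [strand_top _ (by omega) (by omega) (by omega)]
    exact strand_congr _ fun a h1 h2 => by have := hpic.col1 a h1 h2; omega
  -- Here `m = 1` means that a letter `k + 1` follows the entry `k` at `h + 1`.
  obtain ⟨m, hm, e4, e5⟩ : ∃ m : ℤ, (m = 0 ∨ m = 1) ∧
      (∀ L, strand t (h + 1) ℓ i (-(L + r)) = (1 - m) * stp (-h - 1 - r) L) ∧
      (∀ L, strand s (h + 1 + 1) ℓ i (-(L + r)) = - m * stp (-h - 1 - r) L) := by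
    by_cases hb : t (h + 1 + 1) = i + 1
    · have hs : s (h + 1 + 1) = i + 1 := by
        by_cases h3 : h + 1 + 1 < n - K - e
        · have := hpic.mid (h + 1 + 1) (by omega) h3; omega
        · have := run (h + 1 + 1) (by omega) (by omega); omega
      refine ⟨1, Or.inr rfl, fun L => ?_, fun L => ?_⟩
      · rw [strand_both c2 (by omega) (by omega) _ (p := h + 1) (by omega) (by omega) (by omega) hb]
        ring
      · rw [strand_minus c3 (by omega) (by omega) _ (p := h + 1 + 1) (by omega) (by omega) hs
          (by omega)]
        unfold stp; split_ifs <;> omega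
    · refine ⟨0, Or.inl rfl, fun L => ?_, fun L => ?_⟩
      · rw [strand_plus c2 (by omega) (by omega) _ (p := h + 1) (by omega) (by omega) (by omega)
          fun _ => hb]
        unfold stp; split_ifs <;> omega
      · rw [strand_zero _ fun a h1 h2 => ?_]
        · ring
        by_cases h3 : a < n - K - e
        · have := hpic.mid a (by omega) h3
          refine ⟨by omega, fun h5 => hb ?_⟩
          have := c2.succ_eq (a := h + 1) (b := a) (by omega) (by omega) (by omega) h2
            (by omega) (by omega) (by omega)
          subst this; omega
        by_cases h4 : a ≤ n - k - e
        · have := run a (by omega) h4; omega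
        have := hpic.last a (by omega) h2; omega
  have e6 : ∀ L, strand t (h + 1) ℓ (2 * n + 1 - i) (n - i - (L + r)) = 0 := fun L =>
    strand_both c2 (by omega) (by omega) _ (p := n - k - e - 1) (by omega) (by omega)
      (by omega) (by rw [sub_add_cancel]; omega)
  have e7 : ∀ L, strand s (h + 1 + 1) ℓ (2 * n + 1 - i) (n - i - (L + r)) = stp (e - r) L :=
    fun L => by
    rw [strand_plus c3 (by omega) (by omega) _ (p := n - k - e) (by omega) (by omega) (by omega)
      fun h1 => ?_]
    · unfold stp; split_ifs <;> omega
    · have := hpic.last _ (by omega) h1; omega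
  have hz : FarStep (-h - 1 - r) (e - r) fun L => strand t 1 h i (-L) := by
    rcases strand_cases c1 (ρ := i) (by omega) (by omega) with ⟨h1, -⟩ | ⟨p, h1, h2, h3, -, h4⟩ |
      ⟨p, h1, h2, h3, -, h4⟩
    · exact Or.inl fun L => h1 _
    · refine Or.inr (Or.inl ⟨-p, by omega, fun L => ?_⟩)
      simp only [h4]; unfold stp; split_ifs <;> omega
    · refine Or.inr (Or.inr ⟨1 - p, by omega, fun L => ?_⟩)
      simp only [h4]; unfold stp; split_ifs <;> omega
  have hFt : ∀ L, F n ℓ h r i t L = (1 - m) * stp (-h - 1 - r) L + strand t 1 h i (-L) :=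
    fun L => by rw [F_of_lt (by omega), e1, e4, e6]; ring
  have hFs : ∀ L, F n ℓ (h + 1) r i s L =
      stp (e - r) L - m * stp (-h - 1 - r) L + strand t 1 h i (-L) :=
    fun L => by rw [F_of_lt (by omega), e2, e3, e5, e7]; ring
  refine ⟨fun L hL => ?_, (plusMove_far (q := 0) hFt hFs hm (by omega) hz).1, ?_⟩
  · rw [hFt, hFs]; unfold stp; rw [if_pos (by omega), if_pos (by omega)]; ring
  rintro s' ⟨-, hS', c, hc, rfl⟩
  have hlet := hc.letter
  have hone := hc.one_le
  have hle := hc.le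
  have hcrun : c ≠ h + 1 ∧ (c < n - K - e ∨ n - k - e < c ∨ c = n - k - e) := by
    refine ⟨by rintro rfl; omega, ?_⟩
    by_contra hcr
    have h3 := run c (by omega) (by omega)
    omega
  rcases (plusMove_far hFt hFs hm (by omega) hz).2 hc.isFirstMax hc.pos with
    ⟨h1, -, h3, h4⟩ | ⟨h1, h2, h3⟩
  · have hcb : c = n - k - e := by
      rcases hcrun.2 with h5 | h5 | h5
      · by_cases h6 : c ≤ h
        · have := hpic.col1 c hone h6
          unfold lev at h1; rw [if_pos (by omega), if_pos (by omega)] at h1; omega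
        · have := hpic.mid c (by omega) h5; omega
      · have := hpic.last c h5 hle; omega
      · exact h5
    subst hcb
    refine exists_fstep (c := h + 1) hR (rel_of_relA (k := k + 1) (K := K) (e := e) hS' hh hl hln
      ⟨by omega, by omega, g3, g4, g5, by omega, by rw [bump_self]; omega,
        by rw [bump_of_ne _ (by omega)]; exact g8, fun a h5 h6 => ?_, fun a h5 h6 => ?_⟩ ?_)
      (by omega) hl (by omega) h3
      (by unfold lev; rw [if_pos (by omega), if_neg (by omega)]; omega) hc.isFirstMax h4 hc.pos
    · rw [bump_of_ne _ (by omega), bump_of_ne _ (by omega)]; exact run a h5 (by omega)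
    · rw [bump_of_ne t h5]
      by_cases h7 : a = n - k - e
      · subst h7; rw [bump_self]; omega
      · rw [bump_of_ne _ h7]; exact same a h5 (by omega)
    · intro _
      rw [show n - (k + 1) - e + 1 = n - k - e by ring, bump_self]; omega
  · refine hA.same_step hR hh hl hln hS' hc hcrun.1 ?_ rfl h2 h3
    rcases hcrun.2 with h5 | h5 | h5
    · exact Or.inl h5
    · exact Or.inr h5
    · subst h5
      unfold lev at h1; rw [if_neg (by omega), if_neg (by omega)] at h1; omega

/-- A run of one letter disappears: raising its letter in `s`, and the border entry in `t`, leads to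
the same sequence, which is related to itself without an exchange. -/
lemma RelA.compare_single (hR : Rel n ℓ h r t s) (hA : RelA n ℓ h r t s k K e) (hh : 0 ≤ h)
    (hl : h + 1 ≤ ℓ) (hi : i = k) (hkK : k = K) :
    Compare n ℓ h r i t s := by
  subst hkK
  obtain ⟨hT, hS, -⟩ := id hR
  have hpic := hA.pic hT hS hh
  obtain ⟨g1, g2, g3, g4, g5, g6, g7, g8, run, same⟩ := id hA
  have c1 := hT.colOne (by omega)
  have c2 := hT.colTwo hh
  have c1s := hS.colOne (by omega)
  have c3 := hS.colTwo (by omega)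
  have r1 := run (n - k - e) (by omega) (by omega)
  have e1 : ∀ L, strand t 1 h (2 * n + 1 - i) (n - i - L) = 0 := fun L => strand_zero _
    fun a h1 h2 => by have := hpic.col1 a h1 h2; omega
  have e2 : ∀ L, strand s 1 (h + 1) (2 * n + 1 - i) (n - i - L) = 0 := fun L => by
    rw [strand_top _ (by omega) (by omega) (by omega)]
    exact strand_zero _ fun a h1 h2 => by have := hpic.col1 a h1 h2; omega
  -- The value `w = 0` means that the first column ends with `k`: unpaired in `t`, but cancelled in
  -- `s` by `k + 1` at `h + 1`.
  obtain ⟨w, hw, e3, e3'⟩ : ∃ w : ℤ, (w = 0 ∨ w = 1) ∧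
      (∀ L, strand t 1 h i (-L) = (1 - w) * stp (-h) L) ∧
      (∀ L, strand s 1 (h + 1) i (-L) = - w * stp (-h) L) := by
    by_cases hb : 1 ≤ h ∧ t h = i
    · have := hpic.col1 h hb.1 le_rfl
      refine ⟨0, Or.inl rfl, fun L => ?_, fun L => ?_⟩
      · rw [strand_plus c1 (by omega) (by omega) _ (p := h) hb.1 (by omega) (by omega) (by omega)]
        unfold stp; split_ifs <;> omega
      · rw [strand_both c1s (by omega) (by omega) _ (p := h) hb.1 (by omega) (by omega) (by omega)]
        ring
    · refine ⟨1, Or.inr rfl, fun L => ?_, fun L => ?_⟩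
      · rw [strand_zero (t := t) _ fun a h1 h2 => by
          have := hpic.col1 a h1 h2
          refine ⟨fun h3 => hb ?_, by omega⟩
          have h4 := c1s.succ_eq (a := a) (b := h + 1) h1 (by omega) (by omega) le_rfl
            (by omega) (by omega) (by omega)
          have h5 : a = h := by omega
          subst h5; exact ⟨h1, h3⟩]
        ring
      · rw [strand_minus c1s (by omega) (by omega) _ (p := h + 1) (by omega) (by omega) (by omega)
          fun h1 h2 => hb ?_]
        · unfold stp; split_ifs <;> omega
        · rw [add_sub_cancel_right] at h1 h2
          have := hpic.col1 h h1 le_rfl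
          omega
  obtain ⟨m, hm, e4, e5⟩ : ∃ m : ℤ, (m = 0 ∨ m = 1) ∧
      (∀ L, strand t (h + 1) ℓ i (-(L + r)) = (1 - m) * stp (-h - 1 - r) L) ∧
      (∀ L, strand s (h + 1 + 1) ℓ i (-(L + r)) = - m * stp (-h - 1 - r) L) := by
    by_cases hb : t (h + 1 + 1) = i + 1
    · have hs : s (h + 1 + 1) = i + 1 := by
        by_cases h3 : h + 1 + 1 < n - k - e
        · have := hpic.mid (h + 1 + 1) (by omega) h3; omega
        · have := run (h + 1 + 1) (by omega) (by omega); omega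
      refine ⟨1, Or.inr rfl, fun L => ?_, fun L => ?_⟩
      · rw [strand_both c2 (by omega) (by omega) _ (p := h + 1) (by omega) (by omega) (by omega) hb]
        ring
      · rw [strand_minus c3 (by omega) (by omega) _ (p := h + 1 + 1) (by omega) (by omega) hs
          (by omega)]
        unfold stp; split_ifs <;> omega
    · refine ⟨0, Or.inl rfl, fun L => ?_, fun L => ?_⟩
      · rw [strand_plus c2 (by omega) (by omega) _ (p := h + 1) (by omega) (by omega) (by omega)
          fun _ => hb]
        unfold stp; split_ifs <;> omega
      · rw [strand_zero _ fun a h1 h2 => ?_]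
        · ring
        by_cases h3 : a < n - k - e
        · have := hpic.mid a (by omega) h3
          refine ⟨by omega, fun h5 => hb ?_⟩
          have := c2.succ_eq (a := h + 1) (b := a) (by omega) (by omega) (by omega) h2
            (by omega) (by omega) (by omega)
          subst this; omega
        by_cases h4 : a ≤ n - k - e
        · have := run a (by omega) h4; omega
        have := hpic.last a (by omega) h2; omega
  have e6 : ∀ L, strand t (h + 1) ℓ (2 * n + 1 - i) (n - i - (L + r)) = -stp (e - r + 1) L :=
    fun L => by
    rw [strand_minus c2 (by omega) (by omega) _ (p := n - k - e) (by omega) (by omega) (by omega)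
      fun h1 h2 => ?_]
    · unfold stp; split_ifs <;> omega
    · by_cases h3 : n - k - e - 1 = h + 1
      · rw [h3] at h2; omega
      · have := hpic.mid _ (by omega) (show n - k - e - 1 < n - k - e by omega); omega
  have e7 : ∀ L, strand s (h + 1 + 1) ℓ (2 * n + 1 - i) (n - i - (L + r)) = stp (e - r) L :=
    fun L => by
    rw [strand_plus c3 (by omega) (by omega) _ (p := n - k - e) (by omega) (by omega) (by omega)
      fun h1 => ?_]
    · unfold stp; split_ifs <;> omega
    · have := hpic.last _ (by omega) h1; omega
  have hFt : ∀ L, F n ℓ h r i t L =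
      (1 - w) * stp (-h) L + (1 - m) * stp (-h - 1 - r) L - stp (e - r + 1) L :=
    fun L => by rw [F_of_lt (by omega), e1, e3, e4, e6]; ring
  have hFs : ∀ L, F n ℓ (h + 1) r i s L =
      stp (e - r) L - w * stp (-h) L - m * stp (-h - 1 - r) L :=
    fun L => by rw [F_of_lt (by omega), e2, e3', e5, e7]; ring
  refine ⟨fun L hL => ?_, (crossMove (q := 0) hFt hFs hm hw (by omega) (by omega)).1, ?_⟩
  · rw [hFt, hFs]; unfold stp
    rw [if_pos (by omega), if_pos (by omega), if_pos (by omega), if_pos (by omega)]; ring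
  rintro s' ⟨-, hS', c, hc, rfl⟩
  have hlet := hc.letter
  have hone := hc.one_le
  have hle := hc.le
  obtain ⟨h1, -, h3, h4⟩ := (crossMove hFt hFs hm hw (by omega) (by omega)).2 hc.isFirstMax hc.pos
  have hcb : c = n - k - e := by
    by_cases h6 : c ≤ h
    · have := hpic.col1 c hone h6
      unfold lev at h1; rw [if_pos (by omega), if_pos (by omega)] at h1; omega
    by_cases h7 : c = h + 1
    · subst h7; omega
    by_cases h8 : c < n - k - e
    · have := hpic.mid c (by omega) h8; omega
    by_cases h9 : n - k - e < c
    · have := hpic.last c h9 hle; omega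
    · omega
  subst hcb
  have hbump : bump t (h + 1) = bump s (n - k - e) := by
    ext a
    by_cases h5 : a = h + 1
    · subst h5; rw [bump_self, bump_of_ne _ (by omega)]; omega
    · by_cases h6 : a = n - k - e
      · subst h6; rw [bump_self, bump_of_ne _ h5]; omega
      · rw [bump_of_ne _ h5, bump_of_ne _ h6]; exact (same a h5 (by omega)).symm
  have hrel : Rel n ℓ h r (bump s (n - k - e)) (bump s (n - k - e)) := by
    refine rel_of_relC hS' hh hl ?_ ?_
    · rw [bump_of_ne s (show h + 1 ≠ n - k - e by omega), g8]
      intro b h5 h6 _ h7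
      by_cases h8 : b = n - k - e
      · subst h8; rw [bump_self] at h7; omega
      rw [bump_of_ne _ h8] at h7
      by_cases h9 : b < n - k - e
      · have := hpic.mid b h5 h9; omega
      · have := hpic.last b (by omega) h6; omega
    · rw [bump_of_ne s (show h + 1 ≠ n - k - e by omega), g8]
      intro a _ _ h7; omega
  refine exists_fstep (c := h + 1) hR (by rw [hbump]; exact hrel)
    (by omega) hl (by omega) h3
    (by unfold lev; rw [if_pos (by omega), if_neg (by omega)]; omega) hc.isFirstMax h4 hc.pos

/-- Raising `K + 1` at `h + 1` in `s` corresponds to raising the bar of `K + 2` directly in front of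
the run of `t`. This prolongs the run, so that `K` becomes `K + 1`. -/
lemma RelA.compare_top (hR : Rel n ℓ h r t s) (hA : RelA n ℓ h r t s k K e) (hh : 0 ≤ h)
    (hl : h + 1 ≤ ℓ) (hln : ℓ ≤ n - r) (hi : i = K + 1) :
    Compare n ℓ h r i t s := by
  obtain ⟨hT, hS, -⟩ := id hR
  have hpic := hA.pic hT hS hh
  obtain ⟨g1, g2, g3, g4, g5, g6, g7, g8, run, same⟩ := id hA
  have c2 := hT.colTwo hh
  have c1s := hS.colOne (by omega)
  have c3 := hS.colTwo (by omega)
  have r1 := run (n - K - e) (by omega) (by omega)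
  have hmid : ∀ a, h + 1 + 1 ≤ a → a ≤ ℓ → s a = 2 * n - K → a = n - K - e - 1 := by
    intro a h1 h2 h3
    have := c3.succ_eq h1 h2 (b := n - K - e) (by omega) (by omega) (by omega) (by omega) (by omega)
    omega
  have e1 : ∀ L, strand t 1 h (2 * n + 1 - i) (n - i - L) = 0 := fun L => strand_zero _
    fun a h1 h2 => by have := hpic.col1 a h1 h2; omega
  have e2 : ∀ L, strand s 1 (h + 1) (2 * n + 1 - i) (n - i - L) = 0 := fun L => by
    rw [strand_top _ (by omega) (by omega) (by omega)]
    exact strand_zero _ fun a h1 h2 => by have := hpic.col1 a h1 h2; omega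
  have e3 : ∀ L, strand t 1 h i (-L) = 0 := fun L => strand_zero _
    fun a h1 h2 => by have := hpic.col1 a h1 h2; omega
  have e4 : ∀ L, strand s 1 (h + 1) i (-L) = stp (-h - 1) L := fun L => by
    rw [strand_plus c1s (by omega) (by omega) _ (p := h + 1) (by omega) (by omega) (by omega)
      (by omega)]
    unfold stp; split_ifs <;> omega
  have e5 : ∀ L, strand t (h + 1) ℓ i (-(L + r)) = strand s (h + 1 + 1) ℓ i (-(L + r)) := fun L => by
    rw [strand_bot _ (by omega) (by omega) (by omega)]
    refine strand_congr _ fun a h1 h2 => ?_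
    by_cases h3 : a < n - K - e
    · have := hpic.mid a (by omega) h3; omega
    by_cases h4 : a ≤ n - k - e
    · have := run a (by omega) h4; omega
    have := hpic.last a (by omega) h2; omega
  obtain ⟨m, hm, e6, e7, hm0⟩ : ∃ m : ℤ, (m = 0 ∨ m = 1) ∧
      (∀ L, strand t (h + 1) ℓ (2 * n + 1 - i) (n - i - (L + r)) = (1 - m) * stp (e - r) L) ∧
      (∀ L, strand s (h + 1 + 1) ℓ (2 * n + 1 - i) (n - i - (L + r)) = - m * stp (e - r) L) ∧
      (m = 0 → h + 2 ≤ n - K - e - 1 ∧ t (n - K - e - 1) = 2 * n - K) := by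
    by_cases hb : h + 2 ≤ n - K - e - 1 ∧ t (n - K - e - 1) = 2 * n - K
    · refine ⟨0, Or.inl rfl, fun L => ?_, fun L => ?_, fun _ => hb⟩
      · rw [strand_plus c2 (by omega) (by omega) _ (p := n - K - e - 1) (by omega) (by omega)
          (by omega) fun _ => by rw [sub_add_cancel]; omega]
        unfold stp; split_ifs <;> omega
      · have := hpic.mid _ hb.1 (show n - K - e - 1 < n - K - e by omega)
        rw [strand_both c3 (by omega) (by omega) _ (p := n - K - e - 1) (by omega) (by omega)
          (by omega) (by rw [sub_add_cancel]; omega)]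
        ring
    · have hb' : ∀ a, h + 1 + 1 ≤ a → a ≤ ℓ → s a ≠ 2 * n - K := fun a h1 h2 h3 => hb (by
        have := hmid a h1 h2 h3
        subst this
        have := hpic.mid (n - K - e - 1) (by omega) (by omega)
        omega)
      refine ⟨1, Or.inr rfl, fun L => ?_, fun L => ?_, fun h => by omega⟩
      · rw [strand_zero (t := t) _ fun a h1 h2 => ?_]
        · ring
        by_cases h5 : a = h + 1
        · subst h5; omega
        by_cases h3 : a < n - K - e
        · have := hb' a (by omega) h2
          have := hpic.mid a (by omega) h3; omega
        by_cases h4 : a ≤ n - k - e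
        · have := run a (by omega) h4; omega
        have := hpic.last a (by omega) h2; omega
      · rw [strand_minus c3 (by omega) (by omega) _ (p := n - K - e) (by omega) (by omega) (by omega)
          fun h1 h2 => hb' _ h1 (by omega) (by omega)]
        unfold stp; split_ifs <;> omega
  have hz : FarStep (e - r) (-h - 1) fun L => strand s (h + 1 + 1) ℓ i (-(L + r)) := by
    rcases strand_cases c3 (ρ := i) (by omega) (by omega) with ⟨h1, -⟩ | ⟨p, h1, h2, h3, -, h4⟩ |
      ⟨p, h1, h2, h3, -, h4⟩
    · exact Or.inl fun L => h1 _
    · refine Or.inr (Or.inl ⟨-p - r, by omega, fun L => ?_⟩)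
      simp only [h4]; unfold stp; split_ifs <;> omega
    · refine Or.inr (Or.inr ⟨1 - p - r, by omega, fun L => ?_⟩)
      simp only [h4]; unfold stp; split_ifs <;> omega
  have hFt : ∀ L, F n ℓ h r i t L =
      (1 - m) * stp (e - r) L + strand s (h + 1 + 1) ℓ i (-(L + r)) :=
    fun L => by rw [F_of_lt (by omega), e1, e3, e5, e6]; ring
  have hFs : ∀ L, F n ℓ (h + 1) r i s L =
      stp (-h - 1) L - m * stp (e - r) L + strand s (h + 1 + 1) ℓ i (-(L + r)) :=
    fun L => by rw [F_of_lt (by omega), e2, e4, e7]; ring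
  refine ⟨fun L hL => ?_, (plusMove_far (q := 0) hFt hFs hm (by omega) hz).1, ?_⟩
  · rw [hFt, hFs]; unfold stp; rw [if_pos (by omega), if_pos (by omega)]; ring
  rintro s' ⟨-, hS', c, hc, rfl⟩
  have hlet := hc.letter
  have hone := hc.one_le
  have hle := hc.le
  have hcc : c = h + 1 ∨ (h + 2 ≤ c ∧ (c < n - K - e ∨ n - k - e < c)) := by
    by_cases h6 : c ≤ h
    · have := hpic.col1 c hone h6; omega
    by_cases h7 : c = h + 1
    · exact Or.inl h7
    by_cases h8 : n - K - e ≤ c ∧ c ≤ n - k - e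
    · have := run c h8.1 h8.2; omega
    · exact Or.inr ⟨by omega, by omega⟩
  rcases (plusMove_far hFt hFs hm (by omega) hz).2 hc.isFirstMax hc.pos with
    ⟨h1, h2, h3, h4⟩ | ⟨h1, h2, h3⟩
  · obtain ⟨hq1, hq2⟩ := hm0 h2
    -- A barred letter at this level would have to stand directly in front of the run, where the
    -- place of its step is different.
    have hcb : c = h + 1 := by
      rcases hcc with h5 | ⟨h5, h6⟩
      · exact h5
      · rcases hlet with h7 | h7
        · unfold lev at h1; rw [if_pos (by omega), if_neg (by omega)] at h1; omega
        · have := hmid c (by omega) hle (by omega)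
          unfold lev at h1; rw [if_neg (by omega), if_neg (by omega)] at h1; omega
    subst hcb
    refine exists_fstep (c := n - K - e - 1) hR (rel_of_relA (k := k) (K := K + 1) (e := e) hS' hh
      hl hln ⟨g1, by omega, g3, g4, by omega, g6, by rw [bump_of_ne _ (by omega)]; exact g7,
        by rw [bump_self, g8], fun a h5 h6 => ?_, fun a h5 h6 => ?_⟩ ?_)
      (by omega) (by omega) (by omega) h3
      (by unfold lev; rw [if_neg (by omega), if_neg (by omega)]; omega) hc.isFirstMax h4 hc.pos
    · rw [bump_of_ne s (by omega)]
      by_cases h7 : a = n - K - e - 1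
      · subst h7
        have := hpic.mid _ hq1 (show n - K - e - 1 < n - K - e by omega)
        rw [bump_self]; omega
      · rw [bump_of_ne _ h7]; exact run a (by omega) h6
    · rw [bump_of_ne s h5, bump_of_ne _ (by omega)]
      exact same a h5 (by omega)
    · intro h5
      rw [bump_of_ne _ (by omega)]
      have := hpic.last _ (by omega) h5; omega
  · rcases hcc with rfl | ⟨h5, h6⟩
    · unfold lev at h1; rw [if_pos (by omega), if_pos (by omega)] at h1; omega
    · exact hA.same_step hR hh hl hln hS' hc (by omega) h6 rfl h2 h3

lemma RelA.compare (hR : Rel n ℓ h r t s) (hA : RelA n ℓ h r t s k K e) (hh : 0 ≤ h)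
    (hl : h + 1 ≤ ℓ) (hln : ℓ ≤ n - r) (hi : 1 ≤ i) (hin : i ≤ n) : Compare n ℓ h r i t s := by
  by_cases h1 : i = K + 1
  · exact hA.compare_top hR hh hl hln h1
  by_cases h2 : i = k
  · rcases eq_or_lt_of_le hA.le with h3 | h3
    · exact hA.compare_single hR hh hl h2 h3
    · exact hA.compare_bottom hR hh hl hln h2 h3
  refine hA.compare_of_sameMax hR hh hl hln h2 h1 hin ?_
  by_cases h3 : i = k - 1
  · exact hA.sameMax_pred hR.1 hR.2.1 hh h3 hi
  by_cases h4 : i = K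
  · exact hA.sameMax_top hR.1 hR.2.1 hh h4 (by have := hA.le; omega)
  · exact hA.sameMax_other hR.1 hR.2.1 hh hin h3 h2 h4 h1

end

end TypeB

/-! ### Exchange of a barred border letter. -/

namespace TypeB

section

variable {n ℓ h r i : ℤ} {t s s' : ℤ → ℤ} {k K e d : ℤ}

/-- The shape of a pair in `RelB`. -/
structure PicB (n ℓ h : ℤ) (t s : ℤ → ℤ) (k K d : ℤ) : Prop where
  first : ∀ a, 1 ≤ a → a < K - d → s a = t a ∧ 1 ≤ t a ∧ t a < K - 1
  mid : ∀ a, k - d < a → a ≤ h → s a = t a ∧ k < t a ∧ t a ≤ 2 * n + 2 - K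
  col2 : ∀ a, h + 2 ≤ a → a ≤ ℓ → s a = t a ∧ 2 * n + 2 - k < t a ∧ t a ≤ 2 * n + 1

lemma RelB.pic (hT : Tab n ℓ h r t) (hS : Tab n ℓ (h + 1) r s) (hR : RelB n ℓ h r t s k K d)
    (hh : 0 ≤ h) (hl : h + 1 ≤ ℓ) : PicB n ℓ h t s k K d := by
  obtain ⟨g2, g3, g4, g5, g6, g7, g8, run, same⟩ := hR
  have r1 := run (K - d) (by omega) (by omega)
  have r2 := run (k - d) (by omega) (by omega)
  have c1 := hT.colOne (by omega)
  have c1s := hS.colOne (by omega)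
  have c2 := hT.colTwo hh
  refine ⟨fun a h1 h2 => ?_, fun a h1 h2 => ?_, fun a h1 h2 => ?_⟩
  · have := same a (by omega) (by omega)
    have := hT.one_le a h1 (by omega)
    have := c1s.cmp h1 (b := K - d) (by omega) (by omega)
    omega
  · have := same a (by omega) (by omega)
    have := c1.cmp (a := k - d) (b := a) (by omega) (by omega) (by omega)
    have := c1s.cmp (a := a) (b := h + 1) (by omega) (by omega) (by omega)
    omega
  · have := same a (by omega) (by omega)
    have := hT.le_top a (by omega) (by omega)
    have := c2.cmp (a := h + 1) (b := a) (by omega) (by omega) (by omega)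
    omega

lemma RelB.same_step {c q : ℤ} (hR : Rel n ℓ h r t s) (hB : RelB n ℓ h r t s k K d)
    (hh : 0 ≤ h) (hl : h + 1 ≤ ℓ) (hln : ℓ ≤ n - r) (hS' : Tab n ℓ (h + 1) r (bump s c))
    (hc : ActsAt n ℓ (h + 1) r i s c) (h1 : c ≠ h + 1) (h2 : c < K - d ∨ k - d < c)
    (hlev : q = lev n (h + 1) r i (s c) c)
    (hq : IsFirstMax (F n ℓ h r i t) q) (hval : F n ℓ h r i t q = F n ℓ (h + 1) r i s q) :
    ∃ t', FStep n ℓ h r i t t' ∧ Rel n ℓ h r t' (bump s c) ∧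
    ∃ q q', IsFirstMax (F n ℓ (h + 1) r i s) q ∧ IsFirstMax (F n ℓ h r i t) q' ∧
      F n ℓ h r i t q' = F n ℓ (h + 1) r i s q := by
  have hpic := hB.pic hR.1 hR.2.1 hh hl
  have hsc := hB.same c h1 h2
  have hlet := hc.letter
  have hgl := hB.last
  have hgs := hB.start
  have hgle := hB.le
  rw [hsc] at hlet
  subst hlev
  refine exists_fstep (c := c) hR (rel_of_relB (k := k) (K := K) (d := d) hS' hh hl hln ?_ ?_)
    hc.one_le hc.le hlet hq (by rw [lev_succ h1, hsc]) hc.isFirstMax hval hc.pos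
  · refine ⟨hB.le, hB.le_d, hB.d_le, hB.start, hB.last, ?_, ?_, fun a h3 h4 => ?_,
      fun a h3 h4 => ?_⟩
    · rw [bump_of_ne _ (Ne.symm h1)]; exact hB.left
    · rw [bump_of_ne _ (Ne.symm h1)]; exact hB.right
    · rw [bump_of_ne _ (by omega), bump_of_ne _ (by omega)]; exact hB.run a h3 h4
    · unfold bump; rw [hB.same a h3 h4]
  · intro h3
    have := hpic.mid _ (by omega) h3
    have := bump_cases s c (k - d + 1)
    omega

lemma RelB.compare_of_sameMax (hR : Rel n ℓ h r t s) (hB : RelB n ℓ h r t s k K d)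
    (hh : 0 ≤ h) (hl : h + 1 ≤ ℓ) (hln : ℓ ≤ n - r) (h1 : i ≠ k - 1) (h2 : i ≠ K - 2) (hi : i ≤ n)
    (hM : SameMax n (F n ℓ h r i t) (F n ℓ (h + 1) r i s)) : Compare n ℓ h r i t s := by
  refine ⟨hM.1, hM.2.1, ?_⟩
  rintro s' ⟨-, hS', c, hc, rfl⟩
  obtain ⟨hq, hval⟩ := hM.2.2 _ hc.isFirstMax
  have hlet := hc.letter
  have hone := hc.one_le
  have := hB.right
  have := hB.start
  have := hB.last
  have := hB.le
  have := hB.d_le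
  refine hB.same_step hR hh hl hln hS' hc ?_ ?_ rfl hq hval
  · rintro rfl; omega
  · by_contra hcr
    have h3 := hB.run c (by omega) (by omega)
    have h4 := hB.run (c + 1) (by omega) (by omega)
    have h5 := hS'.step c (by omega) (by omega) (by omega)
    rw [bump_self, bump_of_ne _ (by omega)] at h5
    omega

/-- The letter `k` at the end of the run gives a step up in `t`, and the bar of `k` at `h + 1` a
step down; `s` has neither. The displacement by `r` puts the step down first, so that `s` is larger
on the window but has no step up in it. -/
lemma RelB.sameMax_top (hT : Tab n ℓ h r t) (hS : Tab n ℓ (h + 1) r s)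
    (hB : RelB n ℓ h r t s k K d) (hh : 0 ≤ h) (hl : h + 1 ≤ ℓ) (hi : i = k) :
    SameMax n (F n ℓ h r i t) (F n ℓ (h + 1) r i s) := by
  have hpic := hB.pic hT hS hh hl
  obtain ⟨g2, g3, g4, g5, g6, g7, g8, run, same⟩ := hB
  have c1 := hT.colOne (by omega)
  have c2 := hT.colTwo hh
  have c1s := hS.colOne (by omega)
  have r2 := run (k - d) (by omega) (by omega)
  have e1 : ∀ L, strand s 1 (h + 1) (2 * n + 1 - i) (n - i - L) =
      strand t 1 h (2 * n + 1 - i) (n - i - L) := fun L => by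
    rw [strand_top _ (by omega) (by omega) (by omega)]
    refine strand_congr _ fun a h1 h2 => ?_
    by_cases h3 : a < K - d
    · have := hpic.first a (by omega) h3; omega
    by_cases h4 : a ≤ k - d
    · have := run a (by omega) h4; omega
    have := hpic.mid a (by omega) h2; omega
  have e2 : ∀ L, strand t (h + 1) ℓ i (-(L + r)) = 0 := fun L => strand_zero _ fun a h1 h2 => by
    by_cases h3 : a = h + 1
    · subst h3; omega
    · have := hpic.col2 a (by omega) h2; omega
  have e3 : ∀ L, strand s (h + 1 + 1) ℓ i (-(L + r)) = 0 := fun L => strand_zero _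
    fun a h1 h2 => by have := hpic.col2 a (by omega) h2; omega
  have e4 : ∀ L, strand t (h + 1) ℓ (2 * n + 1 - i) (n - i - (L + r)) = -stp (n - k - h - r) L :=
    fun L => by
    rw [strand_minus c2 (by omega) (by omega) _ (p := h + 1) (by omega) (by omega) (by omega)
      (by omega)]
    unfold stp; split_ifs <;> omega
  have e5 : ∀ L, strand s (h + 1 + 1) ℓ (2 * n + 1 - i) (n - i - (L + r)) = 0 :=
    fun L => strand_zero _ fun a h1 h2 => by have := hpic.col2 a (by omega) h2; omega
  have e6 : (∀ L, strand s 1 (h + 1) i (-L) = strand t 1 h i (-L) - stp (d - k) L) ∧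
      ∀ L L', L' ≤ L → strand s 1 (h + 1) i (-L) ≤ strand s 1 (h + 1) i (-L') := by
    by_cases hb : k - d + 1 ≤ h ∧ t (k - d + 1) = i + 1
    · have q1 := hpic.mid _ (by omega) hb.1
      have q2 : ∀ L, strand s 1 (h + 1) i (-L) = - stp (d - k) L := fun L => by
        rw [strand_minus c1s (by omega) (by omega) _ (p := k - d + 1) (by omega) (by omega)
          (by omega) (fun _ => by rw [add_sub_cancel_right]; omega)]
        unfold stp; split_ifs <;> omega
      constructor
      · intro L
        rw [q2, strand_both c1 (by omega) (by omega) _ (p := k - d) (by omega) hb.1 (by omega)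
          hb.2]
        ring
      · intro L L' hL
        rw [q2, q2]; unfold stp; split_ifs <;> omega
    · have q2 : ∀ L, strand s 1 (h + 1) i (-L) = 0 :=
        fun L => strand_zero _ fun a h1 h2 => by
          by_cases h6 : a = h + 1
          · subst h6; omega
          by_cases h3 : a < K - d
          · have := hpic.first a (by omega) h3; omega
          by_cases h4 : a ≤ k - d
          · have := run a (by omega) h4; omega
          have := hpic.mid a (by omega) (by omega)
          refine ⟨by omega, fun h5 => hb ?_⟩
          have := c1.succ_eq (a := k - d) (b := a) (by omega) (by omega) (by omega) (by omega)
            (by omega) (by omega) (by omega)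
          subst this; exact ⟨by omega, by omega⟩
      constructor
      · intro L
        rw [q2, strand_plus c1 (by omega) (by omega) _ (p := k - d) (by omega) (by omega)
          (by omega) (fun h1 h2 => hb ⟨h1, h2⟩)]
        unfold stp; split_ifs <;> omega
      · intro L L' hL
        rw [q2, q2]
  have := hT.le_top (h + 1) (by omega) (by omega)
  refine SameMax.of_window (A := n - k - h - r) (B := d - k) (fun L => ?_) (fun L h1 h2 => ?_)
    (by omega) (by omega)
  · rw [F_of_lt (by omega), F_of_lt (by omega), e1, e2, e3, e4, e5, e6.1]; ring
  · rw [F_of_lt (by omega), F_of_lt (by omega), e1, e1, e3, e3, e5, e5]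
    have z1 : strand t 1 h (2 * n + 1 - i) (n - i - L) = 0 := strand_low (by omega)
    have z2 : strand t 1 h (2 * n + 1 - i) (n - i - (n - k - h - r - 1)) = 0 :=
      strand_low (by omega)
    have := e6.2 L (n - k - h - r - 1) (by omega)
    omega

/-- The run of `t` begins with the unpaired letter `K`, while in `s` it is preceded by `K - 1` and
cancels. In exchange the bar of `K - 1` at `h + 1` contributes a step down to `s`. -/
lemma RelB.sameMax_pred (hT : Tab n ℓ h r t) (hS : Tab n ℓ (h + 1) r s)
    (hB : RelB n ℓ h r t s k K d) (hh : 0 ≤ h) (hl : h + 1 ≤ ℓ) (hln : ℓ ≤ n - r)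
    (hi : i = K - 1) (hkK : K < k) :
    SameMax n (F n ℓ h r i t) (F n ℓ (h + 1) r i s) := by
  have hpic := hB.pic hT hS hh hl
  obtain ⟨g2, g3, g4, g5, g6, g7, g8, run, same⟩ := hB
  have c1 := hT.colOne (by omega)
  have c2 := hT.colTwo hh
  have c1s := hS.colOne (by omega)
  have c3 := hS.colTwo (by omega)
  have r1 := run (K - d) (by omega) (by omega)
  have r2 := run (K - d + 1) (by omega) (by omega)
  have e1 : ∀ L, strand t 1 h i (-L) = -stp (d + 1 - K) L := fun L => by
    rw [strand_minus c1 (by omega) (by omega) _ (p := K - d) (by omega) (by omega) (by omega)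
      fun h1 h2 => ?_]
    · unfold stp; split_ifs <;> omega
    · have := hpic.first _ h1 (by omega); omega
  have e2 : ∀ L, strand s 1 (h + 1) i (-L) = 0 := fun L =>
    strand_both c1s (by omega) (by omega) _ (p := K - d) (by omega) (by omega) (by omega)
      (by omega)
  have e3 : ∀ L, strand s 1 (h + 1) (2 * n + 1 - i) (n - i - L) =
      strand t 1 h (2 * n + 1 - i) (n - i - L) - stp (n - K + 1 - h) L := fun L => by
    by_cases hb : t h = 2 * n + 1 - i
    · have hkh : k - d < h := by
        by_contra h1
        have := run h (by omega) (by omega); omega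
      have := hpic.mid h hkh le_rfl
      rw [strand_both c1s (by omega) (by omega) _ (p := h) (by omega) (by omega) (by omega)
          (by omega),
        strand_plus c1 (by omega) (by omega) _ (p := h) (by omega) (by omega) (by omega) (by omega)]
      unfold stp; split_ifs <;> omega
    · rw [strand_zero (t := t) _ fun a h1 h2 => by
          by_cases h3 : a < K - d
          · have := hpic.first a (by omega) h3; omega
          by_cases h4 : a ≤ k - d
          · have := run a (by omega) h4; omega
          have := hpic.mid a (by omega) h2
          refine ⟨fun h3 => hb ?_, by omega⟩
          have h4 := c1s.succ_eq (a := a) (b := h + 1) h1 (by omega) (by omega) le_rfl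
            (by omega) (by omega) (by omega)
          have h5 : a = h := by omega
          subst h5; exact h3,
        strand_minus c1s (by omega) (by omega) _ (p := h + 1) (by omega) (by omega) (by omega)
          fun h1 h2 => hb ?_]
      · unfold stp; split_ifs <;> omega
      · rw [add_sub_cancel_right] at h1 h2
        by_cases h4 : h ≤ k - d
        · have := run h (by omega) h4; omega
        have := hpic.mid h (by omega) le_rfl
        omega
  have e4 : ∀ L, strand t (h + 1) ℓ i (-(L + r)) = 0 := fun L => strand_zero _ fun a h1 h2 => by
    by_cases h3 : a = h + 1
    · subst h3; omega
    · have := hpic.col2 a (by omega) h2; omega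
  have e5 : ∀ L, strand s (h + 1 + 1) ℓ i (-(L + r)) = 0 := fun L => strand_zero _
    fun a h1 h2 => by have := hpic.col2 a (by omega) h2; omega
  have e6 : ∀ L, strand t (h + 1) ℓ (2 * n + 1 - i) (n - i - (L + r)) =
      strand s (h + 1 + 1) ℓ (2 * n + 1 - i) (n - i - (L + r)) := fun L => by
    rw [strand_bot _ (by omega) (by omega) (by omega)]
    refine strand_congr _ fun a h1 h2 => ?_
    have := hpic.col2 a (by omega) h2; omega
  have e7 : ∀ L, d + 1 - K - 1 ≤ L → strand s (h + 1 + 1) ℓ (2 * n + 1 - i) (n - i - (L + r)) =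
      strand s (h + 1 + 1) ℓ (2 * n + 1 - i) (n - i - (d + 1 - K - 1 + r)) := by
    intro L hL
    rcases strand_cases c3 (ρ := 2 * n + 1 - i) (by omega) (by omega) with ⟨h1, -⟩ |
      ⟨p, h1, h2, h3, -, h4⟩ | ⟨p, h1, h2, h3, -, h4⟩
    · rw [h1, h1]
    · rw [h4, h4]; unfold stp; rw [if_pos (by omega), if_pos (by omega)]
    · rw [h4, h4]; unfold stp; rw [if_pos (by omega), if_pos (by omega)]
  refine SameMax.of_window (A := d + 1 - K) (B := n - K + 1 - h) (fun L => ?_)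
    (fun L h1 h2 => ?_) (by omega) (by omega)
  · rw [F_of_lt (by omega), F_of_lt (by omega), e1, e2, e3, e4, e5, e6]; ring
  · rw [F_of_lt (by omega), F_of_lt (by omega), e2, e2, e3, e3, e5, e5]
    have z1 : strand t 1 h (2 * n + 1 - i) (n - i - L) = 0 := strand_low (by omega)
    have z2 : strand t 1 h (2 * n + 1 - i) (n - i - (d + 1 - K - 1)) = 0 :=
      strand_low (by omega)
    rw [z1, z2, e7 L (by omega)]
    unfold stp; split_ifs <;> omega

lemma RelB.sameMax_other (hT : Tab n ℓ h r t) (hS : Tab n ℓ (h + 1) r s)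
    (hB : RelB n ℓ h r t s k K d) (hh : 0 ≤ h) (hl : h + 1 ≤ ℓ) (hin : i ≤ n)
    (h1 : i ≠ k - 1) (h2 : i ≠ k) (h3 : i ≠ K - 1) (h4 : i ≠ K - 2) :
    SameMax n (F n ℓ h r i t) (F n ℓ (h + 1) r i s) := by
  have hpic := hB.pic hT hS hh hl
  obtain ⟨g2, g3, g4, g5, g6, g7, g8, run, same⟩ := hB
  have c1 := hT.colOne (by omega)
  have c1s := hS.colOne (by omega)
  have key1 : ∀ ρ θ, ρ ≠ 2 * n + 3 - K → (ρ ≤ K - 2 ∨ k < ρ) →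
      cnt s 1 (h + 1) ρ θ = cnt t 1 h ρ θ := fun ρ θ h1 h2 => by
    rw [cnt_top _ (by omega) (by omega)]
    refine cnt_congr _ fun a h3 h4 => ?_
    by_cases h3 : a < K - d
    · have := hpic.first a (by omega) h3; omega
    by_cases h4 : a ≤ k - d
    · have := run a (by omega) h4; omega
    have := hpic.mid a (by omega) (by omega); omega
  have key2 : ∀ ρ θ, ρ ≠ 2 * n + 2 - k →
      cnt s (h + 1 + 1) ℓ ρ θ = cnt t (h + 1) ℓ ρ θ := fun ρ θ h1 => by
    rw [cnt_bot (t := t) _ (by omega) (by omega)]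
    refine cnt_congr _ fun a h3 h4 => ?_
    have := hpic.col2 a (by omega) (by omega); omega
  refine SameMax.of_eq fun L => ?_
  by_cases hlt : i < n
  · have e1 : strand t 1 h i (-L) = strand s 1 (h + 1) i (-L) := by
      by_cases hik : K ≤ i ∧ i < k
      · have r1 := run (i - d) (by omega) (by omega)
        have r2 := run (i - d + 1) (by omega) (by omega)
        have r3 := run (i - d + 1 + 1) (by omega) (by omega)
        rw [strand_both c1 (by omega) (by omega) _ (p := i - d) (by omega) (by omega)
            (by omega) (by omega),
          strand_both c1s (by omega) (by omega) _ (p := i - d + 1) (by omega) (by omega)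
            (by omega) (by omega)]
      · unfold strand
        rw [key1 _ _ (by omega) (by omega), key1 _ _ (by omega) (by omega)]
    rw [F_of_lt hlt, F_of_lt hlt, e1]
    unfold strand
    rw [key1 (2 * n + 1 - i) _ (by omega) (by omega), key1 (2 * n + 1 - i + 1) _ (by omega)
      (by omega), key2 _ _ (by omega), key2 _ _ (by omega), key2 _ _ (by omega),
      key2 _ _ (by omega)]
  · unfold F colF strand
    rw [key1 _ _ (by omega) (by omega), key1 _ _ (by omega) (by omega),
      key1 _ _ (by omega) (by omega), key1 _ _ (by omega) (by omega),
      key1 _ _ (by omega) (by omega), key1 _ _ (by omega) (by omega), key2 _ _ (by omega),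
      key2 _ _ (by omega), key2 _ _ (by omega), key2 _ _ (by omega), key2 _ _ (by omega),
      key2 _ _ (by omega)]

/-- The contribution of the second column when its first entry is `k̄`. -/
lemma RelB.strand_head (hT : Tab n ℓ h r t) (hS : Tab n ℓ (h + 1) r s)
    (hB : RelB n ℓ h r t s k K d) (hh : 0 ≤ h) (hl : h + 1 ≤ ℓ) (hi : i = k - 1) :
    ∃ m : ℤ, (m = 0 ∨ m = 1) ∧
      (∀ L, strand t (h + 1) ℓ (2 * n + 1 - i) (n - i - (L + r)) =
        (1 - m) * stp (n - k - h - r) L) ∧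
      (∀ L, strand s (h + 1 + 1) ℓ (2 * n + 1 - i) (n - i - (L + r)) =
        - m * stp (n - k - h - r) L) := by
  have hpic := hB.pic hT hS hh hl
  obtain ⟨g2, g3, g4, g5, g6, g7, g8, run, same⟩ := hB
  have c2 := hT.colTwo hh
  have c3 := hS.colTwo (by omega)
  by_cases hb : h + 1 + 1 ≤ ℓ ∧ t (h + 1 + 1) = 2 * n + 1 - i + 1
  · have := hpic.col2 (h + 1 + 1) (by omega) hb.1
    refine ⟨1, Or.inr rfl, fun L => ?_, fun L => ?_⟩
    · rw [strand_both c2 (by omega) (by omega) _ (p := h + 1) (by omega) (by omega) (by omega) hb.2]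
      ring
    · rw [strand_minus c3 (by omega) (by omega) _ (p := h + 1 + 1) (by omega) (by omega)
        (by omega) (by omega)]
      unfold stp; split_ifs <;> omega
  · refine ⟨0, Or.inl rfl, fun L => ?_, fun L => ?_⟩
    · rw [strand_plus c2 (by omega) (by omega) _ (p := h + 1) (by omega) (by omega) (by omega)
        fun h1 h2 => hb ⟨h1, h2⟩]
      unfold stp; split_ifs <;> omega
    · rw [strand_zero _ fun a h1 h2 => ?_]
      · ring
      have := hpic.col2 a (by omega) h2
      refine ⟨by omega, fun h5 => hb ?_⟩
      have := c2.succ_eq (a := h + 1) (b := a) (by omega) (by omega) (by omega) h2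
        (by omega) (by omega) (by omega)
      subst this; exact ⟨h2, by omega⟩

/-- The operator raises the last letter `k - 1` of the run of `s`, and the bar of `k` at `h + 1` in
`t`. The run loses its last letter. -/
lemma RelB.compare_bottom (hR : Rel n ℓ h r t s) (hB : RelB n ℓ h r t s k K d) (hh : 0 ≤ h)
    (hl : h + 1 ≤ ℓ) (hln : ℓ ≤ n - r) (hi : i = k - 1) (hkK : K < k) :
    Compare n ℓ h r i t s := by
  obtain ⟨hT, hS, -⟩ := id hR
  have hpic := hB.pic hT hS hh hl
  obtain ⟨m, hm, e4, e5⟩ := hB.strand_head hT hS hh hl hi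
  obtain ⟨g2, g3, g4, g5, g6, g7, g8, run, same⟩ := id hB
  have c1 := hT.colOne (by omega)
  have c1s := hS.colOne (by omega)
  have r1 := run (k - d) (by omega) (by omega)
  have r2 := run (k - d - 1) (by omega) (by omega)
  have e1 : ∀ L, strand t 1 h i (-L) = 0 := fun L =>
    strand_both c1 (by omega) (by omega) _ (p := k - d - 1) (by omega) (by omega)
      (by omega) (by rw [sub_add_cancel]; omega)
  have e2 : ∀ L, strand s 1 (h + 1) i (-L) = stp (d - k) L := fun L => by
    rw [strand_plus c1s (by omega) (by omega) _ (p := k - d) (by omega) (by omega) (by omega)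
      fun h1 => ?_]
    · unfold stp; split_ifs <;> omega
    · by_cases h2 : k - d + 1 = h + 1
      · rw [h2]; omega
      · have := hpic.mid (k - d + 1) (by omega) (by omega); omega
  have e3 : ∀ L, strand s 1 (h + 1) (2 * n + 1 - i) (n - i - L) =
      strand t 1 h (2 * n + 1 - i) (n - i - L) := fun L => by
    rw [strand_top _ (by omega) (by omega) (by omega)]
    refine strand_congr _ fun a h1 h2 => ?_
    by_cases h3 : a < K - d
    · have := hpic.first a (by omega) h3; omega
    by_cases h4 : a ≤ k - d
    · have := run a (by omega) h4; omega
    have := hpic.mid a (by omega) h2; omega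
  have e6 : ∀ L, strand t (h + 1) ℓ i (-(L + r)) = 0 := fun L => strand_zero _ fun a h1 h2 => by
    by_cases h3 : a = h + 1
    · subst h3; omega
    · have := hpic.col2 a (by omega) h2; omega
  have e7 : ∀ L, strand s (h + 1 + 1) ℓ i (-(L + r)) = 0 := fun L => strand_zero _
    fun a h1 h2 => by have := hpic.col2 a (by omega) h2; omega
  have hz : FarStep (n - k - h - r) (d - k) fun L => strand t 1 h (2 * n + 1 - i) (n - i - L) := by
    rcases strand_cases c1 (ρ := 2 * n + 1 - i) (by omega) (by omega) with ⟨h1, -⟩ |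
      ⟨p, h1, h2, h3, -, h4⟩ | ⟨p, h1, h2, h3, -, h4⟩
    · exact Or.inl fun L => h1 _
    · refine Or.inr (Or.inl ⟨n - i - p, by omega, fun L => ?_⟩)
      simp only [h4]; unfold stp; split_ifs <;> omega
    · refine Or.inr (Or.inr ⟨n - i + 1 - p, by omega, fun L => ?_⟩)
      simp only [h4]; unfold stp; split_ifs <;> omega
  have hFt : ∀ L, F n ℓ h r i t L = (1 - m) * stp (n - k - h - r) L +
      strand t 1 h (2 * n + 1 - i) (n - i - L) :=
    fun L => by rw [F_of_lt (by omega), e1, e4, e6]; ring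
  have hFs : ∀ L, F n ℓ (h + 1) r i s L = stp (d - k) L - m * stp (n - k - h - r) L +
      strand t 1 h (2 * n + 1 - i) (n - i - L) :=
    fun L => by rw [F_of_lt (by omega), e2, e3, e5, e7]; ring
  refine ⟨fun L hL => ?_, (plusMove_far (q := 0) hFt hFs hm (by omega) hz).1, ?_⟩
  · rw [hFt, hFs]; unfold stp; rw [if_pos (by omega), if_pos (by omega)]; ring
  rintro s' ⟨-, hS', c, hc, rfl⟩
  have hlet := hc.letter
  have hone := hc.one_le
  have hle := hc.le
  have hcrun : c ≠ h + 1 ∧ (c < K - d ∨ k - d < c ∨ c = k - d) := by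
    refine ⟨by rintro rfl; omega, ?_⟩
    by_contra hcr
    have h3 := run c (by omega) (by omega)
    omega
  rcases (plusMove_far hFt hFs hm (by omega) hz).2 hc.isFirstMax hc.pos with
    ⟨h1, -, h3, h4⟩ | ⟨h1, h2, h3⟩
  · have hcb : c = k - d := by
      rcases hcrun.2 with h5 | h5 | h5
      · have := hpic.first c hone h5; omega
      · by_cases h6 : c ≤ h
        · have := hpic.mid c h5 h6
          unfold lev at h1; rw [if_neg (by omega), if_pos (by omega)] at h1; omega
        · have := hpic.col2 c (by omega) hle; omega
      · exact h5
    subst hcb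
    refine exists_fstep (c := h + 1) hR (rel_of_relB (k := k - 1) (K := K) (d := d) hS' hh hl hln
      ⟨by omega, g3, g4, g5, by omega, by rw [bump_self]; omega,
        by rw [bump_of_ne _ (by omega)]; exact g8, fun a h5 h6 => ?_, fun a h5 h6 => ?_⟩ ?_)
      (by omega) hl (by omega) h3
      (by unfold lev; rw [if_neg (by omega), if_neg (by omega)]; omega) hc.isFirstMax h4 hc.pos
    · rw [bump_of_ne _ (by omega), bump_of_ne _ (by omega)]; exact run a h5 (by omega)
    · rw [bump_of_ne t h5]
      by_cases h7 : a = k - d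
      · subst h7; rw [bump_self]; omega
      · rw [bump_of_ne _ h7]; exact same a h5 (by omega)
    · intro _
      rw [show k - 1 - d + 1 = k - d by ring, bump_self]; omega
  · refine hB.same_step hR hh hl hln hS' hc hcrun.1 ?_ rfl h2 h3
    rcases hcrun.2 with h5 | h5 | h5
    · exact Or.inl h5
    · exact Or.inr h5
    · subst h5
      unfold lev at h1; rw [if_pos (by omega), if_pos (by omega)] at h1; omega

/-- As for an unbarred border letter, a run of length one disappears and both sides become the same
sequence. -/
lemma RelB.compare_single (hR : Rel n ℓ h r t s) (hB : RelB n ℓ h r t s k K d) (hh : 0 ≤ h)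
    (hl : h + 1 ≤ ℓ) (hln : ℓ ≤ n - r) (hi : i = k - 1) (hkK : k = K) :
    Compare n ℓ h r i t s := by
  subst hkK
  obtain ⟨hT, hS, -⟩ := id hR
  have hpic := hB.pic hT hS hh hl
  obtain ⟨m, hm, e4, e5⟩ := hB.strand_head hT hS hh hl hi
  obtain ⟨g2, g3, g4, g5, g6, g7, g8, run, same⟩ := id hB
  have c1 := hT.colOne (by omega)
  have c1s := hS.colOne (by omega)
  have r1 := run (k - d) (by omega) (by omega)
  have e1 : ∀ L, strand t 1 h i (-L) = -stp (d - k + 1) L := fun L => by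
    rw [strand_minus c1 (by omega) (by omega) _ (p := k - d) (by omega) (by omega) (by omega)
      fun h1 h2 => ?_]
    · unfold stp; split_ifs <;> omega
    · have := hpic.first _ h1 (by omega); omega
  have e2 : ∀ L, strand s 1 (h + 1) i (-L) = stp (d - k) L := fun L => by
    rw [strand_plus c1s (by omega) (by omega) _ (p := k - d) (by omega) (by omega) (by omega)
      fun h1 => ?_]
    · unfold stp; split_ifs <;> omega
    · by_cases h2 : k - d + 1 = h + 1
      · rw [h2]; omega
      · have := hpic.mid (k - d + 1) (by omega) (by omega); omega
  obtain ⟨w, hw, e3, e3'⟩ : ∃ w : ℤ, (w = 0 ∨ w = 1) ∧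
      (∀ L, strand t 1 h (2 * n + 1 - i) (n - i - L) = (1 - w) * stp (n - k + 1 - h) L) ∧
      (∀ L, strand s 1 (h + 1) (2 * n + 1 - i) (n - i - L) = - w * stp (n - k + 1 - h) L) := by
    by_cases hb : t h = 2 * n + 1 - i
    · have hkh : k - d < h := by
        by_contra h1
        have := run h (by omega) (by omega); omega
      have := hpic.mid h hkh le_rfl
      refine ⟨0, Or.inl rfl, fun L => ?_, fun L => ?_⟩
      · rw [strand_plus c1 (by omega) (by omega) _ (p := h) (by omega) (by omega) (by omega)
          (by omega)]
        unfold stp; split_ifs <;> omega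
      · rw [strand_both c1s (by omega) (by omega) _ (p := h) (by omega) (by omega) (by omega)
          (by omega)]
        ring
    · refine ⟨1, Or.inr rfl, fun L => ?_, fun L => ?_⟩
      · rw [strand_zero (t := t) _ fun a h1 h2 => by
          by_cases h3 : a < k - d
          · have := hpic.first a (by omega) h3; omega
          by_cases h4 : a ≤ k - d
          · have := run a (by omega) h4; omega
          have := hpic.mid a (by omega) h2
          refine ⟨fun h3 => hb ?_, by omega⟩
          have h4 := c1s.succ_eq (a := a) (b := h + 1) h1 (by omega) (by omega) le_rfl
            (by omega) (by omega) (by omega)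
          have h5 : a = h := by omega
          subst h5; exact h3]
        ring
      · rw [strand_minus c1s (by omega) (by omega) _ (p := h + 1) (by omega) (by omega) (by omega)
          fun h1 h2 => hb ?_]
        · unfold stp; split_ifs <;> omega
        · rw [add_sub_cancel_right] at h1 h2
          by_cases h4 : h ≤ k - d
          · have := run h (by omega) h4; omega
          have := hpic.mid h (by omega) le_rfl
          omega
  have e6 : ∀ L, strand t (h + 1) ℓ i (-(L + r)) = 0 := fun L => strand_zero _ fun a h1 h2 => by
    by_cases h3 : a = h + 1
    · subst h3; omega
    · have := hpic.col2 a (by omega) h2; omega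
  have e7 : ∀ L, strand s (h + 1 + 1) ℓ i (-(L + r)) = 0 := fun L => strand_zero _
    fun a h1 h2 => by have := hpic.col2 a (by omega) h2; omega
  have hFt : ∀ L, F n ℓ h r i t L =
      (1 - w) * stp (n - k + 1 - h) L + (1 - m) * stp (n - k - h - r) L - stp (d - k + 1) L :=
    fun L => by rw [F_of_lt (by omega), e1, e3, e4, e6]; ring
  have hFs : ∀ L, F n ℓ (h + 1) r i s L =
      stp (d - k) L - w * stp (n - k + 1 - h) L - m * stp (n - k - h - r) L :=
    fun L => by rw [F_of_lt (by omega), e2, e3', e5, e7]; ring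
  refine ⟨fun L hL => ?_, (crossMove (q := 0) hFt hFs hm hw (by omega) (by omega)).1, ?_⟩
  · rw [hFt, hFs]; unfold stp
    rw [if_pos (by omega), if_pos (by omega), if_pos (by omega), if_pos (by omega)]; ring
  rintro s' ⟨-, hS', c, hc, rfl⟩
  have hlet := hc.letter
  have hone := hc.one_le
  have hle := hc.le
  obtain ⟨h1, -, h3, h4⟩ := (crossMove hFt hFs hm hw (by omega) (by omega)).2 hc.isFirstMax hc.pos
  have hcb : c = k - d := by
    by_cases h5 : c < k - d
    · have := hpic.first c hone h5; omega
    by_cases h6 : c = k - d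
    · exact h6
    by_cases h7 : c = h + 1
    · subst h7; omega
    by_cases h8 : c ≤ h
    · have := hpic.mid c (by omega) h8
      unfold lev at h1; rw [if_neg (by omega), if_pos (by omega)] at h1; omega
    · have := hpic.col2 c (by omega) hle; omega
  subst hcb
  have hbump : bump t (h + 1) = bump s (k - d) := by
    ext a
    by_cases h5 : a = h + 1
    · subst h5; rw [bump_self, bump_of_ne _ (by omega)]; omega
    · by_cases h6 : a = k - d
      · subst h6; rw [bump_self, bump_of_ne _ h5]; omega
      · rw [bump_of_ne _ h5, bump_of_ne _ h6]; exact (same a h5 (by omega)).symm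
  have hrel : Rel n ℓ h r (bump s (k - d)) (bump s (k - d)) := by
    refine rel_of_relC hS' hh hl ?_ ?_
    · rw [bump_of_ne s (show h + 1 ≠ k - d by omega), g8]
      intro b _ _ h7; omega
    · rw [bump_of_ne s (show h + 1 ≠ k - d by omega), g8]
      intro a h5 h6 _ h7
      by_cases h8 : a = k - d
      · subst h8; rw [bump_self] at h7; omega
      rw [bump_of_ne _ h8] at h7
      by_cases h9 : a < k - d
      · have := hpic.first a h5 h9; omega
      · have := hpic.mid a (by omega) h6; omega
  exact exists_fstep (c := h + 1) hR (by rw [hbump]; exact hrel)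
    (by omega) hl (by omega) h3
    (by unfold lev; rw [if_neg (by omega), if_neg (by omega)]; omega) hc.isFirstMax h4 hc.pos

/-- Raising the bar of `K - 1` at `h + 1` in `s` corresponds to raising the letter `K - 2` in front
of the run of `t`, which prolongs the run by `K - 1`. -/
lemma RelB.compare_top (hR : Rel n ℓ h r t s) (hB : RelB n ℓ h r t s k K d) (hh : 0 ≤ h)
    (hl : h + 1 ≤ ℓ) (hln : ℓ ≤ n - r) (hi : i = K - 2) :
    Compare n ℓ h r i t s := by
  obtain ⟨hT, hS, -⟩ := id hR
  have hpic := hB.pic hT hS hh hl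
  obtain ⟨g2, g3, g4, g5, g6, g7, g8, run, same⟩ := id hB
  have c1 := hT.colOne (by omega)
  have c1s := hS.colOne (by omega)
  have c3 := hS.colTwo (by omega)
  have r1 := run (K - d) (by omega) (by omega)
  have hmid : ∀ a, 1 ≤ a → a ≤ h + 1 → s a = K - 2 → a = K - d - 1 := by
    intro a h1 h2 h3
    have := c1s.succ_eq h1 h2 (b := K - d) (by omega) (by omega) (by omega) (by omega) (by omega)
    omega
  have e1 : ∀ L, strand t 1 h (2 * n + 1 - i) (n - i - L) = 0 := fun L => strand_zero _
    fun a h1 h2 => by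
      by_cases h3 : a < K - d
      · have := hpic.first a (by omega) h3; omega
      by_cases h4 : a ≤ k - d
      · have := run a (by omega) h4; omega
      have := hpic.mid a (by omega) h2; omega
  have e2 : ∀ L, strand s 1 (h + 1) (2 * n + 1 - i) (n - i - L) = stp (n - K + 1 - h) L :=
    fun L => by
    rw [strand_plus c1s (by omega) (by omega) _ (p := h + 1) (by omega) (by omega) (by omega)
      (by omega)]
    unfold stp; split_ifs <;> omega
  have e3 : ∀ L, strand t (h + 1) ℓ i (-(L + r)) = 0 := fun L => strand_zero _ fun a h1 h2 => by
    by_cases h3 : a = h + 1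
    · subst h3; omega
    · have := hpic.col2 a (by omega) h2; omega
  have e4 : ∀ L, strand s (h + 1 + 1) ℓ i (-(L + r)) = 0 := fun L => strand_zero _
    fun a h1 h2 => by have := hpic.col2 a (by omega) h2; omega
  have e5 : ∀ L, strand t (h + 1) ℓ (2 * n + 1 - i) (n - i - (L + r)) =
      strand s (h + 1 + 1) ℓ (2 * n + 1 - i) (n - i - (L + r)) := fun L => by
    rw [strand_bot _ (by omega) (by omega) (by omega)]
    refine strand_congr _ fun a h1 h2 => ?_
    have := hpic.col2 a (by omega) h2; omega
  obtain ⟨m, hm, e6, e7, hm0⟩ : ∃ m : ℤ, (m = 0 ∨ m = 1) ∧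
      (∀ L, strand t 1 h i (-L) = (1 - m) * stp (d + 1 - K) L) ∧
      (∀ L, strand s 1 (h + 1) i (-L) = - m * stp (d + 1 - K) L) ∧
      (m = 0 → 1 ≤ K - d - 1 ∧ t (K - d - 1) = K - 2) := by
    by_cases hb : 1 ≤ K - d - 1 ∧ t (K - d - 1) = K - 2
    · refine ⟨0, Or.inl rfl, fun L => ?_, fun L => ?_, fun _ => hb⟩
      · rw [strand_plus c1 (by omega) (by omega) _ (p := K - d - 1) (by omega) (by omega)
          (by omega) fun _ => by rw [sub_add_cancel]; omega]
        unfold stp; split_ifs <;> omega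
      · have := hpic.first _ hb.1 (show K - d - 1 < K - d by omega)
        rw [strand_both c1s (by omega) (by omega) _ (p := K - d - 1) (by omega) (by omega)
          (by omega) (by rw [sub_add_cancel]; omega)]
        ring
    · have hb' : ∀ a, 1 ≤ a → a ≤ h + 1 → s a ≠ K - 2 := fun a h1 h2 h3 => hb (by
        have := hmid a h1 h2 h3
        subst this
        have := hpic.first (K - d - 1) (by omega) (by omega)
        omega)
      refine ⟨1, Or.inr rfl, fun L => ?_, fun L => ?_, fun h => by omega⟩
      · rw [strand_zero (t := t) _ fun a h1 h2 => ?_]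
        · ring
        by_cases h3 : a < K - d
        · have := hb' a (by omega) (by omega)
          have := hpic.first a (by omega) h3; omega
        by_cases h4 : a ≤ k - d
        · have := run a (by omega) h4; omega
        have := hpic.mid a (by omega) h2; omega
      · rw [strand_minus c1s (by omega) (by omega) _ (p := K - d) (by omega) (by omega) (by omega)
          fun h1 h2 => hb' _ h1 (by omega) (by omega)]
        unfold stp; split_ifs <;> omega
  have hz : FarStep (d + 1 - K) (n - K + 1 - h)
      fun L => strand s (h + 1 + 1) ℓ (2 * n + 1 - i) (n - i - (L + r)) := by
    rcases strand_cases c3 (ρ := 2 * n + 1 - i) (by omega) (by omega) with ⟨h1, -⟩ |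
      ⟨p, h1, h2, h3, -, h4⟩ | ⟨p, h1, h2, h3, -, h4⟩
    · exact Or.inl fun L => h1 _
    · refine Or.inr (Or.inl ⟨n - i - p - r, by omega, fun L => ?_⟩)
      simp only [h4]; unfold stp; split_ifs <;> omega
    · refine Or.inr (Or.inr ⟨n - i + 1 - p - r, by omega, fun L => ?_⟩)
      simp only [h4]; unfold stp; split_ifs <;> omega
  have hFt : ∀ L, F n ℓ h r i t L =
      (1 - m) * stp (d + 1 - K) L + strand s (h + 1 + 1) ℓ (2 * n + 1 - i) (n - i - (L + r)) :=
    fun L => by rw [F_of_lt (by omega), e1, e3, e5, e6]; ring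
  have hFs : ∀ L, F n ℓ (h + 1) r i s L =
      stp (n - K + 1 - h) L - m * stp (d + 1 - K) L +
        strand s (h + 1 + 1) ℓ (2 * n + 1 - i) (n - i - (L + r)) :=
    fun L => by rw [F_of_lt (by omega), e2, e4, e7]; ring
  refine ⟨fun L hL => ?_, (plusMove_far (q := 0) hFt hFs hm (by omega) hz).1, ?_⟩
  · rw [hFt, hFs]; unfold stp; rw [if_pos (by omega), if_pos (by omega)]; ring
  rintro s' ⟨-, hS', c, hc, rfl⟩
  have hlet := hc.letter
  have hone := hc.one_le
  have hle := hc.le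
  have hcc : c = h + 1 ∨ (c ≠ h + 1 ∧ (c < K - d ∨ k - d < c)) := by
    by_cases h7 : c = h + 1
    · exact Or.inl h7
    by_cases h8 : K - d ≤ c ∧ c ≤ k - d
    · have := run c h8.1 h8.2; omega
    · exact Or.inr ⟨h7, by omega⟩
  rcases (plusMove_far hFt hFs hm (by omega) hz).2 hc.isFirstMax hc.pos with
    ⟨h1, h2, h3, h4⟩ | ⟨h1, h2, h3⟩
  · obtain ⟨hq1, hq2⟩ := hm0 h2
    have hcb : c = h + 1 := by
      rcases hcc with h5 | ⟨h5, h6⟩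
      · exact h5
      · by_cases h8 : c ≤ h
        · rcases hlet with h7 | h7
          · have := hmid c hone (by omega) (by omega)
            unfold lev at h1; rw [if_pos (by omega), if_pos (by omega)] at h1; omega
          · rcases h6 with h6 | h6
            · have := hpic.first c hone h6; omega
            · have := hpic.mid c h6 h8; omega
        · have := hpic.col2 c (by omega) hle
          unfold lev at h1; rw [if_neg (by omega), if_neg (by omega)] at h1; omega
    subst hcb
    refine exists_fstep (c := K - d - 1) hR (rel_of_relB (k := k) (K := K - 1) (d := d) hS' hh
      hl hln ⟨by omega, g3, g4, by omega, g6, by rw [bump_of_ne _ (by omega)]; exact g7,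
        by rw [bump_self, g8]; ring, fun a h5 h6 => ?_, fun a h5 h6 => ?_⟩ ?_)
      (by omega) (by omega) (by omega) h3
      (by unfold lev; rw [if_pos (by omega), if_pos (by omega)]; omega) hc.isFirstMax h4 hc.pos
    · rw [bump_of_ne s (by omega)]
      by_cases h7 : a = K - d - 1
      · subst h7
        have := hpic.first _ hq1 (show K - d - 1 < K - d by omega)
        rw [bump_self]; omega
      · rw [bump_of_ne _ h7]; exact run a (by omega) h6
    · rw [bump_of_ne s h5, bump_of_ne _ (by omega)]
      exact same a h5 (by omega)
    · intro h5
      rw [bump_of_ne _ (by omega)]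
      have := hpic.mid _ (by omega) h5; omega
  · rcases hcc with rfl | ⟨h5, h6⟩
    · unfold lev at h1; rw [if_neg (by omega), if_pos (by omega)] at h1; omega
    · exact hB.same_step hR hh hl hln hS' hc (by omega) h6 rfl h2 h3

lemma RelB.compare (hR : Rel n ℓ h r t s) (hB : RelB n ℓ h r t s k K d) (hh : 0 ≤ h)
    (hl : h + 1 ≤ ℓ) (hln : ℓ ≤ n - r) (hin : i ≤ n) : Compare n ℓ h r i t s := by
  by_cases h1 : i = K - 2
  · exact hB.compare_top hR hh hl hln h1
  by_cases h2 : i = k - 1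
  · rcases eq_or_lt_of_le hB.le with h3 | h3
    · exact hB.compare_single hR hh hl hln h2 h3.symm
    · exact hB.compare_bottom hR hh hl hln h2 h3
  refine hB.compare_of_sameMax hR hh hl hln h2 h1 hin ?_
  by_cases h3 : i = k
  · exact hB.sameMax_top hR.1 hR.2.1 hh hl h3
  by_cases h4 : i = K - 1
  · exact hB.sameMax_pred hR.1 hR.2.1 hh hl hln h4 (by have := hB.le; omega)
  · exact hB.sameMax_other hR.1 hR.2.1 hh hl hin h2 h3 h4 h1

end

end TypeB

namespace TypeB

/-! ### Pairs without an exchange -/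

section

variable {n ℓ h r i lo hi : ℤ} {t : ℤ → ℤ}

lemma cnt_succ_top (ρ θ : ℤ) (hlo : lo ≤ hi + 1) : cnt t lo (hi + 1) ρ θ =
    cnt t lo hi ρ θ + if t (hi + 1) = ρ ∧ θ ≤ hi + 1 then 1 else 0 := by
  unfold cnt
  have : Finset.Icc lo (hi + 1) = insert (hi + 1) (Finset.Icc lo hi) := by
    ext a; simp only [Finset.mem_insert, Finset.mem_Icc]; omega
  rw [this, Finset.sum_insert (by simp), add_comm]

lemma cnt_succ_bot (ρ θ : ℤ) (hlo : lo ≤ hi) : cnt t lo hi ρ θ =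
    cnt t (lo + 1) hi ρ θ + if t lo = ρ ∧ θ ≤ lo then 1 else 0 := by
  unfold cnt
  have : Finset.Icc lo hi = insert lo (Finset.Icc (lo + 1) hi) := by
    ext a; simp only [Finset.mem_insert, Finset.mem_Icc]; omega
  rw [this, Finset.sum_insert (by simp), add_comm]

/-- The contribution of a single entry `y` at position `p` to the partial sums. -/
def entryF (n i y p x : ℤ) : ℤ :=
  ((if y = i ∧ -x ≤ p then 1 else 0) - if y = i + 1 ∧ -x + 1 ≤ p then 1 else 0) +
    ((if y = 2 * n + 1 - i ∧ n - i - x ≤ p then 1 else 0) -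
      if y = 2 * n + 1 - i + 1 ∧ n - i - x + 1 ≤ p then 1 else 0) +
    if i = n then (if y = n ∧ -x ≤ p then 1 else 0) - if y = n + 2 ∧ 1 - x ≤ p then 1 else 0 else 0

lemma colF_succ_top (x : ℤ) (hlo : lo ≤ hi + 1) :
    colF n i t lo (hi + 1) x = colF n i t lo hi x + entryF n i (t (hi + 1)) (hi + 1) x := by
  unfold colF strand entryF
  simp only [cnt_succ_top _ _ hlo]
  by_cases h : i = n
  · simp only [if_pos h]; ring
  · simp only [if_neg h]; ring

lemma colF_succ_bot (x : ℤ) (hlo : lo ≤ hi) :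
    colF n i t lo hi x = colF n i t (lo + 1) hi x + entryF n i (t lo) lo x := by
  unfold colF strand entryF
  simp only [cnt_succ_bot (lo := lo) _ _ hlo]
  by_cases h : i = n
  · simp only [if_pos h]; ring
  · simp only [if_neg h]; ring

/-- Moving the border across `h + 1` displaces the contribution of this single entry by `r` and
changes nothing else. -/
lemma F_succ (hh : 0 ≤ h) (hl : h + 1 ≤ ℓ) (L : ℤ) : F n ℓ (h + 1) r i t L = F n ℓ h r i t L +
    (entryF n i (t (h + 1)) (h + 1) L - entryF n i (t (h + 1)) (h + 1) (L + r)) := by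
  unfold F
  rw [colF_succ_top L (by omega), colF_succ_bot (lo := h + 1) (L + r) hl]
  ring

lemma entryF_of_lt (hi : i < n) (y p x : ℤ) : entryF n i y p x =
    (if y = i then stp (-p) x else 0) - (if y = i + 1 then stp (1 - p) x else 0) +
    ((if y = 2 * n + 1 - i then stp (n - i - p) x else 0) -
      if y = 2 * n + 2 - i then stp (n - i + 1 - p) x else 0) := by
  unfold entryF
  rw [if_neg (show ¬ i = n by omega), show 2 * n + 1 - i + 1 = 2 * n + 2 - i by ring]
  have e1 : -x ≤ p ↔ -p ≤ x := by omega
  have e2 : -x + 1 ≤ p ↔ 1 - p ≤ x := by omega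
  have e3 : n - i - x ≤ p ↔ n - i - p ≤ x := by omega
  have e4 : n - i - x + 1 ≤ p ↔ n - i + 1 - p ≤ x := by omega
  simp only [ite_and, e1, e2, e3, e4, stp, add_zero]

/-- No entry is paired with the entry at `h + 1`. -/
structure NoPair (n ℓ h r : ℤ) (t : ℤ → ℤ) : Prop where
  noA : ∀ b, h + 2 ≤ b → b ≤ ℓ → t (h + 1) ≤ n → t b = 2 * n + 2 - t (h + 1) →
    ¬ (-h - 1 ≤ n - t (h + 1) - b ∧ n - t (h + 1) - b ≤ r - h - 2)
  noB : ∀ a, 1 ≤ a → a ≤ h → n + 2 ≤ t (h + 1) → t a = 2 * n + 2 - t (h + 1) →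
    ¬ (n - r - h ≤ t a - a ∧ t a - a ≤ n - h - 1)

/-- The distances excluded inside a column and between columns enlarge the range of `RelC` by one
end point. The larger range is what excludes steps on the boundary of the windows below. -/
lemma RelC.noPair (hC : RelC n ℓ h r t) (hT : Tab n ℓ h r t) (hl : h + 1 ≤ ℓ) :
    NoPair n ℓ h r t where
  noA b h1 h2 h3 h4 := by
    have := hC.noA b h1 h2 h3 h4
    have := hT.col2 (h + 1) b (by omega) (by omega) h2 h3 (by omega)
    omega
  noB a h1 h2 h3 h4 := by
    have := hC.noB a h1 h2 h3 h4
    have := hT.col12 a (h + 1) h1 h2 le_rfl hl (by omega) (by omega)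
    omega

lemma NoPair.bump {c : ℤ} (hC : NoPair n ℓ h r t) (hc : c ≠ h + 1)
    (hlet : t c = i ∨ t c = 2 * n + 1 - i) (h1 : t (h + 1) ≠ i) (h2 : t (h + 1) ≠ 2 * n + 1 - i) :
    NoPair n ℓ h r (bump t c) where
  noA b h3 h4 h5 h6 := by
    rw [bump_of_ne _ (Ne.symm hc)] at h5 h6 ⊢
    have := hC.noA b h3 h4 h5
    have := bump_cases t c b
    by_cases hb : b = c
    · subst hb; omega
    · omega
  noB a h3 h4 h5 h6 := by
    rw [bump_of_ne _ (Ne.symm hc)] at h5 h6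
    have := hC.noB a h3 h4 h5
    have := bump_cases t c a
    by_cases hb : a = c
    · subst hb; omega
    · omega

lemma NoPair.rel (hC : NoPair n ℓ h r t) (hS : Tab n ℓ (h + 1) r t) (hh : 0 ≤ h)
    (hl : h + 1 ≤ ℓ) : Rel n ℓ h r t t :=
  rel_of_relC hS hh hl
    (fun b h1 h2 h3 h4 => by have := hC.noA b h1 h2 h3 h4; omega)
    fun a h1 h2 h3 h4 => by have := hC.noB a h1 h2 h3 h4; omega

lemma NoPair.compare_of_sameMax (hC : NoPair n ℓ h r t) (hR : Rel n ℓ h r t t) (hh : 0 ≤ h)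
    (hl : h + 1 ≤ ℓ) (h1 : t (h + 1) ≠ i) (h2 : t (h + 1) ≠ 2 * n + 1 - i)
    (hM : SameMax n (F n ℓ h r i t) (F n ℓ (h + 1) r i t)) : Compare n ℓ h r i t t := by
  refine ⟨hM.1, hM.2.1, ?_⟩
  rintro s' ⟨-, hS', c, hc, rfl⟩
  obtain ⟨hq, hval⟩ := hM.2.2 _ hc.isFirstMax
  have hlet := hc.letter
  have hch : c ≠ h + 1 := by rintro rfl; omega
  exact exists_fstep (c := c) hR ((hC.bump hch hlet h1 h2).rel hS' hh hl)
    hc.one_le hc.le hlet hq (lev_succ hch) hc.isFirstMax hval hc.pos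

/-- For `r = 0` the border has no influence on the partial sums, and the ranges in which a partner
would count are empty. -/
lemma RelC.compare_zero (hR : Rel n ℓ h 0 t t) (hh : 0 ≤ h) (hl : h + 1 ≤ ℓ) :
    Compare n ℓ h 0 i t t := by
  have hF : F n ℓ (h + 1) 0 i t = F n ℓ h 0 i t := funext fun L => by
    rw [F_succ hh hl, add_zero]; ring
  refine ⟨fun L _ => by rw [hF], fun hs => by rwa [hF] at hs, ?_⟩
  rintro s' ⟨-, hS', c, hc, rfl⟩
  have hq := hc.isFirstMax
  refine exists_fstep (c := c) hR (NoPair.rel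
    ⟨fun b h1 h2 h3 h4 => by omega, fun b h1 h2 h3 h4 => by omega⟩ hS' hh hl) hc.one_le hc.le hc.letter
    (hF ▸ hc.isFirstMax) ?_ hc.isFirstMax (by rw [hF]) hc.pos
  unfold lev; split_ifs <;> omega

lemma RelC.colAll (hR : Rel n ℓ h r t t) (hh : 0 ≤ h) (hC : RelC n ℓ h r t) : Col n t 1 ℓ := by
  intro a h1 h2
  by_cases ha : a = h
  · subst ha; exact hR.1.cross_of_relC h1 h2 hC
  · exact hR.1.step a h1 h2 ha

lemma Col.mono {lo' hi' : ℤ} (hC : Col n t lo hi) (h1 : lo ≤ lo') (h2 : hi' ≤ hi) :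
    Col n t lo' hi' := fun a h3 h4 => hC a (by omega) (by omega)

/-- The step down of `i + 1` is at `-h - r` for the border `h` and at `-h` for `h + 1`. A step up
inside this window could only come from the bar of `i + 1` in the second column, which `noA`
excludes. -/
lemma NoPair.compare_low_minus (hC : NoPair n ℓ h r t) (hcol : Col n t 1 ℓ)
    (hR : Rel n ℓ h r t t) (hh : 0 ≤ h) (hl : h + 1 ≤ ℓ) (hr : 0 ≤ r) (hi1 : 1 ≤ i) (hi : i < n) (hy : t (h + 1) = i + 1) :
    Compare n ℓ h r i t t := by
  have c3 := hcol.mono (lo' := h + 1 + 1) (hi' := ℓ) (by omega) le_rfl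
  refine hC.compare_of_sameMax hR hh hl (by omega) (by omega)
    (SameMax.of_window (A := -h - r) (B := -h) (fun L => ?_) (fun L h1 h2 => ?_)
      (by omega) (by omega))
  · rw [F_succ hh hl, entryF_of_lt hi, entryF_of_lt hi, if_neg (by omega), if_pos hy,
      if_neg (by omega), if_neg (by omega), if_neg (by omega), if_pos hy,
      if_neg (by omega), if_neg (by omega)]
    unfold stp; split_ifs <;> omega
  · rw [F_of_lt hi, F_of_lt hi]
    have low : ∀ a, 1 ≤ a → a ≤ h → t a < i + 1 := fun a h3 h4 => by
      have := hcol.cmp h3 (b := h + 1) (by omega) hl; omega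
    have high : ∀ a, h + 2 ≤ a → a ≤ ℓ → i + 1 < t a := fun a h3 h4 => by
      have := hcol.cmp (a := h + 1) (b := a) (by omega) (by omega) h4; omega
    have z1 : ∀ θ, strand t 1 (h + 1) (2 * n + 1 - i) θ = 0 := fun θ =>
      strand_zero _ fun a h3 h4 => by
        by_cases ha : a = h + 1
        · subst ha; omega
        · have := low a h3 (by omega); omega
    have z2 : ∀ θ, strand t (h + 1 + 1) ℓ i θ = 0 := fun θ => strand_zero _ fun a h3 h4 => by
      have := high a (by omega) (by omega); omega
    have z3 : ∀ θ, h + 1 ≤ θ → strand t 1 (h + 1) i θ = 0 := fun θ hθ => by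
      rcases strand_cases (hcol.mono (lo' := 1) (hi' := h + 1) le_rfl hl) (ρ := i) (by omega)
        (by omega) with ⟨h5, -⟩ | ⟨p, h5, h6, h7, -, h8⟩ | ⟨p, h5, h6, h7, -, h8⟩
      · exact h5 _
      · rw [h8]
        have : p ≠ h + 1 := by rintro rfl; omega
        have := stp_spec θ p; omega
      · rw [h8]
        have := stp_spec (θ + 1) p; omega
    rw [z1, z1, z2, z2, z3 _ (by omega), z3 _ (by omega)]
    rcases strand_cases c3 (ρ := 2 * n + 1 - i) (by omega)
      (by omega) with ⟨h5, -⟩ | ⟨p, h5, h6, h7, -, h8⟩ | ⟨p, h5, h6, h7, -, h8⟩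
    · rw [h5, h5]
    · rw [h8, h8]
      have := hC.noA p (by omega) h6 (by omega) (by omega)
      have := stp_spec (n - i - (L + r)) p
      have := stp_spec (n - i - (-h - r - 1 + r)) p
      omega
    · rw [h8, h8]
      have := stp_spec (n - i - (L + r) + 1) p
      have := stp_spec (n - i - (-h - r - 1 + r) + 1) p
      omega

/-- Here the critical step up would come from a letter `i` in the first column, and `noB` excludes
it from the window. -/
lemma NoPair.compare_high_minus (hC : NoPair n ℓ h r t) (hcol : Col n t 1 ℓ)
    (hR : Rel n ℓ h r t t) (hh : 0 ≤ h) (hl : h + 1 ≤ ℓ) (hr : 0 ≤ r) (hi1 : 1 ≤ i) (hi : i < n)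
    (hy : t (h + 1) = 2 * n + 2 - i) : Compare n ℓ h r i t t := by
  have c1 := hcol.mono (lo' := 1) (hi' := h + 1) le_rfl hl
  refine hC.compare_of_sameMax hR hh hl (by omega) (by omega)
    (SameMax.of_window (A := n - i - h - r) (B := n - i - h) (fun L => ?_) (fun L h1 h2 => ?_)
      (by omega) (by omega))
  · rw [F_succ hh hl, entryF_of_lt hi, entryF_of_lt hi, if_neg (by omega), if_neg (by omega),
      if_neg (by omega), if_pos hy, if_neg (by omega), if_neg (by omega),
      if_neg (by omega), if_pos hy]
    unfold stp; split_ifs <;> omega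
  · rw [F_of_lt hi, F_of_lt hi]
    have high : ∀ a, h + 2 ≤ a → a ≤ ℓ → 2 * n + 2 - i < t a := fun a h3 h4 => by
      have := hcol.cmp (a := h + 1) (b := a) (by omega) (by omega) h4; omega
    have z1 : ∀ θ, strand t (h + 1 + 1) ℓ (2 * n + 1 - i) θ = 0 := fun θ =>
      strand_zero _ fun a h3 h4 => by
        have := high a (by omega) (by omega); omega
    have z2 : ∀ θ, strand t (h + 1 + 1) ℓ i θ = 0 := fun θ => strand_zero _ fun a h3 h4 => by
      have := high a (by omega) (by omega); omega
    have z3 : ∀ θ, h + 1 ≤ θ → strand t 1 (h + 1) (2 * n + 1 - i) θ = 0 := fun θ hθ => by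
      rcases strand_cases c1 (ρ := 2 * n + 1 - i) (by omega)
        (by omega) with ⟨h5, -⟩ | ⟨p, h5, h6, h7, -, h8⟩ | ⟨p, h5, h6, h7, -, h8⟩
      · exact h5 _
      · rw [h8]
        have : p ≠ h + 1 := by rintro rfl; omega
        have := stp_spec θ p; omega
      · rw [h8]
        have := stp_spec (θ + 1) p; omega
    rw [z1, z1, z2, z2, z3 _ (by omega), z3 _ (by omega)]
    rcases strand_cases c1 (ρ := i) (by omega)
      (by omega) with ⟨h5, -⟩ | ⟨p, h5, h6, h7, -, h8⟩ | ⟨p, h5, h6, h7, -, h8⟩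
    · rw [h5, h5]
    · rw [h8, h8]
      have : p ≠ h + 1 := by rintro rfl; omega
      have := hC.noB p (by omega) (by omega) (by omega) (by omega)
      have := stp_spec (-L) p
      have := stp_spec (-(n - i - h - r - 1)) p
      omega
    · rw [h8, h8]
      have := stp_spec (-L + 1) p
      have := stp_spec (-(n - i - h - r - 1) + 1) p
      omega

end

end TypeB

/-! ### No exchange, with the border entry subject to the operator. -/

namespace TypeB

section

variable {n ℓ h r i lo hi : ℤ} {t : ℤ → ℤ}

lemma noPair_bump_cross {c : ℤ} (hc : c = h + 1)
    (hA : ∀ b, h + 2 ≤ b → b ≤ ℓ → t (h + 1) + 1 ≤ n → t b = 2 * n + 1 - t (h + 1) →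
      ¬ (-h ≤ n - t (h + 1) - b ∧ n - t (h + 1) - b ≤ r - h - 1))
    (hB : ∀ a, 1 ≤ a → a ≤ h → n + 1 ≤ t (h + 1) → t a = 2 * n + 1 - t (h + 1) →
      ¬ (n - r - h ≤ t a - a ∧ t a - a ≤ n - h - 1)) : NoPair n ℓ h r (TypeB.bump t c) where
  noA b h3 h4 h5 h6 := by
    subst hc
    rw [bump_self] at h5 h6 ⊢
    rw [bump_of_ne _ (by omega)] at h6
    have := hA b h3 h4 h5 (by omega)
    omega
  noB a h3 h4 h5 h6 := by
    subst hc
    rw [bump_self] at h5 h6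
    rw [bump_of_ne _ (by omega)] at h6 ⊢
    exact hB a h3 h4 (by omega) (by omega)

/-- The step up of `i` at `h + 1` moves from `-h - 1 - r` to `-h - 1`. Besides it only the bar of `i
+ 1` or of `i` in the second column matters. If the bar of `i + 1` gives a step up strictly inside
the window, `s` changes at `h + 1` and `t` at that bar, which creates an exchanged pair; otherwise
both change the same entry. -/
lemma NoPair.compare_low_plus (hC : NoPair n ℓ h r t) (hcol : Col n t 1 ℓ)
    (hR : Rel n ℓ h r t t) (hh : 0 ≤ h) (hl : h + 1 ≤ ℓ) (hln : ℓ ≤ n - r) (hr : 1 ≤ r)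
    (hi1 : 1 ≤ i) (hi : i < n) (hy : t (h + 1) = i) : Compare n ℓ h r i t t := by
  have hT := hR.1
  have c3 := hcol.mono (lo' := h + 1 + 1) (hi' := ℓ) (by omega) le_rfl
  have c1 := hcol.mono (lo' := 1) (hi' := h + 1) le_rfl hl
  have low : ∀ a, 1 ≤ a → a ≤ h → t a < i := fun a h3 h4 => by
    have := hcol.cmp h3 (b := h + 1) (by omega) hl; omega
  have high : ∀ a, h + 2 ≤ a → a ≤ ℓ → i < t a := fun a h3 h4 => by
    have := hcol.cmp (a := h + 1) (b := a) (by omega) (by omega) h4; omega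
  have e1 : ∀ θ, strand t 1 (h + 1) (2 * n + 1 - i) θ = 0 := fun θ =>
    strand_zero _ fun a h3 h4 => by
      by_cases ha : a = h + 1
      · subst ha; omega
      · have := low a h3 (by omega); omega
  have e2 : ∀ L, strand t 1 (h + 1) i (-L) = stp (-h - 1) L := fun L => by
    rw [strand_plus c1 (by omega) (by omega) _ (p := h + 1) (by omega) le_rfl hy (by omega)]
    unfold stp; split_ifs <;> omega
  obtain ⟨m, hm, hm1, e3⟩ : ∃ m : ℤ, (m = 0 ∨ m = 1) ∧
      (m = 1 → h + 2 ≤ ℓ ∧ t (h + 2) = i + 1) ∧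
      ∀ L, strand t (h + 1 + 1) ℓ i (-(L + r)) = - m * stp (-h - 1 - r) L := by
    rcases strand_cases c3 (ρ := i) (by omega) (by omega) with ⟨h1, h2⟩ | ⟨p, h1, h2, h3, -⟩ |
      ⟨p, h1, h2, h3, -, h4⟩
    · exact ⟨0, Or.inl rfl, by omega, fun L => by rw [h1]; ring⟩
    · have := high p (by omega) h2; omega
    · have := hcol.succ_eq (a := h + 1) (b := p) (by omega) hl (by omega) h2 (by omega) (by omega)
        (by omega)
      subst this
      refine ⟨1, Or.inr rfl, fun _ => ⟨by omega, ?_⟩, fun L => ?_⟩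
      · rw [← h3]; congr 1; ring
      · rw [h4]; unfold stp; split_ifs <;> omega
  have hFs : ∀ L, F n ℓ (h + 1) r i t L = stp (-h - 1) L - m * stp (-h - 1 - r) L +
      strand t (h + 1 + 1) ℓ (2 * n + 1 - i) (n - i - (L + r)) := fun L => by
    rw [F_of_lt hi, e1, e2, e3]; ring
  have hFt : ∀ L, F n ℓ h r i t L = (1 - m) * stp (-h - 1 - r) L +
      strand t (h + 1 + 1) ℓ (2 * n + 1 - i) (n - i - (L + r)) := fun L => by
    have h1 := F_succ (n := n) (ℓ := ℓ) (r := r) (i := i) (t := t) hh hl L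
    rw [hFs, entryF_of_lt hi, entryF_of_lt hi, if_pos hy,
      if_neg (by omega), if_neg (by omega), if_neg (by omega), if_pos hy, if_neg (by omega),
      if_neg (by omega), if_neg (by omega)] at h1
    have h2 : stp (-(h + 1)) L = stp (-h - 1) L := by congr 1; ring
    have h3 : stp (-(h + 1)) (L + r) = stp (-h - 1 - r) L := by
      unfold stp; split_ifs <;> omega
    rw [h2, h3] at h1
    linarith
  have hend : ∀ L, n ≤ L → F n ℓ h r i t L = F n ℓ (h + 1) r i t L := fun L hL => by
    rw [hFs, hFt]; unfold stp; rw [if_pos (by omega), if_pos (by omega)]; ring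
  have atc : ∀ c, 1 ≤ c → c ≤ ℓ → (t c = i ∨ t c = 2 * n + 1 - i) →
      c = h + 1 ∨ (h + 2 ≤ c ∧ t c = 2 * n + 1 - i ∧ lev n (h + 1) r i (t c) c = n - i - r - c) := by
    intro c h1 h2 h3
    by_cases h4 : c ≤ h
    · have := low c h1 h4; omega
    · by_cases h5 : c = h + 1
      · exact Or.inl h5
      · have := high c (by omega) h2
        refine Or.inr ⟨by omega, by omega, ?_⟩
        unfold lev; rw [if_neg (by omega), if_neg (by omega)]; ring
  have levs : lev n (h + 1) r i (t (h + 1)) (h + 1) = -h - 1 := by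
    unfold lev; rw [if_pos (by omega), if_pos (by omega)]; ring
  have levt : lev n h r i (t (h + 1)) (h + 1) = -h - 1 - r := by
    unfold lev; rw [if_pos (by omega), if_neg (by omega)]; ring
  have hA : -h - 1 - r < -h - 1 := by omega
  rcases strand_cases c3 (ρ := 2 * n + 1 - i) (by omega) (by omega) with
    ⟨z1, z2⟩ | ⟨p, z1, z2, z3, z4, z5⟩ | ⟨p, z1, z2, z3, z4, z5⟩
  · have hz : ∀ L, strand t (h + 1 + 1) ℓ (2 * n + 1 - i) (n - i - (L + r)) = 0 := fun L => z1 _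
    simp only [hz, add_zero] at hFs hFt
    refine ⟨hend, (plusMove_zero (q := 0) hFt hFs hm hA).1, ?_⟩
    rintro s' ⟨-, hS', c, hc, rfl⟩
    obtain ⟨h1, h2, h3, h4⟩ := (plusMove_zero hFt hFs hm hA).2 hc.isFirstMax hc.pos
    rcases atc c hc.one_le hc.le hc.letter with rfl | ⟨h5, h6, -⟩
    · refine exists_fstep (c := h + 1) hR ((noPair_bump_cross rfl (fun b h5 h6 h7 h8 => ?_)
        fun a h5 h6 h7 h8 => by omega).rel hS' hh hl) (by omega) hl (Or.inl hy) h3 levt.symm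
        hc.isFirstMax h4 hc.pos
      obtain ⟨h9, h10⟩ := (z2 b (by omega) h6).1 (by omega)
      have := hC.noA (b + 1) (by omega) h9 (by omega) (by omega)
      omega
    · obtain ⟨h7, h8⟩ := (z2 c (by omega) hc.le).1 h6
      have := hS'.step c hc.one_le h7 (by omega)
      rw [bump_self, bump_of_ne _ (by omega)] at this
      omega
  · have hx : ∀ L, stp (n - i - (L + r)) p = stp (n - i - r - p) L := fun L => by
      unfold stp; split_ifs <;> omega
    simp only [z5, hx] at hFs hFt
    -- Equality would make `i + 1` at `h + 2` and its bar at `p` a pair forbidden inside the second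
    -- column.
    have hmx : m = 1 → n - i - r - p ≠ -h - 1 - r := fun h1 => by
      obtain ⟨h2, h3⟩ := hm1 h1
      have : h + 2 < p := by
        by_contra h4
        have : p = h + 2 := by omega
        subst this; omega
      have := hT.col2 (h + 2) p (by omega) this z2 (by omega) (by omega)
      omega
    have key := fun q => plusMove_plus (q := q) hFt hFs hm hA hmx
    refine ⟨hend, (key 0).1, ?_⟩
    rintro s' ⟨-, hS', c, hc, rfl⟩
    have hcp : ∀ c, h + 2 ≤ c → c ≤ ℓ → t c = 2 * n + 1 - i → c = p := fun c h1 h2 h3 =>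
      c3.eq_of_eq (by omega) h2 z1 z2 (by omega) (by omega)
    have c_eq := atc c hc.one_le hc.le hc.letter
    rcases (key _).2 hc.isFirstMax hc.pos with ⟨h1, h2, h3, h4, h5⟩ | ⟨h1, h2, h3, h4, h5⟩ |
      ⟨h1, h2, h3, h4⟩
    · rcases c_eq with rfl | ⟨h6, h7, h8⟩
      · refine exists_fstep (c := h + 1) hR ((noPair_bump_cross rfl (fun b h6 h7 h8 h9 => ?_)
          fun a h5 h6 h7 h8 => by omega).rel hS' hh hl) (by omega) hl (Or.inl hy) h4 levt.symm
          hc.isFirstMax h5 hc.pos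
        have := hcp b h6 h7 (by omega)
        omega
      · have := hcp c h6 hc.le h7
        omega
    · rcases c_eq with rfl | ⟨h6, h7, h8⟩
      -- The new run has length one: `t` now has `i` at `h + 1` and its bar at `p`, and `s` has `i +
      -- 1` and its bar at the same places.
      · refine exists_fstep (c := p) hR (rel_of_relA (k := i) (K := i) (e := n - i - p) hS' hh hl
          hln ⟨hi1, le_rfl, by omega, by omega, by omega, by omega, ?_, ?_, fun c h6 h7 => ?_,
          fun c h6 h7 => ?_⟩ fun h6 h7 => ?_) (by omega) z2 (Or.inr z3) h4 ?_ hc.isFirstMax h5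
          hc.pos
        · rw [bump_of_ne _ (by omega), hy]
        · rw [bump_self, hy]
        · have : c = p := by omega
          subst this
          rw [bump_self, bump_of_ne _ (by omega)]; omega
        · rw [bump_of_ne _ (by omega), bump_of_ne _ (by omega)]
        · rw [bump_of_ne _ (by omega)] at h7
          exact z4 _ (by omega) h6 (by omega)
        · unfold lev; rw [if_neg (by omega), if_neg (by omega)]; ring
      · have := hcp c h6 hc.le h7
        omega
    · rcases c_eq with rfl | ⟨h6, h7, h8⟩
      -- The levels of `h + 1` and `p` coincide only if raising `h + 1` creates a pair forbidden
      -- between the two columns.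
      · have := hS'.col12 (h + 1) p (by omega) le_rfl (by omega) z2
        rw [bump_self, bump_of_ne _ (by omega)] at this
        omega
      · have := hcp c h6 hc.le h7
        subst this
        refine exists_fstep (c := c) hR (NoPair.rel ⟨fun b h9 h10 h11 h12 => ?_,
          fun a h9 h10 h11 h12 => ?_⟩ hS' hh hl) (by omega) z2 (Or.inr z3) (h1 ▸ h3) ?_
          hc.isFirstMax (h1 ▸ h4) hc.pos
        · rw [bump_of_ne t (show h + 1 ≠ c by omega)] at h12 ⊢
          rcases bump_cases t c b with ⟨rfl, h13⟩ | ⟨h13, h14⟩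
          · omega
          · have := hC.noA b h9 h10 (by omega) (by omega); omega
        · rw [bump_of_ne _ (by omega)] at h11
          omega
        · rw [lev_succ (by omega)]
  · have hx : ∀ L, stp (n - i - (L + r) + 1) p = stp (n - i - r + 1 - p) L := fun L => by
      unfold stp; split_ifs <;> omega
    simp only [z5, hx, ← sub_eq_add_neg] at hFs hFt
    have hxw : n - i - r + 1 - p ≤ -h - 1 - r ∨ -h - 1 < n - i - r + 1 - p := by
      have := hC.noA p (by omega) z2 (by omega) (by omega); omega
    refine ⟨hend, (plusMove_minus (q := 0) hFt hFs hm hA hxw).1, ?_⟩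
    rintro s' ⟨-, hS', c, hc, rfl⟩
    obtain ⟨h1, h2, h3, h4⟩ := (plusMove_minus hFt hFs hm hA hxw).2 hc.isFirstMax hc.pos
    rcases atc c hc.one_le hc.le hc.letter with rfl | ⟨h5, h6, -⟩
    · refine exists_fstep (c := h + 1) hR ((noPair_bump_cross rfl (fun b h5 h6 h7 h8 => ?_)
        fun a h5 h6 h7 h8 => by omega).rel hS' hh hl) (by omega) hl (Or.inl hy) h3 levt.symm
        hc.isFirstMax h4 hc.pos
      exact absurd (by omega) (z4 b (by omega) h6)
    · exact absurd h6 (z4 c (by omega) hc.le)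

/-- The mirror image: a letter `i` of the first column plays the part of the bar of `i + 1`. If its
step up lies inside the window, a barred exchange with a run of length one is created. -/
lemma NoPair.compare_high_plus (hC : NoPair n ℓ h r t) (hcol : Col n t 1 ℓ)
    (hR : Rel n ℓ h r t t) (hh : 0 ≤ h) (hl : h + 1 ≤ ℓ) (hln : ℓ ≤ n - r) (hr : 1 ≤ r)
    (hi1 : 1 ≤ i) (hi : i < n) (hy : t (h + 1) = 2 * n + 1 - i) : Compare n ℓ h r i t t := by
  have hT := hR.1
  have c3 := hcol.mono (lo' := h + 1 + 1) (hi' := ℓ) (by omega) le_rfl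
  have c1 := hcol.mono (lo' := 1) (hi' := h + 1) le_rfl hl
  have low : ∀ a, 1 ≤ a → a ≤ h → t a < 2 * n + 1 - i := fun a h3 h4 => by
    have := hcol.cmp h3 (b := h + 1) (by omega) hl; omega
  have high : ∀ a, h + 2 ≤ a → a ≤ ℓ → 2 * n + 1 - i < t a := fun a h3 h4 => by
    have := hcol.cmp (a := h + 1) (b := a) (by omega) (by omega) h4; omega
  have e1 : ∀ θ, strand t (h + 1 + 1) ℓ i θ = 0 := fun θ =>
    strand_zero _ fun a h3 h4 => by have := high a (by omega) h4; omega
  have e2 : ∀ L, strand t 1 (h + 1) (2 * n + 1 - i) (n - i - L) = stp (n - i - h - 1) L := fun L => by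
    rw [strand_plus c1 (by omega) (by omega) _ (p := h + 1) (by omega) le_rfl hy (by omega)]
    unfold stp; split_ifs <;> omega
  obtain ⟨m, hm, hm1, e3⟩ : ∃ m : ℤ, (m = 0 ∨ m = 1) ∧
      (m = 1 → h + 2 ≤ ℓ ∧ t (h + 2) = 2 * n + 2 - i) ∧
      ∀ L, strand t (h + 1 + 1) ℓ (2 * n + 1 - i) (n - i - (L + r)) =
        - m * stp (n - i - h - 1 - r) L := by
    rcases strand_cases c3 (ρ := 2 * n + 1 - i) (by omega) (by omega) with ⟨h1, h2⟩ |
      ⟨p, h1, h2, h3, -⟩ | ⟨p, h1, h2, h3, -, h4⟩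
    · exact ⟨0, Or.inl rfl, by omega, fun L => by rw [h1]; ring⟩
    · have := high p (by omega) h2; omega
    · have := hcol.succ_eq (a := h + 1) (b := p) (by omega) hl (by omega) h2 (by omega) (by omega)
        (by omega)
      subst this
      refine ⟨1, Or.inr rfl, fun _ => ⟨by omega, ?_⟩, fun L => ?_⟩
      · rw [show h + 2 = h + 1 + 1 by ring, h3]; ring
      · rw [h4]; unfold stp; split_ifs <;> omega
  have hFs : ∀ L, F n ℓ (h + 1) r i t L = stp (n - i - h - 1) L - m * stp (n - i - h - 1 - r) L +
      strand t 1 (h + 1) i (-L) := fun L => by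
    rw [F_of_lt hi, e1, e2, e3]; ring
  have hFt : ∀ L, F n ℓ h r i t L = (1 - m) * stp (n - i - h - 1 - r) L +
      strand t 1 (h + 1) i (-L) := fun L => by
    have h1 := F_succ (n := n) (ℓ := ℓ) (r := r) (i := i) (t := t) hh hl L
    rw [hFs, entryF_of_lt hi, entryF_of_lt hi, if_neg (by omega),
      if_neg (by omega), if_pos hy, if_neg (by omega), if_neg (by omega), if_neg (by omega),
      if_pos hy, if_neg (by omega)] at h1
    have h2 : stp (n - i - (h + 1)) L = stp (n - i - h - 1) L := by congr 1; ring
    have h3 : stp (n - i - (h + 1)) (L + r) = stp (n - i - h - 1 - r) L := by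
      unfold stp; split_ifs <;> omega
    rw [h2, h3] at h1
    linarith
  have hend : ∀ L, n ≤ L → F n ℓ h r i t L = F n ℓ (h + 1) r i t L := fun L hL => by
    rw [hFs, hFt]; unfold stp; rw [if_pos (by omega), if_pos (by omega)]; ring
  have atc : ∀ c, 1 ≤ c → c ≤ ℓ → (t c = i ∨ t c = 2 * n + 1 - i) →
      c = h + 1 ∨ (c ≤ h ∧ t c = i ∧ lev n (h + 1) r i (t c) c = - c) := by
    intro c h1 h2 h3
    by_cases h4 : c ≤ h
    · have := low c h1 h4
      refine Or.inr ⟨by omega, by omega, ?_⟩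
      unfold lev; rw [if_pos (by omega), if_pos (by omega)]; ring
    · by_cases h5 : c = h + 1
      · exact Or.inl h5
      · have := high c (by omega) h2; omega
  have levs : lev n (h + 1) r i (t (h + 1)) (h + 1) = n - i - h - 1 := by
    unfold lev; rw [if_neg (by omega), if_pos (by omega)]; ring
  have levt : lev n h r i (t (h + 1)) (h + 1) = n - i - h - 1 - r := by
    unfold lev; rw [if_neg (by omega), if_neg (by omega)]; ring
  have hA : n - i - h - 1 - r < n - i - h - 1 := by omega
  rcases strand_cases c1 (ρ := i) (by omega) (by omega) with
    ⟨z1, z2⟩ | ⟨p, z1, z2, z3, z4, z5⟩ | ⟨p, z1, z2, z3, z4, z5⟩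
  · simp only [z1, add_zero] at hFs hFt
    refine ⟨hend, (plusMove_zero (q := 0) hFt hFs hm hA).1, ?_⟩
    rintro s' ⟨-, hS', c, hc, rfl⟩
    obtain ⟨h1, h2, h3, h4⟩ := (plusMove_zero hFt hFs hm hA).2 hc.isFirstMax hc.pos
    rcases atc c hc.one_le hc.le hc.letter with rfl | ⟨h5, h6, -⟩
    · refine exists_fstep (c := h + 1) hR ((noPair_bump_cross rfl (fun a h5 h6 h7 h8 => by omega)
        fun b h5 h6 h7 h8 => ?_).rel hS' hh hl) (by omega) hl (Or.inr hy) h3 levt.symm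
        hc.isFirstMax h4 hc.pos
      obtain ⟨h9, h10⟩ := (z2 b (by omega) (by omega)).1 (by omega)
      have : b + 1 ≠ h + 1 := fun h => by rw [h] at h10; omega
      have := hC.noB (b + 1) (by omega) (by omega) (by omega) (by omega)
      omega
    · obtain ⟨h7, h8⟩ := (z2 c hc.one_le (by omega)).1 h6
      have := hS'.step c hc.one_le (by omega) (by omega)
      rw [bump_self, bump_of_ne _ (by omega)] at this
      omega
  · have hx : ∀ L, stp (-L) p = stp (-p) L := fun L => by
      unfold stp; split_ifs <;> omega
    simp only [z5, hx] at hFs hFt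
    have hph : p ≠ h + 1 := by rintro rfl; omega
    have hmx : m = 1 → -p ≠ n - i - h - 1 - r := fun h1 => by
      obtain ⟨h2, h3⟩ := hm1 h1
      have := hT.col12 p (h + 2) z1 (by omega) (by omega) h2 (by omega) (by omega)
      omega
    have key := fun q => plusMove_plus (q := q) hFt hFs hm hA hmx
    refine ⟨hend, (key 0).1, ?_⟩
    rintro s' ⟨-, hS', c, hc, rfl⟩
    have hcp : ∀ c, 1 ≤ c → c ≤ h → t c = i → c = p := fun c h1 h2 h3 =>
      c1.eq_of_eq h1 (by omega) z1 z2 (by omega) (by omega)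
    have c_eq := atc c hc.one_le hc.le hc.letter
    rcases (key _).2 hc.isFirstMax hc.pos with ⟨h1, h2, h3, h4, h5⟩ | ⟨h1, h2, h3, h4, h5⟩ |
      ⟨h1, h2, h3, h4⟩
    · rcases c_eq with rfl | ⟨h6, h7, h8⟩
      · refine exists_fstep (c := h + 1) hR ((noPair_bump_cross rfl (fun a h5 h6 h7 h8 => by omega)
          fun b h6 h7 h8 h9 => ?_).rel hS' hh hl) (by omega) hl (Or.inr hy) h4 levt.symm
          hc.isFirstMax h5 hc.pos
        have := hcp b h6 h7 (by omega)
        omega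
      · have := hcp c hc.one_le h6 h7
        omega
    · rcases c_eq with rfl | ⟨h6, h7, h8⟩
      · refine exists_fstep (c := p) hR (rel_of_relB (k := i + 1) (K := i + 1) (d := i + 1 - p)
          hS' hh hl hln ⟨le_rfl, by omega, by omega, by omega, by omega, ?_, ?_, fun c h6 h7 => ?_,
          fun c h6 h7 => ?_⟩ fun h6 h7 => ?_) z1 (by omega) (Or.inl z3) h4 ?_ hc.isFirstMax h5
          hc.pos
        · rw [bump_of_ne _ (by omega), hy]; ring
        · rw [bump_self, hy]; ring
        · have : c = p := by omega
          subst this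
          rw [bump_self, bump_of_ne _ (by omega)]; omega
        · rw [bump_of_ne _ (by omega), bump_of_ne _ (by omega)]
        · rw [bump_of_ne _ (by omega)] at h7
          exact z4 _ (by omega) (by omega) h7
        · unfold lev; rw [if_pos (by omega), if_pos (by omega)]; ring
      · have := hcp c hc.one_le h6 h7
        omega
    · rcases c_eq with rfl | ⟨h6, h7, h8⟩
      · have := hS'.col1 p (h + 1) z1 (by omega) le_rfl
        rw [bump_self, bump_of_ne _ (by omega)] at this
        omega
      · have := hcp c hc.one_le h6 h7
        subst this
        refine exists_fstep (c := c) hR (NoPair.rel ⟨fun b h9 h10 h11 h12 => ?_,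
          fun a h9 h10 h11 h12 => ?_⟩ hS' hh hl) hc.one_le hc.le (Or.inl z3) (h1 ▸ h3) ?_
          hc.isFirstMax (h1 ▸ h4) hc.pos
        · rw [bump_of_ne _ (by omega)] at h11
          omega
        · rw [bump_of_ne t (show h + 1 ≠ c by omega)] at h12
          rcases bump_cases t c a with ⟨rfl, h13⟩ | ⟨h13, h14⟩
          · omega
          · have := hC.noB a h9 h10 (by omega) (by omega); omega
        · rw [lev_succ (by omega)]
  · have hx : ∀ L, stp (-L + 1) p = stp (1 - p) L := fun L => by
      unfold stp; split_ifs <;> omega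
    simp only [z5, hx, ← sub_eq_add_neg] at hFs hFt
    have hph : p ≠ h + 1 := by rintro rfl; omega
    have hxw : 1 - p ≤ n - i - h - 1 - r ∨ n - i - h - 1 < 1 - p := by
      have := hC.noB p (by omega) (by omega) (by omega) (by omega); omega
    refine ⟨hend, (plusMove_minus (q := 0) hFt hFs hm hA hxw).1, ?_⟩
    rintro s' ⟨-, hS', c, hc, rfl⟩
    obtain ⟨h1, h2, h3, h4⟩ := (plusMove_minus hFt hFs hm hA hxw).2 hc.isFirstMax hc.pos
    rcases atc c hc.one_le hc.le hc.letter with rfl | ⟨h5, h6, -⟩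
    · refine exists_fstep (c := h + 1) hR ((noPair_bump_cross rfl (fun a h5 h6 h7 h8 => by omega)
        fun b h5 h6 h7 h8 => ?_).rel hS' hh hl) (by omega) hl (Or.inr hy) h3 levt.symm
        hc.isFirstMax h4 hc.pos
      exact absurd (by omega) (z4 b (by omega) (by omega))
    · exact absurd h6 (z4 c hc.one_le (by omega))

end

end TypeB

namespace TypeB

/-! ### The short root -/

section

variable {n ℓ h r i lo hi : ℤ} {t s : ℤ → ℤ}

lemma Col.exists_cut (hC : Col n t lo hi) (hlo : lo ≤ hi + 1) (v : ℤ) :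
    ∃ z, lo ≤ z ∧ z ≤ hi + 1 ∧ ∀ a, lo ≤ a → a ≤ hi → (t a < v ↔ a < z) := by
  obtain ⟨z, ⟨h1, h2⟩, h3⟩ := Int.exists_least_of_bdd (P := fun a => lo ≤ a ∧ (hi < a ∨ v ≤ t a))
    ⟨lo, fun z hz => hz.1⟩ ⟨hi + 1, hlo, Or.inl (by omega)⟩
  refine ⟨z, h1, h3 _ ⟨hlo, Or.inl (by omega)⟩, fun a h4 h5 => ⟨fun h6 => ?_, fun h6 => ?_⟩⟩
  · by_contra h7
    have := hC.le h1 (not_lt.1 h7) h5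
    omega
  · by_contra h7
    have := h3 a ⟨h4, Or.inr (not_lt.1 h7)⟩
    omega

lemma cnt_sub_cnt_succ (ρ θ : ℤ) : cnt t lo hi ρ θ - cnt t lo hi ρ (θ + 1) =
    if lo ≤ θ ∧ θ ≤ hi ∧ t θ = ρ then 1 else 0 := by
  unfold cnt
  rw [← Finset.sum_sub_distrib]
  by_cases h : lo ≤ θ ∧ θ ≤ hi ∧ t θ = ρ
  · rw [if_pos h, Finset.sum_eq_single θ]
    · rw [if_pos ⟨h.2.2, le_rfl⟩, if_neg (by omega), sub_zero]
    · intro a _ ha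
      by_cases hρ : t a = ρ
      · simp only [hρ, true_and]; split_ifs <;> omega
      · simp [hρ]
    · intro hθ; exact absurd (Finset.mem_Icc.2 ⟨h.1, h.2.1⟩) hθ
  · rw [if_neg h]
    refine Finset.sum_eq_zero fun a ha => ?_
    rw [Finset.mem_Icc] at ha
    by_cases hρ : t a = ρ
    · simp only [hρ, true_and]
      by_cases haθ : a = θ
      · subst haθ; exact absurd ⟨ha.1, ha.2, hρ⟩ h
      · split_ifs <;> omega
    · simp [hρ]

/-- The shape of a column with respect to the letters `n`, `0`, `n̄`. -/
structure ZeroBlock (n lo hi : ℤ) (t : ℤ → ℤ) (z z' u u' : ℤ) : Prop where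
  lo_le : lo ≤ z
  le : z ≤ z'
  le_hi : z' ≤ hi + 1
  cut : ∀ a, lo ≤ a → a ≤ hi → (t a < n + 1 ↔ a < z)
  cut' : ∀ a, lo ≤ a → a ≤ hi → (t a < n + 2 ↔ a < z')
  left : (u = 1 ∧ lo ≤ z - 1 ∧ t (z - 1) = n) ∨ (u = -1 ∧ ∀ a, lo ≤ a → a ≤ hi → t a ≠ n)
  right : (u' = -1 ∧ z' ≤ hi ∧ t z' = n + 2) ∨ (u' = 1 ∧ ∀ a, lo ≤ a → a ≤ hi → t a ≠ n + 2)
  colF_eq : ∀ x, colF n n t lo hi x = u * stp (1 - z) x + u' * stp (1 - z') x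

/-- Each `0` at `a` gives a step up at `-a` and a step down at `1 - a`. Over the block of zeros at
`z, …, z' - 1` these telescope to a step up at `1 - z'` and a step down at `1 - z`. A letter `n`
just before the block, or a bar of `n` just after it, counts twice and reverses the corresponding
sign. -/
lemma Col.exists_zeroBlock (hC : Col n t lo hi) (hlo : lo ≤ hi + 1) :
    ∃ z z' u u', ZeroBlock n lo hi t z z' u u' := by
  obtain ⟨z, h1, h2, h3⟩ := hC.exists_cut hlo (n + 1)
  obtain ⟨z', h1', h2', h3'⟩ := hC.exists_cut hlo (n + 2)
  have hz : z ≤ z' := by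
    by_contra h4
    have := h3 z' h1' (by omega); have := h3' z' h1' (by omega); omega
  obtain ⟨u, hu, hu'⟩ : ∃ u : ℤ, ((u = 1 ∧ lo ≤ z - 1 ∧ t (z - 1) = n) ∨
      (u = -1 ∧ ∀ a, lo ≤ a → a ≤ hi → t a ≠ n)) ∧
      ∀ x, 2 * cnt t lo hi n (-x) = (u + 1) * stp (1 - z) x := by
    by_cases h4 : ∃ a, lo ≤ a ∧ a ≤ hi ∧ t a = n
    · obtain ⟨a, h5, h6, h7⟩ := h4
      have h8 : a = z - 1 := by
        by_contra h9
        have h10 := (h3 a h5 h6).1 (by omega)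
        have h11 := (h3 (z - 1) (by omega) (by omega)).2 (by omega)
        have := hC.cmp h5 (b := z - 1) (by omega) (by omega)
        omega
      subst h8
      refine ⟨1, Or.inl ⟨rfl, h5, h7⟩, fun x => ?_⟩
      rw [cnt_eq_stp _ h5 h6 h7
        fun b h8 h9 h10 => hC.eq_of_eq h8 h9 h5 h6 (by omega) (by omega)]
      unfold stp; split_ifs <;> omega
    · refine ⟨-1, Or.inr ⟨rfl, fun a h5 h6 h7 => h4 ⟨a, h5, h6, h7⟩⟩, fun x => ?_⟩
      rw [cnt_eq_zero _ fun a h5 h6 h7 => h4 ⟨a, h5, h6, h7⟩]; ring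
  obtain ⟨u', hv, hv'⟩ : ∃ u : ℤ, ((u = -1 ∧ z' ≤ hi ∧ t z' = n + 2) ∨
      (u = 1 ∧ ∀ a, lo ≤ a → a ≤ hi → t a ≠ n + 2)) ∧
      ∀ x, 2 * cnt t lo hi (n + 2) (1 - x) = (1 - u) * stp (1 - z') x := by
    by_cases h4 : ∃ a, lo ≤ a ∧ a ≤ hi ∧ t a = n + 2
    · obtain ⟨a, h5, h6, h7⟩ := h4
      have h8 : a = z' := by
        by_contra h9
        have h10 := h3' a h5 h6
        have h11 := h3' z' (by omega) (by omega)
        have := hC.cmp (a := z') (b := a) (by omega) (by omega) (by omega)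
        omega
      subst h8
      refine ⟨-1, Or.inl ⟨rfl, h6, h7⟩, fun x => ?_⟩
      rw [cnt_eq_stp _ h5 h6 h7
        fun b h8 h9 h10 => hC.eq_of_eq h8 h9 h5 h6 (by omega) (by omega)]
      unfold stp; split_ifs <;> omega
    · refine ⟨1, Or.inr ⟨rfl, fun a h5 h6 h7 => h4 ⟨a, h5, h6, h7⟩⟩, fun x => ?_⟩
      rw [cnt_eq_zero _ fun a h5 h6 h7 => h4 ⟨a, h5, h6, h7⟩]; ring
  refine ⟨z, z', u, u', h1, hz, h2', h3, h3', hu, hv, fun x => ?_⟩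
  have hmid : cnt t lo hi (n + 1) (-x) - cnt t lo hi (n + 1) (-x + 1) =
      stp (1 - z') x - stp (1 - z) x := by
    rw [cnt_sub_cnt_succ]
    have := stp_spec (1 - z') x
    have := stp_spec (1 - z) x
    split_ifs with h4
    · have := h3 _ h4.1 h4.2.1; have := h3' _ h4.1 h4.2.1; omega
    · by_cases h5 : lo ≤ -x ∧ -x ≤ hi
      · have := h3 _ h5.1 h5.2; have := h3' _ h5.1 h5.2; omega
      · omega
  have e := hu' x
  have e' := hv' x
  unfold colF strand
  rw [if_pos rfl, show 2 * n + 1 - n = n + 1 by ring, show n - n - x = -x by ring,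
    show n + 1 + 1 = n + 2 by ring, show -x + 1 = 1 - x by ring] at *
  linarith

lemma entryF_self (y p x : ℤ) : entryF n n y p x =
    (if y = n then 2 * stp (-p) x else 0) +
    ((if y = n + 1 then stp (-p) x - stp (1 - p) x else 0) -
      if y = n + 2 then 2 * stp (1 - p) x else 0) := by
  unfold entryF
  rw [if_pos rfl, show 2 * n + 1 - n = n + 1 by ring, show n + 1 + 1 = n + 2 by ring]
  have e1 : -x ≤ p ↔ -p ≤ x := by omega
  have e2 : -x + 1 ≤ p ↔ 1 - p ≤ x := by omega
  have e3 : n - n - x ≤ p ↔ -p ≤ x := by omega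
  have e4 : n - n - x + 1 ≤ p ↔ 1 - p ≤ x := by omega
  have e5 : 1 - x ≤ p ↔ 1 - p ≤ x := by omega
  simp only [ite_and, e1, e2, e3, e4, e5, stp]
  by_cases h1 : y = n
  · simp only [h1, if_true]
    rw [if_neg (show ¬ n = n + 1 by omega), if_neg (show ¬ n = n + 1 by omega),
      if_neg (show ¬ n = n + 2 by omega), if_neg (show ¬ n = n + 1 by omega),
      if_neg (show ¬ n = n + 2 by omega)]
    ring
  · simp only [h1, if_false]
    by_cases h2 : y = n + 1
    · subst h2
      have h3 : ¬ n + 1 = n + 2 := by omega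
      simp only [h3, if_true, if_false]
      ring
    · simp only [h2, if_false]
      split_ifs <;> norm_num

/-- A partial sum with a zero of the short root moved from the place `A` to the place `B`. -/
lemma zeroMove {Ft Fs : ℤ → ℤ} {u v W A B z q : ℤ}
    (hFs : ∀ L, Fs L = u * stp z L + stp B L - stp A L + v * stp W L)
    (hFt : ∀ L, Ft L = u * stp z L + stp (B + 1) L - stp (A + 1) L + v * stp W L)
    (hu : u = 1 ∨ u = -1) (hv : v = 1 ∨ v = -1) (hWA : W ≤ A) (hAB : A < B) (hBz : B < z) :
    (∀ L, z ≤ L → Ft L = Fs L) ∧ ((∀ L, Fs L ≤ 0) → ∀ L, Ft L ≤ 0) ∧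
    (IsFirstMax Fs q → 0 < Fs q → v = 1 ∧
      ((u = 1 ∧ q = z ∧ IsFirstMax Ft z ∧ Ft z = Fs q) ∨
       (u = -1 ∧ W = A ∧ q = B ∧ IsFirstMax Ft A ∧ Ft A = Fs q) ∨
       (u = -1 ∧ W < A ∧ q = W ∧ IsFirstMax Ft W ∧ Ft W = Fs q))) := by
  have gs : ∀ L, (L < W ∧ Fs L = 0) ∨ (W ≤ L ∧ L < A ∧ Fs L = v) ∨ (A ≤ L ∧ L < B ∧ Fs L = v - 1) ∨
      (B ≤ L ∧ L < z ∧ Fs L = v) ∨ (z ≤ L ∧ Fs L = u + v) := fun L => by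
    rw [hFs]; unfold stp; split_ifs <;> omega
  have gt : ∀ L, (L < W ∧ Ft L = 0) ∨ (W ≤ L ∧ L ≤ A ∧ Ft L = v) ∨ (A < L ∧ L ≤ B ∧ Ft L = v - 1) ∨
      (B < L ∧ L < z ∧ Ft L = v) ∨ (z ≤ L ∧ Ft L = u + v) := fun L => by
    rw [hFt]; unfold stp; split_ifs <;> omega
  clear hFs hFt
  refine ⟨fun L hL => by have := gs L; have := gt L; omega, fun hs L => ?_, fun hq hpos => ?_⟩
  · have := gs B; have := hs B; have := gs z; have := hs z; have := gt L; omega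
  have hv1 : v = 1 := by have := gs q; omega
  subst hv1
  refine ⟨rfl, ?_⟩
  rcases hu with rfl | rfl
  · have hqz : q = z := by
      have := gs q; have := gs z; have := hq.1 z; have := hq.2 z; omega
    subst hqz
    have e1 : Fs q = 2 := by have := gs q; omega
    have e2 : Ft q = 2 := by have := gt q; omega
    exact Or.inl ⟨rfl, rfl, ⟨fun L => by have := gt L; omega, fun L hL => by have := gt L; omega⟩,
      by omega⟩
  · rcases eq_or_lt_of_le hWA with rfl | hlt
    · have hqz : q = B := by
        have := gs q; have := gs B; have := hq.1 B; have := hq.2 B; omega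
      subst hqz
      have e1 : Fs q = 1 := by have := gs q; omega
      have e2 : Ft W = 1 := by have := gt W; omega
      exact Or.inr (Or.inl ⟨rfl, rfl, rfl,
        ⟨fun L => by have := gt L; omega, fun L hL => by have := gt L; omega⟩, by omega⟩)
    · have hqz : q = W := by
        have := gs q; have := gs W; have := hq.1 W; have := hq.2 W; omega
      subst hqz
      have e1 : Fs q = 1 := by have := gs q; omega
      have e2 : Ft q = 1 := by have := gt q; omega
      exact Or.inr (Or.inr ⟨rfl, hlt, rfl,
        ⟨fun L => by have := gt L; omega, fun L hL => by have := gt L; omega⟩, by omega⟩)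

/-- No entry has an exchange partner for the short root, so the same entry is changed on both sides.
The delicate case is `0` at `h + 1`: then a block of zeros extends up to or across the border, and
one zero of it changes column. -/
lemma NoPair.compare_short (hC : NoPair n ℓ h r t) (hcol : Col n t 1 ℓ)
    (hR : Rel n ℓ h r t t) (hh : 0 ≤ h) (hl : h + 1 ≤ ℓ) (hln : ℓ ≤ n - r) (hr : 1 ≤ r) :
    Compare n ℓ h r n t t := by
  have c1 := hcol.mono (lo' := 1) (hi' := h + 1) le_rfl hl
  have c2 := hcol.mono (lo' := h + 1 + 1) (hi' := ℓ) (by omega) le_rfl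
  obtain ⟨z, z', u, u', Z⟩ := c1.exists_zeroBlock (by omega)
  obtain ⟨w, w', v, v', W⟩ := c2.exists_zeroBlock (by omega)
  have hFs : ∀ L, F n ℓ (h + 1) r n t L = u * stp (1 - z) L + u' * stp (1 - z') L +
      (v * stp (1 - w) (L + r) + v' * stp (1 - w') (L + r)) := fun L => by
    unfold F; rw [Z.colF_eq, W.colF_eq]
  have hFt : ∀ L, F n ℓ h r n t L = F n ℓ (h + 1) r n t L -
    (entryF n n (t (h + 1)) (h + 1) L - entryF n n (t (h + 1)) (h + 1) (L + r)) := fun L => by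
    rw [F_succ hh hl]; ring
  have i1 := Z.lo_le
  have i2 := Z.le
  have i3 := Z.le_hi
  have i4 := Z.cut (h + 1) (by omega) le_rfl
  have i5 := Z.cut' (h + 1) (by omega) le_rfl
  have j1 := W.lo_le
  have j2 := W.le
  have j3 := W.le_hi
  have low : ∀ a, 1 ≤ a → a ≤ h → t a ≤ t (h + 1) ∧ (t (h + 1) ≤ n → t a < t (h + 1)) :=
    fun a h3 h4 => by have := hcol.cmp h3 (b := h + 1) (by omega) hl; omega
  have high : ∀ a, h + 2 ≤ a → a ≤ ℓ → t (h + 1) ≤ t a ∧ (t (h + 1) ≠ n + 1 → t (h + 1) < t a) :=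
    fun a h3 h4 => by
      have := hcol.cmp (a := h + 1) (b := a) (by omega) (by omega) h4; omega
  by_cases y1 : t (h + 1) = n
  · have b1 : z = h + 2 := by omega
    have b2 : z' = h + 2 := by omega
    have b3 : u = 1 := by
      rcases Z.left with h1 | ⟨-, h1⟩
      · exact h1.1
      · exact absurd y1 (h1 _ (by omega) le_rfl)
    have b4 : u' = 1 := by
      rcases Z.right with ⟨-, h1, -⟩ | h1
      · omega
      · exact h1.1
    have b5 : w = h + 2 := by
      by_contra h1
      have := W.cut (h + 2) (by omega) (by omega)
      have := high (h + 2) le_rfl (by omega)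
      omega
    have b6 : v = -1 := by
      rcases W.left with ⟨-, h1, -⟩ | h1
      · omega
      · exact h1.1
    subst b1 b2 b3 b4 b5 b6
    have gt : ∀ L, F n ℓ h r n t L = 2 * stp (-h - 1) (L + r) - stp (-h - 1) (L + r) +
        v' * stp (1 - w') (L + r) := fun L => by
      rw [hFt, hFs, entryF_self, entryF_self, if_pos y1, if_neg (by omega), if_neg (by omega),
        if_pos y1, if_neg (by omega), if_neg (by omega), show 1 - (h + 2) = -h - 1 by ring,
        show -(h + 1) = -h - 1 by ring]
      ring
    have gs : ∀ L, F n ℓ (h + 1) r n t L = 2 * stp (-h - 1) L - stp (-h - 1) (L + r) +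
        v' * stp (1 - w') (L + r) := fun L => by
      rw [hFs, show 1 - (h + 2) = -h - 1 by ring]
      ring
    refine ⟨fun L hL => ?_, fun hs L => ?_, ?_⟩
    · rw [gs, gt]; unfold stp; rw [if_pos (show -h - 1 ≤ L by omega), if_pos (by omega)]
    · have h1 := hs (-h - 1)
      rw [gs] at h1
      rw [gt]
      have := stp_spec (-h - 1) L
      have := stp_spec (-h - 1) (L + r)
      have := stp_spec (1 - w') (L + r)
      have := stp_spec (-h - 1) (-h - 1)
      have := stp_spec (-h - 1) (-h - 1 + r)
      have := stp_spec (1 - w') (-h - 1 + r)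
      rcases W.right with ⟨rfl, -⟩ | ⟨rfl, -⟩ <;> omega
    · rintro s' ⟨-, hS', c, hc, rfl⟩
      have hpos := hc.pos
      have hmax := hc.isFirstMax
      generalize hq : lev n (h + 1) r n (t c) c = q at hpos hmax
      have b7 : v' = 1 := by
        rcases W.right with ⟨rfl, -⟩ | h1
        · rw [gs] at hpos
          have := stp_spec (-h - 1) q
          have := stp_spec (-h - 1) (q + r)
          have := stp_spec (1 - w') (q + r)
          omega
        · exact h1.1
      subst b7
      have h1 := hmax.1 (-h - 1)
      have h2 := hmax.2 (-h - 1)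
      rw [gs] at hpos
      rw [gs, gs] at h1
      rw [gs, gs] at h2
      have f1 := stp_spec (-h - 1) q
      have f2 := stp_spec (-h - 1) (q + r)
      have f3 := stp_spec (1 - w') (q + r)
      have f4 := stp_spec (-h - 1) (-h - 1)
      have f5 := stp_spec (-h - 1) (-h - 1 + r)
      have f6 := stp_spec (1 - w') (-h - 1 + r)
      have hq' : q = -h - 1 := by omega
      subst hq'
      have hch : c = h + 1 := by
        have hlet := hc.letter
        unfold lev at hq
        by_cases h3 : c ≤ h
        · have := low c hc.one_le h3; omega
        · by_cases h4 : c = h + 1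
          · exact h4
          · rw [if_neg (show ¬ c ≤ h + 1 by omega)] at hq
            split_ifs at hq <;> omega
      subst hch
      have hval : F n ℓ h r n t (-h - 1 - r) = F n ℓ (h + 1) r n t (-h - 1) := by
        rw [gs, gt]
        have := stp_spec (-h - 1) (-h - 1 - r + r)
        have := stp_spec (1 - w') (-h - 1 - r + r)
        omega
      refine exists_fstep (c := h + 1) hR ((noPair_bump_cross rfl (fun b h5 h6 h7 h8 => by omega)
        fun a h5 h6 h7 h8 => by omega).rel hS' hh hl) (by omega) hl (Or.inl y1)
        (q' := -h - 1 - r) ⟨fun L => ?_, fun L hL => ?_⟩ ?_ hmax hval (by rw [gs]; omega)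
      · rw [hval, gs, gt]
        have := stp_spec (-h - 1) (L + r)
        have := stp_spec (1 - w') (L + r)
        omega
      · rw [hval, gs, gt]
        have := stp_spec (-h - 1) (L + r)
        have := stp_spec (1 - w') (L + r)
        omega
      · unfold lev; rw [if_pos (by omega), if_neg (by omega)]; ring
  by_cases y2 : t (h + 1) = n + 1
  · have b2 : z' = h + 2 := by omega
    have b4 : u' = 1 := by
      rcases Z.right with ⟨-, h1, -⟩ | h1
      · omega
      · exact h1.1
    have b5 : w = h + 2 := by
      by_contra h1
      have := W.cut (h + 2) (by omega) (by omega)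
      have := high (h + 2) le_rfl (by omega)
      omega
    have b6 : v = -1 := by
      rcases W.left with ⟨-, h1, -⟩ | h1
      · omega
      · exact h1.1
    subst b2 b4 b5 b6
    have gs : ∀ L, F n ℓ (h + 1) r n t L = u * stp (1 - z) L + stp (-h - 1) L -
        stp (-h - 1) (L + r) + v' * stp (1 - w') (L + r) := fun L => by
      rw [hFs, show 1 - (h + 2) = -h - 1 by ring]
      ring
    have gt : ∀ L, F n ℓ h r n t L = u * stp (1 - z) L + stp (-h) L -
        stp (-h) (L + r) + v' * stp (1 - w') (L + r) := fun L => by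
      rw [hFt, gs, entryF_self, entryF_self, if_neg (by omega), if_pos y2, if_neg (by omega),
        if_neg (by omega), if_pos y2, if_neg (by omega), show 1 - (h + 1) = -h by ring,
        show -(h + 1) = -h - 1 by ring]
      ring
    have hu : u = 1 ∨ u = -1 := by rcases Z.left with h1 | h1 <;> omega
    have hv : v' = 1 ∨ v' = -1 := by rcases W.right with h1 | h1 <;> omega
    have shift : ∀ x L, stp x (L + r) = stp (x - r) L := fun x L => by
      unfold stp; split_ifs <;> omega
    simp only [shift] at gs gt
    -- The three outcomes are a letter `n` in front of the block, the zero at `h + 1` itself, and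
    -- the last zero of the second column.
    have key := fun q => zeroMove (q := q) (W := 1 - w' - r) (A := -h - 1 - r) (B := -h - 1)
      (z := 1 - z) gs (fun L => (gt L).trans (by
        rw [show -h - 1 + 1 = -h by ring, show -h - 1 - r + 1 = -h - r by ring])) hu hv (by omega)
      (by omega) (by omega)
    refine ⟨fun L hL => (key 0).1 L (by omega), (key 0).2.1, ?_⟩
    rintro s' ⟨-, hS', c, hc, rfl⟩
    have hpos := hc.pos
    have hmax := hc.isFirstMax
    generalize hq : lev n (h + 1) r n (t c) c = q at hpos hmax
    have hlet := hc.letter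
    have hone := hc.one_le
    have hle := hc.le
    have hrel : Rel n ℓ h r (TypeB.bump t c) (TypeB.bump t c) := by
      by_cases hch : c = h + 1
      · exact (noPair_bump_cross hch (fun b h5 h6 h7 h8 => by omega)
          fun a h5 h6 h7 h8 => by omega).rel hS' hh hl
      · refine NoPair.rel ⟨fun b h7 h8 h9 h10 => ?_, fun b h7 h8 h9 h10 => ?_⟩ hS' hh hl
        · rw [bump_of_ne t (Ne.symm hch)] at h9; omega
        · rw [bump_of_ne t (Ne.symm hch)] at h9; omega
    have hlev : lev n (h + 1) r n (t c) c = -c - if c ≤ h + 1 then 0 else r := by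
      unfold lev; split_ifs <;> omega
    have hlev' : lev n h r n (t c) c = -c - if c ≤ h then 0 else r := by
      unfold lev; split_ifs <;> omega
    rw [hlev] at hq
    obtain ⟨-, ⟨rfl, h1, h2, h3⟩ | ⟨rfl, h0, h1, h2, h3⟩ | ⟨rfl, h0, h1, h2, h3⟩⟩ :=
      (key q).2.2 hmax hpos
    · have hcz : c ≠ h + 1 := by
        rintro rfl
        rw [if_pos le_rfl] at hq
        rcases Z.left with h7 | h7 <;> omega
      refine exists_fstep (c := c) hR hrel hone hle hlet h2 ?_ hmax h3 hpos
      rw [hlev', ← h1, ← hq]; split_ifs <;> omega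
    · have hcz : c = h + 1 := by
        by_contra h7
        by_cases h8 : c ≤ h + 1
        · rw [if_pos h8] at hq; omega
        · rw [if_neg h8] at hq; omega
      subst hcz
      refine exists_fstep (c := h + 1) hR hrel hone hle hlet h2 ?_ hmax h3 hpos
      rw [hlev', if_neg (by omega)]; ring
    · have hcz : c ≠ h + 1 := by
        rintro rfl
        rw [if_pos le_rfl] at hq
        omega
      refine exists_fstep (c := c) hR hrel hone hle hlet h2 ?_ hmax h3 hpos
      rw [hlev', ← h1, ← hq]; split_ifs <;> omega
  -- The bar of `n` at `h + 1` prevents positive partial sums for `s`, so that there is no step to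
  -- lift.
  by_cases y3 : t (h + 1) = n + 2
  · have b2 : z' = h + 1 := by
      by_contra h1
      have := Z.cut' (z') (by omega) (by omega)
      have := low z' (by omega) (by omega)
      rcases Z.right with h2 | h2
      · have := c1.eq_of_eq (a := z') (b := h + 1) (by omega) (by omega) (by omega) le_rfl (by omega)
          (by omega)
        omega
      · exact h2.2 (h + 1) (by omega) le_rfl y3
    have b4 : u' = -1 := by
      rcases Z.right with h1 | h1
      · exact h1.1
      · exact absurd y3 (h1.2 _ (by omega) le_rfl)
    have b5 : w = h + 2 := by
      by_contra h1
      have := W.cut (h + 2) (by omega) (by omega)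
      have := high (h + 2) le_rfl (by omega)
      omega
    have b5' : w' = h + 2 := by
      by_contra h1
      have := W.cut' (h + 2) (by omega) (by omega)
      have := high (h + 2) le_rfl (by omega)
      omega
    have b6 : v = -1 := by
      rcases W.left with ⟨-, h1, -⟩ | h1
      · omega
      · exact h1.1
    have b7 : v' = 1 := by
      rcases W.right with ⟨-, h1, h2⟩ | h1
      · have := high w' (by omega) h1; omega
      · exact h1.1
    subst b2 b4 b5 b5' b6 b7
    have gs : ∀ L, F n ℓ (h + 1) r n t L = u * stp (1 - z) L - stp (-h) L := fun L => by
      rw [hFs, show 1 - (h + 1) = -h by ring]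
      ring
    have gt : ∀ L, F n ℓ h r n t L = u * stp (1 - z) L + stp (-h) L - 2 * stp (-h) (L + r) :=
      fun L => by
      rw [hFt, gs, entryF_self, entryF_self, if_neg (by omega), if_neg (by omega), if_pos y3,
        if_neg (by omega), if_neg (by omega), if_pos y3, show 1 - (h + 1) = -h by ring]
      ring
    have hu : u = 1 ∨ u = -1 := by rcases Z.left with h1 | h1 <;> omega
    refine ⟨fun L hL => ?_, fun hs L => ?_, ?_⟩
    · rw [gs, gt]
      have := stp_spec (-h) L
      have := stp_spec (-h) (L + r)
      omega
    · rw [gt]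
      have := stp_spec (-h) L
      have := stp_spec (-h) (L + r)
      have := stp_spec (1 - z) L
      rcases hu with rfl | rfl <;> omega
    · rintro s' ⟨-, hS', c, hc, rfl⟩
      have hpos := hc.pos
      generalize lev n (h + 1) r n (t c) c = q at hpos
      rw [gs] at hpos
      have := stp_spec (-h) q
      have := stp_spec (1 - z) q
      rcases hu with rfl | rfl <;> omega
  · refine hC.compare_of_sameMax hR hh hl y1 (by omega) (SameMax.of_eq fun L => ?_)
    rw [hFt, entryF_self, entryF_self, if_neg y1, if_neg y2, if_neg y3, if_neg y1, if_neg y2,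
      if_neg y3]
    ring

lemma RelC.compare (hR : Rel n ℓ h r t t) (hC : RelC n ℓ h r t) (hh : 0 ≤ h) (hl : h + 1 ≤ ℓ)
    (hln : ℓ ≤ n - r) (hr : 0 ≤ r) (hi1 : 1 ≤ i) (hin : i ≤ n) : Compare n ℓ h r i t t := by
  rcases eq_or_lt_of_le hr with rfl | hr
  · exact RelC.compare_zero hR hh hl
  have hcol := hC.colAll hR hh
  have hN := hC.noPair hR.1 hl
  rcases eq_or_lt_of_le hin with rfl | hi
  · exact hN.compare_short hcol hR hh hl hln hr
  by_cases h1 : t (h + 1) = i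
  · exact hN.compare_low_plus hcol hR hh hl hln hr hi1 hi h1
  by_cases h2 : t (h + 1) = 2 * n + 1 - i
  · exact hN.compare_high_plus hcol hR hh hl hln hr hi1 hi h2
  by_cases h3 : t (h + 1) = i + 1
  · exact hN.compare_low_minus hcol hR hh hl hr.le hi1 hi h3
  by_cases h4 : t (h + 1) = 2 * n + 2 - i
  · exact hN.compare_high_minus hcol hR hh hl hr.le hi1 hi h4
  refine hN.compare_of_sameMax hR hh hl h1 h2 (SameMax.of_eq fun L => ?_)
  rw [F_succ hh hl, entryF_of_lt hi, entryF_of_lt hi, if_neg h1, if_neg h2, if_neg h3, if_neg h4,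
    if_neg h1, if_neg h2, if_neg h3, if_neg h4]
  ring

/-- The operator `f̃_i` respects the relation. -/
lemma Rel.compare (hR : Rel n ℓ h r t s) (hh : 0 ≤ h) (hl : h + 1 ≤ ℓ)
    (hln : ℓ ≤ n - r) (hr : 0 ≤ r) (hi1 : 1 ≤ i) (hin : i ≤ n) : Compare n ℓ h r i t s := by
  rcases hR.2.2 with ⟨k, K, e, hA⟩ | ⟨k, K, d, hB⟩ | ⟨rfl, hC⟩
  · exact hA.compare hR hh hl hln hi1 hin
  · exact hB.compare hR hh hl hln hin
  · exact hC.compare hR hh hl hln hr hi1 hin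

end

end TypeB

namespace TypeB

/-! ### A single column -/

section

variable {n ℓ h r i : ℤ} {t : ℤ → ℤ} {c : ℤ}

lemma F_single (L : ℤ) : F n ℓ ℓ r i t L = colF n i t 1 ℓ L := by
  unfold F colF strand
  have : ∀ ρ θ, cnt t (ℓ + 1) ℓ ρ θ = 0 := fun ρ θ => cnt_eq_zero _ fun a h1 h2 => by omega
  simp [this]

lemma cnt_bump {lo hi : ℤ} (hlo : lo ≤ c) (hhi : c ≤ hi) (ρ θ : ℤ) : cnt (bump t c) lo hi ρ θ =
    cnt t lo hi ρ θ + ((if t c + 1 = ρ ∧ θ ≤ c then 1 else 0) - if t c = ρ ∧ θ ≤ c then 1 else 0) := by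
  unfold cnt
  rw [← Finset.add_sum_erase _ _ (Finset.mem_Icc.2 ⟨hlo, hhi⟩),
    ← Finset.add_sum_erase (a := c) _ (fun a => if t a = ρ ∧ θ ≤ a then (1 : ℤ) else 0)
      (Finset.mem_Icc.2 ⟨hlo, hhi⟩), bump_self]
  have : ∀ a ∈ (Finset.Icc lo hi).erase c, (if bump t c a = ρ ∧ θ ≤ a then (1 : ℤ) else 0) =
      if t a = ρ ∧ θ ≤ a then 1 else 0 := fun a ha => by
    rw [bump_of_ne _ (Finset.ne_of_mem_erase ha)]
  rw [Finset.sum_congr rfl this]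
  ring

lemma colF_bump {lo hi : ℤ} (hlo : lo ≤ c) (hhi : c ≤ hi) (x : ℤ) : colF n i (bump t c) lo hi x =
    colF n i t lo hi x + (entryF n i (t c + 1) c x - entryF n i (t c) c x) := by
  unfold colF strand entryF
  simp only [cnt_bump hlo hhi]
  by_cases h : i = n
  · simp only [if_pos h]; ring
  · simp only [if_neg h]; ring

/-- Both arrows with the same label, including the two arrows through `0` for the short root, lower
the partial sums by a step at the level of the letter and another at the next level. This is the
contribution of `A_{i,l}` at its own node. -/
lemma entryF_arrow (hi : i ≤ n) {y : ℤ} (hy : y = i ∨ y = 2 * n + 1 - i) (x : ℤ) :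
    entryF n i (y + 1) c x - entryF n i y c x =
      - stp ((if y ≤ n then 0 else n - i) - c) x - stp ((if y ≤ n then 0 else n - i) - c + 1) x := by
  rcases eq_or_lt_of_le hi with rfl | hi
  · rw [entryF_self, entryF_self]
    have h2 : stp (1 - c) x = stp (0 - c + 1) x := by congr 1; ring
    have h3 : stp (-c) x = stp (0 - c) x := by congr 1; ring
    rcases hy with rfl | rfl
    · rw [if_neg (by omega), if_pos rfl, if_neg (by omega), if_pos rfl, if_neg (by omega),
        if_neg (by omega), if_pos le_rfl, h2, h3]
      ring
    · rw [if_neg (by omega), if_neg (by omega), if_pos (by ring), if_neg (by omega),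
        if_pos (by ring), if_neg (by omega), if_neg (by omega), sub_self, h2, h3]
      ring
  · rw [entryF_of_lt hi, entryF_of_lt hi]
    rcases hy with rfl | rfl
    · rw [if_neg (by omega), if_pos rfl, if_neg (by omega), if_neg (by omega), if_pos rfl,
        if_neg (by omega), if_neg (by omega), if_neg (by omega), if_pos (by omega),
        show 0 - c = -c by ring, show 1 - c = -c + 1 by ring]
      ring
    · rw [if_neg (by omega), if_neg (by omega), if_neg (by omega), if_pos (by omega),
        if_neg (by omega), if_neg (by omega), if_pos rfl, if_neg (by omega), if_neg (by omega),
        show n - i + 1 - c = n - i - c + 1 by ring]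
      ring

lemma F_single_bump (hi : i ≤ n) (h1 : 1 ≤ c) (h2 : c ≤ ℓ) (hc : t c = i ∨ t c = 2 * n + 1 - i)
    (L : ℤ) : F n ℓ ℓ r i t L = F n ℓ ℓ r i (bump t c) L + stp (lev n ℓ r i (t c) c) L +
      stp (lev n ℓ r i (t c) c + 1) L := by
  rw [F_single, F_single, colF_bump h1 h2, entryF_arrow hi hc]
  unfold lev
  rw [if_pos h2, sub_zero]
  ring

/-- Taking back the replacement of an entry. -/
def unbump (t : ℤ → ℤ) (c : ℤ) : ℤ → ℤ := fun a => if a = c then t a - 1 else t a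

@[simp] lemma unbump_self (t : ℤ → ℤ) (c : ℤ) : unbump t c c = t c - 1 := by simp [unbump]

lemma unbump_of_ne (t : ℤ → ℤ) {a c : ℤ} (h : a ≠ c) : unbump t c a = t a := by simp [unbump, h]

lemma bump_unbump (t : ℤ → ℤ) (c : ℤ) : bump (unbump t c) c = t := by
  ext a; unfold bump unbump; split_ifs <;> omega

/-- With a single column only the order and the distance condition can fail, and only at the changed
entry: against its right neighbour, as the unbarred member of a pair, or as the barred one. -/
lemma tab_single_bump (hT : Tab n ℓ ℓ r t) (h1 : 1 ≤ c) (h2 : c ≤ ℓ) (h3 : t c ≤ 2 * n)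
    (hs : c + 1 ≤ ℓ → t c + 1 < t (c + 1) ∨ (t c = n ∧ t (c + 1) = n + 1))
    (hp : ∀ b, c < b → b ≤ ℓ → t b + t c = 2 * n + 1 → t c + 1 ≤ n → b - c ≠ n - t c - 1)
    (hp' : ∀ b, 1 ≤ b → b < c → t b + t c = 2 * n + 1 → t b ≤ n → c - b ≠ n - t b) :
    Tab n ℓ ℓ r (bump t c) where
  out a ha := by rw [bump_of_ne _ (by omega)]; exact hT.out a ha
  one_le a ha ha' := by have := hT.one_le a ha ha'; have := bump_cases t c a; omega
  le_top a ha ha' := by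
    have := hT.le_top a ha ha'
    rcases bump_cases t c a with ⟨rfl, h⟩ | h <;> omega
  step a ha ha' _ := by
    have h4 := hT.step a ha ha' (by omega)
    rcases bump_cases t c a with ⟨rfl, h5⟩ | ⟨h5, h6⟩
    · rw [h5, bump_of_ne _ (by omega)]
      have := hs ha'; omega
    · rcases bump_cases t c (a + 1) with ⟨rfl, h7⟩ | ⟨-, h8⟩ <;> omega
  col1 a b ha hab hb h4 h5 := by
    rcases bump_cases t c a with ⟨rfl, h6⟩ | ⟨h6, h7⟩
    · rw [h6] at h4 h5 ⊢
      rw [bump_of_ne _ (by omega)] at h5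
      have := hp b hab hb (by omega) h4
      omega
    · rw [h7] at h4 h5 ⊢
      rcases bump_cases t c b with ⟨rfl, h8⟩ | ⟨h8, h9⟩
      · exact hp' a ha hab (by omega) h4
      · exact hT.col1 a b ha hab hb h4 (by omega)
  col2 a b h4 h5 h6 := by omega
  col12 a b h4 h5 h6 h7 := by omega
  cross h4 h5 := by omega

lemma tab_single_unbump (hT : Tab n ℓ ℓ r t) (h1 : 1 ≤ c) (h2 : c ≤ ℓ) (h3 : 2 ≤ t c)
    (hs : 1 ≤ c - 1 → t (c - 1) < t c - 1 ∨ (t c = n + 2 ∧ t (c - 1) = n + 1))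
    (hp : ∀ b, c < b → b ≤ ℓ → t b + t c = 2 * n + 3 → t c ≤ n + 1 → b - c ≠ n - t c + 1)
    (hp' : ∀ b, 1 ≤ b → b < c → t b + t c = 2 * n + 3 → t b ≤ n → c - b ≠ n - t b) :
    Tab n ℓ ℓ r (unbump t c) where
  out a ha := by rw [unbump_of_ne _ (by omega)]; exact hT.out a ha
  one_le a ha ha' := by
    have := hT.one_le a ha ha'
    by_cases hac : a = c
    · subst hac; rw [unbump_self]; omega
    · rw [unbump_of_ne _ hac]; omega
  le_top a ha ha' := by
    have := hT.le_top a ha ha'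
    by_cases hac : a = c
    · subst hac; rw [unbump_self]; omega
    · rw [unbump_of_ne _ hac]; omega
  step a ha ha' _ := by
    have h4 := hT.step a ha ha' (by omega)
    by_cases h5 : a = c
    · subst h5
      rw [unbump_self, unbump_of_ne _ (by omega)]
      omega
    · rw [unbump_of_ne _ h5]
      by_cases h6 : a + 1 = c
      · subst h6
        rw [add_sub_cancel_right] at hs
        have := hs ha
        rw [unbump_self]; omega
      · rw [unbump_of_ne _ h6]; omega
  col1 a b ha hab hb h4 h5 := by
    by_cases h6 : a = c
    · subst h6
      rw [unbump_self] at h4 h5 ⊢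
      rw [unbump_of_ne _ (by omega)] at h5
      have := hp b hab hb (by omega) (by omega)
      omega
    · rw [unbump_of_ne _ h6] at h4 h5 ⊢
      by_cases h8 : b = c
      · subst h8
        rw [unbump_self] at h5
        exact hp' a ha hab (by omega) h4
      · rw [unbump_of_ne _ h8] at h5
        exact hT.col1 a b ha hab hb h4 (by omega)
  col2 a b h4 h5 h6 := by omega
  col12 a b h4 h5 h6 h7 := by omega
  cross h4 h5 := by omega

lemma lev_single (h2 : c ≤ ℓ) (y : ℤ) : lev n ℓ r i y c = (if y ≤ n then 0 else n - i) - c := by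
  unfold lev; rw [if_pos h2, sub_zero]

lemma exists_fstep_single {q : ℤ} (hT : Tab n ℓ ℓ r t) (h1 : 1 ≤ c) (h2 : c ≤ ℓ)
    (hc : t c = i ∨ t c = 2 * n + 1 - i) (hq : q = (if t c ≤ n then 0 else n - i) - c)
    (hmax : ∀ L, F n ℓ ℓ r i t L ≤ F n ℓ ℓ r i t q)
    (hmax' : ∀ L, L < q → F n ℓ ℓ r i t L < F n ℓ ℓ r i t q)
    (hpos : 0 < F n ℓ ℓ r i t q) (hT' : Tab n ℓ ℓ r (bump t c)) :
    ∃ t', FStep n ℓ ℓ r i t t' := by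
  rw [← lev_single (ℓ := ℓ) (r := r) h2] at hq
  subst hq
  exact ⟨_, hT, hT', c, ⟨h1, h2, hc, ⟨hmax, hmax'⟩, hpos⟩, rfl⟩

/-- Each of the two strands is zero, a step up or a step down, and in every positive case the first
maximum is at a step up. Its letter may be raised: the right neighbour leaves room since the strand
is not cancelled, and a violated distance condition is traced back to one that is already violated.
-/
lemma exists_fstep_single_lt (hT : Tab n ℓ ℓ r t) (hi1 : 1 ≤ i) (hi : i < n)
    (hpos : ∃ L, 0 < F n ℓ ℓ r i t L) : ∃ t', FStep n ℓ ℓ r i t t' := by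
  have hC := hT.colOne le_rfl
  obtain ⟨L₀, hL₀⟩ := hpos
  have hF : ∀ L, F n ℓ ℓ r i t L =
      strand t 1 ℓ i (-L) + strand t 1 ℓ (2 * n + 1 - i) (n - i - L) := fun L => by
    rw [F_single, colF_of_lt hi]
  have s1 : ∀ a L, stp (-L) a = stp (-a) L := fun a L => by unfold stp; split_ifs <;> omega
  have s2 : ∀ a L, stp (-L + 1) a = stp (1 - a) L := fun a L => by unfold stp; split_ifs <;> omega
  have s3 : ∀ a L, stp (n - i - L) a = stp (n - i - a) L := fun a L => by
    unfold stp; split_ifs <;> omega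
  have s4 : ∀ a L, stp (n - i - L + 1) a = stp (n - i + 1 - a) L := fun a L => by
    unfold stp; split_ifs <;> omega
  rcases strand_cases hC (ρ := i) (by omega) (by omega) with ⟨z1, z2⟩ | ⟨a, a1, a2, a3, a4, a5⟩ |
      ⟨a, a1, a2, a3, a4, a5⟩ <;>
    rcases strand_cases hC (ρ := 2 * n + 1 - i) (by omega) (by omega) with ⟨y1, y2⟩ |
      ⟨b, b1, b2, b3, b4, b5⟩ | ⟨b, b1, b2, b3, b4, b5⟩
  · rw [hF, z1, y1] at hL₀; omega
  · simp only [z1, b5, s3, zero_add] at hF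
    refine exists_fstep_single (c := b) (q := n - i - b) hT b1 b2 (Or.inr b3)
      (by rw [if_neg (by omega)]) (fun L => ?_) (fun L hL => ?_) ?_ (tab_single_bump hT b1 b2
        (by omega) (fun h1 => ?_) (fun b' h1 h2 h3 h4 => by omega) fun b' h1 h2 h3 h4 => ?_)
    · rw [hF, hF]; unfold stp; split_ifs <;> omega
    · rw [hF, hF]; unfold stp; split_ifs <;> omega
    · rw [hF]; unfold stp; split_ifs <;> omega
    · have := hC b b1 h1; have := b4 (b + 1) (by omega) h1; omega
    -- A letter `i` at the forbidden distance is followed by `i + 1`, which together with the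
    -- unraised bar of `i + 1` is a forbidden pair of `t`.
    · obtain ⟨h5, h6⟩ := (z2 b' h1 (by omega)).1 (by omega)
      have : b' + 1 ≠ b := fun h => by rw [h] at h6; omega
      have := hT.col1 (b' + 1) b (by omega) (by omega) b2 (by omega) (by omega)
      omega
  · rw [hF, z1, b5] at hL₀; have := stp_nonneg (n - i - L₀ + 1) b; omega
  · simp only [y1, a5, s1, add_zero] at hF
    refine exists_fstep_single (c := a) (q := - a) hT a1 a2 (Or.inl a3)
      (by rw [if_pos (by omega), zero_sub]) (fun L => ?_) (fun L hL => ?_) ?_ (tab_single_bump hT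
        a1 a2 (by omega) (fun h1 => ?_) (fun b' h1 h2 h3 h4 => ?_) fun b' h1 h2 h3 h4 => by omega)
    · rw [hF, hF]; unfold stp; split_ifs <;> omega
    · rw [hF, hF]; unfold stp; split_ifs <;> omega
    · rw [hF]; unfold stp; split_ifs <;> omega
    · have := hC a a1 h1; have := a4 (a + 1) (by omega) h1; omega
    · obtain ⟨h5, h6⟩ := (y2 b' (by omega) h2).1 (by omega)
      have := hT.col1 a (b' + 1) (by omega) (by omega) h5 (by omega) (by omega)
      omega
  · simp only [a5, b5, s1, s3] at hF
    -- With two steps up the first maximum is at the later one, and its letter is raised.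
    by_cases hab : n - i - b ≤ -a
    · refine exists_fstep_single (c := a) (q := - a) hT a1 a2 (Or.inl a3)
        (by rw [if_pos (by omega), zero_sub]) (fun L => ?_) (fun L hL => ?_) ?_ (tab_single_bump hT
        a1 a2 (by omega) (fun h1 => ?_) (fun b' h1 h2 h3 h4 => ?_) fun b' h1 h2 h3 h4 => by omega)
      · rw [hF, hF]; unfold stp; split_ifs <;> omega
      · rw [hF, hF]; unfold stp; split_ifs <;> omega
      · rw [hF]; unfold stp; split_ifs <;> omega
      · have := hC a a1 h1; have := a4 (a + 1) (by omega) h1; omega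
      · have := hC.eq_of_eq (a := b') (b := b) (by omega) h2 b1 b2 (by omega) (by omega); omega
    · refine exists_fstep_single (c := b) (q := n - i - b) hT b1 b2 (Or.inr b3)
        (by rw [if_neg (by omega)]) (fun L => ?_) (fun L hL => ?_) ?_ (tab_single_bump hT b1 b2
        (by omega) (fun h1 => ?_) (fun b' h1 h2 h3 h4 => by omega) fun b' h1 h2 h3 h4 => ?_)
      · rw [hF, hF]; unfold stp; split_ifs <;> omega
      · rw [hF, hF]; unfold stp; split_ifs <;> omega
      · rw [hF]; unfold stp; split_ifs <;> omega
      · have := hC b b1 h1; have := b4 (b + 1) (by omega) h1; omega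
      · have := hC.eq_of_eq (a := b') (b := a) h1 (by omega) a1 a2 (by omega) (by omega); omega
  · simp only [a5, b5, s1, s4] at hF
    have hab : -a < n - i + 1 - b := by
      rw [hF] at hL₀; unfold stp at hL₀; split_ifs at hL₀ <;> omega
    refine exists_fstep_single (c := a) (q := - a) hT a1 a2 (Or.inl a3)
      (by rw [if_pos (by omega), zero_sub]) (fun L => ?_) (fun L hL => ?_) ?_ (tab_single_bump hT
        a1 a2 (by omega) (fun h1 => ?_) (fun b' h1 h2 h3 h4 => ?_) fun b' h1 h2 h3 h4 => by omega)
    · rw [hF, hF]; unfold stp; split_ifs <;> omega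
    · rw [hF, hF]; unfold stp; split_ifs <;> omega
    · rw [hF]; unfold stp; split_ifs <;> omega
    · have := hC a a1 h1; have := a4 (a + 1) (by omega) h1; omega
    · exact absurd (by omega) (b4 b' (by omega) h2)
  · rw [hF, y1, a5] at hL₀; have := stp_nonneg (-L₀ + 1) a; omega
  · simp only [a5, b5, s2, s3] at hF
    have hab : n - i - b < 1 - a := by
      rw [hF] at hL₀; unfold stp at hL₀; split_ifs at hL₀ <;> omega
    refine exists_fstep_single (c := b) (q := n - i - b) hT b1 b2 (Or.inr b3)
      (by rw [if_neg (by omega)]) (fun L => ?_) (fun L hL => ?_) ?_ (tab_single_bump hT b1 b2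
        (by omega) (fun h1 => ?_) (fun b' h1 h2 h3 h4 => by omega) fun b' h1 h2 h3 h4 => ?_)
    · rw [hF, hF]; unfold stp; split_ifs <;> omega
    · rw [hF, hF]; unfold stp; split_ifs <;> omega
    · rw [hF]; unfold stp; split_ifs <;> omega
    · have := hC b b1 h1; have := b4 (b + 1) (by omega) h1; omega
    · exact absurd (by omega) (a4 b' h1 (by omega))
  · rw [hF, a5, b5] at hL₀
    have := stp_nonneg (-L₀ + 1) a; have := stp_nonneg (n - i - L₀ + 1) b; omega

/-- By the shape of the zero block a positive sum means that the bar of `n` is absent, and either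
`n` is present and is raised, or the last zero of a nonempty block is raised. -/
lemma exists_fstep_single_self (hT : Tab n ℓ ℓ r t) (hℓ : 0 ≤ ℓ) (hn : 1 ≤ n)
    (hpos : ∃ L, 0 < F n ℓ ℓ r n t L) : ∃ t', FStep n ℓ ℓ r n t t' := by
  have hC := hT.colOne le_rfl
  obtain ⟨L₀, hL₀⟩ := hpos
  obtain ⟨z, z', u, u', Z⟩ := hC.exists_zeroBlock (by omega)
  have hF : ∀ L, F n ℓ ℓ r n t L = u * stp (1 - z) L + u' * stp (1 - z') L := fun L => by
    rw [F_single, Z.colF_eq]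
  have i1 := Z.lo_le
  have i2 := Z.le
  have i3 := Z.le_hi
  rcases Z.left with ⟨rfl, j1, j2⟩ | ⟨rfl, j1⟩
  · rcases Z.right with ⟨rfl, j3, j4⟩ | ⟨rfl, j3⟩
    · rw [hF] at hL₀; unfold stp at hL₀; split_ifs at hL₀ <;> omega
    · refine exists_fstep_single (c := z - 1) (q := 1 - z) hT j1 (by omega) (Or.inl j2)
        (by rw [if_pos (by omega)]; ring) (fun L => ?_) (fun L hL => ?_) ?_ (tab_single_bump hT
          j1 (by omega) (by omega) (fun h1 => ?_) (fun b h1 h2 h3 h4 => by omega)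
          fun b h1 h2 h3 h4 => by omega)
      · rw [hF, hF]; unfold stp; split_ifs <;> omega
      · rw [hF, hF]; unfold stp; split_ifs <;> omega
      · rw [hF]; unfold stp; split_ifs <;> omega
      · have := hC (z - 1) j1 h1; omega
  · rcases Z.right with ⟨rfl, j3, j4⟩ | ⟨rfl, j3⟩
    · rw [hF] at hL₀; unfold stp at hL₀; split_ifs at hL₀ <;> omega
    · have hlt : z < z' := by
        by_contra h1
        have : z = z' := by omega
        subst this; rw [hF] at hL₀; omega
      have := Z.cut (z' - 1) (by omega) (by omega)
      have := Z.cut' (z' - 1) (by omega) (by omega)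
      have e : t (z' - 1) = n + 1 := by omega
      refine exists_fstep_single (c := z' - 1) (q := 1 - z') hT (by omega) (by omega)
        (Or.inr (by omega)) (by rw [if_neg (by omega)]; ring) (fun L => ?_) (fun L hL => ?_) ?_
        (tab_single_bump hT (by omega) (by omega) (by omega) (fun h1 => ?_)
        (fun b h1 h2 h3 h4 => by omega) fun b h1 h2 h3 h4 => ?_)
      · rw [hF, hF]; unfold stp; split_ifs <;> omega
      · rw [hF, hF]; unfold stp; split_ifs <;> omega
      · rw [hF]; unfold stp; split_ifs <;> omega
      · rw [sub_add_cancel] at h1 ⊢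
        have := j3 z' (by omega) h1; have := Z.cut' z' (by omega) h1; omega
      · exact absurd (by omega) (j1 b h1 (by omega))

/-- The function `G` is the partial sum of the sequence with the entry lowered again, written in
terms of `t`. A step into `t` exists as soon as `G` has its first maximum at the place of that
entry. -/
lemma exists_fstep_to_single (hT : Tab n ℓ ℓ r t) (h1 : 1 ≤ c) (h2 : c ≤ ℓ) (hi : i ≤ n)
    (hc : t c = i + 1 ∨ t c = 2 * n + 2 - i) {q : ℤ} {G : ℤ → ℤ}
    (hq : q = (if t c ≤ n + 1 then 0 else n - i) - c)
    (hG : ∀ L, G L = F n ℓ ℓ r i t L + stp q L + stp (q + 1) L)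
    (hmax : ∀ L, G L ≤ G q) (hmax' : ∀ L, L < q → G L < G q)
    (hpos : 0 < G q) (hT' : Tab n ℓ ℓ r (unbump t c)) :
    ∃ t', FStep n ℓ ℓ r i t' t := by
  have hlet : unbump t c c = i ∨ unbump t c c = 2 * n + 1 - i := by rw [unbump_self]; omega
  have hq' : q = (if unbump t c c ≤ n then 0 else n - i) - c := by
    rw [hq, unbump_self]; split_ifs <;> omega
  have e : ∀ L, F n ℓ ℓ r i (unbump t c) L = G L := fun L => by
    have h3 := F_single_bump (r := r) (ℓ := ℓ) hi h1 h2 hlet L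
    rw [bump_unbump, lev_single h2, ← hq'] at h3
    rw [h3, hG]
  refine ⟨unbump t c, hT', hT, c, ⟨h1, h2, hlet, ?_, ?_⟩, (bump_unbump t c).symm⟩
  · rw [lev_single h2, ← hq']
    exact ⟨fun L => by rw [e, e]; exact hmax L, fun L hL => by rw [e, e]; exact hmax' L hL⟩
  · rw [lev_single h2, ← hq', e]; exact hpos

end

end TypeB

/-! ### A single column: lowering operators and the source. -/

namespace TypeB

section

variable {n ℓ h r i : ℤ} {t : ℤ → ℤ} {c : ℤ}

/-- A value above the final one requires an uncancelled step down. Lowering its letter turns the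
step down into a step up one place earlier, which is then the first maximum. -/
lemma exists_fstep_to_single_lt (hT : Tab n ℓ ℓ r t) (hi1 : 1 ≤ i) (hi : i < n)
    (hpos : ∃ L, F n ℓ ℓ r i t n < F n ℓ ℓ r i t L) : ∃ t', FStep n ℓ ℓ r i t' t := by
  have hC := hT.colOne le_rfl
  obtain ⟨L₀, hL₀⟩ := hpos
  have hF : ∀ L, F n ℓ ℓ r i t L =
      strand t 1 ℓ i (-L) + strand t 1 ℓ (2 * n + 1 - i) (n - i - L) := fun L => by
    rw [F_single, colF_of_lt hi]
  have s1 : ∀ a L, stp (-L) a = stp (-a) L := fun a L => by unfold stp; split_ifs <;> omega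
  have s2 : ∀ a L, stp (-L + 1) a = stp (1 - a) L := fun a L => by unfold stp; split_ifs <;> omega
  have s3 : ∀ a L, stp (n - i - L) a = stp (n - i - a) L := fun a L => by
    unfold stp; split_ifs <;> omega
  have s4 : ∀ a L, stp (n - i - L + 1) a = stp (n - i + 1 - a) L := fun a L => by
    unfold stp; split_ifs <;> omega
  rcases strand_cases hC (ρ := i) (by omega) (by omega) with ⟨z1, z2⟩ | ⟨a, a1, a2, a3, a4, a5⟩ |
      ⟨a, a1, a2, a3, a4, a5⟩ <;>
    rcases strand_cases hC (ρ := 2 * n + 1 - i) (by omega) (by omega) with ⟨y1, y2⟩ |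
      ⟨b, b1, b2, b3, b4, b5⟩ | ⟨b, b1, b2, b3, b4, b5⟩
  · rw [hF, hF, z1, y1, z1, y1] at hL₀; omega
  · simp only [hF, z1, b5] at hL₀; unfold stp at hL₀; split_ifs at hL₀ <;> omega
  · simp only [z1, b5, s4, zero_add] at hF
    refine exists_fstep_to_single (c := b) (q := n - i - b) (G := fun L => stp (n - i - b) L) hT b1 b2
      hi.le (Or.inr (by omega)) (by rw [if_neg (by omega)]) (fun L => ?_) (fun L => ?_)
      (fun L hL => ?_) ?_ (tab_single_unbump hT b1 b2 (by omega) (fun h1 => ?_)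
      (fun b' h1 h2 h3 h4 => by omega) fun b' h1 h2 h3 h4 => ?_)
    · rw [hF, show n - i - b + 1 = n - i + 1 - b by ring]; ring
    · unfold stp; split_ifs <;> omega
    · unfold stp; split_ifs <;> omega
    · simp [stp]
    · have := b4 (b - 1) h1 (by omega); have := hC (b - 1) h1 (by omega)
      rw [sub_add_cancel] at this; omega
    · obtain ⟨h5, h6⟩ := (z2 b' h1 (by omega)).2 (by omega)
      have := hT.col1 (b' - 1) b (by omega) (by omega) b2 (by omega) (by omega)
      omega
  · simp only [hF, y1, a5] at hL₀; unfold stp at hL₀; split_ifs at hL₀ <;> omega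
  · simp only [hF, a5, b5] at hL₀; unfold stp at hL₀; split_ifs at hL₀ <;> omega
  · simp only [a5, b5, s1, s4] at hF
    have hab : -a < n - i + 1 - b := by
      rw [hF, hF] at hL₀; unfold stp at hL₀; split_ifs at hL₀ <;> omega
    refine exists_fstep_to_single (c := b) (q := n - i - b)
      (G := fun L => stp (-a) L + stp (n - i - b) L) hT b1 b2
      hi.le (Or.inr (by omega)) (by rw [if_neg (by omega)]) (fun L => ?_) (fun L => ?_)
      (fun L hL => ?_) ?_ (tab_single_unbump hT b1 b2 (by omega) (fun h1 => ?_)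
      (fun b' h1 h2 h3 h4 => by omega) fun b' h1 h2 h3 h4 => ?_)
    · rw [hF, show n - i - b + 1 = n - i + 1 - b by ring]; ring
    · unfold stp; split_ifs <;> omega
    · unfold stp; split_ifs <;> omega
    · unfold stp; split_ifs <;> omega
    · have := b4 (b - 1) h1 (by omega); have := hC (b - 1) h1 (by omega)
      rw [sub_add_cancel] at this; omega
    · exact absurd (by omega) (a4 b' h1 (by omega))
  · simp only [y1, a5, s2, add_zero] at hF
    refine exists_fstep_to_single (c := a) (q := - a) (G := fun L => stp (-a) L) hT a1 a2
      hi.le (Or.inl a3) (by rw [if_pos (by omega), zero_sub]) (fun L => ?_) (fun L => ?_)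
      (fun L hL => ?_) ?_ (tab_single_unbump hT a1 a2 (by omega) (fun h1 => ?_)
      (fun b' h1 h2 h3 h4 => ?_) fun b' h1 h2 h3 h4 => by omega)
    · rw [hF, show -a + 1 = 1 - a by ring]; ring
    · unfold stp; split_ifs <;> omega
    · unfold stp; split_ifs <;> omega
    · simp [stp]
    · have := a4 (a - 1) h1 (by omega); have := hC (a - 1) h1 (by omega)
      rw [sub_add_cancel] at this; omega
    · obtain ⟨h5, h6⟩ := (y2 b' (by omega) h2).2 (by omega)
      have : b' - 1 ≠ a := fun h => by rw [h] at h6; omega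
      have := hT.col1 a (b' - 1) (by omega) (by omega) (by omega) (by omega) (by omega)
      omega
  · simp only [a5, b5, s2, s3] at hF
    have hab : n - i - b < 1 - a := by
      rw [hF, hF] at hL₀; unfold stp at hL₀; split_ifs at hL₀ <;> omega
    refine exists_fstep_to_single (c := a) (q := - a)
      (G := fun L => stp (-a) L + stp (n - i - b) L) hT a1 a2
      hi.le (Or.inl a3) (by rw [if_pos (by omega), zero_sub]) (fun L => ?_) (fun L => ?_)
      (fun L hL => ?_) ?_ (tab_single_unbump hT a1 a2 (by omega) (fun h1 => ?_)
      (fun b' h1 h2 h3 h4 => ?_) fun b' h1 h2 h3 h4 => by omega)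
    · rw [hF, show -a + 1 = 1 - a by ring]; ring
    · unfold stp; split_ifs <;> omega
    · unfold stp; split_ifs <;> omega
    · unfold stp; split_ifs <;> omega
    · have := a4 (a - 1) h1 (by omega); have := hC (a - 1) h1 (by omega)
      rw [sub_add_cancel] at this; omega
    · exact absurd (by omega) (b4 b' (by omega) h2)
  · simp only [a5, b5, s2, s4] at hF
    -- With two steps down the last maximum precedes the earlier one, and its letter is lowered.
    by_cases hab : n - i + 1 - b ≤ 1 - a
    · refine exists_fstep_to_single (c := b) (q := n - i - b)
        (G := fun L => stp (n - i - b) L - stp (1 - a) L) hT b1 b2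
        hi.le (Or.inr (by omega)) (by rw [if_neg (by omega)]) (fun L => ?_) (fun L => ?_)
        (fun L hL => ?_) ?_ (tab_single_unbump hT b1 b2 (by omega) (fun h1 => ?_)
        (fun b' h1 h2 h3 h4 => by omega) fun b' h1 h2 h3 h4 => ?_)
      · rw [hF, show n - i - b + 1 = n - i + 1 - b by ring]; ring
      · unfold stp; split_ifs <;> omega
      · unfold stp; split_ifs <;> omega
      · unfold stp; split_ifs <;> omega
      · have := b4 (b - 1) h1 (by omega); have := hC (b - 1) h1 (by omega)
        rw [sub_add_cancel] at this; omega
      · have := hC.eq_of_eq (a := b') (b := a) h1 (by omega) a1 a2 (by omega) (by omega); omega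
    · refine exists_fstep_to_single (c := a) (q := - a)
        (G := fun L => stp (-a) L - stp (n - i + 1 - b) L) hT a1 a2
        hi.le (Or.inl a3) (by rw [if_pos (by omega), zero_sub]) (fun L => ?_) (fun L => ?_)
        (fun L hL => ?_) ?_ (tab_single_unbump hT a1 a2 (by omega) (fun h1 => ?_)
        (fun b' h1 h2 h3 h4 => ?_) fun b' h1 h2 h3 h4 => by omega)
      · rw [hF, show -a + 1 = 1 - a by ring]; ring
      · unfold stp; split_ifs <;> omega
      · unfold stp; split_ifs <;> omega
      · unfold stp; split_ifs <;> omega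
      · have := a4 (a - 1) h1 (by omega); have := hC (a - 1) h1 (by omega)
        rw [sub_add_cancel] at this; omega
      · have := hC.eq_of_eq (a := b') (b := b) (by omega) h2 b1 b2 (by omega) (by omega); omega

lemma exists_fstep_to_single_self (hT : Tab n ℓ ℓ r t) (hℓ : 0 ≤ ℓ) (hn : 2 ≤ n)
    (hpos : ∃ L, F n ℓ ℓ r n t n < F n ℓ ℓ r n t L) : ∃ t', FStep n ℓ ℓ r n t' t := by
  have hC := hT.colOne le_rfl
  obtain ⟨L₀, hL₀⟩ := hpos
  obtain ⟨z, z', u, u', Z⟩ := hC.exists_zeroBlock (by omega)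
  have hF : ∀ L, F n ℓ ℓ r n t L = u * stp (1 - z) L + u' * stp (1 - z') L := fun L => by
    rw [F_single, Z.colF_eq]
  have i1 := Z.lo_le
  have i2 := Z.le
  have i3 := Z.le_hi
  rw [hF, hF] at hL₀
  rcases Z.left with ⟨rfl, j1, j2⟩ | ⟨rfl, j1⟩
  · rcases Z.right with ⟨rfl, j3, j4⟩ | ⟨rfl, j3⟩
    · unfold stp at hL₀; split_ifs at hL₀ <;> omega
    · unfold stp at hL₀; split_ifs at hL₀ <;> omega
  · rcases Z.right with ⟨rfl, j3, j4⟩ | ⟨rfl, j3⟩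
    · refine exists_fstep_to_single (c := z') (q := - z')
        (G := fun L => stp (-z') L - stp (1 - z) L) hT (by omega) j3
        le_rfl (Or.inr (by omega)) (by rw [if_neg (by omega)]; ring) (fun L => ?_) (fun L => ?_)
        (fun L hL => ?_) ?_ (tab_single_unbump hT (by omega) j3 (by omega) (fun h1 => ?_)
        (fun b h1 h2 h3 h4 => by omega) fun b h1 h2 h3 h4 => ?_)
      · rw [hF, show -z' + 1 = 1 - z' by ring]; ring
      · unfold stp; split_ifs <;> omega
      · unfold stp; split_ifs <;> omega
      · unfold stp; split_ifs <;> omega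
      · have := Z.cut' (z' - 1) h1 (by omega); omega
      · exact absurd (by omega) (j1 b h1 (by omega))
    · have hlt : z < z' := by
        by_contra h1
        have : z = z' := by omega
        subst this; unfold stp at hL₀; split_ifs at hL₀ <;> omega
      have := Z.cut z (by omega) (by omega)
      have := Z.cut' z (by omega) (by omega)
      have e : t z = n + 1 := by omega
      refine exists_fstep_to_single (c := z) (q := - z)
        (G := fun L => stp (-z) L + stp (1 - z') L) hT (by omega) (by omega)
        le_rfl (Or.inl (by omega)) (by rw [if_pos (by omega)]; ring) (fun L => ?_) (fun L => ?_)
        (fun L hL => ?_) ?_ (tab_single_unbump hT (by omega) (by omega) (by omega) (fun h1 => ?_)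
        (fun b h1 h2 h3 h4 => ?_) fun b h1 h2 h3 h4 => ?_)
      · rw [hF, show -z + 1 = 1 - z by ring]; ring
      · unfold stp; split_ifs <;> omega
      · unfold stp; split_ifs <;> omega
      · unfold stp; split_ifs <;> omega
      · have := Z.cut (z - 1) h1 (by omega); have := j1 (z - 1) h1 (by omega); omega
      · have := j3 b (by omega) h2; omega
      · have := Z.cut b h1 (by omega); omega

/-- The first maximum determines the level. Two letters of different arrows on the same level have
the distance for which raising the barred one violates the condition on pairs. -/
lemma FStep.single_unique {t₁ t₂ : ℤ → ℤ} (h1 : FStep n ℓ ℓ r i t t₁) (h2 : FStep n ℓ ℓ r i t t₂)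
    (hin : i ≤ n) : t₁ = t₂ := by
  obtain ⟨hT, hT₁, c, hc, rfl⟩ := h1
  obtain ⟨-, hT₂, d, hd, rfl⟩ := h2
  have h3 := hc.isFirstMax.unique hd.isFirstMax
  rw [lev_single hc.le, lev_single hd.le] at h3
  have h4 := hc.letter
  have h5 := hd.letter
  by_cases hcd : c = d
  · rw [hcd]
  exfalso
  by_cases h6 : t c ≤ n <;> by_cases h7 : t d ≤ n
  · rw [if_pos h6, if_pos h7] at h3; omega
  · rw [if_pos h6, if_neg h7] at h3
    have := hT₂.col1 c d hc.one_le (by omega) hd.le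
    rw [bump_of_ne _ hcd, bump_self] at this
    omega
  · rw [if_neg h6, if_pos h7] at h3
    have := hT₁.col1 d c hd.one_le (by omega) hc.le
    rw [bump_of_ne _ (Ne.symm hcd), bump_self] at this
    omega
  · rw [if_neg h6, if_neg h7] at h3; omega

/-- The sequence `1, 2, …, ℓ`. -/
def highest (ℓ : ℤ) : ℤ → ℤ := fun a => if 1 ≤ a ∧ a ≤ ℓ then a else 0

/-- An uncancelled `i + 1` is a step down at `1 - a`. The hypothesis on the bar of `i + 1` puts its
step up before this point, so it cannot compensate, and the final value is not the maximum. -/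
lemma exists_lt_of_run (hT : Tab n ℓ ℓ r t) (hi1 : 1 ≤ i) (hi : i < n) {a : ℤ} (ha : 1 ≤ a)
    (ha' : a ≤ ℓ) (hta : t a = i + 1) (hpred : 1 ≤ a - 1 → t (a - 1) ≠ i)
    (hb : ∀ b, 1 ≤ b → b ≤ ℓ → t b = 2 * n + 1 - i → n - i + a ≤ b) :
    ∃ L, F n ℓ ℓ r i t n < F n ℓ ℓ r i t L := by
  have hC := hT.colOne le_rfl
  have hF : ∀ L, F n ℓ ℓ r i t L =
      strand t 1 ℓ i (-L) + strand t 1 ℓ (2 * n + 1 - i) (n - i - L) := fun L => by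
    rw [F_single, colF_of_lt hi]
  have h1 : ∀ θ, strand t 1 ℓ i θ = -stp (θ + 1) a := fun θ =>
    strand_minus hC (by omega) (by omega) θ ha ha' hta hpred
  simp only [h1] at hF
  rcases strand_cases hC (ρ := 2 * n + 1 - i) (by omega) (by omega) with ⟨y1, y2⟩ |
      ⟨b, b1, b2, b3, b4, b5⟩ | ⟨b, b1, b2, b3, b4, b5⟩
  · refine ⟨-a, ?_⟩
    rw [hF, hF, y1, y1]
    unfold stp; split_ifs <;> omega
  · refine ⟨n - i - b, ?_⟩
    have := hb b b1 b2 b3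
    rw [hF, hF, b5, b5]
    unfold stp; split_ifs <;> omega
  · refine ⟨min (-a) (n - i - b), ?_⟩
    rw [hF, hF, b5, b5]
    unfold stp; split_ifs <;> omega

/-- In a source there is no letter `n`, as the first letter of the run ending in `n` could be
lowered. Node `n` then excludes zeros and the bar of `n`. The first barred letter could be lowered
too, so only letters below `n` remain, and the first one exceeding its position could be lowered. -/
lemma eq_highest_of_single (hT : Tab n ℓ ℓ r t) (hℓ : 0 ≤ ℓ) (hln : ℓ + 1 ≤ n)
    (hE : ∀ i, 1 ≤ i → i ≤ n → ¬ ∃ L, F n ℓ ℓ r i t n < F n ℓ ℓ r i t L) : t = highest ℓ := by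
  have hC := hT.colOne le_rfl
  have h1 : ∀ a, 1 ≤ a → a ≤ ℓ → t a ≠ n := fun p h1 h2 h3 => by
    obtain ⟨a, ⟨h4, h5, h6⟩, h7⟩ := Int.exists_least_of_bdd
      (P := fun a => 1 ≤ a ∧ a ≤ p ∧ t a = n - p + a) ⟨1, fun z hz => hz.1⟩
      ⟨p, h1, le_rfl, by omega⟩
    -- The run ends with `n` at `p`, so its first letter, at `a`, is `n - p + a`. The node is at
    -- least 1 because `p ≤ ℓ < n`.
    refine hE (n - p + a - 1) (by omega) (by omega) (exists_lt_of_run hT (a := a) (by omega)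
      (by omega) h4 (by omega) (by omega) (fun h8 h9 => ?_) fun b h8 h9 h10 => ?_)
    · have := h7 (a - 1) ⟨h8, by omega, by omega⟩; omega
    · have : p < b := by
        by_contra h11
        have := hC.le h8 (not_lt.1 h11) h2
        omega
      omega
  obtain ⟨z, z', u, u', Z⟩ := hC.exists_zeroBlock (by omega)
  have hF : ∀ L, F n ℓ ℓ r n t L = u * stp (1 - z) L + u' * stp (1 - z') L := fun L => by
    rw [F_single, Z.colF_eq]
  have i1 := Z.lo_le
  have i2 := Z.le
  have i3 := Z.le_hi
  have hu : u = -1 := by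
    rcases Z.left with ⟨-, h2, h3⟩ | h2
    · exact absurd h3 (h1 _ h2 (by omega))
    · exact h2.1
  subst hu
  have hE' := hE n (by omega) le_rfl
  obtain ⟨hu', h2⟩ : u' = 1 ∧ ∀ a, 1 ≤ a → a ≤ ℓ → t a ≠ n + 2 := by
    rcases Z.right with ⟨rfl, h2, h3⟩ | h2
    · refine absurd ⟨-ℓ - 1, ?_⟩ hE'
      rw [hF, hF]; unfold stp; split_ifs <;> omega
    · exact h2
  subst hu'
  have hzz : z = z' := by
    by_contra h3
    refine hE' ⟨1 - z', ?_⟩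
    rw [hF, hF]; unfold stp; split_ifs <;> omega
  subst hzz
  have hz : z = ℓ + 1 := by
    by_contra h3
    have h4 := Z.cut' z i1 (by omega)
    have h5 := h2 z i1 (by omega)
    have h6 := hT.le_top z i1 (by omega)
    obtain ⟨i, hi⟩ : ∃ i, t z = 2 * n + 2 - i := ⟨2 * n + 2 - t z, by ring⟩
    refine hE i (by omega) (by omega) ⟨n - i - z, ?_⟩
    have hnb : ∀ b, 1 ≤ b → b ≤ ℓ → t b ≠ 2 * n + 1 - i := fun b h7 h8 h9 => by
      have h10 := Z.cut b h7 h8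
      have := hC.le (a := z) (b := b) (by omega) (by omega) h8
      omega
    have hF' : ∀ L, F n ℓ ℓ r i t L = strand t 1 ℓ i (-L) - stp (n - i - L + 1) z := fun L => by
      rw [F_single, colF_of_lt (by omega), strand_minus hC (ρ := 2 * n + 1 - i) (by omega)
        (by omega) _ i1 (by omega) (by omega) fun h7 => hnb _ h7 (by omega)]
      ring
    rw [hF', hF']
    rcases strand_cases hC (ρ := i) (by omega) (by omega) with ⟨y1, y2⟩ |
      ⟨a, b1, b2, b3, b4, b5⟩ | ⟨a, b1, b2, b3, b4, b5⟩
    · rw [y1, y1]; unfold stp; split_ifs <;> omega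
    · have h7 := Z.cut a b1 b2
      have h8 := Z.cut (z - 1) (by omega) (by omega)
      have h9 := h1 (z - 1) (by omega) (by omega)
      have : z - a ≤ n - i := by
        rcases eq_or_lt_of_le (show a ≤ z - 1 by omega) with h10 | h10
        · omega
        · have := hC.cmp b1 h10 (by omega); omega
      rw [b5, b5]; unfold stp; split_ifs <;> omega
    · rw [b5, b5]; unfold stp; split_ifs <;> omega
  ext a
  unfold highest
  split_ifs with ha
  · by_contra hne
    obtain ⟨a, ⟨h4, h5, h6⟩, h7⟩ := Int.exists_least_of_bdd
      (P := fun a => 1 ≤ a ∧ a ≤ ℓ ∧ t a ≠ a) ⟨1, fun z hz => hz.1⟩ ⟨a, ha.1, ha.2, hne⟩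
    have h8 : 1 ≤ a - 1 → t (a - 1) = a - 1 := fun h9 => by
      by_contra h10
      have := h7 (a - 1) ⟨h9, by omega, h10⟩; omega
    have h9 := Z.cut a h4 h5
    have h10 := h1 a h4 h5
    have h11 := hT.one_le a h4 h5
    have h12 : a < t a := by
      rcases eq_or_lt_of_le h4 with rfl | h13
      · omega
      · have := h8 (by omega)
        have := hC (a - 1) (by omega) (by omega)
        rw [sub_add_cancel] at this
        omega
    refine hE (t a - 1) (by omega) (by omega) (exists_lt_of_run hT (a := a) (by omega) (by omega)
      h4 h5 (by ring) (fun h13 => ?_) fun b h13 h14 h15 => ?_)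
    · have := h8 h13; omega
    · have := Z.cut b h13 h14; omega
  · exact hT.out a ha

end

end TypeB

namespace TypeB

/-! ### The monomials of the boxes -/

section

variable {n : ℕ}

lemma φL_ext {m m' : Monomial n} (h : ∀ i L, φL i L m = φL i L m') : m = m' := by
  have key : ∀ (i : Fin n) (l : ℤ) (m : Monomial n), φL i l m - φL i (l - 1) m = m (i, l) := by
    intro i l m
    unfold φL Finsupp.sum
    rw [← Finset.sum_sub_distrib]
    have : ∀ x ∈ m.support, ((if x.1 = i ∧ x.2 ≤ l then m x else 0) -
        if x.1 = i ∧ x.2 ≤ l - 1 then m x else 0) = if x = (i, l) then m x else 0 := by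
      intro x _
      by_cases h1 : x = (i, l)
      · subst h1; simp
      · rw [if_neg h1]
        by_cases h2 : x.1 = i
        · have h3 : x.2 ≠ l := fun h => h1 (Prod.ext h2 h)
          simp only [h2, true_and]
          split_ifs <;> omega
        · simp [h2]
    rw [Finset.sum_congr rfl this, Finset.sum_ite_eq']
    split_ifs with h1
    · rfl
    · exact (Finsupp.notMem_support_iff.1 h1).symm
  ext ⟨i, l⟩
  rw [← key, ← key, h, h]

lemma φL_Y (i : Fin n) (L : ℤ) (k : ℕ) (l : ℤ) :
    φL i L (Y n k l) = if (i : ℕ) + 1 = k then stp l L else 0 := by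
  have hi := i.isLt
  unfold Y stp
  split_ifs with h1 h2 h3 h2 h3
  · rw [φL_single, if_pos ⟨Fin.ext (by simp only; omega), h3⟩]
  · rw [φL_single, if_neg fun h => h3 h.2]
  · rw [φL_single, if_neg]
    rintro ⟨h3, h4⟩
    refine h2 ?_
    rw [← h3]; simp only; omega
  · omega
  · omega
  · exact φL_zero i L

lemma cartan_eq (j i : Fin n) (hij : j ≠ i) : cartan n j i =
    if (i : ℕ) = j + 1 then -1 else if (j : ℕ) = i + 1 then (if (j : ℕ) + 1 = n then -2 else -1)
    else 0 := by
  have hi := i.isLt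
  have hj := j.isLt
  have h1 : (i : ℕ) ≠ j := fun h => hij (Fin.ext h.symm)
  unfold cartan CartanMatrix.B
  simp only [Matrix.transpose_apply, Matrix.of_apply]
  split_ifs <;> omega

lemma φL_two_nsmul (j : Fin n) (L : ℤ) (m : Monomial n) : φL j L (2 • m) = 2 * φL j L m := by
  rw [two_nsmul, φL_add]; ring

lemma φL_box_pos (j : Fin n) (L s : ℤ) {k : ℕ} (h1 : 1 ≤ k) :
    φL j L (box n (.pos k) s) =
      (if (j : ℕ) + 1 = k then (if k = n then 2 else 1) * stp (s + k - 1) L else 0) -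
        if (j : ℕ) + 2 = k then stp (s + k) L else 0 := by
  have e : ((j : ℕ) + 1 = k - 1) = ((j : ℕ) + 2 = k) := by
    apply propext; omega
  unfold box
  by_cases hk : k = n
  · subst hk
    simp only [if_true, φL_add, φL_neg, φL_two_nsmul, φL_Y, e]
    split_ifs <;> ring
  · simp only [if_neg hk, φL_add, φL_neg, φL_Y, e]
    split_ifs <;> ring

lemma φL_box_zero (j : Fin n) (L s : ℤ) : φL j L (box n .zero s) =
    if (j : ℕ) + 1 = n then stp (s + n - 1) L - stp (s + n + 1) L else 0 := by
  unfold box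
  simp only [φL_add, φL_neg, φL_Y]
  split_ifs <;> ring

lemma φL_box_neg (j : Fin n) (L s : ℤ) {k : ℕ} (h1 : 1 ≤ k) :
    φL j L (box n (.neg k) s) = (if (j : ℕ) + 2 = k then stp (s + 2 * n - k) L else 0) -
      if (j : ℕ) + 1 = k then (if k = n then 2 else 1) * stp (s + 2 * n + 1 - k) L else 0 := by
  have e : ((j : ℕ) + 1 = k - 1) = ((j : ℕ) + 2 = k) := by
    apply propext; omega
  unfold box
  by_cases hk : k = n
  · subst hk
    have e1 : s + 2 * (k : ℤ) - k = s + k := by ring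
    have e2 : s + 2 * (k : ℤ) + 1 - k = s + k + 1 := by ring
    simp only [if_true, φL_sub, φL_two_nsmul, φL_Y, e, e1, e2]
    split_ifs <;> ring
  · simp only [if_neg hk, φL_sub, φL_Y, e]
    split_ifs <;> ring

/-- This is the compatibility of boxes with arrows, checked at every node through partial sums. The
level of the factor `A` depends only on the label and on whether the letter is unbarred. -/
lemma box_arrow {x y : Letter} {i : Fin n} {k : ℕ} (h : Letter.Arrow n k x y) (hk : k = i + 1)
    (s : ℤ) : box n y s = box n x s - A i (s + if x.rank n ≤ n then (k : ℤ) else 2 * n - k) := by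
  have hi := i.isLt
  refine φL_ext fun j L => ?_
  have hj := j.isLt
  rw [φL_sub]
  have hA : ∀ l, φL j L (A i l) = if (j : ℕ) = i then stp (l - 1) L + stp (l + 1) L
      else (if (i : ℕ) = j + 1 then -1 else
      if (j : ℕ) = i + 1 then (if (j : ℕ) + 1 = n then -2 else -1) else 0) * stp l L := fun l => by
    by_cases h1 : j = i
    · subst h1; rw [φL_A_self, if_pos rfl]; rfl
    · rw [φL_A_ne h1, cartan_eq _ _ h1, if_neg fun h => h1 (Fin.ext h)]
      unfold stp
      by_cases h2 : l ≤ L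
      · rw [if_pos h2, if_pos h2, mul_one]
      · rw [if_neg h2, if_neg h2, mul_zero]
  rw [hA]
  clear hA
  have e : ∀ l l' : ℤ, l = l' → stp l L = stp l' L := fun l l' h => by rw [h]
  cases h with
  | pos _ h1 h2 =>
    rw [φL_box_pos _ _ _ (by omega), φL_box_pos _ _ _ h1, if_neg (show ¬ k = n by omega)]
    have e0 : Letter.rank n (.pos k) ≤ n := by simp only [Letter.rank]; omega
    rw [if_pos e0]
    push_cast
    have e1 := e (s + ((k : ℤ) + 1) - 1) (s + k) (by ring)
    have e2 := e (s + ((k : ℤ) + 1)) (s + k + 1) (by ring)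
    rw [e1, e2]
    clear e e1 e2 e0
    generalize stp (s + k) L = a, stp (s + k + 1) L = b, stp (s + k - 1) L = c
    split_ifs <;> omega
  | toZero =>
    rw [φL_box_pos _ _ _ (by omega), φL_box_zero]
    have e0 : Letter.rank n (.pos n) ≤ n := by simp only [Letter.rank]; omega
    rw [if_pos e0, if_pos rfl]
    clear e e0
    generalize stp (s + n) L = a, stp (s + n + 1) L = b, stp (s + n - 1) L = c
    split_ifs <;> omega
  | fromZero =>
    rw [φL_box_neg _ _ _ (by omega), φL_box_zero]
    have e0 : ¬ Letter.rank n .zero ≤ n := by simp only [Letter.rank]; omega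
    rw [if_neg e0, if_pos rfl]
    have e1 := e (s + 2 * n - n) (s + n) (by ring)
    have e2 := e (s + 2 * n + 1 - n) (s + n + 1) (by ring)
    have e3 := e (s + (2 * n - n) + 1) (s + n + 1) (by ring)
    have e4 := e (s + (2 * n - n) - 1) (s + n - 1) (by ring)
    have e5 := e (s + (2 * n - n)) (s + n) (by ring)
    rw [e1, e2, e3, e4, e5]
    clear e e0 e1 e2 e3 e4 e5
    generalize stp (s + n) L = a, stp (s + n + 1) L = b, stp (s + n - 1) L = c
    split_ifs <;> omega
  | neg _ h1 h2 =>
    rw [φL_box_neg _ _ _ (k := k + 1) (by omega), φL_box_neg _ _ _ h1,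
      if_neg (show ¬ k = n by omega)]
    have e0 : ¬ Letter.rank n (.neg (k + 1)) ≤ n := by simp only [Letter.rank]; omega
    rw [if_neg e0]
    push_cast
    have e1 := e (s + 2 * n - (k + 1)) (s + (2 * n - k) - 1) (by ring)
    have e2 := e (s + 2 * n + 1 - (k + 1)) (s + (2 * n - k)) (by ring)
    have e3 := e (s + 2 * n - k) (s + (2 * n - k)) (by ring)
    have e4 := e (s + 2 * n + 1 - k) (s + (2 * n - k) + 1) (by ring)
    rw [e1, e2, e3, e4]
    clear e e0 e1 e2 e3 e4
    generalize stp (s + (2 * n - k)) L = a, stp (s + (2 * n - k) + 1) L = b,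
      stp (s + (2 * n - k) - 1) L = c
    split_ifs <;> omega

lemma φL_box_self {x : Letter} (hx : x.Valid n) {j : Fin n} (h : ((j : ℕ) : ℤ) + 1 = n)
    {L s M p σ d : ℤ} (hs : s = d + 1 - 2 * p - 2 * σ)
    (hL : L = d + n + 2 * M ∨ L = d + n + 2 * M + 1) :
    φL j L (box n x s) = entryF n n (x.rank n) p (M + σ) := by
  rw [entryF_self]
  cases x with
  | pos k =>
    have h1 := hx.1
    have h2 := hx.2
    rw [φL_box_pos _ _ _ h1]
    have hy : Letter.rank n (.pos k) = (k : ℤ) := rfl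
    generalize Letter.rank n (.pos k) = y at hy
    rw [if_neg (show ¬ (j : ℕ) + 2 = k by omega), if_neg (show ¬ y = n + 1 by omega),
      if_neg (show ¬ y = n + 2 by omega)]
    unfold stp; split_ifs <;> omega
  | zero =>
    rw [φL_box_zero]
    have hy : Letter.rank n .zero = (n : ℤ) + 1 := rfl
    generalize Letter.rank n .zero = y at hy
    rw [if_pos (show (j : ℕ) + 1 = n by omega), if_neg (show ¬ y = n by omega),
      if_pos hy, if_neg (show ¬ y = n + 2 by omega)]
    unfold stp; split_ifs <;> omega
  | neg k =>
    have h1 := hx.1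
    have h2 := hx.2
    rw [φL_box_neg _ _ _ h1]
    have hy : Letter.rank n (.neg k) = (2 : ℤ) * n + 2 - k := rfl
    generalize Letter.rank n (.neg k) = y at hy
    rw [if_neg (show ¬ (j : ℕ) + 2 = k by omega), if_neg (show ¬ y = n + 1 by omega),
      if_neg (show ¬ y = n by omega)]
    unfold stp; split_ifs <;> omega

lemma φL_box_lt {x : Letter} (hx : x.Valid n) {j : Fin n} (h : ((j : ℕ) : ℤ) + 1 < n)
    {L s M p σ d : ℤ} (hs : s = d + 1 - 2 * p - 2 * σ)
    (hL : L = d + ((j : ℕ) + 1) + 2 * M ∨ L = d + ((j : ℕ) + 1) + 2 * M + 1) :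
    φL j L (box n x s) = entryF n ((j : ℕ) + 1) (x.rank n) p (M + σ) := by
  rw [entryF_of_lt h]
  cases x with
  | pos k =>
    have h1 := hx.1
    have h2 := hx.2
    rw [φL_box_pos _ _ _ h1]
    have hy : Letter.rank n (.pos k) = (k : ℤ) := rfl
    generalize Letter.rank n (.pos k) = y at hy
    rw [if_neg (show ¬ (y = 2 * n + 1 - ((j : ℕ) + 1)) by omega),
      if_neg (show ¬ (y = 2 * n + 2 - ((j : ℕ) + 1)) by omega)]
    by_cases c1 : (j : ℕ) + 1 = k
    · rw [if_pos c1, if_neg (show ¬ k = n by omega), if_neg (show ¬ (j : ℕ) + 2 = k by omega),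
        if_pos (show y = (j : ℕ) + 1 by omega), if_neg (show ¬ y = (j : ℕ) + 1 + 1 by omega)]
      unfold stp; split_ifs <;> omega
    · rw [if_neg c1, if_neg (show ¬ y = (j : ℕ) + 1 by omega)]
      by_cases c2 : (j : ℕ) + 2 = k
      · rw [if_pos c2, if_pos (show y = (j : ℕ) + 1 + 1 by omega)]
        unfold stp; split_ifs <;> omega
      · rw [if_neg c2, if_neg (show ¬ y = (j : ℕ) + 1 + 1 by omega)]
        ring
  | zero =>
    rw [φL_box_zero]
    have hy : Letter.rank n .zero = (n : ℤ) + 1 := rfl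
    generalize Letter.rank n .zero = y at hy
    rw [if_neg (by omega), if_neg (by omega), if_neg (by omega), if_neg (by omega),
      if_neg (by omega)]
    ring
  | neg k =>
    have h1 := hx.1
    have h2 := hx.2
    rw [φL_box_neg _ _ _ h1]
    have hy : Letter.rank n (.neg k) = (2 : ℤ) * n + 2 - k := rfl
    generalize Letter.rank n (.neg k) = y at hy
    rw [if_neg (show ¬ (y = ((j : ℕ) + 1)) by omega),
      if_neg (show ¬ (y = ((j : ℕ) + 1) + 1) by omega)]
    by_cases c1 : (j : ℕ) + 1 = k
    · rw [if_pos c1, if_neg (show ¬ k = n by omega), if_neg (show ¬ (j : ℕ) + 2 = k by omega),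
        if_neg (show ¬ y = 2 * n + 1 - ((j : ℕ) + 1) by omega),
        if_pos (show y = 2 * n + 2 - ((j : ℕ) + 1) by omega)]
      unfold stp; split_ifs <;> omega
    · rw [if_neg c1, if_neg (show ¬ y = 2 * n + 2 - ((j : ℕ) + 1) by omega)]
      by_cases c2 : (j : ℕ) + 2 = k
      · rw [if_pos c2, if_pos (show y = 2 * n + 1 - ((j : ℕ) + 1) by omega)]
        unfold stp; split_ifs <;> omega
      · rw [if_neg c2, if_neg (show ¬ y = 2 * n + 1 - ((j : ℕ) + 1) by omega)]
        ring

/-- Levels are reparametrised by `M`. The suffix of a box at position `p` in a column with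
displacement `σ` makes its variables for node `i` occur at levels congruent to `d + i` modulo 2.
Hence two consecutive levels belong to the same `M`, and the displacement becomes a shift of the
argument. -/
lemma φL_box {x : Letter} (hx : x.Valid n) (j : Fin n) {L s M p σ d : ℤ}
    (hs : s = d + 1 - 2 * p - 2 * σ) (hL : L = d + ((j : ℕ) + 1) + 2 * M ∨
      L = d + ((j : ℕ) + 1) + 2 * M + 1) :
    φL j L (box n x s) = entryF n ((j : ℕ) + 1) (x.rank n) p (M + σ) := by
  have hj := j.isLt
  rcases eq_or_lt_of_le (show ((j : ℕ) : ℤ) + 1 ≤ n by omega) with h | h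
  · rw [h] at hL ⊢
    exact φL_box_self hx h hs hL
  · exact φL_box_lt hx h hs hL

lemma colF_eq_sum (n i : ℤ) (t : ℤ → ℤ) (lo hi x : ℤ) :
    colF n i t lo hi x = ∑ a ∈ Finset.Icc lo hi, entryF n i (t a) a x := by
  unfold colF strand cnt entryF
  by_cases h : i = n
  · simp only [if_pos h, Finset.sum_add_distrib, Finset.sum_sub_distrib]
  · simp only [if_neg h, Finset.sum_add_distrib, Finset.sum_sub_distrib, add_zero]

lemma F_eq_sum {n ℓ h r i : ℤ} (hh : 0 ≤ h) (hl : h ≤ ℓ) (t : ℤ → ℤ) (L : ℤ) : F n ℓ h r i t L =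
    ∑ a ∈ Finset.Icc 1 ℓ, entryF n i (t a) a (L + if a ≤ h then 0 else r) := by
  have h1 : Finset.Icc 1 ℓ = Finset.Icc 1 h ∪ Finset.Icc (h + 1) ℓ := by
    ext a; simp only [Finset.mem_union, Finset.mem_Icc]; omega
  rw [h1, Finset.sum_union (Finset.disjoint_left.2 fun a ha hb => by
    rw [Finset.mem_Icc] at ha hb; omega)]
  unfold F
  rw [colF_eq_sum, colF_eq_sum]
  congr 1
  · refine Finset.sum_congr rfl fun a ha => ?_
    rw [if_pos (Finset.mem_Icc.1 ha).2, add_zero]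
  · refine Finset.sum_congr rfl fun a ha => ?_
    rw [if_neg]
    have := (Finset.mem_Icc.1 ha).1; omega

/-! ### Tableaux and integer sequences -/

/-- The sequence of the positions of the entries in `1 ≺ ⋯ ≺ n ≺ 0 ≺ n̄ ≺ ⋯ ≺ 1̄`. -/
def code (n : ℕ) {ℓ : ℕ} (T : Tableau ℓ) : ℤ → ℤ := fun a =>
  if ha : a.toNat ∈ Finset.Icc 1 ℓ then (T ⟨a.toNat, ha⟩).rank n else 0

lemma code_apply {ℓ : ℕ} (T : Tableau ℓ) (a : Finset.Icc 1 ℓ) :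
    code n T ((a : ℕ) : ℤ) = (T a).rank n := by
  have : ((a : ℕ) : ℤ).toNat ∈ Finset.Icc 1 ℓ := by rw [Int.toNat_natCast]; exact a.2
  unfold code
  rw [dif_pos this]
  congr 2

lemma φL_mon {ℓ h r : ℕ} (hh : h ≤ ℓ) {T : Tableau ℓ} (hT : ∀ a, (T a).Valid n) (j : Fin n)
    {L M : ℤ} (hL : L = ℓ + ((j : ℕ) + 1) + 2 * M ∨ L = ℓ + ((j : ℕ) + 1) + 2 * M + 1) :
    φL j L (mon n h r T) = F n ℓ h r ((j : ℕ) + 1) (code n T) M := by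
  rw [F_eq_sum (by omega) (by omega), mon, φL_sum]
  refine Finset.sum_bij' (fun a _ => ((a : ℕ) : ℤ))
    (fun b hb => ⟨b.toNat, by rw [Finset.mem_Icc] at hb ⊢; omega⟩) (fun a _ => ?_)
    (fun b hb => Finset.mem_univ _) (fun a _ => by simp) (fun b hb => ?_) fun a _ => ?_
  · have := Finset.mem_Icc.1 a.2
    rw [Finset.mem_Icc]; omega
  · have := Finset.mem_Icc.1 hb
    simp only; omega
  · rw [code_apply]
    refine φL_box (hT a) j (d := ℓ) ?_ hL
    by_cases h1 : (a : ℕ) ≤ h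
    · rw [if_pos h1, if_pos (by omega)]; ring
    · rw [if_neg h1, if_neg (by omega)]

end

end TypeB

/-! ### Monomials of integer sequences and steps between them. -/

namespace TypeB

section

variable {n : ℕ}

/-- The letter at the position `ρ` of `1 ≺ ⋯ ≺ n ≺ 0 ≺ n̄ ≺ ⋯ ≺ 1̄`. -/
def letter (n : ℕ) (ρ : ℤ) : Letter :=
  if ρ ≤ n then .pos ρ.toNat else if ρ = n + 1 then .zero else .neg (2 * n + 2 - ρ).toNat

lemma letter_rank {x : Letter} (hx : x.Valid n) : letter n (x.rank n) = x := by
  cases x with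
  | pos k =>
    have h2 := hx.2
    unfold letter Letter.rank
    rw [if_pos (by simp only; omega)]
    simp
  | zero =>
    unfold letter Letter.rank
    rw [if_neg (by simp only; omega), if_pos rfl]
  | neg k =>
    have h2 := hx.2
    unfold letter Letter.rank
    rw [if_neg (by simp only; omega), if_neg (by simp only; omega)]
    simp

lemma rank_letter {ρ : ℤ} (h1 : 1 ≤ ρ) (h2 : ρ ≤ 2 * n + 1) :
    (letter n ρ).rank n = ρ ∧ (letter n ρ).Valid n := by
  unfold letter
  split_ifs with h3 h4
  · exact ⟨by simp only [Letter.rank]; omega, by simp only [Letter.Valid]; omega⟩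
  · exact ⟨h4.symm, trivial⟩
  · exact ⟨by simp only [Letter.rank]; omega, by simp only [Letter.Valid]; omega⟩

lemma rank_range {x : Letter} (hx : x.Valid n) : 1 ≤ x.rank n ∧ x.rank n ≤ 2 * n + 1 := by
  cases x with
  | pos k => have := hx.1; have := hx.2; simp only [Letter.rank]; omega
  | zero => simp only [Letter.rank]; omega
  | neg k => have := hx.1; have := hx.2; simp only [Letter.rank]; omega

lemma arrow_letter {k : ℕ} {ρ : ℤ} (h1 : 1 ≤ k) (h2 : k ≤ n) (hρ : ρ = k ∨ ρ = 2 * n + 1 - k) :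
    Letter.Arrow n k (letter n ρ) (letter n (ρ + 1)) := by
  rcases eq_or_lt_of_le h2 with rfl | h2
  · rcases hρ with rfl | rfl
    · have e1 : letter k (k : ℤ) = .pos k := by simp [letter]
      have e2 : letter k ((k : ℤ) + 1) = .zero := by simp [letter]
      rw [e1, e2]; exact .toZero
    · have e1 : letter k (2 * (k : ℤ) + 1 - k) = .zero := by
        unfold letter; rw [if_neg (by omega), if_pos (by omega)]
      have e2 : letter k (2 * (k : ℤ) + 1 - k + 1) = .neg k := by
        unfold letter; rw [if_neg (by omega), if_neg (by omega)]; congr 1; omega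
      rw [e1, e2]; exact .fromZero
  · rcases hρ with rfl | rfl
    · have e1 : letter n (k : ℤ) = .pos k := by
        unfold letter; rw [if_pos (by omega)]; congr 1
      have e2 : letter n ((k : ℤ) + 1) = .pos (k + 1) := by
        unfold letter; rw [if_pos (by omega)]; congr 1
      rw [e1, e2]; exact .pos k h1 h2
    · have e1 : letter n (2 * (n : ℤ) + 1 - k) = .neg (k + 1) := by
        unfold letter; rw [if_neg (by omega), if_neg (by omega)]; congr 1; omega
      have e2 : letter n (2 * (n : ℤ) + 1 - k + 1) = .neg k := by
        unfold letter; rw [if_neg (by omega), if_neg (by omega)]; congr 1; omega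
      rw [e1, e2]; exact .neg k h1 h2

/-- The tableau of an integer sequence. -/
def decode (n ℓ : ℕ) (t : ℤ → ℤ) : Tableau ℓ := fun a => letter n (t (a : ℕ))

variable {ℓ h r : ℕ} {t t' : ℤ → ℤ}

lemma decode_code {T : Tableau ℓ} (hT : ∀ a, (T a).Valid n) : decode n ℓ (code n T) = T := by
  ext a
  unfold decode
  rw [code_apply, letter_rank (hT a)]

lemma decode_valid (hT : Tab n ℓ h r t) (a : Finset.Icc 1 ℓ) : (decode n ℓ t a).Valid n := by
  have := Finset.mem_Icc.1 a.2
  exact (rank_letter (hT.one_le _ (by omega) (by omega)) (hT.le_top _ (by omega) (by omega))).2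

lemma code_decode (hT : Tab n ℓ h r t) : code n (decode n ℓ t) = t := by
  ext a
  unfold code decode
  split_ifs with h1
  · rw [Finset.mem_Icc] at h1
    have e : ((a.toNat : ℕ) : ℤ) = a := by omega
    simp only [e]
    exact (rank_letter (hT.one_le _ (by omega) (by omega)) (hT.le_top _ (by omega) (by omega))).1
  · rw [Finset.mem_Icc] at h1
    exact (hT.out a (by omega)).symm

/-- The monomial of an integer sequence. -/
noncomputable def smon (n ℓ h r : ℕ) (t : ℤ → ℤ) : Monomial n := mon n h r (decode n ℓ t)

lemma φL_smon (hh : h ≤ ℓ) (hT : Tab n ℓ h r t) (j : Fin n)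
    {L M : ℤ} (hL : L = ℓ + ((j : ℕ) + 1) + 2 * M ∨ L = ℓ + ((j : ℕ) + 1) + 2 * M + 1) :
    φL j L (smon n ℓ h r t) = F n ℓ h r ((j : ℕ) + 1) t M := by
  unfold smon
  rw [φL_mon hh (decode_valid hT) j hL, code_decode hT]

lemma exists_half (ℓ j : ℕ) (L : ℤ) :
    ∃ M : ℤ, L = ℓ + (j + 1) + 2 * M ∨ L = ℓ + (j + 1) + 2 * M + 1 :=
  ⟨(L - ℓ - (j + 1)) / 2, by omega⟩

/-- The partial sums do not change at levels of the wrong parity, because both levels have the same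
index `M`. -/
lemma smon_hasParity (hh : h ≤ ℓ) (hT : Tab n ℓ h r t) (j : Fin n) :
    HasParity j (ℓ + (j : ℕ) + 1) (smon n ℓ h r t) := by
  intro l hl
  obtain ⟨M, hM | hM⟩ := exists_half ℓ j l
  · exact ⟨M, by rw [hM]; ring⟩
  · refine absurd ?_ hl
    rw [φL_smon hh hT j (Or.inr hM), φL_smon hh hT j (M := M) (Or.inl (by rw [hM]; ring))]

lemma smon_bump {c : ℤ} {j : Fin n} (hc : 1 ≤ c) (hc' : c ≤ ℓ)
    (hlet : t c = (j : ℕ) + 1 ∨ t c = 2 * n + 1 - ((j : ℕ) + 1)) :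
    smon n ℓ h r (bump t c) = smon n ℓ h r t -
      A j (ℓ + ((j : ℕ) + 1) + 2 * lev n h r ((j : ℕ) + 1) (t c) c + 1) := by
  have hj := j.isLt
  set a : Finset.Icc 1 ℓ := ⟨c.toNat, by rw [Finset.mem_Icc]; omega⟩ with ha
  have hac : ((a : ℕ) : ℤ) = c := by rw [ha]; simp only; omega
  have harr := arrow_letter (n := n) (k := (j : ℕ) + 1) (ρ := t c) (by omega) (by omega)
    (by push_cast; exact hlet)
  have hsum : ∀ b ∈ Finset.univ.erase a,
      box n (decode n ℓ (bump t c) b) ((ℓ : ℤ) + 1 - 2 * (b : ℕ) - if (b : ℕ) ≤ h then 0 else 2 * (r : ℤ)) =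
      box n (decode n ℓ t b) ((ℓ : ℤ) + 1 - 2 * (b : ℕ) - if (b : ℕ) ≤ h then 0 else 2 * (r : ℤ)) := by
    intro b hb
    have hne : ((b : ℕ) : ℤ) ≠ c := fun h1 => (Finset.mem_erase.1 hb).1 (Subtype.ext (by omega))
    unfold decode
    rw [bump_of_ne _ hne]
  unfold smon mon
  rw [← Finset.add_sum_erase _ _ (Finset.mem_univ a), Finset.sum_congr rfl hsum,
    ← Finset.add_sum_erase _ (fun b : Finset.Icc 1 ℓ => box n (decode n ℓ t b) _)
      (Finset.mem_univ a)]
  have e1 : decode n ℓ (bump t c) a = letter n (t c + 1) := by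
    unfold decode; rw [hac, bump_self]
  have e2 : decode n ℓ t a = letter n (t c) := by unfold decode; rw [hac]
  rw [e1, e2, box_arrow harr rfl]
  have e3 : (letter n (t c)).rank n = t c := (rank_letter (by omega) (by omega)).1
  have e4 : ((ℓ : ℤ) + 1 - 2 * (a : ℕ) - if (a : ℕ) ≤ h then 0 else 2 * (r : ℤ)) +
      (if (letter n (t c)).rank n ≤ n then (((j : ℕ) + 1 : ℕ) : ℤ) else
        2 * n - (((j : ℕ) + 1 : ℕ) : ℤ)) =
      ℓ + ((j : ℕ) + 1) + 2 * lev n h r ((j : ℕ) + 1) (t c) c + 1 := by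
    rw [e3, hac]
    unfold lev
    by_cases h1 : (a : ℕ) ≤ h
    · rw [if_pos h1, if_pos (show c ≤ h by omega)]; split_ifs <;> push_cast <;> ring
    · rw [if_neg h1, if_neg (show ¬ c ≤ h by omega)]; split_ifs <;> push_cast <;> ring
  rw [e4]
  abel

lemma FStep.f_smon {j : Fin n} (hh : h ≤ ℓ) (hF : FStep n ℓ h r ((j : ℕ) + 1) t t') :
    (monomialCrystal n).f j (smon n ℓ h r t) = some (smon n ℓ h r t') := by
  obtain ⟨hT, hT', c, hc, rfl⟩ := hF
  rw [f_eq_some_iff]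
  refine ⟨ℓ + ((j : ℕ) + 1) + 2 * lev n h r ((j : ℕ) + 1) (t c) c, ⟨fun L => ?_, fun L hL => ?_⟩,
    ?_, smon_bump hc.one_le hc.le hc.letter⟩
  · obtain ⟨M, hM⟩ := exists_half ℓ j L
    simp only
    rw [φL_smon hh hT j hM, φL_smon hh hT j (Or.inl rfl)]
    exact hc.isFirstMax.1 M
  · obtain ⟨M, hM⟩ := exists_half ℓ j L
    simp only
    rw [φL_smon hh hT j hM, φL_smon hh hT j (Or.inl rfl)]
    exact hc.isFirstMax.2 M (by omega)
  · rw [φL_smon hh hT j (Or.inl rfl)]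
    exact hc.pos

lemma FStep.e_smon {j : Fin n} (hh : h ≤ ℓ) (hF : FStep n ℓ h r ((j : ℕ) + 1) t t') :
    (monomialCrystal n).e j (smon n ℓ h r t') = some (smon n ℓ h r t) :=
  e_of_f (smon_hasParity hh hF.1 j) (hF.f_smon hh)

end

end TypeB

namespace TypeB

/-! ### Closure, injectivity, and uniqueness of the source -/

section

variable {n ℓ h r : ℕ} {t s : ℤ → ℤ}

/-- Beyond `n` every threshold lies to the left of all positions, so the value at `n` is the final
one, that is, the weight. -/
lemma F_of_le {n ℓ h r i L : ℤ} (hh : 0 ≤ h) (hl : h ≤ ℓ) (hr : 0 ≤ r) (hi : 1 ≤ i) (t : ℤ → ℤ)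
    (hL : n ≤ L) (hn : i ≤ n) : F n ℓ h r i t L = F n ℓ h r i t n := by
  rw [F_eq_sum hh hl, F_eq_sum hh hl]
  refine Finset.sum_congr rfl fun a ha => ?_
  have h1 := (Finset.mem_Icc.1 ha).1
  obtain ⟨x, hx⟩ : ∃ x, x = L + if a ≤ h then 0 else r := ⟨_, rfl⟩
  obtain ⟨x', hx'⟩ : ∃ x, x = n + if a ≤ h then 0 else r := ⟨_, rfl⟩
  rw [← hx, ← hx']
  have h2 : n ≤ x := by split_ifs at hx <;> omega
  have h3 : n ≤ x' := by split_ifs at hx' <;> omega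
  unfold entryF
  have c1 : -x ≤ a ∧ -x + 1 ≤ a ∧ n - i - x ≤ a ∧ n - i - x + 1 ≤ a ∧ 1 - x ≤ a := by omega
  have c2 : -x' ≤ a ∧ -x' + 1 ≤ a ∧ n - i - x' ≤ a ∧ n - i - x' + 1 ≤ a ∧ 1 - x' ≤ a := by omega
  simp only [c1, c2, and_true]

lemma wt_smon (hh : h ≤ ℓ) (hT : Tab n ℓ h r t) (j : Fin n) :
    wt (smon n ℓ h r t) j = F n ℓ h r ((j : ℕ) + 1) t n := by
  obtain ⟨-, hi, -, h1⟩ := exists_φL_bounds j (smon n ℓ h r t)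
  obtain ⟨M, hM⟩ := exists_half ℓ j (max hi (ℓ + (j + 1) + 2 * n))
  have hj := j.isLt
  rw [← h1 (max hi (ℓ + (j + 1) + 2 * n)) (by omega), φL_smon hh hT j hM]
  exact F_of_le (by omega) (by omega) (by omega) (by omega) t (by omega) (by omega)

lemma φ_smon_ne_zero_iff (hh : h ≤ ℓ) (hT : Tab n ℓ h r t) (j : Fin n) :
    φ j (smon n ℓ h r t) ≠ 0 ↔ ∃ L, 0 < F n ℓ h r ((j : ℕ) + 1) t L := by
  rw [Ne, φ_eq_zero_iff]
  push Not
  constructor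
  · rintro ⟨L, hL⟩
    obtain ⟨M, hM⟩ := exists_half ℓ j L
    exact ⟨M, by rwa [φL_smon hh hT j hM] at hL⟩
  · rintro ⟨M, hM⟩
    exact ⟨_, by rwa [φL_smon hh hT j (Or.inl rfl)]⟩

lemma ε_smon_ne_zero_iff (hh : h ≤ ℓ) (hT : Tab n ℓ h r t) (j : Fin n) :
    ε j (smon n ℓ h r t) ≠ 0 ↔
      ∃ L, F n ℓ h r ((j : ℕ) + 1) t n < F n ℓ h r ((j : ℕ) + 1) t L := by
  rw [Ne, ε_eq_zero_iff]
  push Not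
  rw [wt_smon hh hT]
  constructor
  · rintro ⟨L, hL⟩
    obtain ⟨M, hM⟩ := exists_half ℓ j L
    exact ⟨M, by rwa [φL_smon hh hT j hM] at hL⟩
  · rintro ⟨M, hM⟩
    exact ⟨_, by rwa [φL_smon hh hT j (Or.inl rfl)]⟩

lemma φ_smon_eq {q : ℤ} (hh : h ≤ ℓ) (hT : Tab n ℓ h r t) (j : Fin n)
    (hq : ∀ L, F n ℓ h r ((j : ℕ) + 1) t L ≤ F n ℓ h r ((j : ℕ) + 1) t q) :
    φ j (smon n ℓ h r t) = F n ℓ h r ((j : ℕ) + 1) t q := by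
  rw [← φL_smon hh hT j (Or.inl rfl)]
  refine φ_eq_of_max (fun L => ?_) ⟨_, rfl⟩
  obtain ⟨M, hM⟩ := exists_half ℓ j L
  rw [φL_smon hh hT j hM, φL_smon hh hT j (Or.inl rfl)]
  exact hq M

/-- The sequences that satisfy the tableau conditions are closed under the Kashiwara operators, are
determined by their monomials, and have only one source. -/
structure Good (n ℓ h r : ℕ) : Prop where
  f : ∀ (j : Fin n) t, Tab n ℓ h r t → φ j (smon n ℓ h r t) ≠ 0 →
    ∃ t', FStep n ℓ h r ((j : ℕ) + 1) t t'
  e : ∀ (j : Fin n) t, Tab n ℓ h r t → ε j (smon n ℓ h r t) ≠ 0 →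
    ∃ t', FStep n ℓ h r ((j : ℕ) + 1) t' t
  inj : ∀ t u, Tab n ℓ h r t → Tab n ℓ h r u → smon n ℓ h r t = smon n ℓ h r u → t = u
  high : ∀ t, Tab n ℓ h r t → (∀ (j : Fin n) t', ¬ FStep n ℓ h r ((j : ℕ) + 1) t' t) →
    t = highest ℓ

lemma sum_bump {c ℓ : ℤ} (h1 : 1 ≤ c) (h2 : c ≤ ℓ) (t : ℤ → ℤ) :
    ∑ a ∈ Finset.Icc 1 ℓ, bump t c a = ∑ a ∈ Finset.Icc 1 ℓ, t a + 1 := by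
  rw [← Finset.add_sum_erase _ _ (Finset.mem_Icc.2 ⟨h1, h2⟩),
    ← Finset.add_sum_erase _ t (Finset.mem_Icc.2 ⟨h1, h2⟩), bump_self,
    Finset.sum_congr rfl fun a ha => bump_of_ne t (Finset.ne_of_mem_erase ha)]
  ring

/-- Induction on the sum of the ranks. If some `ẽ_j` is nonzero on the common monomial, both
sequences have predecessors with equal monomials, hence equal ones by induction; otherwise both are
the unique source. The relation `G` carries the extra information by which a step forward from a
sequence is unique. -/
lemma smon_injective (hh : h ≤ ℓ) (G : Fin n → (ℤ → ℤ) → (ℤ → ℤ) → Prop)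
    (hE : ∀ (j : Fin n) t, Tab n ℓ h r t → ε j (smon n ℓ h r t) ≠ 0 →
      ∃ t', FStep n ℓ h r ((j : ℕ) + 1) t' t ∧ G j t' t)
    (hG : ∀ j t t₁ t₂, G j t t₁ → G j t t₂ → t₁ = t₂)
    (high : ∀ t, Tab n ℓ h r t → (∀ (j : Fin n) t', ¬ FStep n ℓ h r ((j : ℕ) + 1) t' t) →
      t = highest ℓ) {t u : ℤ → ℤ} (hT : Tab n ℓ h r t) (hU : Tab n ℓ h r u)
    (htu : smon n ℓ h r t = smon n ℓ h r u) : t = u := by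
  obtain ⟨N, hN⟩ : ∃ N : ℕ, ∑ a ∈ Finset.Icc 1 (ℓ : ℤ), t a ≤ N := ⟨_, Int.self_le_toNat _⟩
  induction N generalizing t u with
  | zero =>
    by_cases hex : ∃ j, ε j (smon n ℓ h r t) ≠ 0
    · obtain ⟨j, hj⟩ := hex
      obtain ⟨t', ⟨hT', -, c, hc, rfl⟩, -⟩ := hE j t hT hj
      rw [sum_bump hc.one_le hc.le] at hN
      have : 0 ≤ ∑ a ∈ Finset.Icc 1 (ℓ : ℤ), t' a := Finset.sum_nonneg fun a ha => by
        have := hT'.one_le a (Finset.mem_Icc.1 ha).1 (Finset.mem_Icc.1 ha).2; omega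
      push_cast at hN; omega
    · push Not at hex
      rw [high t hT, high u hU]
      · intro j t' hF
        have := hex j
        rw [htu] at this
        have h1 := hF.e_smon hh
        simp [monomialCrystal, this] at h1
      · intro j t' hF
        have h1 := hF.e_smon hh
        simp [monomialCrystal, hex j] at h1
  | succ N ih =>
    by_cases hex : ∃ j, ε j (smon n ℓ h r t) ≠ 0
    · obtain ⟨j, hj⟩ := hex
      obtain ⟨t', hF, hGt⟩ := hE j t hT hj
      obtain ⟨u', hF', hGu⟩ := hE j u hU (htu ▸ hj)
      have h1 := hF.e_smon hh
      rw [htu, hF'.e_smon hh] at h1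
      obtain ⟨hT', -, c, hc, rfl⟩ := hF
      rw [sum_bump hc.one_le hc.le] at hN
      have h2 := ih hT' hF'.1 (Option.some.inj h1).symm (by push_cast at hN; omega)
      subst h2
      exact hG j _ _ _ hGt hGu
    · push Not at hex
      rw [high t hT, high u hU]
      · intro j t' hF
        have := hex j
        rw [htu] at this
        have h1 := hF.e_smon hh
        simp [monomialCrystal, this] at h1
      · intro j t' hF
        have h1 := hF.e_smon hh
        simp [monomialCrystal, hex j] at h1

lemma good_single (hℓ : 1 ≤ ℓ) (hln : ℓ + 1 ≤ n) : Good n ℓ ℓ r := by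
  have hE : ∀ (j : Fin n) t, Tab n ℓ ℓ r t → ε j (smon n ℓ ℓ r t) ≠ 0 →
      ∃ t', FStep n ℓ ℓ r ((j : ℕ) + 1) t' t := fun j t hT hj => by
    rw [ε_smon_ne_zero_iff le_rfl hT] at hj
    have := j.isLt
    rcases eq_or_lt_of_le (show ((j : ℕ) : ℤ) + 1 ≤ n by omega) with h1 | h1
    · rw [h1] at hj ⊢
      exact exists_fstep_to_single_self hT (by omega) (by omega) hj
    · exact exists_fstep_to_single_lt hT (by omega) h1 hj
  have high : ∀ t, Tab n ℓ ℓ r t → (∀ (j : Fin n) t', ¬ FStep n ℓ ℓ r ((j : ℕ) + 1) t' t) →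
      t = highest ℓ := fun t hT hn => by
    refine eq_highest_of_single hT (by omega) (by omega) fun i h1 h2 h3 => ?_
    obtain ⟨j, rfl⟩ : ∃ j : Fin n, i = (j : ℕ) + 1 := ⟨⟨(i - 1).toNat, by omega⟩, by simp only; omega⟩
    obtain ⟨t', ht'⟩ := hE j t hT ((ε_smon_ne_zero_iff le_rfl hT j).2 h3)
    exact hn j t' ht'
  refine ⟨fun j t hT hj => ?_, hE, fun t u hT hU htu => ?_, high⟩
  · rw [φ_smon_ne_zero_iff le_rfl hT] at hj
    have := j.isLt
    rcases eq_or_lt_of_le (show ((j : ℕ) : ℤ) + 1 ≤ n by omega) with h1 | h1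
    · rw [h1] at hj ⊢
      exact exists_fstep_single_self hT (by omega) (by omega) hj
    · exact exists_fstep_single_lt hT (by omega) h1 hj
  · exact smon_injective le_rfl (fun j => FStep n ℓ ℓ r ((j : ℕ) + 1))
      (fun j t hT hj => by obtain ⟨t', ht'⟩ := hE j t hT hj; exact ⟨t', ht', ht'⟩)
      (fun j t t₁ t₂ h1 h2 => h1.single_unique h2 (by have := j.isLt; omega)) high hT hU htu

/-- If `φ_j` is nonzero for `s`, then closure gives a step of `s`, and only for such a step does the
comparison supply first maxima with equal values. The other case uses nonpositivity. -/
lemma Rel.smon_eq (hG : Good n ℓ (h + 1) r) (hl : h + 1 ≤ ℓ) (hln : ℓ + r ≤ n)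
    (hR : Rel n ℓ h r t s) (j : Fin n) :
    wt (smon n ℓ h r t) j = wt (smon n ℓ (h + 1) r s) j ∧
      φ j (smon n ℓ h r t) = φ j (smon n ℓ (h + 1) r s) := by
  have hS : Tab n ℓ ((h + 1 : ℕ) : ℤ) r s := by push_cast; exact hR.2.1
  have hj := j.isLt
  obtain ⟨c1, c2, c3⟩ := hR.compare (i := (j : ℕ) + 1) (by omega) (by omega) (by omega) (by omega)
    (by omega) (by omega)
  constructor
  · rw [wt_smon (by omega) hR.1, wt_smon hl hS, c1 _ le_rfl]; push_cast; rfl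
  · by_cases h0 : φ j (smon n ℓ (h + 1) r s) = 0
    · rw [h0]
      by_contra h1
      obtain ⟨L, hL⟩ := (φ_smon_ne_zero_iff (by omega) hR.1 j).1 h1
      have h2 := mt (φ_smon_ne_zero_iff hl hS j).2 (not_not.2 h0)
      push Not at h2
      have := c2 (by push_cast at h2; exact h2) L
      omega
    · obtain ⟨s', hs'⟩ := hG.f j s hS h0
      obtain ⟨-, -, -, q, q', hq, hq', hqq⟩ := c3 s' (by push_cast at hs'; exact hs')
      rw [φ_smon_eq (by omega) hR.1 j hq'.1, φ_smon_eq hl hS j (q := q) (by push_cast; exact hq.1),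
        hqq]
      push_cast; rfl

lemma tab_highest (hh : h ≤ ℓ) (hln : ℓ + 1 ≤ n) : Tab n ℓ h r (highest ℓ) where
  out a ha := by unfold highest; rw [if_neg ha]
  one_le a h1 h2 := by unfold highest; rw [if_pos ⟨h1, h2⟩]; exact h1
  le_top a h1 h2 := by unfold highest; rw [if_pos ⟨h1, h2⟩]; omega
  step a h1 h2 _ := by
    unfold highest; rw [if_pos ⟨h1, by omega⟩, if_pos ⟨by omega, h2⟩]; omega
  col1 a b h1 h2 h3 h4 h5 := by
    unfold highest at h5
    rw [if_pos ⟨h1, by omega⟩, if_pos ⟨by omega, by omega⟩] at h5; omega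
  col2 a b h1 h2 h3 h4 h5 := by
    unfold highest at h5
    rw [if_pos ⟨by omega, by omega⟩, if_pos ⟨by omega, by omega⟩] at h5; omega
  col12 a b h1 h2 h3 h3' h4 h5 := by
    unfold highest at h5
    rw [if_pos ⟨by omega, by omega⟩, if_pos ⟨by omega, by omega⟩] at h5; omega
  cross h1 h2 := by
    unfold highest; rw [if_pos ⟨h1, by omega⟩, if_pos ⟨by omega, h2⟩]; omega

lemma rel_highest (hl : h + 1 ≤ ℓ) (hln : ℓ + 1 ≤ n) : Rel n ℓ h r (highest ℓ) (highest ℓ) := by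
  have hS : Tab n ℓ (h + 1) r (highest ℓ) := by
    have := tab_highest (r := r) (h := h + 1) hl hln; push_cast at this; exact this
  refine rel_of_relC hS (by omega) (by omega) (fun b h1 h2 h3 h4 => ?_) fun a h1 h2 h3 h4 => ?_
  · unfold highest at h4
    rw [if_pos ⟨by omega, by omega⟩, if_pos ⟨by omega, by omega⟩] at h4; omega
  · unfold highest at h3
    rw [if_pos ⟨by omega, by omega⟩] at h3; omega

/-- All properties are transported along `Rel`. A step into `t` is found by relating `t` to some
`s`, stepping back from `s`, passing to the partner `t'` of the result, and lifting the step forward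
from there. -/
lemma Good.pred (hG : Good n ℓ (h + 1) r) (hl : h + 1 ≤ ℓ) (hln : ℓ + 1 ≤ n) (hr : r + ℓ ≤ n) :
    Good n ℓ h r := by
  have hcast : ((h + 1 : ℕ) : ℤ) = h + 1 := by push_cast; ring
  have cmp : ∀ (j : Fin n) {t s}, Rel n ℓ h r t s → Compare n ℓ h r ((j : ℕ) + 1) t s :=
    fun j t s hR => hR.compare (by omega) (by omega) (by omega) (by omega) (by omega)
      (by have := j.isLt; omega)
  -- The comparison lifts the step forward from `s'`; the target has partner `s`, so it is `t` by
  -- uniqueness on the left.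
  have lift : ∀ (j : Fin n) {t s s'}, Rel n ℓ h r t s → FStep n ℓ (h + 1) r ((j : ℕ) + 1) s' s →
      ∃ t', FStep n ℓ h r ((j : ℕ) + 1) t' t ∧ Rel n ℓ h r t' s' := by
    intro j t s s' hR hF
    obtain ⟨t', ht'⟩ := exists_rel_left hF.1 (by omega) (by omega) (by omega)
    obtain ⟨t'', h1, h2, -⟩ := (cmp j ht').2.2 s hF
    have := h2.left_unique hR (by omega) (by omega) (by omega)
    subst this
    exact ⟨t', h1, ht'⟩
  have hE : ∀ (j : Fin n) t, Tab n ℓ h r t → ε j (smon n ℓ h r t) ≠ 0 →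
      ∃ t', FStep n ℓ h r ((j : ℕ) + 1) t' t ∧ ∃ s' s, Rel n ℓ h r t' s' ∧ Rel n ℓ h r t s ∧
        FStep n ℓ (h + 1) r ((j : ℕ) + 1) s' s := by
    intro j t hT hj
    obtain ⟨s, hR⟩ := exists_rel_right hT (by omega) (by omega) (by omega)
    obtain ⟨h1, h2⟩ := hR.smon_eq hG hl (by omega) j
    rw [ε_eq, h1, h2, ← ε_eq] at hj
    obtain ⟨s', hs'⟩ := hG.e j s (by rw [hcast]; exact hR.2.1) hj
    rw [hcast] at hs'
    obtain ⟨t', h3, h4⟩ := lift j hR hs'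
    exact ⟨t', h3, s', s, h4, hR, hs'⟩
  have high : ∀ t, Tab n ℓ h r t → (∀ (j : Fin n) t', ¬ FStep n ℓ h r ((j : ℕ) + 1) t' t) →
      t = highest ℓ := by
    intro t hT hn
    obtain ⟨s, hR⟩ := exists_rel_right hT (by omega) (by omega) (by omega)
    have hs : s = highest ℓ := hG.high s (by rw [hcast]; exact hR.2.1) fun j s' hs' => by
      rw [hcast] at hs'
      obtain ⟨t', h3, -⟩ := lift j hR hs'
      exact hn j t' h3
    subst hs
    exact hR.left_unique (rel_highest hl hln) (by omega) (by omega) (by omega)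
  refine ⟨fun j t hT hj => ?_, fun j t hT hj => ?_, fun t u hT hU htu => ?_, high⟩
  · obtain ⟨s, hR⟩ := exists_rel_right hT (by omega) (by omega) (by omega)
    rw [(hR.smon_eq hG hl (by omega) j).2] at hj
    obtain ⟨s', hs'⟩ := hG.f j s (by rw [hcast]; exact hR.2.1) hj
    rw [hcast] at hs'
    obtain ⟨t', h1, -⟩ := (cmp j hR).2.2 s' hs'
    exact ⟨t', h1⟩
  · obtain ⟨t', h1, -⟩ := hE j t hT hj
    exact ⟨t', h1⟩
  · refine smon_injective (by omega) _ hE ?_ high hT hU htu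
    -- The chain of determinations is `t`, its partner `s'`, the result `s` of the step (by
    -- injectivity for `h + 1`), and the partner of `s`.
    rintro j t t₁ t₂ ⟨s', s, h1, h2, h3⟩ ⟨v', v, h4, h5, h6⟩
    have h7 := h1.right_unique h4 (by omega) (by omega)
    subst h7
    have h8 : s = v := by
      rw [← hcast] at h3 h6
      refine hG.inj _ _ h3.2.1 h6.2.1 (Option.some.inj ?_)
      rw [← h3.f_smon hl, ← h6.f_smon hl]
    subst h8
    exact h2.left_unique h5 (by omega) (by omega) (by omega)

/-- Downward induction from the single column, with `d = ℓ - h`; truncated subtraction makes the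
steps beyond `ℓ` trivial. -/
lemma good (hℓ : 1 ≤ ℓ) (hln : ℓ + 1 ≤ n) (hr : r + ℓ ≤ n) (hh : h ≤ ℓ) : Good n ℓ h r := by
  obtain ⟨d, rfl⟩ : ∃ d, h = ℓ - d := ⟨ℓ - h, by omega⟩
  induction d with
  | zero => exact good_single hℓ hln
  | succ d ih =>
    by_cases hd : d + 1 ≤ ℓ
    · have h1 : ℓ - (d + 1) + 1 = ℓ - d := by omega
      exact Good.pred (h1 ▸ ih (by omega)) (by omega) hln hr
    · have h1 : ℓ - (d + 1) = ℓ - d := by omega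
      rw [h1]; exact ih (by omega)

end

end TypeB

namespace TypeB

/-! ### The conditions on tableaux in terms of integer sequences -/

section

variable {n ℓ h r : ℕ} {T : Tableau ℓ}

lemma rank_pos (k : ℕ) : (Letter.pos k).rank n = k := rfl

lemma rank_zero : Letter.zero.rank n = n + 1 := rfl

lemma rank_neg (k : ℕ) : (Letter.neg k).rank n = 2 * n + 2 - k := rfl

lemma rank_injective {x y : Letter} (hx : x.Valid n) (hy : y.Valid n)
    (h : x.rank n = y.rank n) : x = y := by rw [← letter_rank hx, h, letter_rank hy]

lemma Tableau.Has.code_eq {a : ℕ} {x : Letter} (hx : T.Has a x) :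
    1 ≤ a ∧ a ≤ ℓ ∧ code n T a = x.rank n := by
  obtain ⟨ha, rfl⟩ := hx
  exact ⟨(Finset.mem_Icc.1 ha).1, (Finset.mem_Icc.1 ha).2, code_apply T ⟨a, ha⟩⟩

lemma has_of_code (hT : ∀ a, (T a).Valid n) {a : ℕ} {x : Letter} (hx : x.Valid n) (h1 : 1 ≤ a)
    (h2 : a ≤ ℓ) (h3 : code n T a = x.rank n) : T.Has a x := by
  have ha := Finset.mem_Icc.2 ⟨h1, h2⟩
  exact ⟨ha, rank_injective (hT _) hx ((code_apply T ⟨a, ha⟩).symm.trans h3)⟩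

lemma exists_has {a : ℕ} (h1 : 1 ≤ a) (h2 : a ≤ ℓ) : ∃ x, T.Has a x :=
  ⟨_, Finset.mem_Icc.2 ⟨h1, h2⟩, rfl⟩

lemma has_pos_iff (hT : ∀ a, (T a).Valid n) {a k : ℕ} :
    T.Has a (.pos k) ↔ 1 ≤ a ∧ a ≤ ℓ ∧ 1 ≤ k ∧ k ≤ n ∧ code n T a = k := by
  constructor
  · intro hx
    obtain ⟨h1, h2, h3⟩ := hx.code_eq (n := n)
    obtain ⟨ha, e⟩ := hx
    have := e ▸ hT ⟨a, ha⟩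
    exact ⟨h1, h2, this.1, this.2, h3⟩
  · rintro ⟨h1, h2, h3, h4, h5⟩
    exact has_of_code hT ⟨h3, h4⟩ h1 h2 h5

lemma has_neg_iff (hT : ∀ a, (T a).Valid n) {a k : ℕ} :
    T.Has a (.neg k) ↔ 1 ≤ a ∧ a ≤ ℓ ∧ 1 ≤ k ∧ k ≤ n ∧ code n T a = 2 * n + 2 - k := by
  constructor
  · intro hx
    obtain ⟨h1, h2, h3⟩ := hx.code_eq (n := n)
    obtain ⟨ha, e⟩ := hx
    have := e ▸ hT ⟨a, ha⟩
    exact ⟨h1, h2, this.1, this.2, h3⟩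
  · rintro ⟨h1, h2, h3, h4, h5⟩
    exact has_of_code hT ⟨h3, h4⟩ h1 h2 h5

lemma code_range (hT : ∀ a, (T a).Valid n) {a : ℤ} (h1 : 1 ≤ a) (h2 : a ≤ ℓ) :
    1 ≤ code n T a ∧ code n T a ≤ 2 * n + 1 := by
  lift a to ℕ using by omega
  have := code_apply (n := n) T ⟨a, Finset.mem_Icc.2 ⟨by omega, by omega⟩⟩
  rw [show code n T a = _ from this]
  exact rank_range (hT _)

lemma IsTableau.step (hT : IsTableau n h r T) (a : ℤ) (h1 : 1 ≤ a) (h2 : a + 1 ≤ ℓ) (h3 : a ≠ h) :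
    code n T a < code n T (a + 1) ∨ (code n T a = n + 1 ∧ code n T (a + 1) = n + 1) := by
  lift a to ℕ using by omega
  obtain ⟨x, hx⟩ := exists_has (T := T) (a := a) (by omega) (by omega)
  obtain ⟨y, hy⟩ := exists_has (T := T) (a := a + 1) (by omega) (by omega)
  have hx' := (hx.code_eq (n := n)).2.2
  have hy' := (hy.code_eq (n := n)).2.2
  push_cast at hy'
  rw [hx', hy']
  rcases hT.B1 a x y hx hy (by omega) with h4 | ⟨rfl, rfl⟩
  · exact Or.inl h4
  · exact Or.inr ⟨rfl, rfl⟩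

/-- For the border condition only the two ends of the required run are kept. -/
lemma IsTableau.tab (hT : IsTableau n h r T) : Tab n ℓ h r (code n T) where
  out a ha := by
    unfold code
    rw [dif_neg]
    rw [Finset.mem_Icc]; omega
  one_le a h1 h2 := (code_range hT.valid h1 h2).1
  le_top a h1 h2 := (code_range hT.valid h1 h2).2
  step := hT.step
  col1 a b h1 h2 h3 h4 h5 h6 := by
    lift a to ℕ using by omega
    lift b to ℕ using by omega
    by_cases hb : b ≤ ℓ
    · have r1 := code_range hT.valid (a := a) (by omega) (by omega)
      obtain ⟨k, hk⟩ := Int.eq_ofNat_of_zero_le (show 0 ≤ code n T a by omega)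
      exact hT.B2 ⟨a, b, k, by omega, by omega,
        (has_pos_iff hT.valid).2 ⟨by omega, by omega, by omega, by omega, hk⟩,
        (has_neg_iff hT.valid).2 ⟨by omega, by omega, by omega, by omega, by omega⟩, by omega⟩
    · have e : code n T (b : ℤ) = 0 := by
        unfold code
        rw [dif_neg]
        rw [Finset.mem_Icc]; omega
      omega
  col2 a b h1 h2 h3 h4 h5 h6 := by
    lift a to ℕ using by omega
    lift b to ℕ using by omega
    have r1 := code_range hT.valid (a := a) (by omega) (by omega)
    obtain ⟨k, hk⟩ := Int.eq_ofNat_of_zero_le (show 0 ≤ code n T a by omega)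
    exact hT.B3 ⟨a, b, k, by omega, by omega,
      (has_pos_iff hT.valid).2 ⟨by omega, by omega, by omega, by omega, hk⟩,
      (has_neg_iff hT.valid).2 ⟨by omega, by omega, by omega, by omega, by omega⟩, by omega⟩
  col12 a b h1 h2 h3 h4 h5 h6 h7 := by
    lift a to ℕ using by omega
    lift b to ℕ using by omega
    have r1 := code_range hT.valid (a := a) (by omega) (by omega)
    obtain ⟨k, hk⟩ := Int.eq_ofNat_of_zero_le (show 0 ≤ code n T a by omega)
    exact hT.B4 ⟨a, b, k, by omega, by omega,
      (has_pos_iff hT.valid).2 ⟨by omega, by omega, by omega, by omega, hk⟩,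
      (has_neg_iff hT.valid).2 ⟨by omega, by omega, by omega, by omega, by omega⟩, by omega⟩
  cross h1 h2 := by
    obtain ⟨x, hx⟩ := exists_has (T := T) (a := h) (by omega) (by omega)
    obtain ⟨y, hy⟩ := exists_has (T := T) (a := h + 1) (by omega) (by omega)
    have hx' := (hx.code_eq (n := n)).2.2
    have hy' := (hy.code_eq (n := n)).2.2
    push_cast at hy'
    have hc1 : Col n (code n T) 1 h := fun a h3 h4 => hT.step a h3 (by omega) (by omega)
    have hc2 : Col n (code n T) (h + 1) ℓ := fun a h3 h4 => hT.step a (by omega) h4 (by omega)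
    by_cases hlt : code n T h < code n T (h + 1)
    · exact Or.inl (Or.inl hlt)
    rw [hx', hy'] at hlt
    cases y with
    | pos k =>
      obtain ⟨k', rfl, b', b, g1, g2, g3, g4, g5⟩ := hT.B5 k x hy hx (by omega)
      have v1 := ((has_pos_iff hT.valid).1 hy)
      have v2 := ((has_pos_iff hT.valid).1 hx)
      have e1 := (has_neg_iff hT.valid).1 (g3 b' le_rfl g1)
      have e2 := (has_neg_iff hT.valid).1 (g3 b g1 le_rfl)
      simp only [rank_pos] at hx' hy' hlt
      have w1 : (n : ℤ) - k - (n - k - b) = (b : ℕ) := by ring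
      have w2 : (n : ℤ) - k' - (n - k - b) = (b' : ℕ) := by omega
      have p1 : ¬ b < h := fun g => by
        have := (hc1.cmp (a := b) (b := h) (by omega) (by omega) le_rfl).1
        omega
      have p2 : b ≠ h := fun g => by rw [← g] at hx'; omega
      -- The run consists of barred letters and cannot pass through `h + 1`, where the letter is
      -- unbarred; so it lies in the second column.
      have p3 : ¬ b' ≤ h + 1 := fun g => by
        have := (has_neg_iff hT.valid).1 (g3 (h + 1) g (by omega))
        push_cast at this
        omega
      refine Or.inr (Or.inl ⟨by omega, by omega, n - k - b, by omega, by omega, ?_⟩)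
      rw [hx', hy', w1, w2]
      omega
    | zero =>
      have := hT.B7 x hy hx
      simp only [rank_zero] at *
      exact Or.inl (Or.inr ⟨by omega, by omega⟩)
    | neg k =>
      obtain ⟨k', rfl, a', a, g1, g2, g3, g4, g5⟩ := hT.B6 k x hy hx (by omega)
      have v1 := ((has_neg_iff hT.valid).1 hy)
      have v2 := ((has_neg_iff hT.valid).1 hx)
      have e1 := (has_pos_iff hT.valid).1 (g3 a' le_rfl g1)
      have e2 := (has_pos_iff hT.valid).1 (g3 a g1 le_rfl)
      simp only [rank_neg] at hx' hy' hlt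
      have w1 : 2 * (n : ℤ) + 2 - (2 * n + 2 - k) - (k - a) = (a : ℕ) := by ring
      have w2 : 2 * (n : ℤ) + 2 - (2 * n + 2 - k') - (k - a) = (a' : ℕ) := by omega
      have p1 : ¬ h + 1 < a := fun g => by
        have := (hc2.cmp (a := h + 1) (b := a) le_rfl (by omega) (by omega)).1
        omega
      have p2 : a ≠ h + 1 := fun g => by rw [g] at e2; push_cast at e2; omega
      refine Or.inr (Or.inr ⟨by omega, by omega, k - a, by omega, by omega, ?_⟩)
      rw [hx', hy', w1, w2]
      omega

/-- The letters between the two ends of a run are recovered from strict increase: the ends differ by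
as many ranks as positions. -/
lemma isTableau_of_tab (hh : h ≤ ℓ) (hv : ∀ a, (T a).Valid n) (hT : Tab n ℓ h r (code n T)) :
    IsTableau n h r T where
  valid := hv
  B1 a x y hx hy ha := by
    obtain ⟨h1, h2, h3⟩ := hx.code_eq (n := n)
    obtain ⟨h4, h5, h6⟩ := hy.code_eq (n := n)
    push_cast at h6
    rcases hT.step a (by omega) (by omega) (by omega) with h7 | ⟨h7, h8⟩
    · exact Or.inl (by omega)
    · obtain ⟨ha, rfl⟩ := hx
      obtain ⟨hb, rfl⟩ := hy
      exact Or.inr ⟨rank_injective (n := n) (hv _) trivial (by simp only [rank_zero]; omega),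
        rank_injective (n := n) (hv _) trivial (by simp only [rank_zero]; omega)⟩
  B2 := by
    rintro ⟨a, b, k, h1, h2, h3, h4, h5⟩
    have h3 := (has_pos_iff hv).1 h3
    have h4 := (has_neg_iff hv).1 h4
    exact hT.col1 a b (by omega) (by omega) (by omega) (by omega) (by omega) (by omega)
  B3 := by
    rintro ⟨a, b, k, h1, h2, h3, h4, h5⟩
    have h3 := (has_pos_iff hv).1 h3
    have h4 := (has_neg_iff hv).1 h4
    exact hT.col2 a b (by omega) (by omega) (by omega) (by omega) (by omega) (by omega)
  B4 := by
    rintro ⟨a, b, k, h1, h2, h3, h4, h5⟩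
    have h3 := (has_pos_iff hv).1 h3
    have h4 := (has_neg_iff hv).1 h4
    exact hT.col12 a b (by omega) (by omega) (by omega) (by omega) (by omega) (by omega) (by omega)
  B5 k x hk hx hle := by
    have v := (has_pos_iff hv).1 hk
    push_cast at v
    obtain ⟨h1, h2, h3⟩ := hx.code_eq (n := n)
    simp only [rank_pos] at hle
    rcases hT.cross (by omega) (by omega) with g | ⟨g1, g2, e, g3, g4, g5, g6, g7, g8⟩ | g
    · omega
    · obtain ⟨b, hb⟩ := Int.eq_ofNat_of_zero_le (show 0 ≤ (n : ℤ) - code n T (h + 1) - e by omega)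
      obtain ⟨b', hb'⟩ := Int.eq_ofNat_of_zero_le (show 0 ≤ (n : ℤ) - code n T h - e by omega)
      obtain ⟨k', hk'⟩ := Int.eq_ofNat_of_zero_le (show 0 ≤ code n T h by omega)
      rw [hb] at g6
      rw [hb'] at g8
      have hc := hT.colTwo (by omega)
      refine ⟨k', ?_, b', b, by omega, by omega, fun c hc1 hc2 => ?_, by omega, by omega⟩
      · obtain ⟨ha, rfl⟩ := hx
        exact rank_injective (n := n) (hv _) ⟨by omega, by omega⟩ (by simp only [rank_pos]; omega)
      · refine (has_neg_iff hv).2 ⟨by omega, by omega, by omega, by omega, ?_⟩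
        have e1 : code n T b' + (c - b') ≤ code n T c := by
          rcases eq_or_lt_of_le hc1 with rfl | hlt
          · omega
          · exact (hc.cmp (a := b') (b := c) (by omega) (by omega) (by omega)).2.2 (by omega)
        have e2 : code n T c + (b - c) ≤ code n T b := by
          rcases eq_or_lt_of_le hc2 with rfl | hlt
          · omega
          · exact (hc.cmp (a := c) (b := b) (by omega) (by omega) (by omega)).2.2 (by omega)
        omega
    · omega
  B6 k x hk hx hle := by
    have v := (has_neg_iff hv).1 hk
    push_cast at v
    obtain ⟨h1, h2, h3⟩ := hx.code_eq (n := n)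
    simp only [rank_neg] at hle
    have r1 := code_range hv (a := h) (by omega) (by omega)
    rcases hT.cross (by omega) (by omega) with g | g | ⟨g1, g2, e, g3, g4, g5, g6, g7, g8⟩
    · omega
    · omega
    · obtain ⟨a, ha⟩ := Int.eq_ofNat_of_zero_le
        (show 0 ≤ 2 * (n : ℤ) + 2 - code n T (h + 1) - e by omega)
      obtain ⟨a', ha'⟩ := Int.eq_ofNat_of_zero_le (show 0 ≤ 2 * (n : ℤ) + 2 - code n T h - e by omega)
      obtain ⟨k', hk'⟩ := Int.eq_ofNat_of_zero_le (show 0 ≤ 2 * (n : ℤ) + 2 - code n T h by omega)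
      rw [ha] at g8
      rw [ha'] at g6
      have hc := hT.colOne (by omega)
      refine ⟨k', ?_, a', a, by omega, by omega, fun c hc1 hc2 => ?_, by omega, by omega⟩
      · obtain ⟨ha, rfl⟩ := hx
        exact rank_injective (n := n) (hv _) ⟨by omega, by omega⟩ (by simp only [rank_neg]; omega)
      · refine (has_pos_iff hv).2 ⟨by omega, by omega, by omega, by omega, ?_⟩
        have e2 : code n T c + (a - c) ≤ code n T a := by
          rcases eq_or_lt_of_le hc2 with rfl | hlt
          · omega
          · exact (hc.cmp (a := c) (b := a) (by omega) (by omega) (by omega)).2.1 (by omega)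
        have e1 : code n T a' + (c - a') ≤ code n T c := by
          rcases eq_or_lt_of_le hc1 with rfl | hlt
          · omega
          · exact (hc.cmp (a := a') (b := c) (by omega) (by omega) (by omega)).2.1 (by omega)
        omega
  B7 x hz hx := by
    obtain ⟨h4, h5, h6⟩ := hz.code_eq (n := n)
    obtain ⟨h1, h2, h3⟩ := hx.code_eq (n := n)
    push_cast at h6
    simp only [rank_zero] at h6 ⊢
    rcases hT.cross (by omega) (by omega) with g | g | g <;> omega

end

end TypeB

namespace TypeB

/-! ### Crystals embedded into the monomial crystal -/

section

variable {n : ℕ} {X X' : Type} {S : CrystalData (Fin n) X} {S' : CrystalData (Fin n) X'}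
  {g : X → Monomial n} {g' : X' → Monomial n}

/-- `g` embeds `S` into the monomials, compatibly with the crystal structures, and the levels of
the variables `Y_{i,l}` that occur in an element of the image are congruent modulo `2`. -/
structure IsEmbedding (S : CrystalData (Fin n) X) (g : X → Monomial n) : Prop where
  injective : Function.Injective g
  wt : ∀ b, S.wt b = wt (g b)
  ε : ∀ i b, S.ε i b = ε i (g b)
  φ : ∀ i b, S.φ i b = φ i (g b)
  e : ∀ i b, (S.e i b).map g = (monomialCrystal n).e i (g b)
  f : ∀ i b, (S.f i b).map g = (monomialCrystal n).f i (g b)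
  parity : ∀ i b, ∃ c, HasParity i c (g b)

lemma IsEmbedding.e_iff (hg : IsEmbedding S g) (i : Fin n) (b b' : X) :
    S.e i b = some b' ↔ (monomialCrystal n).e i (g b) = some (g b') := by
  rw [← hg.e, ← Option.map_some, (Option.map_injective hg.injective).eq_iff]

lemma IsEmbedding.f_iff (hg : IsEmbedding S g) (i : Fin n) (b b' : X) :
    S.f i b = some b' ↔ (monomialCrystal n).f i (g b) = some (g b') := by
  rw [← hg.f, ← Option.map_some, (Option.map_injective hg.injective).eq_iff]

/-- The axioms hold for the monomial formulas themselves, except that `f̃_i` and `ẽ_i` are inverse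
to each other only under the parity condition. -/
lemma IsEmbedding.isCrystal (hg : IsEmbedding S g) : IsCrystal (cartan n) S := by
  have wt_e : ∀ i b b', S.e i b = some b' → ∀ j, S.wt b' j = S.wt b j + cartan n j i := by
    intro i b b' h j
    rw [hg.e_iff, e_eq_some_iff] at h
    obtain ⟨q, -, -, h⟩ := h
    rw [hg.wt, hg.wt, h, wt_add, wt_A]
  have wt_f : ∀ i b b', S.f i b = some b' → ∀ j, S.wt b' j = S.wt b j - cartan n j i := by
    intro i b b' h j
    rw [hg.f_iff, f_eq_some_iff] at h
    obtain ⟨q, -, -, h⟩ := h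
    rw [hg.wt, hg.wt, h, wt_sub_A]
  have φ_e : ∀ i b b', S.e i b = some b' → S.φ i b' = S.φ i b + 1 := fun i b b' h => by
    rw [hg.φ, hg.φ, φ_of_e ((hg.e_iff _ _ _).1 h)]
  have φ_f : ∀ i b b', S.f i b = some b' → S.φ i b' = S.φ i b - 1 := fun i b b' h => by
    rw [hg.φ, hg.φ, φ_of_f ((hg.f_iff _ _ _).1 h)]
  have φ_eq : ∀ i b, S.φ i b = S.ε i b + S.wt b i := fun i b => by
    rw [hg.φ, hg.ε, hg.wt, ε_eq]; ring
  refine ⟨φ_eq, wt_e, fun i b b' h => ?_, φ_e, wt_f, fun i b b' h => ?_, φ_f, fun i b b' => ?_⟩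
  · have h1 := φ_eq i b; have h2 := φ_eq i b'
    have h3 := φ_e i b b' h
    have h4 := wt_e i b b' h i
    rw [cartan_self] at h4
    omega
  · have h1 := φ_eq i b; have h2 := φ_eq i b'
    have h3 := φ_f i b b' h
    have h4 := wt_f i b b' h i
    rw [cartan_self] at h4
    omega
  · rw [hg.f_iff, hg.e_iff]
    exact ⟨e_of_f (hg.parity i b).choose_spec, f_of_e (hg.parity i b').choose_spec⟩

lemma IsEmbedding.isCrystalIso (hg : IsEmbedding S g) (hg' : IsEmbedding S' g') {k : X → X'}
    (hk : ∀ b, g' (k b) = g b) (hs : Function.Surjective k) : IsCrystalIso S S' k where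
  bijective := ⟨fun a b h => hg.injective (by rw [← hk, h, hk]), hs⟩
  wt_map b := by rw [hg'.wt, hk, hg.wt]
  ε_map i b := by rw [hg'.ε, hk, hg.ε]
  φ_map i b := by rw [hg'.φ, hk, hg.φ]
  e_map i b := by
    apply Option.map_injective hg'.injective
    rw [hg'.e, hk, ← hg.e, Option.map_map]
    exact congrArg (Option.map · (S.e i b)) (funext fun b => (hk b).symm)
  f_map i b := by
    apply Option.map_injective hg'.injective
    rw [hg'.f, hk, ← hg.f, Option.map_map]
    exact congrArg (Option.map · (S.f i b)) (funext fun b => (hk b).symm)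

end

section

variable {I X X' X'' : Type} {S : CrystalData I X} {S' : CrystalData I X'} {S'' : CrystalData I X''}

lemma IsCrystalIso.comp {g : X → X'} {g' : X' → X''} (h' : IsCrystalIso S' S'' g')
    (h : IsCrystalIso S S' g) : IsCrystalIso S S'' (g' ∘ g) where
  bijective := h'.bijective.comp h.bijective
  wt_map b := (h'.wt_map _).trans (h.wt_map b)
  ε_map i b := (h'.ε_map i _).trans (h.ε_map i b)
  φ_map i b := (h'.φ_map i _).trans (h.φ_map i b)
  e_map i b := by rw [Function.comp_apply, h'.e_map, h.e_map, Option.map_map]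
  f_map i b := by rw [Function.comp_apply, h'.f_map, h.f_map, Option.map_map]

lemma IsCrystalIso.symm {g : X → X'} {g' : X' → X} (h : IsCrystalIso S S' g)
    (h1 : ∀ x, g (g' x) = x) : IsCrystalIso S' S g' := by
  have h2 : ∀ x, g' (g x) = x := fun x => h.bijective.1 (h1 _)
  refine ⟨⟨fun a b hab => by rw [← h1 a, hab, h1], fun b => ⟨g b, h2 b⟩⟩, fun b => ?_, fun i b => ?_,
    fun i b => ?_, fun i b => ?_, fun i b => ?_⟩
  · rw [← h.wt_map, h1]
  · rw [← h.ε_map, h1]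
  · rw [← h.φ_map, h1]
  · apply Option.map_injective h.bijective.1
    rw [← h.e_map, h1, Option.map_map, funext h1 (f := g ∘ g') (g := id), Option.map_id_apply]
  · apply Option.map_injective h.bijective.1
    rw [← h.f_map, h1, Option.map_map, funext h1 (f := g ∘ g') (g := id), Option.map_id_apply]

end

/-! ### The crystal of tableaux -/

section

variable {n ℓ h r : ℕ} {t t' : ℤ → ℤ}

lemma letter_code {T : Tableau ℓ} (hT : ∀ a, (T a).Valid n) (a : Finset.Icc 1 ℓ) :
    letter n (code n T ((a : ℕ) : ℤ)) = T a := by rw [code_apply, letter_rank (hT a)]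

lemma code_injective {T T' : Tableau ℓ} (hT : ∀ a, (T a).Valid n) (hT' : ∀ a, (T' a).Valid n)
    (h : code n T = code n T') : T = T' := by rw [← decode_code hT, h, decode_code hT']

lemma mon_eq_smon {T : Tableau ℓ} (hT : ∀ a, (T a).Valid n) :
    mon n h r T = smon n ℓ h r (code n T) := by rw [smon, decode_code hT]

lemma exists_tableau (hh : h ≤ ℓ) (hT : Tab n ℓ h r t) : ∃ T : B n ℓ h r, code n T.1 = t :=
  ⟨⟨decode n ℓ t, isTableau_of_tab hh (decode_valid hT) (by rwa [code_decode hT])⟩, code_decode hT⟩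

lemma Good.mon_injective (hG : Good n ℓ h r) :
    Function.Injective fun T : B n ℓ h r => mon n h r T.1 := fun T T' hTT => by
  simp only [mon_eq_smon T.2.valid, mon_eq_smon T'.2.valid] at hTT
  exact Subtype.ext (code_injective T.2.valid T'.2.valid (hG.inj _ _ T.2.tab T'.2.tab hTT))

lemma FStep.step {T T' : B n ℓ h r} {j : Fin n}
    (hF : FStep n ℓ h r ((j : ℕ) + 1) (code n T.1) (code n T'.1)) :
    Tableau.Step n (j + 1) T.1 T'.1 := by
  obtain ⟨-, -, c, hc, hcc⟩ := hF
  have h1 := hc.one_le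
  have h2 := hc.le
  have hj := j.isLt
  obtain ⟨a, ha⟩ : ∃ a : Finset.Icc 1 ℓ, ((a : ℕ) : ℤ) = c :=
    ⟨⟨c.toNat, by rw [Finset.mem_Icc]; omega⟩, by simp only; omega⟩
  subst ha
  refine ⟨a, ?_, fun b hb => ?_⟩
  · rw [← letter_code T.2.valid, ← letter_code T'.2.valid, hcc, bump_self]
    exact arrow_letter (by omega) (by omega) (by have := hc.letter; omega)
  · rw [← letter_code T.2.valid, ← letter_code T'.2.valid, hcc, bump_of_ne]
    exact fun hab => hb (Subtype.ext (by omega))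

lemma FStep.f_mon (hh : h ≤ ℓ) {T T' : B n ℓ h r} {j : Fin n}
    (hF : FStep n ℓ h r ((j : ℕ) + 1) (code n T.1) (code n T'.1)) :
    (monomialCrystal n).f j (mon n h r T.1) = some (mon n h r T'.1) := by
  rw [mon_eq_smon T.2.valid, mon_eq_smon T'.2.valid, hF.f_smon hh]

lemma FStep.e_mon (hh : h ≤ ℓ) {T T' : B n ℓ h r} {j : Fin n}
    (hF : FStep n ℓ h r ((j : ℕ) + 1) (code n T.1) (code n T'.1)) :
    (monomialCrystal n).e j (mon n h r T'.1) = some (mon n h r T.1) := by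
  rw [mon_eq_smon T.2.valid, mon_eq_smon T'.2.valid, hF.e_smon hh]

lemma Good.exists_f (hG : Good n ℓ h r) (hh : h ≤ ℓ) {T : B n ℓ h r} {j : Fin n} {m : Monomial n}
    (hm : (monomialCrystal n).f j (mon n h r T.1) = some m) : ∃ T' : B n ℓ h r,
      FStep n ℓ h r ((j : ℕ) + 1) (code n T.1) (code n T'.1) ∧ mon n h r T'.1 = m := by
  have h1 : φ j (smon n ℓ h r (code n T.1)) ≠ 0 := fun h0 => by
    rw [← mon_eq_smon T.2.valid] at h0
    simp [monomialCrystal, h0] at hm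
  obtain ⟨t', ht'⟩ := hG.f j _ T.2.tab h1
  obtain ⟨T', rfl⟩ := exists_tableau hh ht'.2.1
  exact ⟨T', ht', Option.some.inj ((ht'.f_mon hh).symm.trans hm)⟩

lemma Good.exists_e (hG : Good n ℓ h r) (hh : h ≤ ℓ) {T : B n ℓ h r} {j : Fin n} {m : Monomial n}
    (hm : (monomialCrystal n).e j (mon n h r T.1) = some m) : ∃ T' : B n ℓ h r,
      FStep n ℓ h r ((j : ℕ) + 1) (code n T'.1) (code n T.1) ∧ mon n h r T'.1 = m := by
  have h1 : ε j (smon n ℓ h r (code n T.1)) ≠ 0 := fun h0 => by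
    rw [← mon_eq_smon T.2.valid] at h0
    simp [monomialCrystal, h0] at hm
  obtain ⟨t', ht'⟩ := hG.e j _ T.2.tab h1
  obtain ⟨T', rfl⟩ := exists_tableau hh ht'.1
  exact ⟨T', ht', Option.some.inj ((ht'.e_mon hh).symm.trans hm)⟩

/-- Closure ensures that a tableau with the required monomial and one replaced entry exists;
whichever one is chosen, its monomial is prescribed. -/
lemma Good.isEmbedding (hG : Good n ℓ h r) (hh : h ≤ ℓ) :
    IsEmbedding (tableauCrystal n ℓ h r) fun T => mon n h r T.1 where
  injective := hG.mon_injective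
  wt _ := rfl
  ε _ _ := rfl
  φ _ _ := rfl
  e j T := by
    rcases hm : (monomialCrystal n).e j (mon n h r T.1) with _ | m
    · simp [tableauCrystal, hm]
    · obtain ⟨T', h1, h2⟩ := hG.exists_e hh hm
      have hex : ∃ T' : B n ℓ h r, Tableau.Step n (j + 1) T'.1 T.1 ∧
          (monomialCrystal n).e j (mon n h r T.1) = some (mon n h r T'.1) :=
        ⟨T', h1.step, by rw [hm, h2]⟩
      simp only [tableauCrystal, dif_pos hex, Option.map_some]
      exact hex.choose_spec.2.symm.trans hm
  f j T := by
    rcases hm : (monomialCrystal n).f j (mon n h r T.1) with _ | m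
    · simp [tableauCrystal, hm]
    · obtain ⟨T', h1, h2⟩ := hG.exists_f hh hm
      have hex : ∃ T' : B n ℓ h r, Tableau.Step n (j + 1) T.1 T'.1 ∧
          (monomialCrystal n).f j (mon n h r T.1) = some (mon n h r T'.1) :=
        ⟨T', h1.step, by rw [hm, h2]⟩
      simp only [tableauCrystal, dif_pos hex, Option.map_some]
      exact hex.choose_spec.2.symm.trans hm
  parity j T := ⟨_, by
    rw [mon_eq_smon T.2.valid]; exact smon_hasParity hh T.2.tab j⟩

lemma Good.f_iff_fstep (hG : Good n ℓ h r) (hh : h ≤ ℓ) {T T' : B n ℓ h r} {j : Fin n} :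
    (tableauCrystal n ℓ h r).f j T = some T' ↔
      FStep n ℓ h r ((j : ℕ) + 1) (code n T.1) (code n T'.1) := by
  rw [(hG.isEmbedding hh).f_iff]
  refine ⟨fun hf => ?_, fun hF => hF.f_mon hh⟩
  obtain ⟨T'', h1, h2⟩ := hG.exists_f hh hf
  rwa [← hG.mon_injective h2]

/-! ### The component of the monomial `M_{ℓ,h,r}` -/

/-- The boxes `1, …, m` telescope inside each column. At the border the displacement by `2r` leaves
the two uncancelled factors in `Y_h`. -/
lemma smon_highest (hh : h ≤ ℓ) (hln : ℓ + 1 ≤ n) : smon n ℓ h r (highest ℓ) = M n ℓ h r := by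
  have hY : ∀ l, Y n 0 l = 0 := fun l => dif_neg (by omega)
  have key : ∀ m, m ≤ ℓ → ∑ a ∈ Finset.Icc 1 m,
      box n (.pos a) ((ℓ : ℤ) + 1 - 2 * a - if a ≤ h then 0 else 2 * (r : ℤ)) =
      if m ≤ h then Y n m (ℓ - m) else
        Y n h ((ℓ : ℤ) - h) - Y n h ((ℓ : ℤ) - h - 2 * r) + Y n m (ℓ - m - 2 * (r : ℤ)) := by
    intro m
    induction m with
    | zero => intro _; simp [hY]
    | succ m ih =>
      intro hm
      rw [Finset.sum_Icc_succ_top (by omega), ih (by omega)]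
      have e : ∀ s : ℤ, box n (.pos (m + 1)) s = - Y n m (s + (m + 1)) + Y n (m + 1) (s + m) := by
        intro s
        simp only [box, if_neg (show ¬ m + 1 = n by omega)]
        push_cast
        rw [show s + ((m : ℤ) + 1) - 1 = s + m by ring]
      rw [e]
      push_cast
      rcases lt_trichotomy m h with h1 | rfl | h1
      · rw [if_pos (by omega), if_pos (by omega), if_pos (by omega),
          show (ℓ : ℤ) + 1 - 2 * (m + 1) - 0 + (m + 1) = ℓ - m by ring,
          show (ℓ : ℤ) + 1 - 2 * (m + 1) - 0 + m = ℓ - (m + 1) by ring]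
        abel
      · rw [if_pos (by omega), if_neg (by omega), if_neg (by omega),
          show (ℓ : ℤ) + 1 - 2 * (m + 1) - 2 * r + (m + 1) = ℓ - m - 2 * r by ring,
          show (ℓ : ℤ) + 1 - 2 * (m + 1) - 2 * r + m = ℓ - (m + 1) - 2 * r by ring]
        abel
      · rw [if_neg (by omega), if_neg (by omega), if_neg (by omega),
          show (ℓ : ℤ) + 1 - 2 * (m + 1) - 2 * r + (m + 1) = ℓ - m - 2 * r by ring,
          show (ℓ : ℤ) + 1 - 2 * (m + 1) - 2 * r + m = ℓ - (m + 1) - 2 * r by ring]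
        abel
  have h1 : smon n ℓ h r (highest ℓ) = ∑ a : Finset.Icc 1 ℓ,
      box n (.pos a) ((ℓ : ℤ) + 1 - 2 * (a : ℕ) - if (a : ℕ) ≤ h then 0 else 2 * (r : ℤ)) := by
    unfold smon mon
    refine Finset.sum_congr rfl fun a _ => ?_
    have ha := Finset.mem_Icc.1 a.2
    congr 1
    unfold decode highest letter
    rw [if_pos (show (1 : ℤ) ≤ (a : ℕ) ∧ ((a : ℕ) : ℤ) ≤ ℓ by omega), if_pos (by omega),
      Int.toNat_natCast]
  rw [h1, Finset.sum_coe_sort (Finset.Icc 1 ℓ) fun a : ℕ =>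
    box n (.pos a) ((ℓ : ℤ) + 1 - 2 * (a : ℤ) - if a ≤ h then 0 else 2 * (r : ℤ)), key ℓ le_rfl, M]
  rcases eq_or_lt_of_le hh with rfl | h2
  · rw [if_pos le_rfl, show (h : ℤ) - h - 2 * r = -2 * r by ring, sub_add_cancel]
  · rw [if_neg (by omega), show (ℓ : ℤ) - ℓ - 2 * r = -2 * r by ring]

lemma Good.exists_of_mem_component (hG : Good n ℓ h r) (hh : h ≤ ℓ) (hln : ℓ + 1 ≤ n)
    {m : Monomial n} (hm : m ∈ component (M n ℓ h r)) : ∃ T : B n ℓ h r, mon n h r T.1 = m := by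
  induction hm with
  | base =>
    obtain ⟨T, hT⟩ := exists_tableau hh (tab_highest (r := r) hh hln)
    exact ⟨T, by rw [mon_eq_smon T.2.valid, hT, smon_highest hh hln]⟩
  | e i _ he ih =>
    obtain ⟨T, rfl⟩ := ih
    obtain ⟨T', -, hT'⟩ := hG.exists_e hh he
    exact ⟨T', hT'⟩
  | f i _ hf ih =>
    obtain ⟨T, rfl⟩ := ih
    obtain ⟨T', -, hT'⟩ := hG.exists_f hh hf
    exact ⟨T', hT'⟩

/-- A sequence that is not the source has a predecessor with smaller sum of ranks, so descent ends
at the generating monomial. -/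
lemma Good.mem_component (hG : Good n ℓ h r) (hh : h ≤ ℓ) (hln : ℓ + 1 ≤ n) (T : B n ℓ h r) :
    mon n h r T.1 ∈ component (M n ℓ h r) := by
  have key : ∀ N : ℕ, ∀ t, Tab n ℓ h r t → ∑ a ∈ Finset.Icc 1 (ℓ : ℤ), t a = N →
      smon n ℓ h r t ∈ component (M n ℓ h r) := by
    intro N
    induction N with
    | zero =>
      intro t hT hs
      by_cases hn : ∀ (j : Fin n) t', ¬ FStep n ℓ h r ((j : ℕ) + 1) t' t
      · rw [hG.high t hT hn, smon_highest hh hln]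
        exact .base
      · push Not at hn
        obtain ⟨j, t', hT', -, c, hc, rfl⟩ := hn
        rw [sum_bump hc.one_le hc.le] at hs
        have : 0 ≤ ∑ a ∈ Finset.Icc 1 (ℓ : ℤ), t' a := Finset.sum_nonneg fun a ha => by
          have := Finset.mem_Icc.1 ha
          have := hT'.one_le a this.1 this.2
          omega
        omega
    | succ N ih =>
      intro t hT hs
      by_cases hn : ∀ (j : Fin n) t', ¬ FStep n ℓ h r ((j : ℕ) + 1) t' t
      · rw [hG.high t hT hn, smon_highest hh hln]
        exact .base
      · push Not at hn
        obtain ⟨j, t', hF⟩ := hn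
        refine .f j (ih t' hF.1 ?_) (hF.f_smon hh)
        obtain ⟨-, -, c, hc, rfl⟩ := hF
        rw [sum_bump hc.one_le hc.le] at hs
        push_cast at hs
        omega
  have h0 : 0 ≤ ∑ a ∈ Finset.Icc 1 (ℓ : ℤ), code n T.1 a := Finset.sum_nonneg fun a ha => by
    have := Finset.mem_Icc.1 ha
    have := T.2.tab.one_le a this.1 this.2
    omega
  obtain ⟨N, hN⟩ := Int.eq_ofNat_of_zero_le h0
  rw [mon_eq_smon T.2.valid]
  exact key N _ T.2.tab hN

lemma Good.isEmbedding_component (hG : Good n ℓ h r) (hh : h ≤ ℓ) (hln : ℓ + 1 ≤ n) :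
    IsEmbedding (componentCrystal (M n ℓ h r)) Subtype.val where
  injective := Subtype.val_injective
  wt _ := rfl
  ε _ _ := rfl
  φ _ _ := rfl
  e i b := by
    rcases hm : (monomialCrystal n).e i b.1 with _ | m
    · simp [componentCrystal, CrystalData.restrict, hm]
    · have : m ∈ component (M n ℓ h r) := Generated.e i b.2 hm
      simp [componentCrystal, CrystalData.restrict, hm, this]
  f i b := by
    rcases hm : (monomialCrystal n).f i b.1 with _ | m
    · simp [componentCrystal, CrystalData.restrict, hm]
    · have : m ∈ component (M n ℓ h r) := Generated.f i b.2 hm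
      simp [componentCrystal, CrystalData.restrict, hm, this]
  parity i b := by
    obtain ⟨T, hT⟩ := hG.exists_of_mem_component hh hln b.2
    rw [← hT]
    exact (hG.isEmbedding hh).parity i T

lemma Good.isCrystalIso_mon (hG : Good n ℓ h r) (hh : h ≤ ℓ) (hln : ℓ + 1 ≤ n)
    (hm : ∀ T : B n ℓ h r, mon n h r T.1 ∈ component (M n ℓ h r)) :
    IsCrystalIso (tableauCrystal n ℓ h r) (componentCrystal (M n ℓ h r))
      fun T => ⟨mon n h r T.1, hm T⟩ :=
  (hG.isEmbedding hh).isCrystalIso (hG.isEmbedding_component hh hln) (fun _ => rfl) fun m => by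
    obtain ⟨T, hT⟩ := hG.exists_of_mem_component hh hln m.2
    exact ⟨T, Subtype.ext hT⟩

end

end TypeB

namespace TypeB

/-! ### The map `τ` in terms of integer sequences -/

section

variable {n ℓ h r : ℕ} {T : Tableau ℓ} {k a b : ℕ}

lemma code_of_not_mem {c : ℤ} (hc : ¬ (1 ≤ c ∧ c ≤ ℓ)) : code n T c = 0 :=
  dif_neg (by rw [Finset.mem_Icc]; omega)

lemma code_natCast {c : ℕ} (hc : c ∈ Finset.Icc 1 ℓ) : code n T c = (T ⟨c, hc⟩).rank n :=
  code_apply T ⟨c, hc⟩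

lemma startA_spec (hb : T.Has b (.neg k)) :
    (1 ≤ startA T k b ∧ startA T k b ≤ b ∧
      ∀ d, startA T k b ≤ d → d ≤ b → T.Has d (.neg (b + k - d))) ∧
    (2 ≤ startA T k b → ¬ T.Has (startA T k b - 1) (.neg (b + k - (startA T k b - 1)))) := by
  have hne : {c | 1 ≤ c ∧ c ≤ b ∧ ∀ d, c ≤ d → d ≤ b → T.Has d (.neg (b + k - d))}.Nonempty :=
    ⟨b, (Finset.mem_Icc.1 hb.1).1, le_rfl, fun d h1 h2 => by
      rw [le_antisymm h2 h1, Nat.add_sub_cancel_left]; exact hb⟩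
  have hmem := Nat.sInf_mem hne
  refine ⟨hmem, fun h2 hT => ?_⟩
  have := Nat.sInf_le (s := {c | 1 ≤ c ∧ c ≤ b ∧ ∀ d, c ≤ d → d ≤ b → T.Has d (.neg (b + k - d))})
    (m := startA T k b - 1) ⟨by omega, by have := hmem.2.1; unfold startA; omega, fun d h3 h4 => by
      rcases eq_or_lt_of_le h3 with rfl | h5
      · exact hT
      · exact hmem.2.2 d (by change startA T k b ≤ d; omega) h4⟩
  change startA T k b ≤ _ at this
  omega

lemma startB_spec (ha : T.Has a (.pos k)) :
    (1 ≤ startB T k a ∧ startB T k a ≤ a ∧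
      ∀ d, startB T k a ≤ d → d ≤ a → ∃ j, j + a = k + d ∧ T.Has d (.pos j)) ∧
    (2 ≤ startB T k a → ¬ ∃ j, j + a = k + (startB T k a - 1) ∧
      T.Has (startB T k a - 1) (.pos j)) := by
  have hne : {c | 1 ≤ c ∧ c ≤ a ∧
      ∀ d, c ≤ d → d ≤ a → ∃ j, j + a = k + d ∧ T.Has d (.pos j)}.Nonempty :=
    ⟨a, (Finset.mem_Icc.1 ha.1).1, le_rfl, fun d h1 h2 => ⟨k, by omega, by
      rw [le_antisymm h2 h1]; exact ha⟩⟩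
  have hmem := Nat.sInf_mem hne
  refine ⟨hmem, fun h2 hT => ?_⟩
  have := Nat.sInf_le (s := {c | 1 ≤ c ∧ c ≤ a ∧
      ∀ d, c ≤ d → d ≤ a → ∃ j, j + a = k + d ∧ T.Has d (.pos j)})
    (m := startB T k a - 1) ⟨by omega, by have := hmem.2.1; unfold startB; omega, fun d h3 h4 => by
      rcases eq_or_lt_of_le h3 with rfl | h5
      · exact hT
      · exact hmem.2.2 d (by change startB T k a ≤ d; omega) h4⟩
  change startB T k a ≤ _ at this
  omega

lemma tauA_spec (hT : IsTableau n h r T) (hl : h + 1 ≤ ℓ) (hr : r + ℓ ≤ n)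
    (hA : CaseA n h r T k b) :
    (∀ c, (tauA h T k b c).Valid n) ∧ Rel n ℓ h r (code n T) (code n (tauA h T k b)) := by
  obtain ⟨hk, hb, h1, h2⟩ := hA
  have v1 := (has_pos_iff hT.valid).1 hk
  have v2 := (has_neg_iff hT.valid).1 hb
  push_cast at v1
  have hc1 := hT.tab.colOne (by omega)
  -- The definition of `τ` does not say in which column the bar of `k` lies. In the first column it
  -- would force a barred entry at `h`, which cannot precede `k` at the border.
  have hbh : h + 2 ≤ b := by
    by_contra hlt
    rcases Nat.lt_trichotomy b h with g | rfl | g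
    · have g1 := (hc1.cmp (a := b) (b := h) (by omega) (by omega) le_rfl).1
      have g2 := hT.tab.cross (by omega) (by omega)
      omega
    · have g2 := hT.tab.cross (by omega) (by omega)
      omega
    · have g1 : b = h + 1 := by omega
      subst g1
      push_cast at v2
      omega
  obtain ⟨⟨s1, s2, s3⟩, s4⟩ := startA_spec hb
  obtain ⟨s, hs⟩ : ∃ s, s = startA T k b := ⟨_, rfl⟩
  rw [← hs] at s1 s2 s3 s4
  have w1 := (has_neg_iff hT.valid).1 (s3 s le_rfl s2)
  have hsh : h + 2 ≤ s := by
    by_contra hlt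
    have := (has_neg_iff hT.valid).1 (s3 (h + 1) (by omega) (by omega))
    push_cast at this
    omega
  have e1 : ∀ c (hc : c ∈ Finset.Icc 1 ℓ), tauA h T k b ⟨c, hc⟩ =
      if c = h + 1 then .pos (b + k - s + 1) else
        if s ≤ c ∧ c ≤ b then .neg (b + k - c + 1) else T ⟨c, hc⟩ := fun c hc => by
    rw [hs]; rfl
  refine ⟨fun c => ?_, hT.tab, ?_⟩
  · rw [← Subtype.coe_eta c c.2, e1]
    split_ifs with g1 g2
    · exact ⟨by omega, by omega⟩
    · exact ⟨by omega, by omega⟩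
    · exact hT.valid _
  have hR : RelA n ℓ h r (code n T) (code n (tauA h T k b)) k (k + b - s) (n - k - b) := by
    refine ⟨by omega, by omega, by omega, by omega, by omega, by omega, v1.2.2.2.2, ?_,
      fun c g1 g2 => ?_, fun c g1 g2 => ?_⟩
    · have := code_natCast (n := n) (T := tauA h T k b) (Finset.mem_Icc.2 ⟨Nat.le_add_left 1 h, hl⟩)
      push_cast at this
      rw [this, e1, if_pos rfl, rank_pos]
      omega
    · lift c to ℕ using by omega
      have := (has_neg_iff hT.valid).1 (s3 c (by omega) (by omega))
      rw [code_natCast (n := n) (T := tauA h T k b) (Finset.mem_Icc.2 ⟨by omega, by omega⟩), e1,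
        if_neg (by omega), if_pos (by omega), rank_neg]
      omega
    · by_cases hc : 1 ≤ c ∧ c ≤ ℓ
      · lift c to ℕ using by omega
        have hc' : c ∈ Finset.Icc 1 ℓ := Finset.mem_Icc.2 ⟨by omega, by omega⟩
        rw [code_natCast hc', code_natCast hc', e1, if_neg (by omega), if_neg (by omega)]
      · rw [code_of_not_mem hc, code_of_not_mem hc]
  refine ⟨tab_of_relA hT.tab (by omega) (by omega) hR fun g1 g2 => s4 (by omega) ?_,
    Or.inl ⟨_, _, _, hR⟩⟩
  refine (has_neg_iff hT.valid).2 ⟨by omega, by omega, by omega, by omega, ?_⟩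
  rw [show ((s - 1 : ℕ) : ℤ) = n - (k + b - s) - (n - k - b) - 1 by omega, g2]
  omega

lemma tauB_spec (hT : IsTableau n h r T) (hl : h + 1 ≤ ℓ) (hr : r + ℓ ≤ n)
    (hB : CaseB n h r T k a) :
    (∀ c, (tauB h T k a c).Valid n) ∧ Rel n ℓ h r (code n T) (code n (tauB h T k a)) := by
  obtain ⟨hk, ha, h1, h2⟩ := hB
  have v1 := (has_neg_iff hT.valid).1 hk
  have v2 := (has_pos_iff hT.valid).1 ha
  push_cast at v1
  have hc2 := hT.tab.colTwo (by omega)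
  have hah : a ≤ h := by
    by_contra hlt
    by_cases g : a = h + 1
    · subst g
      push_cast at v2
      omega
    · have g1 := (hc2.cmp (a := h + 1) (b := a) (by omega) (by omega) (by omega)).1
      omega
  obtain ⟨⟨s1, s2, s3⟩, s4⟩ := startB_spec ha
  obtain ⟨s, hs⟩ : ∃ s, s = startB T k a := ⟨_, rfl⟩
  rw [← hs] at s1 s2 s3 s4
  obtain ⟨K, hK, w⟩ := s3 s le_rfl s2
  have w1 := (has_pos_iff hT.valid).1 w
  have e1 : ∀ c (hc : c ∈ Finset.Icc 1 ℓ), tauB h T k a ⟨c, hc⟩ =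
      if c = h + 1 then .neg (k + s - a - 1) else
        if s ≤ c ∧ c ≤ a then .pos (k + c - a - 1) else T ⟨c, hc⟩ := fun c hc => by
    rw [hs]; rfl
  refine ⟨fun c => ?_, hT.tab, ?_⟩
  · rw [← Subtype.coe_eta c c.2, e1]
    split_ifs with g1 g2
    · exact ⟨by omega, by omega⟩
    · exact ⟨by omega, by omega⟩
    · exact hT.valid _
  have hR : RelB n ℓ h r (code n T) (code n (tauB h T k a)) k K (k - a) := by
    refine ⟨by omega, by omega, by omega, by omega, by omega, v1.2.2.2.2, ?_,
      fun c g1 g2 => ?_, fun c g1 g2 => ?_⟩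
    · have := code_natCast (n := n) (T := tauB h T k a) (Finset.mem_Icc.2 ⟨Nat.le_add_left 1 h, hl⟩)
      push_cast at this
      rw [this, e1, if_pos rfl, rank_neg]
      omega
    · lift c to ℕ using by omega
      obtain ⟨j, hj, hj'⟩ := s3 c (by omega) (by omega)
      have := (has_pos_iff hT.valid).1 hj'
      rw [code_natCast (n := n) (T := tauB h T k a) (Finset.mem_Icc.2 ⟨by omega, by omega⟩), e1,
        if_neg (by omega), if_pos (by omega), rank_pos]
      omega
    · by_cases hc : 1 ≤ c ∧ c ≤ ℓ
      · lift c to ℕ using by omega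
        have hc' : c ∈ Finset.Icc 1 ℓ := Finset.mem_Icc.2 ⟨by omega, by omega⟩
        rw [code_natCast hc', code_natCast hc', e1, if_neg (by omega), if_neg (by omega)]
      · rw [code_of_not_mem hc, code_of_not_mem hc]
  refine ⟨tab_of_relB hT.tab (by omega) (by omega) (by omega) hR fun g1 g2 => s4 (by omega) ?_,
    Or.inr (Or.inl ⟨_, _, _, hR⟩)⟩
  refine ⟨K - 1, by omega, (has_pos_iff hT.valid).2 ⟨by omega, by omega, by omega, by omega, ?_⟩⟩
  rw [show ((s - 1 : ℕ) : ℤ) = K - (k - a) - 1 by omega, g2]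
  omega

/-- Whichever pair is selected by choice, the result is related to `T`. In the remaining case the
absence of such pairs is `RelC`. -/
lemma tau_spec (hT : IsTableau n h r T) (hl : h + 1 ≤ ℓ) (hr : r + ℓ ≤ n) :
    (∀ c, (tau n h r T c).Valid n) ∧ Rel n ℓ h r (code n T) (code n (tau n h r T)) := by
  unfold tau
  split_ifs with hA hB
  · exact tauA_spec hT hl hr hA.choose_spec
  · exact tauB_spec hT hl hr hB.choose_spec
  have r1 := code_range hT.valid (a := h + 1) (by omega) (by omega)
  have hC : RelC n ℓ h r (code n T) := by
    refine ⟨fun b h1 h2 h3 h4 h5 => hA ?_, fun a h1 h2 h3 h4 h5 => hB ?_⟩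
    · lift b to ℕ using by omega
      obtain ⟨k, hk⟩ := Int.eq_ofNat_of_zero_le (show 0 ≤ code n T (h + 1) by omega)
      exact ⟨(k, b), show CaseA n h r T k b from ⟨(has_pos_iff hT.valid).2 ⟨by omega, by omega, by omega, by omega, by
        push_cast; exact hk⟩, (has_neg_iff hT.valid).2 ⟨by omega, by omega, by omega, by omega,
        by omega⟩, by omega, by omega⟩⟩
    · lift a to ℕ using by omega
      obtain ⟨k, hk⟩ := Int.eq_ofNat_of_zero_le (show 0 ≤ 2 * (n : ℤ) + 2 - code n T (h + 1) by omega)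
      exact ⟨(k, a), show CaseB n h r T k a from ⟨(has_neg_iff hT.valid).2 ⟨by omega, by omega, by omega, by omega, by
        push_cast; omega⟩, (has_pos_iff hT.valid).2 ⟨by omega, by omega, by omega, by omega,
        by omega⟩, by omega, by omega⟩⟩
  exact ⟨hT.valid, hT.tab, tab_of_relC hT.tab (by omega) (by omega) hC, Or.inr (Or.inr ⟨rfl, hC⟩)⟩

/-! ### The isomorphism `τ` -/

lemma tau_mem (hl : h + 1 ≤ ℓ) (hr : r + ℓ ≤ n) (T : B n ℓ h r) :
    tau n h r T.1 ∈ B n ℓ (h + 1) r := by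
  obtain ⟨h1, h2⟩ := tau_spec T.2 hl hr
  exact isTableau_of_tab hl h1 (by push_cast; exact h2.2.1)

/-- The comparison only lifts steps of `f̃_i` from `h + 1` to `h`. This suffices: `ẽ_i` is inverse
to `f̃_i` in both crystals, and equality of `φ_i` and `ε_i` decides when the operators vanish. -/
lemma isCrystalIso_tau (hl : h + 1 ≤ ℓ) (hln : ℓ + 1 ≤ n) (hr : r + ℓ ≤ n)
    (hτ : ∀ T : B n ℓ h r, tau n h r T.1 ∈ B n ℓ (h + 1) r) :
    IsCrystalIso (tableauCrystal n ℓ h r) (tableauCrystal n ℓ (h + 1) r)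
      fun T => ⟨tau n h r T.1, hτ T⟩ := by
  have hcast : ((h + 1 : ℕ) : ℤ) = h + 1 := by push_cast; ring
  have hG : Good n ℓ h r := good (by omega) hln hr (by omega)
  have hG' : Good n ℓ (h + 1) r := good (by omega) hln hr hl
  have hR : ∀ T : B n ℓ h r, Rel n ℓ h r (code n T.1) (code n (tau n h r T.1)) :=
    fun T => (tau_spec T.2 hl hr).2
  have hwt : ∀ (T : B n ℓ h r) i, wt (mon n h r T.1) i = wt (mon n (h + 1) r (tau n h r T.1)) i ∧
      φ i (mon n h r T.1) = φ i (mon n (h + 1) r (tau n h r T.1)) := fun T i => by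
    rw [mon_eq_smon T.2.valid, mon_eq_smon (hτ T).valid]
    exact (hR T).smon_eq hG' hl (by omega) i
  have hε : ∀ (T : B n ℓ h r) i, ε i (mon n h r T.1) = ε i (mon n (h + 1) r (tau n h r T.1)) :=
    fun T i => by rw [ε_eq, ε_eq, (hwt T i).1, (hwt T i).2]
  have hinj : Function.Injective
      fun T : B n ℓ h r => (⟨tau n h r T.1, hτ T⟩ : B n ℓ (h + 1) r) := fun T T' hTT => by
    have h1 : tau n h r T.1 = tau n h r T'.1 := congrArg Subtype.val hTT
    have h2 := hR T
    rw [h1] at h2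
    exact Subtype.ext (code_injective T.2.valid T'.2.valid
      (h2.left_unique (hR T') (by omega) (by omega) (by omega)))
  have hfst : ∀ (i : Fin n) (T T' : B n ℓ h r),
      (tableauCrystal n ℓ (h + 1) r).f i ⟨tau n h r T.1, hτ T⟩ = some ⟨tau n h r T'.1, hτ T'⟩ →
      (tableauCrystal n ℓ h r).f i T = some T' := fun i T T' hf => by
    rw [hG'.f_iff_fstep hl, hcast] at hf
    have hi := i.isLt
    obtain ⟨t', h1, h2, -⟩ := ((hR T).compare (i := (i : ℕ) + 1) (by omega) (by omega) (by omega)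
      (by omega) (by omega) (by omega)).2.2 _ hf
    rw [hG.f_iff_fstep (by omega), ← h2.left_unique (hR T') (by omega) (by omega) (by omega)]
    exact h1
  have hsur : Function.Surjective
      fun T : B n ℓ h r => (⟨tau n h r T.1, hτ T⟩ : B n ℓ (h + 1) r) := fun U => by
    have hU : Tab n ℓ (h + 1) r (code n U.1) := by rw [← hcast]; exact U.2.tab
    obtain ⟨t, ht⟩ := exists_rel_left hU (by omega) (by omega) (by omega)
    obtain ⟨T, rfl⟩ := exists_tableau (by omega) ht.1
    exact ⟨T, Subtype.ext (code_injective (hτ T).valid U.2.valid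
      ((hR T).right_unique ht (by omega) (by omega)))⟩
  have crys := (hG.isEmbedding (by omega)).isCrystal
  have crys' := (hG'.isEmbedding hl).isCrystal
  have fnone : ∀ {k} (hk : k ≤ ℓ) (hGk : Good n ℓ k r) (i : Fin n) (T : B n ℓ k r),
      (tableauCrystal n ℓ k r).f i T = none ↔ φ i (mon n k r T.1) = 0 := fun hk hGk i T => by
    rw [← Option.map_eq_none_iff, (hGk.isEmbedding hk).f]
    simp [monomialCrystal]
  have enone : ∀ {k} (hk : k ≤ ℓ) (hGk : Good n ℓ k r) (i : Fin n) (T : B n ℓ k r),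
      (tableauCrystal n ℓ k r).e i T = none ↔ ε i (mon n k r T.1) = 0 := fun hk hGk i T => by
    rw [← Option.map_eq_none_iff, (hGk.isEmbedding hk).e]
    simp [monomialCrystal]
  refine ⟨⟨hinj, hsur⟩, fun T => funext fun i => (hwt T i).1.symm, fun i T => (hε T i).symm,
    fun i T => (hwt T i).2.symm, fun i T => ?_, fun i T => ?_⟩
  · rcases hU : (tableauCrystal n ℓ (h + 1) r).e i ⟨tau n h r T.1, hτ T⟩ with _ | U
    · rw [enone hl hG', ← hε, ← enone (by omega) hG] at hU
      rw [hU, Option.map_none]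
    · obtain ⟨T', rfl⟩ := hsur U
      rw [(crys.f_iff_e _ _ _).1 (hfst i T' T ((crys'.f_iff_e _ _ _).2 hU)), Option.map_some]
  · rcases hU : (tableauCrystal n ℓ (h + 1) r).f i ⟨tau n h r T.1, hτ T⟩ with _ | U
    · rw [fnone hl hG', ← (hwt T i).2, ← fnone (by omega) hG] at hU
      rw [hU, Option.map_none]
    · obtain ⟨T', rfl⟩ := hsur U
      rw [hfst i T T' hU, Option.map_some]

end

end TypeB

theorem mainTheorem9 (n ℓ r : ℕ) (hℓ : 1 ≤ ℓ) (hℓn : ℓ + 1 ≤ n) (hr : r + ℓ ≤ n) :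
    (∀ h : ℕ, h ≤ ℓ →
      TypeB.IsCrystal (TypeB.cartan n) (TypeB.tableauCrystal n ℓ h r) ∧
      TypeB.IsCrystal (TypeB.cartan n) (TypeB.componentCrystal (TypeB.M n ℓ h r)) ∧
      ∃ hm : ∀ T : TypeB.B n ℓ h r,
          TypeB.mon n h r T.1 ∈ TypeB.component (TypeB.M n ℓ h r),
        TypeB.IsCrystalIso (TypeB.tableauCrystal n ℓ h r)
          (TypeB.componentCrystal (TypeB.M n ℓ h r))
          (fun T => ⟨TypeB.mon n h r T.1, hm T⟩)) ∧
    (∀ h : ℕ, h + 1 ≤ ℓ →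
      ∃ hτ : ∀ T : TypeB.B n ℓ h r, TypeB.tau n h r T.1 ∈ TypeB.B n ℓ (h + 1) r,
        TypeB.IsCrystalIso (TypeB.tableauCrystal n ℓ h r)
          (TypeB.tableauCrystal n ℓ (h + 1) r)
          (fun T => ⟨TypeB.tau n h r T.1, hτ T⟩) ∧
        ∃ Φ : TypeB.component (TypeB.M n ℓ h r) → TypeB.component (TypeB.M n ℓ (h + 1) r),
          TypeB.IsCrystalIso (TypeB.componentCrystal (TypeB.M n ℓ h r))
            (TypeB.componentCrystal (TypeB.M n ℓ (h + 1) r)) Φ ∧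
          ∀ (T : TypeB.B n ℓ h r) (hT : TypeB.mon n h r T.1 ∈ TypeB.component (TypeB.M n ℓ h r)),
            (Φ ⟨TypeB.mon n h r T.1, hT⟩ : TypeB.Monomial n) =
              TypeB.mon n (h + 1) r (TypeB.tau n h r T.1)) := by
  refine ⟨fun h hh => ?_, fun h hh => ?_⟩
  · have hG := TypeB.good (r := r) hℓ hℓn hr hh
    exact ⟨(hG.isEmbedding hh).isCrystal, (hG.isEmbedding_component hh hℓn).isCrystal,
      hG.mem_component hh hℓn, hG.isCrystalIso_mon hh hℓn _⟩
  · have hG := TypeB.good (h := h) (r := r) hℓ hℓn hr (by omega)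
    have hG' := TypeB.good (r := r) hℓ hℓn hr hh
    have iso := hG.isCrystalIso_mon (by omega) hℓn (hG.mem_component (by omega) hℓn)
    have iso' := hG'.isCrystalIso_mon hh hℓn (hG'.mem_component hh hℓn)
    have isoτ := TypeB.isCrystalIso_tau hh hℓn hr (TypeB.tau_mem hh hr)
    -- The map on monomials is `τ` conjugated by the isomorphisms `T ↦ m_T`; injectivity of the
    -- first one identifies the chosen preimage of `m_T` with `T`.
    obtain ⟨g, hg⟩ := iso.bijective.2.hasRightInverse
    refine ⟨TypeB.tau_mem hh hr, isoτ, _, (iso'.comp isoτ).comp (iso.symm hg), fun T hT => ?_⟩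
    have h1 : g ⟨TypeB.mon n h r T.1, hT⟩ = T := iso.bijective.1 (hg _)
    simp only [Function.comp_apply, h1]
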